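/- Let $k\ge 1$ and let $\alpha_1,\dots,\alpha_k,\beta_1,\dots,\beta_k>0$ with $\alpha_1\cdots\alpha_k=\beta_1\cdots\beta_k$ (the $2\times k$-periodic Aztec diamond). Put $$\Phi(z)=\frac1{(1-z^{-1})^k}\prod_{m=1}^k\begin{pmatrix}1&\alpha_mz^{-1}\\ \alpha_m^{-1}&1\end{pmatrix}\begin{pmatrix}1&\beta_mz^{-1}\\ \beta_m^{-1}&1\end{pmatrix}.$$ Let $\rho_1,\rho_2$ be the eigenvalues of $\Phi$, ordered by $|\rho_2(z)|<|\rho_1(z)|$ for $z\in\mathbb C\setminus((-\infty,0]\cup\{1\})$ and defined on $(-\infty,0]$ by continuity from the upper half plane, and let $E$ be such that $\Phi=E\,\mathrm{diag}(\rho_1,\rho_2)E^{-1}$ away from a finite set. *Finite kernel.* For even $N$ and integers $0<m,m'<N$, $-\frac{kN}2\le\xi,\xi'\le-1$, the correlation kernel $K$ of the Aztec diamond of size $kN$ is given by $$\big[K(2km,2\xi+i;2km',2\xi'+j)\big]_{i,j=0}^1=-\frac{\mathbf 1_{m>m'}}{2\pi i}\oint_{\gamma_{0,1}}\Phi(z)^{m-m'}z^{\xi'-\xi}\frac{dz}z$$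 $$+\frac1{(2\pi i)^2}\oint_{\gamma_1}\oint_{\gamma_{0,1}}\frac{w^{\xi'}}{z^{\xi+1}}\frac{(1-z^{-1})^{kN/2}}{(1-w^{-1})^{kN/2}}\,\rho_1(w)^{\frac N2-m'}E(w)\begin{pmatrix}1&0\\0&0\end{pmatrix}E(w)^{-1}\Phi(z)^{m-\frac N2}\frac{dz\,dw}{z-w},$$ where $\gamma_1$ is a simple closed curve around $1$ with $0$ in its exterior and $\gamma_{0,1}$ is a simple closed curve around $0$ and $\gamma_1$, each meeting $\mathbb R$ in exactly two points. (All simple closed curves used for integration are piecewise $C^1$ and positively oriented.) *Regions.* Let $p(z)=((z-1)^k\operatorname{Tr}\Phi(z))^2-4(z-1)^{2k}$, a polynomial, and write $p=q^2p_0$ with $q$ monic, $p_0$ and $q$ having only simple zeros. Let $0=x_0>x_1>\dots>x_{2(k'-1)}$ be the zeros of $p_0$, let $I_\ell=(x_{2\ell},x_{2\ell-1})$ for $1\le\ell\le k'-1$, let $\mathcal R=\{(z,w)\in\mathbb C^2:w^2=p_0(z)\}$ (with a point added at infinity) and $C_\ell^+=\{(z,w)\in\mathcal R:z\in\overline{I_\ell}\}$.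 For $(\chi,\eta)\in(-1,1)^2$ let $F$ be the multivalued function on $\mathcal R$ $$F(z,w;\chi,\eta)=\tfrac k4(\eta+1)\log z-\tfrac k2\log(z-1)-\tfrac\chi2\log\rho(z,w),\qquad \rho(z,w)=\tfrac12\operatorname{Tr}\Phi(z)+\frac{q(z)w}{2(z-1)^k}.$$ Let $\mathcal G_S$ be the set of those $(\chi,\eta)\in(-1,1)^2$ for which $F$ has four distinct critical points on some $C_\ell^+$, $1\le \ell\le k'-1$, and let $\mathcal E_{RS}^{(\ell)}$ be the set of those $(\chi,\eta)\in(-1,1)^2$ for which $F$ has a critical point of order at least two on $C_\ell^+$. (The interior of $\mathcal E_{RS}^{(\ell)}$ is the union of the bounded components of its complement in $\mathbb R^2$.) **Theorem.** Let $1\le\ell\le k'-1$ and let $(\chi,\eta)\in\mathcal G_S$ lie in the interior of $\mathcal E_{RS}^{(\ell)}$. For $\kappa,\kappa',\zeta,\zeta'\in\mathbb Z$ and even $N$ let $$m=\tfrac N2(\chi+1)+e_\chi+\kappa,\quad m'=\tfrac N2(\chi+1)+e_\chi+\kappa',\quad \xi=\tfrac{kN}4(\eta-1)+e_\eta+\zeta,\quad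 \xi'=\tfrac{kN}4(\eta-1)+e_\eta+\zeta',$$ where $e_\chi,e_\eta\in[0,1)$ make these numbers integers. Then, as $N\to\infty$ through the even integers, $$\big[K(2km,2\xi+i;2km',2\xi'+j)\big]_{i,j=0}^1\longrightarrow\big[K^{(\ell)}_{smooth}(2k\kappa,2\zeta+i;2k\kappa',2\zeta'+j)\big]_{i,j=0}^1,$$ where the right-hand side is $$\frac{\mathbf 1_{\kappa\le\kappa'}}{2\pi i}\oint_{\gamma_\ell}\rho_1(z)^{\kappa-\kappa'}z^{\zeta'-\zeta}E(z)\begin{pmatrix}1&0\\0&0\end{pmatrix}E(z)^{-1}\frac{dz}z-\frac{\mathbf 1_{\kappa>\kappa'}}{2\pi i}\oint_{\gamma_\ell}\rho_2(z)^{\kappa-\kappa'}z^{\zeta'-\zeta}E(z)\begin{pmatrix}0&0\\0&1\end{pmatrix}E(z)^{-1}\frac{dz}z,$$ and $\gamma_\ell$ is any simple closed curve with $0$ and $1$ in its interior that meets $\mathbb R$ in exactly two points, one in $I_\ell$ and one in $(1,\infty)$. Moreover the error is exponentially small: there is $\varepsilon>0$, depending only on the weights, $\ell$, $\chi$ and $\eta$,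 and for all $\kappa,\zeta,\kappa',\zeta'$ a constant $C$, such that for all even $N$ for which $m,m',\xi,\xi'$ lie in the ranges above, every entry of the difference of the two matrices is at most $Ce^{-\varepsilon N}$ in absolute value. -/

import Mathlib

namespace AztecDiamond

noncomputable section

/-- Edge weights of the `2 × k`-periodic Aztec diamond (after the gauge transformation):
positive numbers `α₁, …, α_k`, `β₁, …, β_k` with `α₁ ⋯ α_k = β₁ ⋯ β_k`. -/
structure Weighting (k : ℕ) where
  α : Fin k → ℝ
  β : Fin k → ℝ
  α_pos : ∀ m, 0 < α m
  β_pos : ∀ m, 0 < β m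
  prod_eq : ∏ m, α m = ∏ m, β m

/-- The factor with rows `(1, a z⁻¹)` and `(a⁻¹, 1)` of the symbols. -/
def factor (a : ℝ) (z : ℂ) : Matrix (Fin 2) (Fin 2) ℂ :=
  !![1, (a : ℂ) * z⁻¹; (a : ℂ)⁻¹, 1]

variable {k : ℕ}

/-- `Φ(z) = (1 - z⁻¹)⁻ᵏ ∏ₘ factor(αₘ) factor(βₘ)`, an ordered product. -/
def Phi (W : Weighting k) (z : ℂ) : Matrix (Fin 2) (Fin 2) ℂ :=
  ((1 - z⁻¹) ^ k)⁻¹ • (List.ofFn fun m => factor (W.α m) z * factor (W.β m) z).prod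

/-! ### Eigenvalues -/

/-- Half of a square root of the discriminant of the characteristic polynomial. -/
def halfSqrtDisc (M : Matrix (Fin 2) (Fin 2) ℂ) : ℂ :=
  (M.trace ^ 2 - 4 * M.det) ^ (1 / 2 : ℂ) / 2

/-- The eigenvalue of larger modulus of a `2 × 2` matrix. -/
def eigLarge (M : Matrix (Fin 2) (Fin 2) ℂ) : ℂ :=
  open Classical in
  if ‖M.trace / 2 - halfSqrtDisc M‖ ≤ ‖M.trace / 2 + halfSqrtDisc M‖
  then M.trace / 2 + halfSqrtDisc M else M.trace / 2 - halfSqrtDisc M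

/-- The other eigenvalue. -/
def eigSmall (M : Matrix (Fin 2) (Fin 2) ℂ) : ℂ := M.trace - eigLarge M

theorem halfSqrtDisc_sq (M : Matrix (Fin 2) (Fin 2) ℂ) :
    halfSqrtDisc M ^ 2 = (M.trace ^ 2 - 4 * M.det) / 4 := by
  have h : ((M.trace ^ 2 - 4 * M.det) ^ (1 / 2 : ℂ)) ^ 2 = M.trace ^ 2 - 4 * M.det := by
    rw [one_div]
    exact Complex.cpow_nat_inv_pow (M.trace ^ 2 - 4 * M.det) (n := 2) two_ne_zero
  rw [halfSqrtDisc, div_pow, h]; norm_num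

theorem eigLarge_add_eigSmall (M : Matrix (Fin 2) (Fin 2) ℂ) :
    eigLarge M + eigSmall M = M.trace := by
  simp [eigSmall]

theorem eigLarge_mul_eigSmall (M : Matrix (Fin 2) (Fin 2) ℂ) :
    eigLarge M * eigSmall M = M.det := by
  have h := halfSqrtDisc_sq M
  unfold eigSmall eigLarge
  split_ifs <;> linear_combination -h

theorem norm_eigSmall_le (M : Matrix (Fin 2) (Fin 2) ℂ) : ‖eigSmall M‖ ≤ ‖eigLarge M‖ := by
  unfold eigSmall eigLarge
  split_ifs with h
  · convert h using 2; ring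
  · refine le_of_eq_of_le ?_ (not_le.mp h).le
    congr 1; ring

/-- A function on the slit plane `ℂ ∖ (-∞, 0]`, extended to `(-∞, 0]` by its limits from the
upper half plane. -/
def extendFromAbove (f : ℂ → ℂ) (z : ℂ) : ℂ :=
  open Classical in
  if z ∈ Complex.slitPlane then f z else Filter.limUnder (nhdsWithin z {w | 0 < w.im}) f

/-- `ρ₁(z)`: the eigenvalue of `Φ(z)` of larger modulus, for `z ∉ (-∞, 0]`. -/
def rho₁ (W : Weighting k) : ℂ → ℂ := extendFromAbove fun z => eigLarge (Phi W z)

/-- `ρ₂(z)`: the eigenvalue of `Φ(z)` of smaller modulus, for `z ∉ (-∞, 0]`. -/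
def rho₂ (W : Weighting k) : ℂ → ℂ := extendFromAbove fun z => eigSmall (Phi W z)

/-- `Φ(z) = E(z) diag(ρ₁(z), ρ₂(z)) E(z)⁻¹` for all `z` outside a finite set. -/
def Diagonalizes (W : Weighting k) (E : ℂ → Matrix (Fin 2) (Fin 2) ℂ) : Prop :=
  ∃ S : Set ℂ, S.Finite ∧ ∀ z ∉ S, IsUnit (E z).det ∧
    Phi W z = E z * Matrix.diagonal ![rho₁ W z, rho₂ W z] * (E z)⁻¹

/-! ### The Riemann surface -/

/-- The polynomial matrix `(z - 1)ᵏ Φ(z)`, see `map_scaledPhi`. -/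
def scaledPhi (W : Weighting k) : Matrix (Fin 2) (Fin 2) (Polynomial ℝ) :=
  (List.ofFn fun m =>
    (!![Polynomial.X + Polynomial.C (W.α m / W.β m), Polynomial.C (W.α m + W.β m);
        Polynomial.C ((W.α m)⁻¹ + (W.β m)⁻¹) * Polynomial.X,
        Polynomial.X + Polynomial.C (W.β m / W.α m)] :
      Matrix (Fin 2) (Fin 2) (Polynomial ℝ))).prod

theorem map_scaledPhi (W : Weighting k) {z : ℂ} (h0 : z ≠ 0) (h1 : z ≠ 1) :
    (scaledPhi W).map (Polynomial.aeval z) = (z - 1) ^ k • Phi W z := by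
  have hz : (1 - z⁻¹) ≠ 0 := by
    rw [sub_ne_zero]; intro h; exact h1 (inv_eq_one.mp h.symm)
  have hpow : (z - 1) ^ k • Phi W z =
      z ^ k • (List.ofFn fun m => factor (W.α m) z * factor (W.β m) z).prod := by
    rw [Phi, smul_smul]
    congr 1
    rw [← div_eq_mul_inv, ← div_pow]
    congr 1
    field_simp
  rw [hpow]
  have base : ∀ a b : ℝ, 0 < a → 0 < b →
      (!![Polynomial.X + Polynomial.C (a / b), Polynomial.C (a + b);
          Polynomial.C (a⁻¹ + b⁻¹) * Polynomial.X, Polynomial.X + Polynomial.C (b / a)] :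
        Matrix (Fin 2) (Fin 2) (Polynomial ℝ)).map (Polynomial.aeval z) =
      z • (factor a z * factor b z) := by
    intro a b ha hb
    have ha0 : (a : ℂ) ≠ 0 := by exact_mod_cast ha.ne'
    have hb0 : (b : ℂ) ≠ 0 := by exact_mod_cast hb.ne'
    ext i j
    fin_cases i <;> fin_cases j <;> simp [factor] <;> field_simp <;> ring
  have key : ∀ (n : ℕ) (a b : Fin n → ℝ), (∀ m, 0 < a m) → (∀ m, 0 < b m) →
      ((List.ofFn fun m =>
        (!![Polynomial.X + Polynomial.C (a m / b m), Polynomial.C (a m + b m);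
            Polynomial.C ((a m)⁻¹ + (b m)⁻¹) * Polynomial.X,
            Polynomial.X + Polynomial.C (b m / a m)] :
          Matrix (Fin 2) (Fin 2) (Polynomial ℝ))).prod).map (Polynomial.aeval z) =
      z ^ n • (List.ofFn fun m => factor (a m) z * factor (b m) z).prod := by
    intro n
    induction n with
    | zero => intro a b _ _; ext i j; fin_cases i <;> fin_cases j <;> simp
    | succ n ih =>
      intro a b ha hb
      have hrec := ih (fun m => a m.succ) (fun m => b m.succ)
        (fun m => ha m.succ) (fun m => hb m.succ)
      rw [List.ofFn_succ, List.ofFn_succ, List.prod_cons, List.prod_cons, Matrix.map_mul, hrec,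
        base _ _ (ha 0) (hb 0), Matrix.smul_mul, Matrix.mul_smul, smul_smul, pow_succ']
  exact key k W.α W.β W.α_pos W.β_pos

/-- `p(z) = ((z - 1)ᵏ Tr Φ(z))² - 4 (z - 1)²ᵏ`, see `aeval_polyP`. -/
def polyP (W : Weighting k) : Polynomial ℝ :=
  (scaledPhi W).trace ^ 2 - 4 * (Polynomial.X - 1) ^ (2 * k)

theorem aeval_polyP (W : Weighting k) {z : ℂ} (h0 : z ≠ 0) (h1 : z ≠ 1) :
    Polynomial.aeval z (polyP W) =
      ((z - 1) ^ k * (Phi W z).trace) ^ 2 - 4 * (z - 1) ^ (2 * k) := by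
  have h : Polynomial.aeval z (scaledPhi W).trace = (z - 1) ^ k * (Phi W z).trace := by
    have := congrArg Matrix.trace (map_scaledPhi W h0 h1)
    rw [Matrix.trace_smul, smul_eq_mul] at this
    rw [← this]
    simp [Matrix.trace, Matrix.diag]
  rw [polyP, map_sub, map_pow, h, map_mul, map_ofNat]
  simp

/-- The monic polynomial `q` in `p = q² p₀`, where `p₀` has only simple zeros. -/
def polyQ (W : Weighting k) : Polynomial ℝ :=
  ∏ s ∈ (polyP W).roots.toFinset,
    (Polynomial.X - Polynomial.C s) ^ ((polyP W).rootMultiplicity s / 2)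

/-- The polynomial `p₀ = p / q²`. -/
def polyP₀ (W : Weighting k) : Polynomial ℝ := polyP W /ₘ polyQ W ^ 2

theorem polyP_eq (W : Weighting k) : polyP W = polyQ W ^ 2 * polyP₀ W := by
  have hmonic : (polyQ W ^ 2).Monic :=
    (Polynomial.monic_prod_of_monic _ _ fun s _ => (Polynomial.monic_X_sub_C s).pow _).pow 2
  have hdvd : polyQ W ^ 2 ∣ polyP W := by
    refine dvd_trans ?_ (Polynomial.prod_multiset_X_sub_C_dvd (polyP W))
    rw [Finset.prod_multiset_map_count, polyQ, ← Finset.prod_pow]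
    refine Finset.prod_dvd_prod_of_dvd _ _ fun s _ => ?_
    rw [← pow_mul, Polynomial.count_roots]
    exact pow_dvd_pow _ (Nat.div_mul_le_self _ _)
  have h := Polynomial.modByMonic_add_div (polyP W) (polyQ W ^ 2)
  rw [(Polynomial.modByMonic_eq_zero_iff_dvd hmonic).mpr hdvd, zero_add] at h
  exact h.symm

/-- The zeros of `p₀` in decreasing order. -/
def branchList (W : Weighting k) : List ℝ := (polyP₀ W).roots.toFinset.sort (· ≥ ·)

/-- The zeros `x₀ > x₁ > ⋯` of `p₀`. -/
def branchPoint (W : Weighting k) (j : ℕ) : ℝ := (branchList W).getD j 0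

/-- The loops are numbered by `ℓ = 1, …, k' - 1`, where `p₀` has `2k' - 1` zeros. -/
def IsLoopIndex (W : Weighting k) (l : ℕ) : Prop := 1 ≤ l ∧ 2 * l < (branchList W).length

/-- The open interval `I_ℓ = (x_{2ℓ}, x_{2ℓ-1})`. -/
def gap (W : Weighting k) (l : ℕ) : Set ℝ :=
  Set.Ioo (branchPoint W (2 * l)) (branchPoint W (2 * l - 1))

/-- The affine part of the Riemann surface, `w² = p₀(z)`. -/
def surface (W : Weighting k) : Set (ℂ × ℂ) :=
  {P | P.2 ^ 2 = Polynomial.aeval P.1 (polyP₀ W)}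

/-- The loop `C_ℓ⁺` of the points of the surface that lie above the closure of `I_ℓ`. -/
def loop (W : Weighting k) (l : ℕ) : Set (ℂ × ℂ) :=
  {P | P ∈ surface W ∧ ∃ x ∈ closure (gap W l), P.1 = (x : ℂ)}

/-- The meromorphic function `ρ(z, w) = Tr Φ(z) / 2 + q(z) w / (2 (z - 1)ᵏ)` on the surface. -/
def rhoSurface (W : Weighting k) (P : ℂ × ℂ) : ℂ :=
  (Phi W P.1).trace / 2 + Polynomial.aeval P.1 (polyQ W) * P.2 / (2 * (P.1 - 1) ^ k)

/-- A local holomorphic parametrization `ψ` of the surface near `P = ψ(0)`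
(the inverse of a chart centred at `P`). -/
def IsLocalParam (W : Weighting k) (P : ℂ × ℂ) (ψ : ℂ → ℂ × ℂ) : Prop :=
  AnalyticAt ℂ ψ 0 ∧ ψ 0 = P ∧ deriv ψ 0 ≠ 0 ∧ ∀ᶠ t in nhds (0 : ℂ), ψ t ∈ surface W

/-- The derivative of `F ∘ ψ` for the multivalued function
`F(z, w; χ, η) = (k/4)(η + 1) log z - (k/2) log (z - 1) - (χ/2) log ρ(z, w)`.
It does not depend on the branches of the logarithms. -/
def dF (W : Weighting k) (χ η : ℝ) (ψ : ℂ → ℂ × ℂ) (t : ℂ) : ℂ :=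
  (k : ℂ) / 4 * (η + 1) * logDeriv (fun s => (ψ s).1) t
    - (k : ℂ) / 2 * logDeriv (fun s => (ψ s).1 - 1) t
    - (χ : ℂ) / 2 * logDeriv (fun s => rhoSurface W (ψ s)) t

/-- `P` is a critical point of `F(·; χ, η)` of order at least `n`: in a local coordinate centred
at `P`, the derivative of `F` vanishes at the origin to order at least `n`. -/
def IsCriticalOfOrder (W : Weighting k) (χ η : ℝ) (n : ℕ∞) (P : ℂ × ℂ) : Prop :=
  ∃ ψ, IsLocalParam W P ψ ∧ n ≤ analyticOrderAt (dF W χ η ψ) 0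

/-- `(-1, 1)²`. -/
def square : Set (ℝ × ℝ) := Set.Ioo (-1) 1 ×ˢ Set.Ioo (-1) 1

/-- The smooth region `𝒢_S`: `F` has four distinct critical points on one of the loops. -/
def smoothRegion (W : Weighting k) : Set (ℝ × ℝ) :=
  {c | c ∈ square ∧ ∃ l, IsLoopIndex W l ∧ ∃ S : Finset (ℂ × ℂ), S.card = 4 ∧
    ∀ P ∈ S, P ∈ loop W l ∧ IsCriticalOfOrder W c.1 c.2 1 P}

/-- The rough-smooth boundary `ℰ_RS^(ℓ)`: `F` has a critical point of order at least two on the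
`ℓ`-th loop. -/
def roughSmoothCurve (W : Weighting k) (l : ℕ) : Set (ℝ × ℝ) :=
  {c | c ∈ square ∧ ∃ P ∈ loop W l, IsCriticalOfOrder W c.1 c.2 2 P}

/-- The interior of a closed curve: the union of the bounded components of its complement. -/
def curveInterior (Γ : Set (ℝ × ℝ)) : Set (ℝ × ℝ) :=
  {c | c ∉ Γ ∧ Bornology.IsBounded (connectedComponentIn Γᶜ c)}

/-! ### Contours and kernels -/

/-- A piecewise `C¹` simple closed curve in `ℂ`, parametrized by `[0, 1]`. -/
structure SimpleContour where
  toFun : ℝ → ℂ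
  continuousOn : ContinuousOn toFun (Set.Icc 0 1)
  closed : toFun 0 = toFun 1
  injOn : Set.InjOn toFun (Set.Ico 0 1)
  piecewise : ∃ B : Finset ℝ, ∀ a b : ℝ, 0 ≤ a → a < b → b ≤ 1 →
    (∀ t ∈ B, t ∉ Set.Ioo a b) → ContDiffOn ℝ 1 toFun (Set.Icc a b)

namespace SimpleContour

/-- The set of points on the curve. -/
def trace (γ : SimpleContour) : Set ℂ := γ.toFun '' Set.Icc 0 1

/-- The contour integral `∮_γ f(z) dz`. -/
def integral (γ : SimpleContour) (f : ℂ → ℂ) : ℂ :=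
  ∫ t in (0 : ℝ)..1, f (γ.toFun t) * deriv γ.toFun t

/-- The winding number around `a`. -/
def winding (γ : SimpleContour) (a : ℂ) : ℂ :=
  (2 * Real.pi * Complex.I)⁻¹ * γ.integral fun z => (z - a)⁻¹

/-- `γ` is positively oriented and has `a` in its interior. -/
def Encloses (γ : SimpleContour) (a : ℂ) : Prop := a ∉ γ.trace ∧ γ.winding a = 1

/-- `a` is in the exterior of `γ`. -/
def Excludes (γ : SimpleContour) (a : ℂ) : Prop := a ∉ γ.trace ∧ γ.winding a = 0

/-- The points where the curve meets the real line. -/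
def realPoints (γ : SimpleContour) : Set ℝ := {x | (x : ℂ) ∈ γ.trace}

end SimpleContour

/-- `γ₁` goes around `1` and has `0` in its exterior, `γ₀₁` goes around `0` and `γ₁` (hence also
around `1`); both are positively oriented and meet the real line at exactly two points. -/
def AdmissiblePair (γ₁ γ₀₁ : SimpleContour) : Prop :=
  γ₁.Encloses 1 ∧ γ₁.Excludes 0 ∧ γ₁.realPoints.ncard = 2 ∧
  γ₀₁.Encloses 0 ∧ γ₀₁.Encloses 1 ∧ (∀ w ∈ γ₁.trace, γ₀₁.Encloses w) ∧
  γ₀₁.realPoints.ncard = 2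

/-- `γ` is positively oriented, has `0` and `1` in its interior and meets the real line at exactly
two points, one of them in `I_ℓ` and the other one in `(1, ∞)`. -/
def AdmissibleSmooth (W : Weighting k) (l : ℕ) (γ : SimpleContour) : Prop :=
  γ.Encloses 0 ∧ γ.Encloses 1 ∧
    ∃ a ∈ gap W l, ∃ b ∈ Set.Ioi (1 : ℝ), γ.realPoints = {a, b}

/-- `E(z) diag(1, 0) E(z)⁻¹`. -/
def proj₁ (E : ℂ → Matrix (Fin 2) (Fin 2) ℂ) (z : ℂ) : Matrix (Fin 2) (Fin 2) ℂ :=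
  E z * !![1, 0; 0, 0] * (E z)⁻¹

/-- `E(z) diag(0, 1) E(z)⁻¹`. -/
def proj₂ (E : ℂ → Matrix (Fin 2) (Fin 2) ℂ) (z : ℂ) : Matrix (Fin 2) (Fin 2) ℂ :=
  E z * !![0, 0; 0, 1] * (E z)⁻¹

/-- The block `[K(2km, 2ξ + i; 2km', 2ξ' + j)]` of the correlation kernel of the Aztec diamond of
size `kN`, for even `N`. -/
def finiteKernel (W : Weighting k) (E : ℂ → Matrix (Fin 2) (Fin 2) ℂ) (γ₁ γ₀₁ : SimpleContour)
    (N : ℕ) (m ξ m' ξ' : ℤ) : Matrix (Fin 2) (Fin 2) ℂ :=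
  Matrix.of fun i j =>
    -((if m' < m then 1 else 0) / (2 * Real.pi * Complex.I)) *
        γ₀₁.integral (fun z => (Phi W z ^ (m - m')) i j * z ^ (ξ' - ξ) / z)
    + 1 / (2 * Real.pi * Complex.I) ^ 2 *
        γ₁.integral (fun w => γ₀₁.integral (fun z =>
          w ^ ξ' / z ^ (ξ + 1) *
            ((1 - z⁻¹) ^ (k * (N / 2)) / (1 - w⁻¹) ^ (k * (N / 2))) *
            rho₁ W w ^ (((N / 2 : ℕ) : ℤ) - m') *
            (proj₁ E w * Phi W z ^ (m - ((N / 2 : ℕ) : ℤ))) i j / (z - w)))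

/-- The block `[K_smooth(2kκ, 2ζ + i; 2kκ', 2ζ' + j)]`, where `γ` is a contour that is admissible
for the `ℓ`-th gap. -/
def smoothKernel (W : Weighting k) (E : ℂ → Matrix (Fin 2) (Fin 2) ℂ) (γ : SimpleContour)
    (κ ζ κ' ζ' : ℤ) : Matrix (Fin 2) (Fin 2) ℂ :=
  Matrix.of fun i j =>
    (if κ ≤ κ' then 1 else 0) / (2 * Real.pi * Complex.I) *
        γ.integral (fun z => rho₁ W z ^ (κ - κ') * z ^ (ζ' - ζ) * proj₁ E z i j / z)
    - (if κ' < κ then 1 else 0) / (2 * Real.pi * Complex.I) *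
        γ.integral (fun z => rho₂ W z ^ (κ - κ') * z ^ (ζ' - ζ) * proj₂ E z i j / z)

/-- `m = (N/2)(χ + 1) + e_χ + κ` with the `e_χ ∈ [0, 1)` that makes `m` an integer. -/
def mCoord (N : ℕ) (χ : ℝ) (κ : ℤ) : ℤ := ⌈(N : ℝ) / 2 * (χ + 1)⌉ + κ

/-- `ξ = (kN/4)(η - 1) + e_η + ζ` with the `e_η ∈ [0, 1)` that makes `ξ` an integer. -/
def xiCoord (k N : ℕ) (η : ℝ) (ζ : ℤ) : ℤ := ⌈(k : ℝ) * N / 4 * (η - 1)⌉ + ζ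

/-- The range `0 < m < N`, `-kN/2 ≤ ξ ≤ -1` of the arguments of the kernel (`N` even). -/
def InRange (k N : ℕ) (m ξ : ℤ) : Prop :=
  0 < m ∧ m < N ∧ -((k * (N / 2) : ℕ) : ℤ) ≤ ξ ∧ ξ ≤ -1

end

end AztecDiamond

open AztecDiamond

namespace AztecDiamond

open Set MeasureTheory intervalIntegral Topology Filter

/-! ### Primitives on star-shaped domains -/

/-! The difference of the two kernels is rewritten as a double contour integral whose integrand is
exponentially small, with a saddle point in the gap $I_\ell$.

Algebra. The integrand of the finite kernel is a sum of products $G(w)H(z)/(z-w)$, where $H$ is a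
Laurent polynomial and $G$ belongs to one sheet of the spectral curve. The integral over $z$ retains
the part $H_+$ of $H$ with nonnegative exponents (`IsContour.cauchy_laurent`). Except for a pole at
$1$, $G$ is holomorphic on the plane cut along $(-\infty,0]$ with the cut opened along $I_\ell$, and
there contour integrals depend only on the winding numbers around $0$ and $1$
(`exists_residues_cutDomain`). So $\gamma_1$ becomes a loop around $0$ and $1$ outside a circle
$|z|=\rho$, minus a loop around $0$ alone inside that circle, both crossing the negative axis in
$I_\ell$. On the inner loop $H_+$ is the Cauchy integral of $H$ over the circle; on the outer loop
$H_+-H$ is. The extra term $GH$ is the integrand of the smooth kernel (`integral_laurentPos_eq`).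
Summed over both sheets, $G$ is rational with its only pole at $1$ and vanishes at infinity, so the
second sheet can serve in place of the first (`integral_add_laurentPos_eq`). Hence the difference of
the kernels is plus or minus a remainder on either sheet (`finiteKernel_sub_smoothKernel`); the
first sheet is used for $\chi\ge0$ and the second for $\chi\le0$, so that only $|\chi|$ matters.

Analysis. The integrand of the remainder is bounded by a constant times $e^{N(h(z)-h(w))}$, where
$h$ is `height`. Required are a circle and two loops, one on each side of it, on which $h$ is
strictly larger than on the circle (`exists_contours`). Two facts control $h$. First, the
eigenvalues of $(z-1)^k\Phi$ have different moduli off $(-\infty,0]$, since the factors expand an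
indefinite form (`slitPlane_subset_hyperbolicSet`), and also on the gaps (`polyP_pos_of_mem_gap`).
Second, the logarithmic derivative of the larger eigenvalue $\lambda_1$ is the average over $\theta$
of those of the polynomials $(z-1)^k(\operatorname{Tr}\Phi-2\cos\theta)$ (`logDeriv_lam₁`), whose
zeros are real and nonpositive by the first fact. Hence
$\operatorname{Im}(z\lambda_1'/\lambda_1)/\operatorname{Im}z$ is monotone along upper half circles
around $0$, and $z\rho_1'/\rho_1$ increases strictly on each gap.

Saddle. On the sheet of $\rho_1$, with $|\chi|$ for $\chi$, a point $x$ of the gap is critical iff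
$\theta_{|\chi|}(x)=\eta$, where $\theta$ is `theta`. If no such $x$ has $\theta'(x)<0$, then
$(\chi,\eta)$ can be moved to infinity without meeting the rough-smooth curve, contrary to its being
inside (`exists_saddle`). At a zero with $\theta'<0$, $h$ has a strict local minimum along the real
axis, while on the circle through $x$ it is largest at $x$ (`height_circle_le`). By the maximum
principle on annuli, every other circle around $0$ has a point higher than $x$ (`exists_height_gt`).
Superlevel sets on upper half circles are arcs, so these points can be joined to paths from a very
small, or very large, circle to the negative axis near $x$; their mirror images close them to the
desired loops. -/

theorem exists_primitive_of_starConvex {U : Set ℂ} (hU : IsOpen U) {c : ℂ}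
    (hc : StarConvex ℝ c U) {h : ℂ → ℂ} (hh : DifferentiableOn ℂ h U) :
    ∃ Q : ℂ → ℂ, ∀ z ∈ U, HasDerivAt Q (h z) z := by
  -- The primitive is the integral of `h` along the segment from the centre to `z`.
  refine ⟨fun z => ∫ t in (0 : ℝ)..1, h (c + t * (z - c)) * (z - c), fun z₀ hz₀ => ?_⟩
  have hmem : ∀ z ∈ U, ∀ t : ℝ, t ∈ Icc (0 : ℝ) 1 → c + t * (z - c) ∈ U := by
    intro z hz t ht
    have := hc hz (a := 1 - t) (b := t) (by linarith [ht.2]) ht.1 (by ring)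
    convert this using 1
    simp only [Complex.real_smul]; push_cast; ring
  have hd : ContinuousOn (deriv h) U := (hh.deriv hU).continuousOn
  obtain ⟨δ, hδ, hball⟩ := Metric.nhds_basis_closedBall.mem_iff.mp (hU.mem_nhds hz₀)
  set F' : ℂ → ℝ → ℂ := fun z t =>
    deriv h (c + t * (z - c)) * t * (z - c) + h (c + t * (z - c)) with hF'
  have hmaps : MapsTo (fun p : ℂ × ℝ => c + p.2 * (p.1 - c))
      (Metric.closedBall z₀ δ ×ˢ Icc (0 : ℝ) 1) U := fun p hp => hmem _ (hball hp.1) _ hp.2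
  have hcont : ContinuousOn (fun p : ℂ × ℝ => c + p.2 * (p.1 - c))
      (Metric.closedBall z₀ δ ×ˢ Icc (0 : ℝ) 1) := by fun_prop
  have hF'c : ContinuousOn (fun p : ℂ × ℝ => F' p.1 p.2)
      (Metric.closedBall z₀ δ ×ˢ Icc (0 : ℝ) 1) := by
    refine ((((hd.comp hcont hmaps).mul (by fun_prop)).mul (by fun_prop))).add
      (hh.continuousOn.comp hcont hmaps)
  have hcompact : IsCompact (Metric.closedBall z₀ δ ×ˢ Icc (0 : ℝ) 1) :=
    (isCompact_closedBall _ _).prod isCompact_Icc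
  obtain ⟨C, hC⟩ := hcompact.exists_bound_of_continuousOn hF'c
  have hslice : ∀ z ∈ Metric.closedBall z₀ δ, ContinuousOn
      (fun t : ℝ => h (c + t * (z - c)) * (z - c)) (Icc 0 1) := by
    intro z hz
    refine (hh.continuousOn.comp (by fun_prop) fun t ht => hmem z (hball hz) t ht).mul (by fun_prop)
  have hslice' : ContinuousOn (F' z₀) (Icc 0 1) :=
    hF'c.comp (f := fun t : ℝ => (z₀, t)) (by fun_prop)
      fun t ht => ⟨Metric.mem_closedBall_self hδ.le, ht⟩
  have key := intervalIntegral.hasDerivAt_integral_of_dominated_loc_of_deriv_le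
    (μ := volume) (F := fun z t => h (c + t * (z - c)) * (z - c)) (F' := F') (x₀ := z₀)
    (s := Metric.closedBall z₀ δ) (a := 0) (b := 1) (bound := fun _ => C)
    (Metric.closedBall_mem_nhds _ hδ) ?_ ?_ ?_ ?_ ?_ ?_
  · have h2 := key.2
    -- The `z`-derivative of the integrand is also the `t`-derivative of `t * h (c + t * (z₀ - c))`,
    -- so it integrates to `h z₀`.
    have : ∫ t in (0 : ℝ)..1, F' z₀ t =
        (1 : ℝ) * h (c + (1 : ℝ) * (z₀ - c)) - (0 : ℝ) * h (c + (0 : ℝ) * (z₀ - c)) := by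
      refine integral_eq_sub_of_hasDerivAt (f := fun t : ℝ => (t : ℂ) * h (c + t * (z₀ - c)))
        (fun t ht => ?_) ?_
      · rw [uIcc_of_le zero_le_one] at ht
        have h1 : HasDerivAt h (deriv h (c + t * (z₀ - c))) (c + t * (z₀ - c)) :=
          (hh.differentiableAt (hU.mem_nhds (hmem z₀ hz₀ t ht))).hasDerivAt
        have h2 : HasDerivAt (fun t : ℝ => c + (t : ℂ) * (z₀ - c)) (z₀ - c) t := by
          simpa using ((Complex.ofRealCLM.hasDerivAt (x := t)).mul_const (z₀ - c)).const_add c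
        have h3 := (Complex.ofRealCLM.hasDerivAt (x := t)).mul (h1.comp t h2)
        refine h3.congr_deriv ?_
        simp only [hF', Complex.ofRealCLM_apply, Complex.ofReal_one, Function.comp]; ring
      · exact hslice'.intervalIntegrable_of_Icc zero_le_one
    rw [this] at h2
    simpa using h2
  · filter_upwards [Metric.closedBall_mem_nhds z₀ hδ] with z hz
    exact ((hslice z hz).intervalIntegrable_of_Icc zero_le_one).def'.aestronglyMeasurable
  · exact (hslice z₀ (Metric.mem_closedBall_self hδ.le)).intervalIntegrable_of_Icc zero_le_one
  · exact (hslice'.intervalIntegrable_of_Icc zero_le_one).def'.aestronglyMeasurable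
  · refine Eventually.of_forall fun t ht z hz => ?_
    rw [uIoc_of_le zero_le_one] at ht
    exact hC (z, t) ⟨hz, ⟨ht.1.le, ht.2⟩⟩
  · exact intervalIntegrable_const
  · refine Eventually.of_forall fun t ht z hz => ?_
    rw [uIoc_of_le zero_le_one] at ht
    have h1 : HasDerivAt h (deriv h (c + t * (z - c))) (c + t * (z - c)) :=
      (hh.differentiableAt (hU.mem_nhds (hmem z (hball hz) t ⟨ht.1.le, ht.2⟩))).hasDerivAt
    have h2 : HasDerivAt (fun z : ℂ => c + (t : ℂ) * (z - c)) t z := by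
      simpa using (((hasDerivAt_id z).sub_const c).const_mul (t : ℂ)).const_add c
    have h3 := (h1.comp z h2).mul ((hasDerivAt_id z).sub_const c)
    refine h3.congr_deriv ?_
    simp only [hF', Function.comp, id]; ring

/-! ### Contour functionals -/

/-- A functional on the continuous functions on the compact set `K` that behaves like the
integration along a rectifiable path in `K` from `a` to `b`. -/
structure IsContour (I : (ℂ → ℂ) → ℂ) (K : Set ℂ) (a b : ℂ) : Prop where
  isCompact : IsCompact K
  congr : ∀ f g, EqOn f g K → I f = I g
  add : ∀ f g, ContinuousOn f K → ContinuousOn g K → I (fun z => f z + g z) = I f + I g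
  smul : ∀ (c : ℂ) f, I (fun z => c * f z) = c * I f
  bound : ∃ L : ℝ, 0 ≤ L ∧ ∀ g M, 0 ≤ M → (∀ z ∈ K, ‖g z‖ ≤ M) → ‖I g‖ ≤ L * M
  ftc : ∀ Q g, ContinuousOn g K → (∀ z ∈ K, HasDerivAt Q (g z) z) → I g = Q b - Q a

namespace IsContour

variable {I J : (ℂ → ℂ) → ℂ} {K K' : Set ℂ} {a b c : ℂ}

theorem trans (hI : IsContour I K a b) (hJ : IsContour J K' b c) :
    IsContour (fun g => I g + J g) (K ∪ K') a c where
  isCompact := hI.isCompact.union hJ.isCompact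
  congr f g h := by
    simp only [hI.congr f g (h.mono subset_union_left), hJ.congr f g (h.mono subset_union_right)]
  add f g hf hg := by
    simp only [hI.add f g (hf.mono subset_union_left) (hg.mono subset_union_left),
      hJ.add f g (hf.mono subset_union_right) (hg.mono subset_union_right)]
    ring
  smul k f := by simp only [hI.smul, hJ.smul]; ring
  bound := by
    obtain ⟨L, hL, h1⟩ := hI.bound
    obtain ⟨L', hL', h2⟩ := hJ.bound
    refine ⟨L + L', add_nonneg hL hL', fun g M hM h => ?_⟩
    calc _ ≤ ‖I g‖ + ‖J g‖ := norm_add_le _ _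
      _ ≤ L * M + L' * M := add_le_add (h1 g M hM fun z hz => h z (Or.inl hz))
          (h2 g M hM fun z hz => h z (Or.inr hz))
      _ = _ := by ring
  ftc Q g hg h := by
    simp only [hI.ftc Q g (hg.mono subset_union_left) fun z hz => h z (Or.inl hz),
      hJ.ftc Q g (hg.mono subset_union_right) fun z hz => h z (Or.inr hz)]
    ring

theorem symm (hI : IsContour I K a b) : IsContour (fun g => -I g) K b a where
  isCompact := hI.isCompact
  congr f g h := by simp only [hI.congr f g h]
  add f g hf hg := by simp only [hI.add f g hf hg]; ring
  smul k f := by simp only [hI.smul]; ring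
  bound := by simpa using hI.bound
  ftc Q g hg h := by simp only [hI.ftc Q g hg h]; ring

theorem sub (hI : IsContour I K a b) {f g : ℂ → ℂ} (hf : ContinuousOn f K)
    (hg : ContinuousOn g K) : I (fun z => f z - g z) = I f - I g := by
  have h1 := hI.add f (fun z => -1 * g z) hf (continuousOn_const.mul hg)
  rw [hI.smul] at h1
  rw [sub_eq_add_neg, ← neg_one_mul, ← h1]
  exact hI.congr _ _ fun z _ => by ring

theorem sum (hI : IsContour I K a b) {ι : Type*} (s : Finset ι) {f : ι → ℂ → ℂ}
    (hf : ∀ i ∈ s, ContinuousOn (f i) K) : I (fun z => ∑ i ∈ s, f i z) = ∑ i ∈ s, I (f i) := by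
  classical
  induction s using Finset.induction_on with
  | empty => simpa using hI.smul 0 fun _ => 0
  | insert i s hi ih =>
    simp only [Finset.sum_insert hi]
    rw [hI.add _ _ (hf i (Finset.mem_insert_self _ _))
      (continuousOn_finsetSum _ fun j hj => hf j (Finset.mem_insert_of_mem hj)),
      ih fun j hj => hf j (Finset.mem_insert_of_mem hj)]

/-- A closed contour integral of a function with a primitive vanishes. -/
theorem eq_zero (hI : IsContour I K a a) {Q g : ℂ → ℂ} (hg : ContinuousOn g K)
    (h : ∀ z ∈ K, HasDerivAt Q (g z) z) : I g = 0 := by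
  rw [hI.ftc Q g hg h, sub_self]

end IsContour

/-! ### Piecewise continuously differentiable paths -/

/-- `γ` restricted to `[a, b]` is a path along which the fundamental theorem of calculus holds. -/
structure IsRectifiable (γ : ℝ → ℂ) (a b : ℝ) : Prop where
  le : a ≤ b
  continuousOn : ContinuousOn γ (Icc a b)
  integrable : IntervalIntegrable (deriv γ) volume a b
  ftc : ∀ Q g : ℂ → ℂ, ContinuousOn g (γ '' Icc a b) →
    (∀ t ∈ Icc a b, HasDerivAt Q (g (γ t)) (γ t)) →
    ∫ t in a..b, g (γ t) * deriv γ t = Q (γ b) - Q (γ a)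

namespace IsRectifiable

variable {γ : ℝ → ℂ} {a b c : ℝ}

theorem integrable_mul (h : IsRectifiable γ a b) {g : ℂ → ℂ} (hg : ContinuousOn g (γ '' Icc a b)) :
    IntervalIntegrable (fun t => g (γ t) * deriv γ t) volume a b := by
  refine h.integrable.continuousOn_mul ?_
  rw [uIcc_of_le h.le]
  exact hg.comp h.continuousOn (mapsTo_image _ _)

theorem trans (h₁ : IsRectifiable γ a b) (h₂ : IsRectifiable γ b c) : IsRectifiable γ a c where
  le := h₁.le.trans h₂.le
  continuousOn := by
    rw [← Icc_union_Icc_eq_Icc h₁.le h₂.le]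
    exact h₁.continuousOn.union_of_isClosed h₂.continuousOn isClosed_Icc isClosed_Icc
  integrable := h₁.integrable.trans h₂.integrable
  ftc Q g hg hQ := by
    have s₁ : Icc a b ⊆ Icc a c := Icc_subset_Icc_right h₂.le
    have s₂ : Icc b c ⊆ Icc a c := Icc_subset_Icc_left h₁.le
    rw [← integral_add_adjacent_intervals
      (h₁.integrable_mul (hg.mono (image_mono s₁)))
      (h₂.integrable_mul (hg.mono (image_mono s₂))),
      h₁.ftc Q g (hg.mono (image_mono s₁)) fun t ht => hQ t (s₁ ht),
      h₂.ftc Q g (hg.mono (image_mono s₂)) fun t ht => hQ t (s₂ ht)]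
    ring

theorem of_contDiffOn (hab : a < b) (hγ : ContDiffOn ℝ 1 γ (Icc a b)) : IsRectifiable γ a b := by
  have hint : IntervalIntegrable (deriv γ) volume a b := by
    have := (hγ.derivWithin (m := 0) (uniqueDiffOn_Icc hab) (by simp)).continuousOn
    apply (this.intervalIntegrable_of_Icc (μ := volume) hab.le).congr_ae
    simp only [hab.le, uIoc_of_le]
    -- Smoothness within `[a, b]` says nothing about the two-sided `deriv γ` at the end points;
    -- these are a null set.
    rw [← restrict_Ioo_eq_restrict_Ioc]
    filter_upwards [self_mem_ae_restrict measurableSet_Ioo] with x hx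
    exact derivWithin_of_mem_nhds (Icc_mem_nhds hx.1 hx.2)
  refine ⟨hab.le, hγ.continuousOn, hint, fun Q g hg hQ => ?_⟩
  refine integral_eq_sub_of_hasDerivAt_of_le (f := fun t => Q (γ t)) hab.le ?_ ?_ ?_
  · intro t ht
    exact ((hQ t ht).continuousAt).comp_continuousWithinAt (hγ.continuousOn t ht)
  · intro t ht
    have hd : HasDerivAt γ (deriv γ t) t := by
      apply DifferentiableAt.hasDerivAt
      exact ((hγ t ⟨ht.1.le, ht.2.le⟩).differentiableWithinAt one_ne_zero).differentiableAt
        (Icc_mem_nhds ht.1 ht.2)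
    exact (hQ t ⟨ht.1.le, ht.2.le⟩).comp t hd
  · refine hint.continuousOn_mul ?_
    rw [uIcc_of_le hab.le]
    exact hg.comp hγ.continuousOn (mapsTo_image _ _)

theorem isContour (h : IsRectifiable γ a b) :
    IsContour (fun g => ∫ t in a..b, g (γ t) * deriv γ t) (γ '' Icc a b) (γ a) (γ b) where
  isCompact := isCompact_Icc.image_of_continuousOn h.continuousOn
  congr f g hfg := by
    refine integral_congr fun t ht => ?_
    rw [uIcc_of_le h.le] at ht
    simp only [hfg (mem_image_of_mem γ ht)]
  add f g hf hg := by
    rw [← integral_add (h.integrable_mul hf) (h.integrable_mul hg)]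
    exact integral_congr fun t _ => by simp only; ring
  smul c f := by
    rw [← intervalIntegral.integral_const_mul]
    exact integral_congr fun t _ => by simp only; ring
  bound := by
    refine ⟨∫ t in a..b, ‖deriv γ t‖, integral_nonneg h.le fun t _ => norm_nonneg _,
      fun g M hM hg => ?_⟩
    rw [mul_comm, ← intervalIntegral.integral_const_mul]
    refine norm_integral_le_of_norm_le h.le (Eventually.of_forall fun t ht => ?_)
      (h.integrable.norm.const_mul M)
    rw [norm_mul]
    exact mul_le_mul_of_nonneg_right (hg _ (mem_image_of_mem γ ⟨ht.1.le, ht.2⟩)) (norm_nonneg _)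
  ftc Q g hg hQ := h.ftc Q g hg fun t ht => hQ _ (mem_image_of_mem γ ht)

end IsRectifiable

namespace SimpleContour

/-- Strong induction on the number of break points inside the interval: split at one of them, or
apply the smooth case if there is none. -/
theorem isRectifiable (γ : SimpleContour) : IsRectifiable γ.toFun 0 1 := by
  obtain ⟨B, hB⟩ := γ.piecewise
  have key : ∀ n : ℕ, ∀ a b : ℝ, 0 ≤ a → a < b → b ≤ 1 → (B.filter (· ∈ Ioo a b)).card = n →
      IsRectifiable γ.toFun a b := by
    intro n
    induction n using Nat.strong_induction_on with
    | _ n ih =>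
      intro a b ha hab hb hn
      by_cases hne : ∃ t ∈ B, t ∈ Ioo a b
      · obtain ⟨t, htB, ht⟩ := hne
        have h1 : (B.filter (· ∈ Ioo a t)).card < n := by
          rw [← hn]
          refine Finset.card_lt_card ((Finset.ssubset_iff_of_subset ?_).mpr ⟨t, ?_, ?_⟩)
          · exact Finset.monotone_filter_right _ fun s _ hs => ⟨hs.1, hs.2.trans ht.2⟩
          · simp [htB, ht.1, ht.2]
          · simp
        have h2 : (B.filter (· ∈ Ioo t b)).card < n := by
          rw [← hn]
          refine Finset.card_lt_card ((Finset.ssubset_iff_of_subset ?_).mpr ⟨t, ?_, ?_⟩)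
          · exact Finset.monotone_filter_right _ fun s _ hs => ⟨ht.1.trans hs.1, hs.2⟩
          · simp [htB, ht.1, ht.2]
          · simp
        exact (ih _ h1 a t ha ht.1 (ht.2.le.trans hb) rfl).trans
          (ih _ h2 t b (ha.trans ht.1.le) ht.2 hb rfl)
      · push Not at hne
        exact IsRectifiable.of_contDiffOn hab (hB a b ha hab hb hne)
  exact key _ 0 1 le_rfl one_pos le_rfl rfl

theorem isContour (γ : SimpleContour) :
    IsContour γ.integral γ.trace (γ.toFun 0) (γ.toFun 0) := by
  have := γ.isRectifiable.isContour
  rwa [← γ.closed] at this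

/-- Changing a function at finitely many points does not change its contour integral. -/
theorem integral_congr_off_finite (γ : SimpleContour) {S : Set ℂ} (hS : S.Finite) {f g : ℂ → ℂ}
    (h : ∀ z ∈ γ.trace, z ∉ S → f z = g z) : γ.integral f = γ.integral g := by
  refine intervalIntegral.integral_congr_ae ?_
  -- The curve is injective on `[0, 1)`, so it visits a finite set at finitely many parameters;
  -- these and the parameter `1` form a null set.
  have hfin : (Ico (0 : ℝ) 1 ∩ γ.toFun ⁻¹' S).Finite :=
    Set.Finite.of_finite_image (hS.subset (by rintro _ ⟨t, ht, rfl⟩; exact ht.2))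
      (γ.injOn.mono inter_subset_left)
  · have hnull : volume ((Ico (0 : ℝ) 1 ∩ γ.toFun ⁻¹' S) ∪ {1}) = 0 :=
      (hfin.union (finite_singleton 1)).measure_zero volume
    filter_upwards [measure_eq_zero_iff_ae_notMem.mp hnull] with t ht hmem
    rw [uIoc_of_le zero_le_one] at hmem
    simp only [mem_union, mem_singleton_iff, not_or] at ht
    have ht1 : t < 1 := lt_of_le_of_ne hmem.2 ht.2
    rw [h (γ.toFun t) (mem_image_of_mem _ ⟨hmem.1.le, hmem.2⟩) fun hs => ht.1 ⟨⟨hmem.1.le, ht1⟩, hs⟩]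

end SimpleContour
end AztecDiamond

namespace AztecDiamond

open Set MeasureTheory intervalIntegral Topology Filter

/-! ### The slit plane with a window -/

/-- The plane cut along `(-∞, 0]`, with the cut opened along the interval `(l, r)`. -/
def cutDomain (l r : ℝ) : Set ℂ := Complex.slitPlane ∪ {z | z.im = 0 ∧ z.re ∈ Ioo l r}

theorem isOpen_im_ne_or_re_mem (l r : ℝ) : IsOpen {z : ℂ | z.im ≠ 0 ∨ z.re ∈ Ioo l r} :=
  (isOpen_ne_fun Complex.continuous_im continuous_const).union
    (isOpen_Ioo.preimage Complex.continuous_re)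

theorem mem_cutDomain_iff {l r : ℝ} {z : ℂ} :
    z ∈ cutDomain l r ↔ z ∈ Complex.slitPlane ∨ (z.im = 0 ∧ z.re ∈ Ioo l r) := Iff.rfl

theorem isOpen_cutDomain (l r : ℝ) : IsOpen (cutDomain l r) := by
  have : cutDomain l r = Complex.slitPlane ∪ {z : ℂ | z.im ≠ 0 ∨ z.re ∈ Ioo l r} := by
    ext z
    simp only [cutDomain, mem_union, mem_ofPred_eq, Complex.mem_slitPlane_iff]
    tauto
  rw [this]
  exact Complex.isOpen_slitPlane.union (isOpen_im_ne_or_re_mem l r)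

theorem ne_zero_of_mem_cutDomain {l r : ℝ} (hr : r ≤ 0) {z : ℂ} (hz : z ∈ cutDomain l r) :
    z ≠ 0 := by
  rintro rfl
  rcases hz with h | h
  · exact Complex.zero_notMem_slitPlane h
  · exact absurd h.2.2 (by simpa using hr)

/-- The function `log (-z) + πi` is holomorphic across the negative axis. It equals `log z` above
the axis and, by the next lemma, `log z + 2πi` below it. -/
theorem log_neg_of_im_pos {z : ℂ} (hz : 0 < z.im) :
    Complex.log (-z) + Real.pi * Complex.I = Complex.log z := by
  rw [Complex.log, Complex.log, norm_neg, Complex.arg_neg_eq_arg_sub_pi_of_im_pos hz]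
  push_cast; ring

theorem log_neg_of_im_neg {z : ℂ} (hz : z.im < 0) :
    Complex.log (-z) = Complex.log z + Real.pi * Complex.I := by
  rw [Complex.log, Complex.log, norm_neg, Complex.arg_neg_eq_arg_add_pi_of_im_neg hz]
  push_cast; ring

theorem exists_const_of_hasDerivAt_eq {U : Set ℂ} (hU : IsOpen U) (hc : Convex ℝ U) {f g h : ℂ → ℂ}
    (hf : ∀ z ∈ U, HasDerivAt f (h z) z) (hg : ∀ z ∈ U, HasDerivAt g (h z) z) :
    ∃ α, ∀ z ∈ U, f z = g z + α := by
  rcases U.eq_empty_or_nonempty with rfl | ⟨z₀, hz₀⟩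
  · exact ⟨0, by simp⟩
  refine ⟨f z₀ - g z₀, fun z hz => ?_⟩
  have := hU.is_const_of_deriv_eq_zero (f := fun z => f z - g z) hc.isPreconnected
    (fun z hz => ((hf z hz).fun_sub (hg z hz)).differentiableAt.differentiableWithinAt)
    (fun z hz => by simpa using ((hf z hz).fun_sub (hg z hz)).deriv) hz hz₀
  linear_combination this

/-- On the cut plane with a window every holomorphic function has a primitive up to a multiple
of `1 / z`. -/
theorem exists_primitive_cutDomain {l r : ℝ} (hlr : l < r) (hr : r ≤ 0) {h : ℂ → ℂ}
    (hh : DifferentiableOn ℂ h (cutDomain l r)) :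
    ∃ (c : ℂ) (Q : ℂ → ℂ), ∀ z ∈ cutDomain l r, HasDerivAt Q (h z - c * z⁻¹) z := by
  classical
  -- Both half planes joined through the vertical strip over the window: star-shaped about the
  -- midpoint of the window.
  set D : Set ℂ := {z : ℂ | z.im ≠ 0 ∨ (z.re ∈ Ioo l r)} with hD
  have hDo : IsOpen D := isOpen_im_ne_or_re_mem l r
  have hDs : D ⊆ cutDomain l r := by
    intro z hz
    rw [mem_cutDomain_iff, Complex.mem_slitPlane_iff]
    rcases hz with h | h <;> tauto
  have hstar : StarConvex ℝ (((l + r) / 2 : ℝ) : ℂ) D := by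
    intro z hz a b ha hb hab
    rcases eq_or_lt_of_le hb with rfl | hb'
    · right
      have : a = 1 := by linarith
      subst this
      simp only [one_smul, zero_smul, add_zero, Complex.ofReal_re]
      constructor <;> linarith
    · rcases hz with h | h
      · left
        simp [hb'.ne', h]
      · right
        have : (a • (((l + r) / 2 : ℝ) : ℂ) + b • z).re = a * ((l + r) / 2) + b * z.re := by simp
        rw [this]
        exact convex_Ioo l r ⟨by linarith, by linarith⟩ h ha hb hab
  obtain ⟨Q₁, hQ₁⟩ := exists_primitive_of_starConvex Complex.isOpen_slitPlane
    Complex.starConvex_one_slitPlane (hh.mono subset_union_left)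
  obtain ⟨Q₂, hQ₂⟩ := exists_primitive_of_starConvex hDo hstar (hh.mono hDs)
  obtain ⟨α, hα⟩ := exists_const_of_hasDerivAt_eq (U := {z : ℂ | 0 < z.im})
    (isOpen_lt continuous_const Complex.continuous_im) (convex_halfSpace_im_gt 0)
    (fun z hz => hQ₁ z (Or.inr (ne_of_gt hz))) (fun z hz => hQ₂ z (Or.inl (ne_of_gt hz)))
  obtain ⟨β, hβ⟩ := exists_const_of_hasDerivAt_eq (U := {z : ℂ | z.im < 0})
    (isOpen_lt Complex.continuous_im continuous_const) (convex_halfSpace_im_lt 0)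
    (fun z hz => hQ₁ z (Or.inr (ne_of_lt hz))) (fun z hz => hQ₂ z (Or.inl (ne_of_lt hz)))
  -- The primitives on the slit plane and on `D` differ by `α` above and by `β` below the axis. The
  -- logarithm jumps by `2πi` between the two sides, so this multiple of it absorbs the mismatch.
  set c : ℂ := (α - β) / (2 * Real.pi * Complex.I) with hc
  have hcπ : c * (2 * Real.pi * Complex.I) = α - β := by
    rw [hc, div_mul_cancel₀]
    exact Complex.two_pi_I_ne_zero
  refine ⟨c, fun z => if z ∈ Complex.slitPlane then Q₁ z - c * Complex.log z
    else Q₂ z - c * (Complex.log (-z) + Real.pi * Complex.I) + α, fun z hz => ?_⟩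
  by_cases hzs : z ∈ Complex.slitPlane
  · refine ((hQ₁ z hzs).fun_sub ((Complex.hasDerivAt_log hzs).const_mul c)).congr_of_eventuallyEq ?_
    filter_upwards [Complex.isOpen_slitPlane.mem_nhds hzs] with y hy
    simp [hy]
  · have hz' : z.im = 0 ∧ z.re ∈ Ioo l r := hz.resolve_left hzs
    have hneg : -z ∈ Complex.slitPlane := by
      left; simpa using hz'.2.2.trans_le hr
    have hlog : HasDerivAt (fun y => Complex.log (-y) + Real.pi * Complex.I) z⁻¹ z := by
      have := ((Complex.hasDerivAt_log hneg).comp z (hasDerivAt_neg z)).add_const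
        (Real.pi * Complex.I : ℂ)
      refine this.congr_deriv ?_
      rw [inv_neg]; ring
    refine (((hQ₂ z (Or.inr hz'.2)).fun_sub (hlog.const_mul c)).add_const α).congr_of_eventuallyEq ?_
    filter_upwards [(isOpen_Ioo.preimage Complex.continuous_re).mem_nhds hz'.2] with y hy
    split_ifs with hys
    · have hyim : y.im ≠ 0 := by
        rcases Complex.mem_slitPlane_iff.mp hys with h | h
        · exact absurd (hy.2.trans_le hr) (not_lt.mpr h.le)
        · exact h
      rcases lt_or_gt_of_ne hyim with h | h
      · simp only [hβ y h, log_neg_of_im_neg h]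
        linear_combination hcπ
      · simp only [hα y h, log_neg_of_im_pos h]
        ring
    · rfl

variable {I : (ℂ → ℂ) → ℂ} {K : Set ℂ} {a : ℂ}

theorem IsContour.continuousOn_pow_inv {n : ℕ} {w : ℂ} {K : Set ℂ} (hw : w ∉ K) :
    ContinuousOn (fun z : ℂ => ((z - w) ^ n)⁻¹) K := by
  refine ContinuousOn.inv₀ (by fun_prop) fun z hz => pow_ne_zero _ (sub_ne_zero.mpr ?_)
  rintro rfl; exact hw hz

theorem continuousOn_sub_inv {w : ℂ} {K : Set ℂ} (hw : w ∉ K) :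
    ContinuousOn (fun z : ℂ => (z - w)⁻¹) K := by
  refine ContinuousOn.inv₀ (by fun_prop) fun z hz => sub_ne_zero.mpr ?_
  rintro rfl; exact hw hz

theorem continuousOn_inv_id {K : Set ℂ} (hw : (0 : ℂ) ∉ K) :
    ContinuousOn (fun z : ℂ => z⁻¹) K := by
  simpa using continuousOn_sub_inv hw

theorem continuousOn_zpow_id {K : Set ℂ} (n : ℤ) (hw : (0 : ℂ) ∉ K) :
    ContinuousOn (fun z : ℂ => z ^ n) K :=
  continuousOn_id.zpow₀ n fun z hz => Or.inl (by rintro rfl; exact hw hz)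

/-- The integral of a higher order pole along a closed contour vanishes. -/
theorem IsContour.pole_eq_zero (hI : IsContour I K a a) {w : ℂ} (hw : w ∉ K) (n : ℕ) :
    I (fun z => ((z - w) ^ (n + 2))⁻¹) = 0 := by
  refine hI.eq_zero (Q := fun z => -((n + 1 : ℂ)⁻¹) * ((z - w) ^ (n + 1))⁻¹)
    (IsContour.continuousOn_pow_inv hw) fun z hz => ?_
  have hzw : z - w ≠ 0 := sub_ne_zero.mpr (by rintro rfl; exact hw hz)
  have h1 : HasDerivAt (fun z : ℂ => (z - w) ^ (n + 1)) ((n + 1 : ℕ) * (z - w) ^ n) z := by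
    simpa using ((hasDerivAt_id z).sub_const w).fun_pow (n + 1)
  refine ((h1.inv (pow_ne_zero _ hzw)).const_mul _).congr_deriv ?_
  have : (n + 1 : ℂ) ≠ 0 := by exact_mod_cast Nat.succ_ne_zero n
  push_cast
  field_simp
  ring

/-- Contour integrals of holomorphic functions on the cut plane with a window, with a pole at `1`
allowed, are combinations of the two winding numbers. -/
theorem exists_residues_cutDomain {l r : ℝ} (hlr : l < r) (hr : r ≤ 0) (e : ℕ) {h : ℂ → ℂ}
    (hh : DifferentiableOn ℂ h (cutDomain l r)) :
    ∃ c d : ℂ, (e = 0 → d = 0) ∧ ∀ (I : (ℂ → ℂ) → ℂ) (K : Set ℂ) (a : ℂ), IsContour I K a a →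
      K ⊆ cutDomain l r → 1 ∉ K →
      I (fun z => h z * ((z - 1) ^ e)⁻¹) = c * I (fun z => z⁻¹) + d * I (fun z => (z - 1)⁻¹) := by
  have h1mem : (1 : ℂ) ∈ cutDomain l r := Or.inl (by simp)
  induction e generalizing h with
  | zero =>
    obtain ⟨c, Q, hQ⟩ := exists_primitive_cutDomain hlr hr hh
    refine ⟨c, 0, fun _ => rfl, fun I K a hI hK _ => ?_⟩
    have h0 : (0 : ℂ) ∉ K := fun h => ne_zero_of_mem_cutDomain hr (hK h) rfl
    have hc : ContinuousOn (fun z => c * z⁻¹) K := continuousOn_const.mul (continuousOn_inv_id h0)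
    have := hI.eq_zero (Q := Q) (g := fun z => h z - c * z⁻¹)
      ((hh.continuousOn.mono hK).sub hc) fun z hz => hQ z (hK hz)
    rw [hI.sub (hh.continuousOn.mono hK) hc, hI.smul] at this
    simp only [pow_zero, inv_one, mul_one]
    linear_combination this
  | succ e ih =>
    -- Writing `h z = h 1 + (z - 1) * dslope h 1 z` lowers the order of the pole by one.
    have hd : DifferentiableOn ℂ (dslope h 1) (cutDomain l r) :=
      (Complex.differentiableOn_dslope ((isOpen_cutDomain l r).mem_nhds h1mem)).mpr hh
    obtain ⟨c, d, -, hcd⟩ := ih hd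
    -- The split-off term is a pure pole at `1`, which has a residue only if it is simple.
    refine ⟨c, d + if e = 0 then h 1 else 0, fun h => by simp at h, fun I K a hI hK h1 => ?_⟩
    have hcongr : EqOn (fun z => h z * ((z - 1) ^ (e + 1))⁻¹)
        (fun z => dslope h 1 z * ((z - 1) ^ e)⁻¹ + h 1 * ((z - 1) ^ (e + 1))⁻¹) K := by
      intro z hz
      have hz1 : z ≠ 1 := by rintro rfl; exact h1 hz
      have hz1' := sub_ne_zero.mpr hz1
      simp only
      rw [dslope_of_ne _ hz1, slope_def_field]
      field_simp
      ring
    rw [hI.congr _ _ hcongr, hI.add (fun z => dslope h 1 z * ((z - 1) ^ e)⁻¹) (fun z => h 1 * ((z - 1) ^ (e + 1))⁻¹)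
      ((hd.continuousOn.mono hK).mul (IsContour.continuousOn_pow_inv h1))
      (continuousOn_const.mul (IsContour.continuousOn_pow_inv h1)), hcd I K a hI hK h1, hI.smul]
    rcases e with _ | e
    · simp; ring
    · rw [hI.pole_eq_zero h1]; simp

/-! ### Rational functions with poles at `0` and `1` -/

theorem IsContour.zpow_eq (hI : IsContour I K a a) (h0 : (0 : ℂ) ∉ K) (n : ℤ) :
    I (fun z => z ^ n) = if n = -1 then I (fun z => z⁻¹) else 0 := by
  split_ifs with h
  · subst h; simp
  · refine hI.eq_zero (Q := fun z => (n + 1 : ℂ)⁻¹ * z ^ (n + 1)) (continuousOn_zpow_id n h0)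
      fun z hz => ?_
    have hz0 : z ≠ 0 := by rintro rfl; exact h0 hz
    refine ((hasDerivAt_zpow (n + 1) z (Or.inl hz0)).const_mul _).congr_deriv ?_
    have : (n + 1 : ℂ) ≠ 0 := by
      intro h'; apply h; have : ((n + 1 : ℤ) : ℂ) = 0 := by push_cast; exact h'
      have := Int.cast_eq_zero.mp this; omega
    push_cast
    rw [add_sub_cancel_right, inv_mul_cancel_left₀ this]

/-- Induction on `e` and, in both directions, on `p`, by
$z^{p+1}(z-1)^{-e-1}=z^p(z-1)^{-e-1}+z^p(z-1)^{-e}$. The coefficients do not depend on the contour.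
-/
theorem exists_residues_zpow (e : ℕ) (p : ℤ) :
    ∃ c d : ℂ, ∀ (I : (ℂ → ℂ) → ℂ) (K : Set ℂ) (a : ℂ), IsContour I K a a → 0 ∉ K → 1 ∉ K →
      I (fun z => z ^ p * ((z - 1) ^ e)⁻¹) =
        c * I (fun z => z⁻¹) + d * I (fun z => (z - 1)⁻¹) := by
  have hcont : ∀ (e : ℕ) (p : ℤ) (K : Set ℂ), (0 : ℂ) ∉ K → (1 : ℂ) ∉ K →
      ContinuousOn (fun z : ℂ => z ^ p * ((z - 1) ^ e)⁻¹) K := fun e p K h0 h1 =>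
    (continuousOn_zpow_id p h0).mul (IsContour.continuousOn_pow_inv h1)
  induction e generalizing p with
  | zero =>
    refine ⟨if p = -1 then 1 else 0, 0, fun I K a hI h0 _ => ?_⟩
    simp only [pow_zero, inv_one, mul_one]
    rw [hI.zpow_eq h0]
    split_ifs <;> simp
  | succ e ih =>
    induction p using Int.induction_on with
    | zero =>
      refine ⟨0, if e = 0 then 1 else 0, fun I K a hI _ h1 => ?_⟩
      simp only [zpow_zero, one_mul]
      rcases e with _ | e
      · simp
      · rw [hI.pole_eq_zero h1]; simp
    | succ p ihp =>
      obtain ⟨c, d, h⟩ := ihp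
      obtain ⟨c', d', h'⟩ := ih p
      refine ⟨c + c', d + d', fun I K a hI h0 h1 => ?_⟩
      rw [hI.congr _ (fun z => z ^ (p : ℤ) * ((z - 1) ^ (e + 1))⁻¹ + z ^ (p : ℤ) * ((z - 1) ^ e)⁻¹),
        hI.add _ _ (hcont _ _ _ h0 h1) (hcont _ _ _ h0 h1), h I K a hI h0 h1, h' I K a hI h0 h1]
      · ring
      · intro z hz
        have hz0 : z ≠ 0 := by rintro rfl; exact h0 hz
        have hz1 : z - 1 ≠ 0 := sub_ne_zero.mpr (by rintro rfl; exact h1 hz)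
        simp only
        rw [zpow_add_one₀ hz0]
        field_simp
        ring
    | pred p ihp =>
      obtain ⟨c, d, h⟩ := ihp
      obtain ⟨c', d', h'⟩ := ih (-p - 1)
      refine ⟨c - c', d - d', fun I K a hI h0 h1 => ?_⟩
      rw [hI.congr _ (fun z => z ^ (-p : ℤ) * ((z - 1) ^ (e + 1))⁻¹
          - z ^ (-p - 1 : ℤ) * ((z - 1) ^ e)⁻¹),
        hI.sub (hcont _ _ _ h0 h1) (hcont _ _ _ h0 h1), h I K a hI h0 h1, h' I K a hI h0 h1]
      · ring
      · intro z hz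
        have hz0 : z ≠ 0 := by rintro rfl; exact h0 hz
        have hz1 : z - 1 ≠ 0 := sub_ne_zero.mpr (by rintro rfl; exact h1 hz)
        simp only
        rw [zpow_sub_one₀ hz0]
        field_simp
        ring

/-- Since `c` and `d` are chosen before the contour, two contours with the same winding numbers
around `0` and `1` give the same integral. -/
theorem exists_residues_polynomial (b : Polynomial ℂ) (e : ℕ) (p : ℤ) :
    ∃ c d : ℂ, ∀ (I : (ℂ → ℂ) → ℂ) (K : Set ℂ) (a : ℂ), IsContour I K a a → 0 ∉ K → 1 ∉ K →
      I (fun z => z ^ p * b.eval z * ((z - 1) ^ e)⁻¹) =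
        c * I (fun z => z⁻¹) + d * I (fun z => (z - 1)⁻¹) := by
  choose c d h using fun j : ℕ => exists_residues_zpow e (p + j)
  refine ⟨∑ j ∈ Finset.range (b.natDegree + 1), b.coeff j * c j,
    ∑ j ∈ Finset.range (b.natDegree + 1), b.coeff j * d j, fun I K a hI h0 h1 => ?_⟩
  rw [hI.congr _ (fun z => ∑ j ∈ Finset.range (b.natDegree + 1),
    b.coeff j * (z ^ (p + j) * ((z - 1) ^ e)⁻¹)), hI.sum, Finset.sum_mul, Finset.sum_mul,
    ← Finset.sum_add_distrib]
  · refine Finset.sum_congr rfl fun j _ => ?_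
    rw [hI.smul, h j I K a hI h0 h1]; ring
  · intro j _
    exact continuousOn_const.mul ((continuousOn_zpow_id _ h0).mul
      (IsContour.continuousOn_pow_inv h1))
  · intro z hz
    have hz0 : z ≠ 0 := by rintro rfl; exact h0 hz
    simp only
    rw [Polynomial.eval_eq_sum_range, Finset.mul_sum, Finset.sum_mul]
    refine Finset.sum_congr rfl fun j _ => ?_
    rw [zpow_add₀ hz0, zpow_natCast]; ring

/-! ### Cauchy integrals of Laurent polynomials -/

/-- Polynomial division $z^{n+1}/(z-w)=z^n+w\,z^n/(z-w)$, run in both directions from `n = 0`. The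
exponent `-1` is met only when descending, which is why the residue at `0` appears exactly for `n <
0`. -/
theorem IsContour.zpow_div_sub (hI : IsContour I K a a) (h0 : (0 : ℂ) ∉ K) {w : ℂ} (hw0 : w ≠ 0)
    (hw : w ∉ K) (n : ℤ) :
    I (fun z => z ^ n * (z - w)⁻¹) =
      w ^ n * I (fun z => (z - w)⁻¹) - (if n < 0 then w ^ n else 0) * I (fun z => z⁻¹) := by
  have hc : ∀ n : ℤ, ContinuousOn (fun z : ℂ => z ^ n * (z - w)⁻¹) K := fun n =>
    (continuousOn_zpow_id n h0).mul (continuousOn_sub_inv hw)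
  induction n using Int.induction_on with
  | zero => simp
  | succ n ih =>
    rw [hI.congr _ (fun z => z ^ (n : ℤ) + w * (z ^ (n : ℤ) * (z - w)⁻¹)),
      hI.add (fun z => z ^ (n : ℤ)) (fun z => w * (z ^ (n : ℤ) * (z - w)⁻¹))
        (continuousOn_zpow_id _ h0) (continuousOn_const.mul (hc _)), hI.smul, ih,
      hI.zpow_eq h0, if_neg (by omega), if_neg (by omega), if_neg (by omega), zpow_add_one₀ hw0]
    · ring
    · intro z hz
      have hz0 : z ≠ 0 := by rintro rfl; exact h0 hz
      have hzw : z - w ≠ 0 := sub_ne_zero.mpr (by rintro rfl; exact hw hz)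
      simp only
      rw [zpow_add_one₀ hz0]
      field_simp
      ring
  | pred n ih =>
    rw [hI.congr _ (fun z => w⁻¹ * (z ^ (-n : ℤ) * (z - w)⁻¹ - z ^ (-n - 1 : ℤ))), hI.smul,
      hI.sub (hc _) (continuousOn_zpow_id _ h0), ih, hI.zpow_eq h0, zpow_sub_one₀ hw0]
    · rcases n with _ | n
      · simp
        ring
      · rw [if_pos (by omega), if_neg (by omega), if_pos (by omega)]
        ring
    · intro z hz
      have hz0 : z ≠ 0 := by rintro rfl; exact h0 hz
      have hzw : z - w ≠ 0 := sub_ne_zero.mpr (by rintro rfl; exact hw hz)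
      simp only
      rw [zpow_sub_one₀ hz0]
      field_simp
      ring

/-- The part with nonnegative exponents of the Laurent polynomial `z ^ s * b(z)`. -/
noncomputable def laurentPos (b : Polynomial ℂ) (s : ℤ) (w : ℂ) : ℂ :=
  ∑ j ∈ Finset.range (b.natDegree + 1), if 0 ≤ s + j then b.coeff j * w ^ (s + j).toNat else 0

theorem differentiable_laurentPos (b : Polynomial ℂ) (s : ℤ) : Differentiable ℂ (laurentPos b s) := by
  unfold laurentPos
  refine Differentiable.fun_sum fun j _ => ?_
  split_ifs <;> fun_prop

/-- Linear combination of the monomial case. The coefficient of the winding number around `0` is the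
part of the Laurent polynomial with negative exponents. -/
theorem IsContour.laurent_div_sub (hI : IsContour I K a a) (h0 : (0 : ℂ) ∉ K) {w : ℂ} (hw0 : w ≠ 0)
    (hw : w ∉ K) (b : Polynomial ℂ) (s : ℤ) :
    I (fun z => z ^ s * b.eval z * (z - w)⁻¹) =
      w ^ s * b.eval w * I (fun z => (z - w)⁻¹)
        - (w ^ s * b.eval w - laurentPos b s w) * I (fun z => z⁻¹) := by
  rw [hI.congr _ (fun z => ∑ j ∈ Finset.range (b.natDegree + 1),
    b.coeff j * (z ^ (s + j) * (z - w)⁻¹)), hI.sum]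
  · have hb : w ^ s * b.eval w = ∑ j ∈ Finset.range (b.natDegree + 1), b.coeff j * w ^ (s + j) := by
      rw [Polynomial.eval_eq_sum_range, Finset.mul_sum]
      refine Finset.sum_congr rfl fun j _ => ?_
      rw [zpow_add₀ hw0, zpow_natCast]; ring
    have hneg : w ^ s * b.eval w - laurentPos b s w =
        ∑ j ∈ Finset.range (b.natDegree + 1), b.coeff j * if s + j < 0 then w ^ (s + j) else 0 := by
      rw [hb, laurentPos, ← Finset.sum_sub_distrib]
      refine Finset.sum_congr rfl fun j _ => ?_
      by_cases hj : 0 ≤ s + j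
      · rw [if_pos hj, if_neg (by omega), ← zpow_natCast, Int.toNat_of_nonneg hj]; ring
      · rw [if_neg hj, if_pos (by omega)]; ring
    rw [hneg, hb, Finset.sum_mul, Finset.sum_mul, ← Finset.sum_sub_distrib]
    refine Finset.sum_congr rfl fun j _ => ?_
    rw [hI.smul, hI.zpow_div_sub h0 hw0 hw]; ring
  · intro j _
    exact continuousOn_const.mul ((continuousOn_zpow_id _ h0).mul (continuousOn_sub_inv hw))
  · intro z hz
    have hz0 : z ≠ 0 := by rintro rfl; exact h0 hz
    simp only
    rw [Polynomial.eval_eq_sum_range, Finset.mul_sum, Finset.sum_mul]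
    refine Finset.sum_congr rfl fun j _ => ?_
    rw [zpow_add₀ hz0, zpow_natCast]; ring

/-! ### Winding numbers -/

/-- `1 - u ∈ slitPlane` iff `u ∉ [1, ∞)`. -/
theorem one_sub_mem_slitPlane {u : ℂ} (h : ∀ x : ℝ, 1 ≤ x → u ≠ x) : 1 - u ∈ Complex.slitPlane := by
  by_contra hu
  rw [Complex.mem_slitPlane_iff, not_or, not_lt, not_not] at hu
  simp only [Complex.sub_re, Complex.one_re, Complex.sub_im, Complex.one_im] at hu
  exact h u.re (by linarith [hu.1]) (Complex.ext (by simp) (by simp; linarith [hu.2]))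

/-- If the contour avoids the ray from `w` to infinity pointing away from `0`, then `log (1 - z /
w)` is a primitive along it. -/
theorem IsContour.sub_inv_eq_zero (hI : IsContour I K a a) {w : ℂ} (hw : w ≠ 0)
    (h : ∀ z ∈ K, ∀ x : ℝ, 1 ≤ x → z ≠ x * w) : I (fun z => (z - w)⁻¹) = 0 := by
  have hwK : w ∉ K := fun hK => h w hK 1 le_rfl (by simp)
  refine hI.eq_zero (Q := fun z => Complex.log (1 - z / w)) (continuousOn_sub_inv hwK)
    fun z hz => ?_
  have hs : 1 - z / w ∈ Complex.slitPlane := one_sub_mem_slitPlane fun x hx heq =>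
    h z hz x hx (by rw [← heq]; field_simp)
  have hzw : z - w ≠ 0 := sub_ne_zero.mpr (by rintro rfl; exact hwK hz)
  have h1 : HasDerivAt (fun z : ℂ => 1 - z / w) (-(1 / w)) z :=
    ((hasDerivAt_id z).div_const w).const_sub 1
  refine ((Complex.hasDerivAt_log hs).comp z h1).congr_deriv ?_
  have : w - z ≠ 0 := fun h => hzw (by linear_combination -h)
  have h3 : 1 - z / w = (w - z) / w := by field_simp
  rw [h3]
  field_simp
  ring

/-- If the contour avoids the segment from `0` to `w`, then `log (1 - w / z)` is a primitive of the
difference of the integrands. -/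
theorem IsContour.sub_inv_eq_inv (hI : IsContour I K a a) {w : ℂ}
    (h : ∀ z ∈ K, ∀ x : ℝ, x ∈ Icc (0 : ℝ) 1 → z ≠ x * w) :
    I (fun z => (z - w)⁻¹) = I (fun z => z⁻¹) := by
  have hwK : w ∉ K := fun hK => h w hK 1 (by simp) (by simp)
  have h0K : (0 : ℂ) ∉ K := fun hK => h 0 hK 0 (by simp) (by simp)
  rw [← sub_eq_zero, ← hI.sub (continuousOn_sub_inv hwK) (continuousOn_inv_id h0K)]
  refine hI.eq_zero (Q := fun z => Complex.log (1 - w / z))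
    ((continuousOn_sub_inv hwK).sub (continuousOn_inv_id h0K)) fun z hz => ?_
  have hz0 : z ≠ 0 := by rintro rfl; exact h0K hz
  have hs : 1 - w / z ∈ Complex.slitPlane := one_sub_mem_slitPlane fun x hx heq => by
    have hx0 : (x : ℂ) ≠ 0 := by exact_mod_cast (by linarith : (0 : ℝ) < x).ne'
    refine h z hz x⁻¹ ⟨inv_nonneg.mpr (by linarith), inv_le_one_of_one_le₀ hx⟩ ?_
    have : w = x * z := by rw [← heq]; field_simp
    rw [this]; push_cast; field_simp
  have hzw : z - w ≠ 0 := sub_ne_zero.mpr (by rintro rfl; exact hwK hz)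
  have h1 : HasDerivAt (fun z : ℂ => 1 - w / z) (w / z ^ 2) z := by
    have := ((hasDerivAt_inv hz0).const_mul w).const_sub 1
    refine (this.congr_deriv ?_).congr_of_eventuallyEq ?_
    · field_simp
    · exact Eventually.of_forall fun y => by simp [div_eq_mul_inv]
  refine ((Complex.hasDerivAt_log hs).comp z h1).congr_deriv ?_
  have h3 : 1 - w / z = (z - w) / z := by field_simp
  rw [h3]
  field_simp
  ring

/-! ### Circles -/

/-- The integral along the circle around `0` of radius `r`. -/
noncomputable def circ (r : ℝ) (g : ℂ → ℂ) : ℂ :=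
  ∫ t in (0 : ℝ)..2 * Real.pi, g (circleMap 0 r t) * deriv (circleMap 0 r) t

theorem circ_eq_circleIntegral (r : ℝ) (g : ℂ → ℂ) : circ r g = ∮ z in C(0, r), g z := by
  simp only [circ, circleIntegral, smul_eq_mul]
  exact integral_congr fun t _ => mul_comm _ _

theorem circ_isContour {r : ℝ} (hr : 0 < r) : IsContour (circ r) (Metric.sphere 0 r) r r := by
  have := (IsRectifiable.of_contDiffOn (γ := circleMap 0 r) Real.two_pi_pos
    (contDiff_circleMap 0 r).contDiffOn).isContour
  have h2 : circleMap 0 r '' Icc 0 (2 * Real.pi) = Metric.sphere 0 r := by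
    refine Subset.antisymm ?_ ?_
    · rintro _ ⟨t, -, rfl⟩
      exact circleMap_mem_sphere 0 hr.le t
    · have := image_circleMap_Ioc 0 r
      rw [abs_of_pos hr] at this
      rw [← this]
      exact image_mono Ioc_subset_Icc_self
  have h3 : circleMap 0 r (2 * Real.pi) = r := by simp [circleMap]
  have h4 : circleMap 0 r 0 = r := by simp [circleMap]
  rwa [h2, h3, h4] at this

theorem circ_inv {r : ℝ} (hr : 0 < r) : circ r (fun z => z⁻¹) = 2 * Real.pi * Complex.I := by
  rw [circ_eq_circleIntegral]
  simpa using circleIntegral.integral_sub_inv_of_mem_ball (c := 0) (w := 0) (R := r) (by simpa)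

theorem circ_sub_inv_of_lt {r : ℝ} {w : ℂ} (hw : ‖w‖ < r) :
    circ r (fun z => (z - w)⁻¹) = 2 * Real.pi * Complex.I := by
  rw [circ_eq_circleIntegral]
  exact circleIntegral.integral_sub_inv_of_mem_ball (by simpa using hw)

theorem circ_sub_inv_of_gt {r : ℝ} (hr : 0 < r) {w : ℂ} (hw : r < ‖w‖) :
    circ r (fun z => (z - w)⁻¹) = 0 := by
  refine (circ_isContour hr).sub_inv_eq_zero (norm_pos_iff.mp (hr.trans hw)) ?_
  rintro z hz x hx rfl
  rw [mem_sphere_zero_iff_norm, norm_mul, Complex.norm_real, Real.norm_of_nonneg (by linarith)] at hz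
  nlinarith

theorem circ_norm_le {r : ℝ} (hr : 0 < r) {g : ℂ → ℂ} {M : ℝ} (h : ∀ z, ‖z‖ = r → ‖g z‖ ≤ M) :
    ‖circ r g‖ ≤ 2 * Real.pi * r * M := by
  rw [circ_eq_circleIntegral]
  exact circleIntegral.norm_integral_le_of_norm_le_const hr.le fun z hz => h z (by simpa using hz)

end AztecDiamond

namespace AztecDiamond

open Set Topology Filter Matrix

/-! ### The spectrum of the symbol off the negative axis -/

/-- The indefinite form `Re (conj v₀ * v₁)`. -/
def coneForm (v : Fin 2 → ℂ) : ℝ := ((starRingEnd ℂ) (v 0) * v 1).re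

theorem coneForm_smul (c : ℂ) (v : Fin 2 → ℂ) : coneForm (c • v) = ‖c‖ ^ 2 * coneForm v := by
  have : (starRingEnd ℂ) ((c • v) 0) * (c • v) 1 =
      ((starRingEnd ℂ) c * c) * ((starRingEnd ℂ) (v 0) * v 1) := by simp; ring
  rw [coneForm, this, Complex.conj_mul', ← Complex.ofReal_pow, Complex.re_ofReal_mul]
  rfl

/-- `A` expands `σ` times the cone form by more than the factor `κ`. -/
def StrictCone (σ κ : ℝ) (A : Matrix (Fin 2) (Fin 2) ℂ) : Prop :=
  ∀ v, v ≠ 0 → κ * (σ * coneForm v) < σ * coneForm (A *ᵥ v)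

theorem StrictCone.mul {σ κ κ' : ℝ} {A B : Matrix (Fin 2) (Fin 2) ℂ} (hκ : 0 < κ)
    (hA : StrictCone σ κ A) (hB : StrictCone σ κ' B) : StrictCone σ (κ * κ') (A * B) := by
  intro v hv
  have h := mul_lt_mul_of_pos_left (hB v hv) hκ
  rw [← mulVec_mulVec, mul_assoc]
  -- The hypothesis on `A` needs a nonzero vector; if `B` annihilates `v`, then `h` is already the
  -- claim, as the form vanishes at `0`.
  by_cases h0 : B *ᵥ v = 0
  · simpa [h0, coneForm] using h
  · exact h.trans (hA _ h0)

theorem strictCone_list {ι : Type*} {σ κ : ℝ} (hκ : 0 < κ) (f : ι → Matrix (Fin 2) (Fin 2) ℂ) :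
    ∀ L : List ι, L ≠ [] → (∀ x ∈ L, StrictCone σ κ (f x)) →
      StrictCone σ (κ ^ L.length) (L.map f).prod
  | [], h, _ => absurd rfl h
  | [x], _, h => by simpa using h x (by simp)
  | x :: y :: L, _, h => by
    have ih := strictCone_list hκ f (y :: L) (by simp) fun z hz => h z (by simp_all)
    have := (h x (by simp)).mul hκ ih
    rw [List.map_cons, List.prod_cons, List.length_cons, pow_succ']
    exact this

/-- The adjugate plays the role of the inverse, for which the opposite cone is expanded. It reverses
products, hence the exchanged order in the induction. -/
theorem strictCone_list_adjugate {ι : Type*} {σ κ : ℝ} (hκ : 0 < κ)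
    (f : ι → Matrix (Fin 2) (Fin 2) ℂ) :
    ∀ L : List ι, L ≠ [] → (∀ x ∈ L, StrictCone σ κ (f x).adjugate) →
      StrictCone σ (κ ^ L.length) (L.map f).prod.adjugate
  | [], h, _ => absurd rfl h
  | [x], _, h => by simpa using h x (by simp)
  | x :: y :: L, _, h => by
    have ih := strictCone_list_adjugate hκ f (y :: L) (by simp) fun z hz => h z (by simp_all)
    have := ih.mul (pow_pos hκ _) (h x (by simp))
    rw [List.map_cons, List.prod_cons, List.length_cons, pow_succ, adjugate_mul_distrib]
    exact this

/-- The factors of the symbol, conjugated by `diag(1, s)` and multiplied by `s`. -/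
noncomputable def rootFactor (s : ℂ) (a : ℝ) : Matrix (Fin 2) (Fin 2) ℂ := !![s, (a : ℂ); (a : ℂ)⁻¹, s]

/-- The image has the form of `v` scaled by `‖s‖ ^ 2 + 1`, plus `s.re` times a form that is definite
with the sign of `a`. Thus `0 < s.re` gives strict expansion, of the form itself for positive `a`
and of its negative for negative `a`. -/
theorem coneForm_rootFactor (s : ℂ) {a : ℝ} (ha : a ≠ 0) (v : Fin 2 → ℂ) :
    coneForm (rootFactor s a *ᵥ v) =
      (‖s‖ ^ 2 + 1) * coneForm v + s.re * (‖v 0‖ ^ 2 / a + a * ‖v 1‖ ^ 2) := by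
  simp only [coneForm, rootFactor, ← Complex.normSq_eq_norm_sq, Complex.normSq_apply]
  simp [Matrix.mulVec, dotProduct, Fin.sum_univ_two, ← Complex.ofReal_inv]
  field_simp
  ring

theorem strictCone_rootFactor {s : ℂ} (hs : 0 < s.re) {a : ℝ} (ha : 0 < a) :
    StrictCone 1 (‖s‖ ^ 2 + 1) (rootFactor s a) := by
  intro v hv
  rw [coneForm_rootFactor s ha.ne']
  have : 0 < ‖v 0‖ ^ 2 / a + a * ‖v 1‖ ^ 2 := by
    by_cases h0 : v 0 = 0
    · have h1 : v 1 ≠ 0 := fun h1 => hv (by ext i; fin_cases i <;> simp [h0, h1])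
      have := norm_pos_iff.mpr h1
      positivity
    · have := norm_pos_iff.mpr h0
      positivity
  nlinarith [mul_pos hs this]

theorem strictCone_rootFactor_neg {s : ℂ} (hs : 0 < s.re) {a : ℝ} (ha : 0 < a) :
    StrictCone (-1) (‖s‖ ^ 2 + 1) (rootFactor s (-a)) := by
  intro v hv
  have h := strictCone_rootFactor hs ha v hv
  rw [coneForm_rootFactor s ha.ne'] at h
  rw [coneForm_rootFactor s (neg_ne_zero.mpr ha.ne'), div_neg]
  linarith

theorem adjugate_rootFactor (s : ℂ) (a : ℝ) : (rootFactor s a).adjugate = rootFactor s (-a) := by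
  simp [rootFactor, adjugate_fin_two_of, inv_neg]

theorem exists_sqrt_re_pos {z : ℂ} (hz : z ∈ Complex.slitPlane) : ∃ s : ℂ, s ^ 2 = z ∧ 0 < s.re := by
  refine ⟨Complex.exp (Complex.log z / 2), ?_, ?_⟩
  · rw [← Complex.exp_nat_mul]
    rw [show ((2 : ℕ) : ℂ) * (Complex.log z / 2) = Complex.log z by push_cast; ring]
    exact Complex.exp_log (Complex.slitPlane_ne_zero hz)
  · rw [Complex.exp_re]
    refine mul_pos (Real.exp_pos _) (Real.cos_pos_of_mem_Ioo ?_)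
    have h1 := Complex.neg_pi_lt_arg z
    have h2 := (Complex.arg_le_pi z).lt_of_ne (Complex.mem_slitPlane_iff_arg.mp hz).1
    have h3 : (Complex.log z / 2).im = z.arg / 2 := by
      rw [show (2 : ℂ) = ((2 : ℝ) : ℂ) by norm_num, Complex.div_ofReal_im, Complex.log_im]
    rw [h3]
    constructor <;> linarith

variable {k : ℕ}

/-- The matrix `(z - 1)ᵏ Φ(z)`. -/
noncomputable def symbol (W : Weighting k) (z : ℂ) : Matrix (Fin 2) (Fin 2) ℂ :=
  (scaledPhi W).map (Polynomial.aeval z)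

/-- The trace of `(z - 1)ᵏ Φ(z)`. -/
noncomputable def symbolTrace (W : Weighting k) (z : ℂ) : ℂ :=
  Polynomial.aeval z (scaledPhi W).trace

theorem trace_symbol (W : Weighting k) (z : ℂ) : (symbol W z).trace = symbolTrace W z := by
  simp [symbol, symbolTrace, Matrix.trace, Matrix.diag]

/-- The factors of `scaledPhi`. -/
noncomputable def polyFactor (p : ℝ × ℝ) : Matrix (Fin 2) (Fin 2) (Polynomial ℝ) :=
  !![Polynomial.X + Polynomial.C (p.1 / p.2), Polynomial.C (p.1 + p.2);
    Polynomial.C (p.1⁻¹ + p.2⁻¹) * Polynomial.X, Polynomial.X + Polynomial.C (p.2 / p.1)]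

/-- The pairs of weights in their order. -/
def Weighting.pairs (W : Weighting k) : List (ℝ × ℝ) := List.ofFn fun m => (W.α m, W.β m)

theorem Weighting.pairs_pos (W : Weighting k) : ∀ p ∈ W.pairs, 0 < p.1 ∧ 0 < p.2 := by
  intro p hp
  obtain ⟨m, rfl⟩ := List.mem_ofFn.mp hp
  exact ⟨W.α_pos m, W.β_pos m⟩

theorem Weighting.length_pairs (W : Weighting k) : W.pairs.length = k := List.length_ofFn

theorem scaledPhi_eq (W : Weighting k) : scaledPhi W = (W.pairs.map polyFactor).prod := by
  rw [scaledPhi, Weighting.pairs, List.map_ofFn]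
  rfl

theorem symbol_eq (W : Weighting k) (z : ℂ) :
    symbol W z = (W.pairs.map fun p => (polyFactor p).map (Polynomial.aeval z)).prod := by
  rw [symbol, scaledPhi_eq]
  have := map_list_prod ((Polynomial.aeval (R := ℝ) z).mapMatrix (m := Fin 2))
    (W.pairs.map polyFactor)
  rw [List.map_map] at this
  exact this

/-- With $z=s^2$, conjugation by $\operatorname{diag}(1,s)$ splits each factor of the symbol into
two matrices to which the cone estimate applies. -/
theorem polyFactor_mul_diagonal {p : ℝ × ℝ} (h1 : 0 < p.1) (h2 : 0 < p.2) {s : ℂ} :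
    (polyFactor p).map (Polynomial.aeval (s ^ 2)) * Matrix.diagonal ![1, s] =
      Matrix.diagonal ![1, s] * (rootFactor s p.1 * rootFactor s p.2) := by
  have e1 : (p.1 : ℂ) ≠ 0 := by exact_mod_cast h1.ne'
  have e2 : (p.2 : ℂ) ≠ 0 := by exact_mod_cast h2.ne'
  ext i j
  fin_cases i <;> fin_cases j <;>
    simp [polyFactor, rootFactor, Matrix.mul_apply, Matrix.diagonal] <;>
    field_simp <;> ring

/-- Each factor has determinant $(z-1)^2$, whatever its weights. So $p=\operatorname{Tr}^2-4\det$ is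
the discriminant of the symbol. -/
theorem det_symbol (W : Weighting k) (z : ℂ) : (symbol W z).det = (z - 1) ^ (2 * k) := by
  rw [symbol_eq, ← Matrix.coe_detMonoidHom, map_list_prod, List.map_map]
  rw [List.map_congr_left (g := fun _ => (z - 1) ^ 2)]
  · rw [List.map_const', List.prod_replicate, W.length_pairs, ← pow_mul]
  · intro p hp
    have e1 : (p.1 : ℂ) ≠ 0 := by exact_mod_cast (W.pairs_pos p hp).1.ne'
    have e2 : (p.2 : ℂ) ≠ 0 := by exact_mod_cast (W.pairs_pos p hp).2.ne'
    simp [polyFactor, Matrix.det_fin_two]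
    field_simp
    ring

/-- The set of `z` for which `(z - 1)ᵏ Φ(z)` has eigenvalues of different moduli. -/
def hyperbolicSet (W : Weighting k) : Set ℂ :=
  {z | ∀ c : ℝ, c ∈ Icc (-1 : ℝ) 1 → symbolTrace W z ≠ 2 * c * (z - 1) ^ k}

theorem norm_add_I_mul_sqrt {c : ℝ} (hc : c ∈ Icc (-1 : ℝ) 1) :
    ‖(c : ℂ) + Real.sqrt (1 - c ^ 2) * Complex.I‖ = 1 ∧
    ‖(c : ℂ) - Real.sqrt (1 - c ^ 2) * Complex.I‖ = 1 ∧
    ((c : ℂ) + Real.sqrt (1 - c ^ 2) * Complex.I) * (c - Real.sqrt (1 - c ^ 2) * Complex.I) = 1 := by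
  have h : 0 ≤ 1 - c ^ 2 := by nlinarith [hc.1, hc.2]
  have hs := Real.sq_sqrt h
  refine ⟨?_, ?_, ?_⟩
  · rw [Complex.norm_add_mul_I, hs]; simp
  · have := Complex.norm_add_mul_I c (-Real.sqrt (1 - c ^ 2))
    rw [Complex.ofReal_neg, neg_mul, ← sub_eq_add_neg] at this
    rw [this, neg_sq, hs]; simp
  · have : ((Real.sqrt (1 - c ^ 2) : ℝ) : ℂ) ^ 2 = 1 - (c : ℂ) ^ 2 := by
      rw [← Complex.ofReal_pow, hs]; push_cast; ring
    linear_combination this - (Real.sqrt (1 - c ^ 2) : ℂ) ^ 2 * Complex.I_sq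

/-- Otherwise the eigenvalues are $e^{\pm i\theta}(z-1)^k$ with $c=\cos\theta$, both of modulus
$|m|$ for $m=(z-1)^k$. An eigenvector `v` of `R` for one is an eigenvector of its adjugate for the
other. `R` expands the cone form, and its adjugate the negative of the form, by more than
$(|s|^2+1)^{2k}\ge|s^2-1|^{2k}=|m|^2$. Since both multiply the form of `v` by exactly $|m|^2$, one
of the two is contradicted, according to the sign of the form at `v`. -/
theorem slitPlane_subset_hyperbolicSet (hk : 1 ≤ k) (W : Weighting k) :
    Complex.slitPlane ⊆ hyperbolicSet W := by
  intro z hz c hc hT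
  obtain ⟨s, rfl, hs⟩ := exists_sqrt_re_pos hz
  have hs0 : s ≠ 0 := by rintro rfl; simp at hs
  set D : Matrix (Fin 2) (Fin 2) ℂ := Matrix.diagonal ![1, s] with hD
  set R := (W.pairs.map fun p => rootFactor s p.1 * rootFactor s p.2).prod with hR
  have hMD : ∀ L : List (ℝ × ℝ), (∀ p ∈ L, 0 < p.1 ∧ 0 < p.2) →
      (L.map fun p => (polyFactor p).map (Polynomial.aeval (s ^ 2))).prod * D =
        D * (L.map fun p => rootFactor s p.1 * rootFactor s p.2).prod := by
    intro L
    induction L with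
    | nil => intro _; simp
    | cons p L ih =>
      intro h
      rw [List.map_cons, List.prod_cons, List.map_cons, List.prod_cons, Matrix.mul_assoc,
        ih fun q hq => h q (List.mem_cons_of_mem _ hq), ← Matrix.mul_assoc, hD,
        polyFactor_mul_diagonal (h p (by simp)).1 (h p (by simp)).2, Matrix.mul_assoc]
  have hsim : symbol W (s ^ 2) * D = D * R := by
    rw [symbol_eq]; exact hMD _ W.pairs_pos
  have hDdet : IsUnit D.det := by
    rw [hD, Matrix.det_diagonal]; simp [Fin.prod_univ_two, hs0]
  have hReq : R = D⁻¹ * symbol W (s ^ 2) * D := by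
    rw [Matrix.mul_assoc, hsim, ← Matrix.mul_assoc, Matrix.nonsing_inv_mul _ hDdet, Matrix.one_mul]
  have htr : R.trace = symbolTrace W (s ^ 2) := by
    rw [hReq, Matrix.trace_mul_comm, ← Matrix.mul_assoc, Matrix.mul_nonsing_inv _ hDdet,
      Matrix.one_mul, trace_symbol]
  have hdet : R.det = (s ^ 2 - 1) ^ (2 * k) := by
    rw [hReq, Matrix.det_mul, Matrix.det_mul, mul_right_comm, ← Matrix.det_mul,
      Matrix.nonsing_inv_mul _ hDdet, Matrix.det_one, one_mul, det_symbol]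
  obtain ⟨n1, n2, n3⟩ := norm_add_I_mul_sqrt hc
  set e : ℂ := (c : ℂ) + Real.sqrt (1 - c ^ 2) * Complex.I with he
  set e' : ℂ := (c : ℂ) - Real.sqrt (1 - c ^ 2) * Complex.I with he'
  have hsum : e + e' = 2 * c := by rw [he, he']; ring
  set m : ℂ := (s ^ 2 - 1) ^ k with hm
  have hdetm : R.det = m ^ 2 := by rw [hdet, hm]; ring
  have hev : (R - (m * e) • (1 : Matrix (Fin 2) (Fin 2) ℂ)).det = 0 := by
    have h1 : (R - (m * e) • (1 : Matrix (Fin 2) (Fin 2) ℂ)).det =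
        (m * e) ^ 2 - R.trace * (m * e) + R.det := by
      simp [Matrix.det_fin_two, Matrix.trace_fin_two]; ring
    rw [h1, htr, hT, hdetm, ← hsum]
    linear_combination (-m ^ 2) * n3
  obtain ⟨v, hv, hv0⟩ := Matrix.exists_mulVec_eq_zero_iff.mpr hev
  have hRv : R *ᵥ v = (m * e) • v := by
    rw [Matrix.sub_mulVec, Matrix.smul_mulVec, Matrix.one_mulVec, sub_eq_zero] at hv0
    exact hv0
  have hadj : R.adjugate *ᵥ v = (m * e') • v := by
    have h1 : R.adjugate = R.trace • (1 : Matrix (Fin 2) (Fin 2) ℂ) - R := by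
      rw [Matrix.adjugate_fin_two]
      ext i j
      fin_cases i <;> fin_cases j <;> simp [Matrix.trace_fin_two]
    rw [h1, Matrix.sub_mulVec, Matrix.smul_mulVec, Matrix.one_mulVec, hRv, ← sub_smul, htr, hT,
      ← hsum]
    congr 1; ring
  have hne : W.pairs ≠ [] := by
    intro h; have := W.length_pairs; rw [h] at this; simp at this; omega
  have hκ : 0 < (‖s‖ ^ 2 + 1) * (‖s‖ ^ 2 + 1) := by positivity
  have c1 := strictCone_list (σ := 1) hκ (fun p : ℝ × ℝ => rootFactor s p.1 * rootFactor s p.2)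
    W.pairs hne (fun p hp => (strictCone_rootFactor hs (W.pairs_pos p hp).1).mul (by positivity)
      (strictCone_rootFactor hs (W.pairs_pos p hp).2)) v hv
  have c2 := strictCone_list_adjugate (σ := -1) hκ
    (fun p : ℝ × ℝ => rootFactor s p.1 * rootFactor s p.2)
    W.pairs hne (fun p hp => by
      rw [adjugate_mul_distrib, adjugate_rootFactor, adjugate_rootFactor]
      exact (strictCone_rootFactor_neg hs (W.pairs_pos p hp).2).mul (by positivity)
        (strictCone_rootFactor_neg hs (W.pairs_pos p hp).1)) v hv
  rw [← hR, hRv, coneForm_smul, norm_mul, n1, mul_one] at c1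
  rw [← hR, hadj, coneForm_smul, norm_mul, n2, mul_one] at c2
  have hmle : ‖m‖ ^ 2 ≤ ((‖s‖ ^ 2 + 1) * (‖s‖ ^ 2 + 1)) ^ W.pairs.length := by
    rw [W.length_pairs, hm, norm_pow, ← pow_two, ← pow_mul, ← pow_mul, mul_comm k 2, mul_comm 2 k]
    refine pow_le_pow_left₀ (norm_nonneg _) ?_ _
    calc _ ≤ ‖s ^ 2‖ + ‖(1 : ℂ)‖ := norm_sub_le _ _
      _ = _ := by simp
  rcases le_or_gt 0 (coneForm v) with h | h
  · nlinarith [mul_le_mul_of_nonneg_right hmle h]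
  · nlinarith [mul_le_mul_of_nonneg_right hmle (neg_nonneg.mpr h.le)]

/-! ### The larger eigenvalue -/

/-- The eigenvalue of `(z - 1)ᵏ Φ(z)` of larger modulus. -/
noncomputable def lam₁ (W : Weighting k) (z : ℂ) : ℂ := eigLarge (symbol W z)

/-- The eigenvalue of `(z - 1)ᵏ Φ(z)` of smaller modulus. -/
noncomputable def lam₂ (W : Weighting k) (z : ℂ) : ℂ := eigSmall (symbol W z)

theorem lam_add (W : Weighting k) (z : ℂ) : lam₁ W z + lam₂ W z = symbolTrace W z := by
  rw [lam₁, lam₂, eigLarge_add_eigSmall, trace_symbol]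

theorem lam_mul (W : Weighting k) (z : ℂ) : lam₁ W z * lam₂ W z = (z - 1) ^ (2 * k) := by
  rw [lam₁, lam₂, eigLarge_mul_eigSmall, det_symbol]

theorem norm_lam₂_le (W : Weighting k) (z : ℂ) : ‖lam₂ W z‖ ≤ ‖lam₁ W z‖ := norm_eigSmall_le _

theorem roots_eq_of_norm_lt {x y x' y' : ℂ} (h : ‖y‖ < ‖x‖) (h' : ‖y'‖ ≤ ‖x'‖)
    (hs : x + y = x' + y') (hp : x * y = x' * y') : x' = x ∧ y' = y := by
  have : (x' - x) * (x' - y) = 0 := by linear_combination (-x') * hs + hp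
  rcases mul_eq_zero.mp this with h1 | h1
  · have h2 : x' = x := by linear_combination h1
    exact ⟨h2, by linear_combination -hs - h1⟩
  · have h2 : x' = y := by linear_combination h1
    have h3 : y' = x := by linear_combination -hs - h1
    rw [h2, h3] at h'
    exact absurd h (not_lt.mpr h')

theorem eig_eq_of_norm_lt {M : Matrix (Fin 2) (Fin 2) ℂ} {x y : ℂ} (h : ‖y‖ < ‖x‖)
    (hs : x + y = M.trace) (hp : x * y = M.det) : eigLarge M = x ∧ eigSmall M = y :=
  roots_eq_of_norm_lt h (norm_eigSmall_le M) (hs.trans (eigLarge_add_eigSmall M).symm)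
    (hp.trans (eigLarge_mul_eigSmall M).symm)

/-- With $\rho=\lambda_1/(z-1)^k$ the eigenvalues are $\rho^{\pm1}(z-1)^k$. Their moduli agree iff
$|\rho|=1$, and then the trace is $2\operatorname{Re}\rho\,(z-1)^k$ with
$\operatorname{Re}\rho\in[-1,1]$. -/
theorem mem_hyperbolicSet_iff (W : Weighting k) (z : ℂ) :
    z ∈ hyperbolicSet W ↔ ‖lam₂ W z‖ < ‖lam₁ W z‖ := by
  constructor
  · intro hz
    refine (norm_lam₂_le W z).lt_of_ne fun heq => ?_
    have hmul : lam₁ W z * lam₂ W z = ((z - 1) ^ k) ^ 2 := by rw [lam_mul]; ring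
    -- Here the product of the eigenvalues vanishes, so equal moduli force both to vanish, and `c =
    -- 0` works.
    by_cases hm : (z - 1) ^ k = 0
    · have h1 : ‖lam₁ W z‖ * ‖lam₂ W z‖ = 0 := by rw [← norm_mul, hmul, hm]; simp
      rw [heq, mul_self_eq_zero] at h1
      have h2 : lam₂ W z = 0 := by rw [← norm_eq_zero, heq, h1]
      refine hz 0 (by norm_num) ?_
      rw [← lam_add, norm_eq_zero.mp h1, h2]; simp
    · have hx : lam₁ W z ≠ 0 := by
        intro h; rw [h, zero_mul] at hmul; exact hm (pow_eq_zero_iff two_ne_zero |>.mp hmul.symm)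
      set ρ := lam₁ W z / (z - 1) ^ k with hρ
      have h1 : lam₁ W z = ρ * (z - 1) ^ k := by rw [hρ]; field_simp
      have hρ0 : ρ ≠ 0 := div_ne_zero hx hm
      have h2 : lam₂ W z = ρ⁻¹ * (z - 1) ^ k := by
        have : lam₁ W z * lam₂ W z = lam₁ W z * (ρ⁻¹ * (z - 1) ^ k) := by
          rw [hmul, h1]; field_simp
        exact mul_left_cancel₀ hx this
      have hnorm : ‖ρ‖ = 1 := by
        rw [h1, h2, norm_mul, norm_mul, norm_inv] at heq
        have h3 := mul_right_cancel₀ (norm_ne_zero_iff.mpr hm) heq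
        have h4 : ‖ρ‖ * ‖ρ‖ = 1 := by
          nth_rewrite 1 [← h3]; exact inv_mul_cancel₀ (norm_ne_zero_iff.mpr hρ0)
        nlinarith [norm_nonneg ρ]
      refine hz ρ.re ⟨?_, ?_⟩ ?_
      · have := Complex.abs_re_le_norm ρ; rw [hnorm] at this; exact (abs_le.mp this).1
      · have := Complex.abs_re_le_norm ρ; rw [hnorm] at this; exact (abs_le.mp this).2
      · have hinv : ρ⁻¹ = (starRingEnd ℂ) ρ := by
          rw [Complex.inv_def, Complex.normSq_eq_norm_sq, hnorm]; simp
        rw [← lam_add, h1, h2, hinv, ← add_mul, Complex.add_conj]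
        push_cast; rfl
  · intro h c hc hT
    obtain ⟨n1, n2, n3⟩ := norm_add_I_mul_sqrt hc
    set e : ℂ := (c : ℂ) + Real.sqrt (1 - c ^ 2) * Complex.I with he
    set e' : ℂ := (c : ℂ) - Real.sqrt (1 - c ^ 2) * Complex.I with he'
    have := roots_eq_of_norm_lt (x' := e * (z - 1) ^ k) (y' := e' * (z - 1) ^ k) h
      (by rw [norm_mul, norm_mul, n1, n2]) (by rw [lam_add, hT, he, he']; ring)
      (by rw [lam_mul]; linear_combination (-((z - 1) ^ (2 * k))) * n3)
    rw [← this.1, ← this.2, norm_mul, norm_mul, n1, n2] at h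
    exact lt_irrefl _ h

theorem lam₁_ne_zero {W : Weighting k} {z : ℂ} (hz : z ∈ hyperbolicSet W) : lam₁ W z ≠ 0 := by
  rw [mem_hyperbolicSet_iff] at hz
  exact norm_pos_iff.mp ((norm_nonneg _).trans_lt hz)

/-- The parallelogram law recovers $(|\lambda_1|\pm|\lambda_2|)^2$ from the trace, the discriminant
and the determinant. No branch of the eigenvalue is involved, so $|\lambda_1|$ is continuous on the
whole plane. -/
theorem norm_lam₁ (W : Weighting k) (z : ℂ) : ‖lam₁ W z‖ =
    (Real.sqrt (‖symbolTrace W z‖ ^ 2 / 2 + ‖symbolTrace W z ^ 2 - 4 * (z - 1) ^ (2 * k)‖ / 2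
        + 2 * ‖(z - 1) ^ (2 * k)‖) +
      Real.sqrt (‖symbolTrace W z‖ ^ 2 / 2 + ‖symbolTrace W z ^ 2 - 4 * (z - 1) ^ (2 * k)‖ / 2
        - 2 * ‖(z - 1) ^ (2 * k)‖)) / 2 := by
  have h1 : symbolTrace W z ^ 2 - 4 * (z - 1) ^ (2 * k) = (lam₁ W z - lam₂ W z) ^ 2 := by
    rw [← lam_add, ← lam_mul]; ring
  have hpar := parallelogram_law_with_norm ℝ (lam₁ W z) (lam₂ W z)
  rw [h1, norm_pow, ← lam_mul, ← lam_add, norm_mul]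
  have hle := norm_lam₂_le W z
  rw [show ‖lam₁ W z + lam₂ W z‖ ^ 2 / 2 + ‖lam₁ W z - lam₂ W z‖ ^ 2 / 2
      + 2 * (‖lam₁ W z‖ * ‖lam₂ W z‖) = (‖lam₁ W z‖ + ‖lam₂ W z‖) ^ 2 by linarith,
    show ‖lam₁ W z + lam₂ W z‖ ^ 2 / 2 + ‖lam₁ W z - lam₂ W z‖ ^ 2 / 2
      - 2 * (‖lam₁ W z‖ * ‖lam₂ W z‖) = (‖lam₁ W z‖ - ‖lam₂ W z‖) ^ 2 by linarith,
    Real.sqrt_sq (by positivity), Real.sqrt_sq (by linarith)]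
  ring

theorem differentiable_symbolTrace (W : Weighting k) : Differentiable ℂ (symbolTrace W) := by
  exact Polynomial.differentiable_aeval _

theorem continuous_norm_lam₁ (W : Weighting k) : Continuous fun z => ‖lam₁ W z‖ := by
  have h := (differentiable_symbolTrace W).continuous
  simp only [norm_lam₁]
  fun_prop

/-- Because $\lambda_1\lambda_2=(z-1)^{2k}$, the condition compares $|z-1|^{2k}$ with
$|\lambda_1|^2$, and both are continuous everywhere. -/
theorem isOpen_hyperbolicSet (W : Weighting k) : IsOpen (hyperbolicSet W) := by
  have : hyperbolicSet W = {z | ‖(z - 1) ^ (2 * k)‖ < ‖lam₁ W z‖ ^ 2} := by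
    ext z
    rw [mem_hyperbolicSet_iff, mem_ofPred_eq, ← lam_mul, norm_mul, pow_two]
    constructor
    · intro h
      exact mul_lt_mul_of_pos_left h ((norm_nonneg _).trans_lt h)
    · intro h
      by_contra h'
      push Not at h'
      exact absurd (mul_le_mul_of_nonneg_left h' (norm_nonneg (lam₁ W z))) (not_le.mpr h)
  rw [this]
  exact isOpen_lt (by fun_prop) ((continuous_norm_lam₁ W).pow 2)

/-- Take the local analytic square root of the discriminant that equals $\lambda_1-\lambda_2$ at
$z_0$. By continuity the root of larger modulus keeps the plus sign near $z_0$. -/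
theorem analyticAt_lam₁ {W : Weighting k} {z₀ : ℂ} (hz₀ : z₀ ∈ hyperbolicSet W) :
    AnalyticAt ℂ (lam₁ W) z₀ := by
  set d : ℂ → ℂ := fun z => symbolTrace W z ^ 2 - 4 * (z - 1) ^ (2 * k) with hd
  have hT : AnalyticAt ℂ (symbolTrace W) z₀ := (differentiable_symbolTrace W).analyticAt z₀
  have hda : AnalyticAt ℂ d z₀ := by fun_prop
  set x := lam₁ W z₀ with hx
  set y := lam₂ W z₀ with hy
  have hd0 : d z₀ = (x - y) ^ 2 := by
    simp only [hd, hx, hy]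
    rw [← lam_add, ← lam_mul]; ring
  have hlt := (mem_hyperbolicSet_iff W z₀).mp hz₀
  have hxy : x - y ≠ 0 := by
    intro h; rw [sub_eq_zero.mp h] at hx; rw [← hx, ← hy] at hlt; exact lt_irrefl _ hlt
  have hd00 : d z₀ ≠ 0 := by rw [hd0]; exact pow_ne_zero 2 hxy
  set ψ : ℂ → ℂ := fun z => (x - y) * (d z / d z₀) ^ (1 / 2 : ℂ) with hψ
  have hψa : AnalyticAt ℂ ψ z₀ := by
    refine analyticAt_const.mul (AnalyticAt.cpow (hda.div_const) analyticAt_const ?_)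
    rw [div_self hd00]; simp
  have hψ2 : ∀ z, ψ z ^ 2 = d z := by
    intro z
    have h : ((d z / d z₀) ^ (1 / 2 : ℂ)) ^ 2 = d z / d z₀ := by
      rw [one_div]; exact Complex.cpow_nat_inv_pow (d z / d z₀) (n := 2) two_ne_zero
    simp only [hψ]
    rw [mul_pow, h, ← hd0]; field_simp
  have hψ0 : ψ z₀ = x - y := by simp [hψ, div_self hd00]
  have hev : ∀ᶠ z in 𝓝 z₀, ‖(symbolTrace W z - ψ z) / 2‖ < ‖(symbolTrace W z + ψ z) / 2‖ := by
    refine ContinuousAt.eventually_lt (f := fun z => ‖(symbolTrace W z - ψ z) / 2‖)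
      (g := fun z => ‖(symbolTrace W z + ψ z) / 2‖)
      ((hT.continuousAt.sub hψa.continuousAt).div_const 2).norm
      ((hT.continuousAt.add hψa.continuousAt).div_const 2).norm ?_
    rw [hψ0, ← lam_add, ← hx, ← hy]
    rw [show (x + y - (x - y)) / 2 = y by ring, show (x + y + (x - y)) / 2 = x by ring]
    exact hlt
  refine ((hT.add hψa).div_const (c := 2)).congr ?_
  filter_upwards [hev] with z hz
  have := (eig_eq_of_norm_lt (M := symbol W z) hz (by rw [trace_symbol]; ring)
    (by rw [det_symbol]; have := hψ2 z; simp only [hd] at this; linear_combination (-1 / 4) * this)).1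
  exact this.symm

theorem differentiableOn_lam₁ (W : Weighting k) : DifferentiableOn ℂ (lam₁ W) (hyperbolicSet W) :=
  fun _ hz => (analyticAt_lam₁ hz).differentiableAt.differentiableWithinAt

theorem differentiableOn_lam₂ (W : Weighting k) : DifferentiableOn ℂ (lam₂ W) (hyperbolicSet W) := by
  have : lam₂ W = fun z => symbolTrace W z - lam₁ W z := by
    ext z; rw [← lam_add]; ring
  rw [this]
  exact (differentiable_symbolTrace W).differentiableOn.sub (differentiableOn_lam₁ W)

end AztecDiamond

namespace AztecDiamond

open Set Topology Filter MeasureTheory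

variable {k : ℕ}

/-! ### The Thouless formula -/

/-- The polynomial `(z - 1)ᵏ (Tr Φ(z) - 2 c)`. -/
noncomputable def phasePoly (W : Weighting k) (c : ℝ) : Polynomial ℂ :=
  (scaledPhi W).trace.map (algebraMap ℝ ℂ)
    - Polynomial.C (2 * c : ℂ) * (Polynomial.X - Polynomial.C 1) ^ k

theorem eval_phasePoly (W : Weighting k) (c : ℝ) (z : ℂ) :
    (phasePoly W c).eval z = symbolTrace W z - 2 * c * (z - 1) ^ k := by
  simp [phasePoly, symbolTrace, Polynomial.eval_map_algebraMap]

theorem eval_phasePoly_ne_zero {W : Weighting k} {z : ℂ} (hz : z ∈ hyperbolicSet W) {c : ℝ}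
    (hc : c ∈ Icc (-1 : ℝ) 1) : (phasePoly W c).eval z ≠ 0 := by
  rw [eval_phasePoly]; exact sub_ne_zero.mpr (hz c hc)

theorem eval_derivative_phasePoly (W : Weighting k) (c : ℝ) (z : ℂ) :
    (phasePoly W c).derivative.eval z =
      deriv (symbolTrace W) z - 2 * c * deriv (fun z : ℂ => (z - 1) ^ k) z := by
  rw [← Polynomial.deriv]
  have h1 : (fun x => Polynomial.eval x (phasePoly W c)) =
      fun z => symbolTrace W z - 2 * c * (z - 1) ^ k := funext fun z => eval_phasePoly W c z
  rw [h1]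
  have hd : DifferentiableAt ℂ (fun z : ℂ => (z - 1) ^ k) z := by fun_prop
  rw [deriv_fun_sub (differentiable_symbolTrace W z) (hd.const_mul _), deriv_const_mul _ hd]

/-- The zeros of `phasePoly` are real and nonpositive. -/
theorem phasePoly_roots (hk : 1 ≤ k) {W : Weighting k} {c : ℝ} (hc : c ∈ Icc (-1 : ℝ) 1) :
    ∀ r ∈ (phasePoly W c).roots, r.im = 0 ∧ r.re ≤ 0 := by
  intro r hr
  have hr0 := (Polynomial.mem_roots'.mp hr).2
  have hs : r ∉ Complex.slitPlane := fun h =>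
    eval_phasePoly_ne_zero (slitPlane_subset_hyperbolicSet hk W h) hc hr0
  rw [Complex.mem_slitPlane_iff, not_or, not_not, not_lt] at hs
  exact ⟨hs.2, hs.1⟩

theorem logDeriv_phasePoly {W : Weighting k} {z : ℂ} (hz : z ∈ hyperbolicSet W) {c : ℝ}
    (hc : c ∈ Icc (-1 : ℝ) 1) :
    z * ((phasePoly W c).derivative.eval z / (phasePoly W c).eval z) =
      ((phasePoly W c).roots.map fun r => z / (z - r)).sum := by
  rw [(IsAlgClosed.splits _).eval_derivative_div_eval_of_ne_zero (eval_phasePoly_ne_zero hz hc),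
    ← Multiset.sum_map_mul_left]
  congr 1
  exact Multiset.map_congr rfl fun r _ => by ring

/-- The logarithmic derivative of the larger eigenvalue is the average of the logarithmic
derivatives of the polynomials `phasePoly W (cos θ)`. -/
theorem logDeriv_lam₁ {W : Weighting k} {z : ℂ} (hz : z ∈ hyperbolicSet W) :
    deriv (lam₁ W) z / lam₁ W z = (2 * Real.pi)⁻¹ * ∫ θ in (0 : ℝ)..2 * Real.pi,
      (phasePoly W (Real.cos θ)).derivative.eval z / (phasePoly W (Real.cos θ)).eval z := by
  set m : ℂ → ℂ := fun z => (z - 1) ^ k with hm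
  set T' := deriv (symbolTrace W) z with hT'
  set m' := deriv m z with hm'
  set L := lam₁ W z with hL
  have hL0 : L ≠ 0 := lam₁_ne_zero hz
  have hlt := (mem_hyperbolicSet_iff W z).mp hz
  have hmul : ∀ z, lam₁ W z * lam₂ W z = m z ^ 2 := fun z => by rw [lam_mul, hm]; ring
  -- $\sigma=1/\rho_1$ away from $z=1$. It lies in the open unit disc, and the trace is
  -- $\lambda_1(1+\sigma^2)$.
  set σ := m z / L with hσ
  have hσ1 : ‖σ‖ < 1 := by
    have h1 : ‖m z‖ ^ 2 < ‖L‖ ^ 2 := by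
      rw [← norm_pow, ← hmul, norm_mul, pow_two]
      exact mul_lt_mul_of_pos_left hlt ((norm_nonneg _).trans_lt hlt)
    rw [hσ, norm_div, div_lt_one (norm_pos_iff.mpr hL0)]
    exact lt_of_pow_lt_pow_left₀ 2 (norm_nonneg _) h1
  have hmσ : m z = L * σ := by rw [hσ]; field_simp
  have hT : symbolTrace W z = L * (1 + σ ^ 2) := by
    have h2 : lam₂ W z = L * σ ^ 2 := by
      have : L * lam₂ W z = L * (L * σ ^ 2) := by rw [hmul, hmσ]; ring
      exact mul_left_cancel₀ hL0 this
    rw [← lam_add, h2]; ring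
  have hσ2 : 1 - σ ^ 2 ≠ 0 := by
    intro h
    have : ‖σ‖ ^ 2 = 1 := by rw [← norm_pow, ← sub_eq_zero.mp h]; simp
    nlinarith [norm_nonneg σ]
  have hden : ∀ ζ : ℂ, ‖ζ‖ ≤ 1 → 1 - ζ * σ ≠ 0 := by
    intro ζ hζ h
    have : ‖ζ * σ‖ = 1 := by rw [← sub_eq_zero.mp h]; simp
    rw [norm_mul] at this
    nlinarith [norm_nonneg ζ, norm_nonneg σ]
  have hden' : ∀ ζ : ℂ, ‖ζ‖ = 1 → ζ - σ ≠ 0 := by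
    intro ζ hζ h
    rw [sub_eq_zero.mp h] at hζ
    exact absurd hζ hσ1.ne
  have hfac : ∀ ζ : ℂ, ‖ζ‖ = 1 →
      symbolTrace W z - (ζ + ζ⁻¹) * m z = L * (1 - ζ * σ) * (ζ - σ) / ζ := by
    intro ζ hζ
    have hζ0 : ζ ≠ 0 := by rintro rfl; simp at hζ
    rw [hT, hmσ]; field_simp; ring
  -- At $\zeta=e^{i\theta}$ the integrand is $\frac12(e(\zeta)+e(\zeta^{-1}))$. Unlike the symmetric
  -- expression, $e$ alone is a function holomorphic on the closed disc times
  -- $\zeta/(\zeta-\sigma)$, so Cauchy's formula gives its mean.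
  set e : ℂ → ℂ := fun ζ => (T' - 2 * ζ * m') / (symbolTrace W z - (ζ + ζ⁻¹) * m z) with he
  have havg : Real.circleAverage e 0 1 = (T' - 2 * σ * m') / (L * (1 - σ ^ 2)) := by
    have h1 := circleAverage_sub_sub_inv_smul_of_differentiable_on_off_countable (c := 0) (R := 1)
      (w := σ) (f := fun ζ => (T' - 2 * ζ * m') / (L * (1 - ζ * σ))) countable_empty ?_ ?_ ?_
    · rw [show σ ^ 2 = σ * σ by ring, ← h1]
      refine Real.circleAverage_congr_sphere fun ζ hζ => ?_
      have hζ1 : ‖ζ‖ = 1 := by simpa using hζ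
      have hζ0 : ζ ≠ 0 := by rintro rfl; simp at hζ1
      have e1 := hden ζ hζ1.le
      have e2 := hden' ζ hζ1
      simp only [he, hfac ζ hζ1, sub_zero, smul_eq_mul]
      field_simp
    · intro ζ hζ
      have hζ1 : ‖ζ‖ ≤ 1 := by simpa using hζ
      refine ContinuousAt.continuousWithinAt (ContinuousAt.div (by fun_prop) (by fun_prop) ?_)
      exact mul_ne_zero hL0 (hden ζ hζ1)
    · intro ζ hζ
      have hζ1 : ‖ζ‖ ≤ 1 := by have := hζ.1; simp at this; exact this.le
      refine DifferentiableAt.div (by fun_prop) (by fun_prop) ?_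
      exact mul_ne_zero hL0 (hden ζ hζ1)
    · simpa using hσ1
  have hecont : ContinuousOn e (Metric.sphere 0 1) := by
    intro ζ hζ
    have hζ1 : ‖ζ‖ = 1 := by simpa using hζ
    have hζ0 : ζ ≠ 0 := by rintro rfl; simp at hζ1
    refine ContinuousAt.continuousWithinAt (ContinuousAt.div (by fun_prop) ?_ ?_)
    · exact continuousAt_const.sub ((continuousAt_id.add (continuousAt_inv₀ hζ0)).mul
        continuousAt_const)
    · rw [hfac ζ hζ1]
      exact div_ne_zero (mul_ne_zero (mul_ne_zero hL0 (hden ζ hζ1.le)) (hden' ζ hζ1)) hζ0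
  have heinv : ContinuousOn (fun ζ => e ζ⁻¹) (Metric.sphere 0 1) := by
    refine hecont.comp (fun ζ hζ => ?_) fun ζ hζ => ?_
    · have hζ1 : ‖ζ‖ = 1 := by simpa using hζ
      have hζ0 : ζ ≠ 0 := by rintro rfl; simp at hζ1
      exact (continuousAt_inv₀ hζ0).continuousWithinAt
    · have hζ1 : ‖ζ‖ = 1 := by simpa using hζ
      simp [hζ1]
  have hsum : Real.circleAverage (fun ζ => e ζ + e ζ⁻¹) 0 1 =
      2 * ((T' - 2 * σ * m') / (L * (1 - σ ^ 2))) := by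
    rw [Real.circleAverage_fun_add (hecont.circleIntegrable zero_le_one)
      (heinv.circleIntegrable zero_le_one), Real.circleAverage_zero_one_congr_inv, havg]
    ring
  have hquad : ∀ z, lam₁ W z ^ 2 - symbolTrace W z * lam₁ W z + m z ^ 2 = 0 := fun z => by
    rw [← hmul, ← lam_add]; ring
  -- Derivative of the characteristic equation at the eigenvalue; it identifies the mean just
  -- computed with $\lambda_1'/\lambda_1$.
  have hderiv : 2 * L * deriv (lam₁ W) z - (T' * L + symbolTrace W z * deriv (lam₁ W) z)
      + 2 * m z * m' = 0 := by
    have hLd : HasDerivAt (lam₁ W) (deriv (lam₁ W) z) z :=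
      (analyticAt_lam₁ hz).differentiableAt.hasDerivAt
    have hTd : HasDerivAt (symbolTrace W) T' z := (differentiable_symbolTrace W z).hasDerivAt
    have hmd : HasDerivAt m m' z := by
      have : DifferentiableAt ℂ m z := by simp only [hm]; fun_prop
      exact this.hasDerivAt
    have h1 := ((hLd.fun_pow 2).fun_sub (hTd.fun_mul hLd)).fun_add (hmd.fun_pow 2)
    have h2 : (fun z => lam₁ W z ^ 2 - symbolTrace W z * lam₁ W z + m z ^ 2) = fun _ => 0 :=
      funext hquad
    rw [h2] at h1
    have h3 := h1.unique (hasDerivAt_const z 0)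
    simp only [Nat.cast_ofNat, Nat.add_one_sub_one, pow_one] at h3
    exact h3
  have hval : deriv (lam₁ W) z / L = (T' - 2 * σ * m') / (L * (1 - σ ^ 2)) := by
    rw [div_eq_div_iff hL0 (mul_ne_zero hL0 hσ2)]
    rw [hT, hmσ] at hderiv
    clear_value σ L
    linear_combination hderiv
  rw [hval]
  have hfin : (T' - 2 * σ * m') / (L * (1 - σ ^ 2)) =
      (1 / 2) * Real.circleAverage (fun ζ => e ζ + e ζ⁻¹) 0 1 := by rw [hsum]; ring
  rw [hfin, Real.circleAverage_def, Complex.real_smul, ← mul_assoc, mul_comm (1 / 2 : ℂ), mul_assoc,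
    ← intervalIntegral.integral_const_mul]
  push_cast
  congr 1
  refine intervalIntegral.integral_congr fun θ _ => ?_
  rw [eval_phasePoly, eval_derivative_phasePoly]
  have hζ : circleMap 0 1 θ = Complex.exp (θ * Complex.I) := by simp [circleMap]
  have hζi : (circleMap 0 1 θ)⁻¹ = Complex.exp (-θ * Complex.I) := by
    rw [hζ, ← Complex.exp_neg]; congr 1; ring
  have hcos : 2 * ((Real.cos θ : ℝ) : ℂ) = circleMap 0 1 θ + (circleMap 0 1 θ)⁻¹ := by
    rw [hζi, hζ, Complex.ofReal_cos, Complex.cos]; ring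
  simp only [he, inv_inv]
  rw [hcos]
  ring

theorem continuous_logDeriv_phasePoly {W : Weighting k} {z : ℂ} (hz : z ∈ hyperbolicSet W) :
    Continuous fun θ : ℝ =>
      z * ((phasePoly W (Real.cos θ)).derivative.eval z / (phasePoly W (Real.cos θ)).eval z) := by
  have h : ∀ θ : ℝ, (phasePoly W (Real.cos θ)).eval z ≠ 0 := fun θ =>
    eval_phasePoly_ne_zero hz ⟨Real.neg_one_le_cos θ, Real.cos_le_one θ⟩
  simp only [eval_phasePoly] at h
  simp only [eval_phasePoly, eval_derivative_phasePoly]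
  refine continuous_const.mul (Continuous.div ?_ ?_ h)
  · fun_prop
  · fun_prop

/-- The function `z λ₁'(z) / λ₁(z)`. -/
noncomputable def eulerLam (W : Weighting k) (z : ℂ) : ℂ := z * (deriv (lam₁ W) z / lam₁ W z)

theorem eulerLam_eq {W : Weighting k} {z : ℂ} (hz : z ∈ hyperbolicSet W) :
    eulerLam W z = (2 * Real.pi)⁻¹ * ∫ θ in (0 : ℝ)..2 * Real.pi,
      z * ((phasePoly W (Real.cos θ)).derivative.eval z / (phasePoly W (Real.cos θ)).eval z) := by
  rw [eulerLam, logDeriv_lam₁ hz, intervalIntegral.integral_const_mul]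
  ring

theorem eulerLam_re {W : Weighting k} {z : ℂ} (hz : z ∈ hyperbolicSet W) :
    (eulerLam W z).re = (2 * Real.pi)⁻¹ * ∫ θ in (0 : ℝ)..2 * Real.pi,
      (z * ((phasePoly W (Real.cos θ)).derivative.eval z /
        (phasePoly W (Real.cos θ)).eval z)).re := by
  rw [eulerLam_eq hz, Complex.re_ofReal_mul]
  congr 1
  exact (Complex.reCLM.intervalIntegral_comp_comm
    ((continuous_logDeriv_phasePoly hz).intervalIntegrable _ _)).symm

theorem eulerLam_im {W : Weighting k} {z : ℂ} (hz : z ∈ hyperbolicSet W) :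
    (eulerLam W z).im = (2 * Real.pi)⁻¹ * ∫ θ in (0 : ℝ)..2 * Real.pi,
      (z * ((phasePoly W (Real.cos θ)).derivative.eval z /
        (phasePoly W (Real.cos θ)).eval z)).im := by
  rw [eulerLam_eq hz, Complex.im_ofReal_mul]
  congr 1
  exact (Complex.imCLM.intervalIntegral_comp_comm
    ((continuous_logDeriv_phasePoly hz).intervalIntegrable _ _)).symm

theorem im_div_sub {z r : ℂ} (hr : r.im = 0) :
    (z / (z - r)).im = z.im * (-r.re / ‖z - r‖ ^ 2) := by
  rw [Complex.div_im, ← Complex.normSq_eq_norm_sq]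
  simp only [Complex.sub_re, Complex.sub_im, hr]
  ring

theorem im_logDeriv_phasePoly (hk : 1 ≤ k) {W : Weighting k} {z : ℂ} (hz : z ∈ hyperbolicSet W)
    {c : ℝ} (hc : c ∈ Icc (-1 : ℝ) 1) :
    (z * ((phasePoly W c).derivative.eval z / (phasePoly W c).eval z)).im =
      z.im * ((phasePoly W c).roots.map fun r => -r.re / ‖z - r‖ ^ 2).sum := by
  rw [logDeriv_phasePoly hz hc, ← Complex.imCLM_apply, map_multiset_sum, Multiset.map_map,
    ← Multiset.sum_map_mul_left]
  congr 1
  exact Multiset.map_congr rfl fun r hr => im_div_sub (phasePoly_roots hk hc r hr).1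

/-- The quotient is the sum of $-r/|z-r|^2$ over the zeros $r\le0$, and on a circle around $0$ the
distance to such an $r$ increases with the real part of $z$. -/
theorem im_logDeriv_phasePoly_div_le (hk : 1 ≤ k) (W : Weighting k) {z z' : ℂ} (hz : 0 < z.im)
    (hz' : 0 < z'.im) (hn : ‖z‖ = ‖z'‖) (hre : z.re ≤ z'.re) {c : ℝ} (hc : c ∈ Icc (-1 : ℝ) 1) :
    (z' * ((phasePoly W c).derivative.eval z' / (phasePoly W c).eval z')).im / z'.im ≤
      (z * ((phasePoly W c).derivative.eval z / (phasePoly W c).eval z)).im / z.im := by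
  have hh : ∀ z : ℂ, 0 < z.im → z ∈ hyperbolicSet W := fun z hz =>
    slitPlane_subset_hyperbolicSet hk W (Or.inr hz.ne')
  rw [im_logDeriv_phasePoly hk (hh z' hz') hc, im_logDeriv_phasePoly hk (hh z hz) hc,
    mul_div_cancel_left₀ _ hz.ne', mul_div_cancel_left₀ _ hz'.ne']
  refine Multiset.sum_map_le_sum_map _ _ fun r hr => ?_
  obtain ⟨him, hr0⟩ := phasePoly_roots hk hc r hr
  have hsq : ∀ z : ℂ, ‖z - r‖ ^ 2 = ‖z‖ ^ 2 - 2 * z.re * r.re + r.re ^ 2 := by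
    intro z
    rw [← Complex.normSq_eq_norm_sq, ← Complex.normSq_eq_norm_sq, Complex.normSq_apply,
      Complex.normSq_apply]
    simp only [Complex.sub_re, Complex.sub_im, him]; ring
  have hpos : 0 < ‖z - r‖ ^ 2 := by
    have : z - r ≠ 0 := fun h => by
      have := congrArg Complex.im h; simp [him] at this; exact hz.ne' this
    positivity
  refine div_le_div_of_nonneg_left (by linarith) hpos ?_
  rw [hsq, hsq, hn]
  nlinarith

/-- On the upper half of a circle around `0` the function `Im (z λ₁' / λ₁) / Im z` decreases with
the real part. -/
theorem eulerLam_im_div_le (hk : 1 ≤ k) (W : Weighting k) {z z' : ℂ} (hz : 0 < z.im)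
    (hz' : 0 < z'.im) (hn : ‖z‖ = ‖z'‖) (hre : z.re ≤ z'.re) :
    (eulerLam W z').im / z'.im ≤ (eulerLam W z).im / z.im := by
  have hh : ∀ z : ℂ, 0 < z.im → z ∈ hyperbolicSet W := fun z hz =>
    slitPlane_subset_hyperbolicSet hk W (Or.inr hz.ne')
  rw [eulerLam_im (hh z hz), eulerLam_im (hh z' hz'), mul_div_assoc, mul_div_assoc]
  refine mul_le_mul_of_nonneg_left ?_ (by positivity)
  rw [← intervalIntegral.integral_div, ← intervalIntegral.integral_div]
  refine intervalIntegral.integral_mono (by positivity) ?_ ?_ fun θ =>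
    im_logDeriv_phasePoly_div_le hk W hz hz' hn hre ⟨Real.neg_one_le_cos θ, Real.cos_le_one θ⟩
  · exact ((Complex.continuous_im.comp (continuous_logDeriv_phasePoly (hh z' hz'))).div_const
      _).intervalIntegrable _ _
  · exact ((Complex.continuous_im.comp (continuous_logDeriv_phasePoly (hh z hz))).div_const
      _).intervalIntegrable _ _

/-- At real points `z λ₁' / λ₁` is real. -/
theorem eulerLam_im_ofReal (hk : 1 ≤ k) {W : Weighting k} {x : ℝ}
    (hx : (x : ℂ) ∈ hyperbolicSet W) : (eulerLam W x).im = 0 := by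
  rw [eulerLam_im hx]
  simp only [im_logDeriv_phasePoly hk hx ⟨Real.neg_one_le_cos _, Real.cos_le_one _⟩]
  simp

/-- Each summand $t/(t-r)$ has derivative $-r/(t-r)^2\ge0$, and the hypothesis keeps the zeros out
of `[x, y]`, so no pole is crossed. -/
theorem re_logDeriv_phasePoly_le (hk : 1 ≤ k) {W : Weighting k} {x y : ℝ} (hxy : x ≤ y)
    (hx : (x : ℂ) ∈ hyperbolicSet W) (hy : (y : ℂ) ∈ hyperbolicSet W) {c : ℝ}
    (hc : c ∈ Icc (-1 : ℝ) 1)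
    (h : ∀ t ∈ Icc x y, symbolTrace W t ≠ 2 * c * ((t : ℂ) - 1) ^ k) :
    ((x : ℂ) * ((phasePoly W c).derivative.eval (x : ℂ) / (phasePoly W c).eval (x : ℂ))).re ≤
      ((y : ℂ) * ((phasePoly W c).derivative.eval (y : ℂ) / (phasePoly W c).eval (y : ℂ))).re := by
  rw [logDeriv_phasePoly hx hc, logDeriv_phasePoly hy hc, ← Complex.reCLM_apply,
    ← Complex.reCLM_apply, map_multiset_sum, map_multiset_sum, Multiset.map_map, Multiset.map_map]
  refine Multiset.sum_map_le_sum_map _ _ fun r hr => ?_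
  obtain ⟨him, hr0⟩ := phasePoly_roots hk hc r hr
  obtain ⟨s, rfl⟩ : ∃ s : ℝ, r = s := ⟨r.re, Complex.ext rfl (by simpa using him)⟩
  rw [Complex.ofReal_re] at hr0
  have hs : s ∉ Icc x y := fun hs => h s hs (by
    have := (Polynomial.mem_roots'.mp hr).2
    rw [Polynomial.IsRoot, eval_phasePoly] at this
    exact sub_eq_zero.mp this)
  have hprod : 0 < (x - s) * (y - s) := by
    rw [mem_Icc, not_and_or, not_le, not_le] at hs
    rcases hs with hs | hs
    · exact mul_pos (by linarith) (by linarith)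
    · exact mul_pos_of_neg_of_neg (by linarith) (by linarith)
  have e : ∀ x : ℝ, (Complex.reCLM ∘ fun r : ℂ => (x : ℂ) / (x - r)) (s : ℂ) = x / (x - s) :=
    fun x => by
      simp only [Function.comp_apply, Complex.reCLM_apply]
      rw [← Complex.ofReal_sub, ← Complex.ofReal_div, Complex.ofReal_re]
  have hx0 : x - s ≠ 0 := left_ne_zero_of_mul hprod.ne'
  have hy0 : y - s ≠ 0 := right_ne_zero_of_mul hprod.ne'
  rw [e, e, ← sub_nonneg, show y / (y - s) - x / (x - s) = s * (x - y) / ((x - s) * (y - s)) by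
    field_simp; ring]
  exact div_nonneg (mul_nonneg_of_nonpos_of_nonpos hr0 (by linarith)) hprod.le

/-- `z λ₁' / λ₁` increases between two points of the real axis if `|Tr Φ| ≥ 2` in between. -/
theorem eulerLam_re_le (hk : 1 ≤ k) {W : Weighting k} {x y : ℝ} (hxy : x ≤ y)
    (hx' : (x : ℂ) ∈ hyperbolicSet W) (hy' : (y : ℂ) ∈ hyperbolicSet W)
    (h : ∀ t ∈ Icc x y, ∀ c ∈ Ioo (-1 : ℝ) 1, symbolTrace W t ≠ 2 * c * ((t : ℂ) - 1) ^ k) :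
    (eulerLam W x).re ≤ (eulerLam W y).re := by
  rw [eulerLam_re hx', eulerLam_re hy']
  refine mul_le_mul_of_nonneg_left ?_ (by positivity)
  refine intervalIntegral.integral_mono_ae (by positivity)
    ((Complex.continuous_re.comp (continuous_logDeriv_phasePoly hx')).intervalIntegrable _ _)
    ((Complex.continuous_re.comp (continuous_logDeriv_phasePoly hy')).intervalIntegrable _ _) ?_
  -- Only $\cos\theta=\pm1$ is not covered by the hypothesis, and that is a null set of angles. This
  -- lets the interval contain points with $|\operatorname{Tr}\Phi|=2$, which `polyP_touch`
  -- requires.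
  have hcount : {θ : ℝ | Real.sin θ = 0}.Countable := by
    have : {θ : ℝ | Real.sin θ = 0} ⊆ range fun n : ℤ => (n : ℝ) * Real.pi := fun θ hθ =>
      Real.sin_eq_zero_iff.mp hθ
    exact (countable_range _).mono this
  filter_upwards [hcount.ae_notMem volume] with θ hθ
  have hsin : 0 < Real.sin θ ^ 2 := lt_of_le_of_ne (sq_nonneg _) (Ne.symm (pow_ne_zero 2 hθ))
  have hc : Real.cos θ ∈ Ioo (-1 : ℝ) 1 := by
    have := Real.sin_sq_add_cos_sq θ
    exact ⟨by nlinarith [Real.neg_one_le_cos θ], by nlinarith [Real.cos_le_one θ]⟩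
  exact re_logDeriv_phasePoly_le hk hxy hx' hy' (Ioo_subset_Icc_self hc) fun t ht => h t ht _ hc

end AztecDiamond

namespace AztecDiamond

open Set Topology Filter MeasureTheory

variable {k : ℕ}

/-! ### The gaps -/

theorem hasDerivAt_log_norm {g : ℝ → ℂ} {g' : ℂ} {t : ℝ} (hg : HasDerivAt g g' t) (h0 : g t ≠ 0) :
    HasDerivAt (fun s => Real.log ‖g s‖) (g' / g t).re t := by
  -- Dividing by `g t` brings the value to `1`, away from the cut of the logarithm.
  have h1 : HasDerivAt (fun s => g s / g t) (g' / g t) t := hg.div_const _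
  have h2 := h1.clog_real (by rw [div_self h0]; simp)
  rw [div_self h0, div_one] at h2
  have h3 := (Complex.reCLM.hasFDerivAt.comp_hasDerivAt t h2).add_const (Real.log ‖g t‖)
  refine h3.congr_of_eventuallyEq ?_
  filter_upwards [hg.continuousAt.eventually_ne h0] with s hs
  simp only [Function.comp_apply, Complex.reCLM_apply]
  rw [Complex.log_re, norm_div, Real.log_div (norm_ne_zero_iff.mpr hs) (norm_ne_zero_iff.mpr h0)]
  ring

/-- The logarithmic derivative `z ρ₁'(z) / ρ₁(z)`. -/
noncomputable def eulerRho (W : Weighting k) (z : ℂ) : ℂ := eulerLam W z - k * (z / (z - 1))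

/-- Obtained by differentiating the characteristic equation. The square of $\lambda_1-\lambda_2$ is
$p$, so this describes $z\rho_1'/\rho_1$ near zeros of $p$. -/
theorem eulerRho_mul {W : Weighting k} {z : ℂ} (hz : z ∈ hyperbolicSet W) (h1 : z ≠ 1) :
    (lam₁ W z - lam₂ W z) * eulerRho W z =
      z * (deriv (symbolTrace W) z - k * symbolTrace W z / (z - 1)) := by
  have hz1 : z - 1 ≠ 0 := sub_ne_zero.mpr h1
  have hL0 := lam₁_ne_zero hz
  have hderiv : 2 * lam₁ W z * deriv (lam₁ W) z - (deriv (symbolTrace W) z * lam₁ W z +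
      symbolTrace W z * deriv (lam₁ W) z) + 2 * k * (lam₁ W z * lam₂ W z) / (z - 1) = 0 := by
    have hLd : HasDerivAt (lam₁ W) (deriv (lam₁ W) z) z :=
      (analyticAt_lam₁ hz).differentiableAt.hasDerivAt
    have hTd : HasDerivAt (symbolTrace W) (deriv (symbolTrace W) z) z :=
      (differentiable_symbolTrace W z).hasDerivAt
    have hmd : HasDerivAt (fun z : ℂ => (z - 1) ^ (2 * k)) ((2 * k) * (z - 1) ^ (2 * k) / (z - 1))
        z := by
      refine (((hasDerivAt_id z).sub_const 1).fun_pow (2 * k)).congr_deriv ?_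
      rcases Nat.eq_zero_or_pos k with rfl | hk
      · simp
      · obtain ⟨n, hn⟩ : ∃ n, 2 * k = n + 1 := ⟨2 * k - 1, by omega⟩
        have : (2 * (k : ℂ)) = n + 1 := by exact_mod_cast hn
        rw [this, hn, pow_succ]; simp; field_simp
    have h1 := ((hLd.fun_pow 2).fun_sub (hTd.fun_mul hLd)).fun_add hmd
    have h2 : (fun z => lam₁ W z ^ 2 - symbolTrace W z * lam₁ W z + (z - 1) ^ (2 * k)) =
        fun _ => 0 := funext fun z => by rw [← lam_mul, ← lam_add]; ring
    rw [h2] at h1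
    have h3 := h1.unique (hasDerivAt_const z 0)
    simp only [Nat.cast_ofNat, Nat.add_one_sub_one, pow_one] at h3
    rw [← h3, ← lam_mul]
  rw [← lam_add] at hderiv ⊢
  rw [eulerRho, eulerLam]
  field_simp at hderiv ⊢
  linear_combination z * hderiv

/-- The Lyapunov exponent `log |ρ₁|`. -/
noncomputable def lyapunov (W : Weighting k) (z : ℂ) : ℝ :=
  Real.log ‖lam₁ W z‖ - k * Real.log ‖z - 1‖

theorem norm_pow_le_norm_lam₁ (W : Weighting k) (z : ℂ) : ‖z - 1‖ ^ k ≤ ‖lam₁ W z‖ := by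
  have h : (‖z - 1‖ ^ k) ^ 2 ≤ ‖lam₁ W z‖ ^ 2 := by
    rw [← pow_mul, mul_comm k 2, ← norm_pow, ← lam_mul, norm_mul, pow_two]
    exact mul_le_mul_of_nonneg_left (norm_lam₂_le W z) (norm_nonneg _)
  exact le_of_sq_le_sq h (norm_nonneg _)

theorem norm_pow_lt_norm_lam₁ {W : Weighting k} {z : ℂ} (hz : z ∈ hyperbolicSet W) :
    ‖z - 1‖ ^ k < ‖lam₁ W z‖ := by
  have hlt := (mem_hyperbolicSet_iff W z).mp hz
  have h : (‖z - 1‖ ^ k) ^ 2 < ‖lam₁ W z‖ ^ 2 := by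
    rw [← pow_mul, mul_comm k 2, ← norm_pow, ← lam_mul, norm_mul, pow_two]
    exact mul_lt_mul_of_pos_left hlt ((norm_nonneg _).trans_lt hlt)
  exact lt_of_pow_lt_pow_left₀ 2 (norm_nonneg _) h

theorem lyapunov_pos {W : Weighting k} {z : ℂ} (hz : z ∈ hyperbolicSet W) (h1 : z ≠ 1) :
    0 < lyapunov W z := by
  have hpos : 0 < ‖z - 1‖ := norm_pos_iff.mpr (sub_ne_zero.mpr h1)
  rw [lyapunov, ← Real.log_pow, sub_pos]
  exact Real.log_lt_log (by positivity) (norm_pow_lt_norm_lam₁ hz)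

theorem lyapunov_eq_zero {W : Weighting k} {z : ℂ} (hz : z ∉ hyperbolicSet W) :
    lyapunov W z = 0 := by
  have heq : ‖lam₂ W z‖ = ‖lam₁ W z‖ := by
    rw [mem_hyperbolicSet_iff] at hz; exact le_antisymm (norm_lam₂_le W z) (not_lt.mp hz)
  have h : ‖lam₁ W z‖ ^ 2 = (‖z - 1‖ ^ k) ^ 2 := by
    rw [← pow_mul, mul_comm k 2, ← norm_pow (z - 1), ← lam_mul, norm_mul, heq, pow_two]
  rw [lyapunov, ← Real.log_pow, (sq_eq_sq₀ (norm_nonneg _) (by positivity)).mp h, sub_self]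

theorem continuousAt_lyapunov {W : Weighting k} {z : ℂ} (h1 : z ≠ 1) :
    ContinuousAt (lyapunov W) z := by
  have hpos : 0 < ‖z - 1‖ := norm_pos_iff.mpr (sub_ne_zero.mpr h1)
  have h : 0 < ‖lam₁ W z‖ := (pow_pos hpos k).trans_le (norm_pow_le_norm_lam₁ W z)
  have h2 : ContinuousAt (fun z : ℂ => ‖z - 1‖) z := by fun_prop
  exact ((continuous_norm_lam₁ W).continuousAt.log h.ne').sub
    (continuousAt_const.mul (h2.log hpos.ne'))

theorem hasDerivAt_log_norm_lam₁ {W : Weighting k} {x : ℝ} (hx : (x : ℂ) ∈ hyperbolicSet W)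
    (h0 : x ≠ 0) : HasDerivAt (fun x : ℝ => Real.log ‖lam₁ W x‖) ((eulerLam W x).re / x) x := by
  have h := hasDerivAt_log_norm ((analyticAt_lam₁ hx).differentiableAt.hasDerivAt.comp_ofReal)
    (lam₁_ne_zero hx)
  refine h.congr_deriv ?_
  rw [eulerLam, Complex.re_ofReal_mul]
  field_simp

theorem hasDerivAt_log_norm_sub_one {x : ℝ} (h1 : x ≠ 1) :
    HasDerivAt (fun x : ℝ => Real.log ‖(x : ℂ) - 1‖) (x - 1)⁻¹ x := by
  have h1' : (x : ℂ) - 1 ≠ 0 := sub_ne_zero.mpr (by exact_mod_cast h1)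
  have h := hasDerivAt_log_norm (((hasDerivAt_id (x : ℂ)).sub_const 1).comp_ofReal) h1'
  refine h.congr_deriv ?_
  rw [show ((1 : ℂ) / (id (x : ℂ) - 1)) = (((x - 1)⁻¹ : ℝ) : ℂ) by push_cast; simp,
    Complex.ofReal_re]

theorem eulerRho_re_ofReal (W : Weighting k) (x : ℝ) :
    (eulerRho W x).re = (eulerLam W x).re - k * (x / (x - 1)) := by
  rw [eulerRho, Complex.sub_re, show (k : ℂ) * ((x : ℂ) / ((x : ℂ) - 1)) =
    ((k * (x / (x - 1)) : ℝ) : ℂ) by push_cast; rfl, Complex.ofReal_re]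

theorem hasDerivAt_lyapunov {W : Weighting k} {x : ℝ} (hx : (x : ℂ) ∈ hyperbolicSet W)
    (h0 : x ≠ 0) (h1 : x ≠ 1) :
    HasDerivAt (fun x : ℝ => lyapunov W x) ((eulerRho W x).re / x) x := by
  refine ((hasDerivAt_log_norm_lam₁ hx h0).fun_sub
    ((hasDerivAt_log_norm_sub_one h1).const_mul (k : ℝ))).congr_deriv ?_
  rw [eulerRho_re_ofReal]
  have : x - 1 ≠ 0 := sub_ne_zero.mpr h1
  field_simp

theorem symbolTrace_ofReal (W : Weighting k) (x : ℝ) :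
    symbolTrace W x = (((scaledPhi W).trace.eval x : ℝ) : ℂ) :=
  Polynomial.aeval_algebraMap_apply_eq_algebraMap_eval x _

theorem eval_polyP (W : Weighting k) (x : ℝ) :
    (polyP W).eval x = (scaledPhi W).trace.eval x ^ 2 - 4 * (x - 1) ^ (2 * k) := by
  simp [polyP]

theorem aeval_polyP_eq (W : Weighting k) (z : ℂ) :
    Polynomial.aeval z (polyP W) = (lam₁ W z - lam₂ W z) ^ 2 := by
  have h : Polynomial.aeval z (polyP W) = symbolTrace W z ^ 2 - 4 * (z - 1) ^ (2 * k) := by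
    rw [polyP, symbolTrace, map_sub, map_pow, map_mul, map_ofNat]; simp
  rw [h, ← lam_add, ← lam_mul]; ring

/-- At real points the trace is real, and $p\le0$ says that its ratio to $2(x-1)^k$ lies in
$[-1,1]$. At $x=1$ both sides say that the trace does not vanish. -/
theorem ofReal_mem_hyperbolicSet_iff (hk : 1 ≤ k) (W : Weighting k) (x : ℝ) :
    (x : ℂ) ∈ hyperbolicSet W ↔ 0 < (polyP W).eval x := by
  rw [eval_polyP]
  have key : ∀ c : ℝ, symbolTrace W x = 2 * c * ((x : ℂ) - 1) ^ k ↔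
      (scaledPhi W).trace.eval x = 2 * c * (x - 1) ^ k := fun c => by
    rw [symbolTrace_ofReal]; exact_mod_cast Iff.rfl
  constructor
  · intro h
    by_contra hneg
    rw [not_lt, mul_comm 2 k, pow_mul] at hneg
    rcases eq_or_ne x 1 with rfl | hx
    · refine h 0 (by norm_num) ((key 0).mpr ?_)
      rw [sub_self, zero_pow (by omega), zero_pow two_ne_zero] at hneg
      nlinarith [sq_nonneg ((scaledPhi W).trace.eval 1)]
    · have hm : (x - 1) ^ k ≠ 0 := pow_ne_zero _ (sub_ne_zero.mpr hx)
      refine h ((scaledPhi W).trace.eval x / (2 * (x - 1) ^ k)) ?_ ((key _).mpr (by field_simp))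
      rw [mem_Icc, ← abs_le, ← sq_le_one_iff_abs_le_one, div_pow, div_le_one (by positivity)]
      linarith
  · intro h c hc hT
    rw [(key c).mp hT, mul_pow, mul_comm 2 k, pow_mul] at h
    have hc2 : c ^ 2 ≤ 1 := by rw [sq_le_one_iff_abs_le_one, abs_le]; exact hc
    nlinarith [sq_nonneg ((x - 1) ^ k)]

theorem symbolTrace_ne_of_polyP_nonneg {W : Weighting k} {x : ℝ} (h1 : x ≠ 1)
    (h : 0 ≤ (polyP W).eval x) {c : ℝ} (hc : c ∈ Ioo (-1 : ℝ) 1) :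
    symbolTrace W x ≠ 2 * c * ((x : ℂ) - 1) ^ k := by
  intro hT
  rw [symbolTrace_ofReal] at hT
  have hT' : (scaledPhi W).trace.eval x = 2 * c * (x - 1) ^ k := by exact_mod_cast hT
  rw [eval_polyP, hT', mul_pow, mul_comm 2 k, pow_mul] at h
  have hc2 : c ^ 2 < 1 := by rw [sq_lt_one_iff_abs_lt_one, abs_lt]; exact hc
  have hm : 0 < ((x - 1) ^ k) ^ 2 := by
    have : (x - 1) ^ k ≠ 0 := pow_ne_zero _ (sub_ne_zero.mpr h1)
    positivity
  nlinarith

/-- The part from $\lambda_1$ is nondecreasing by the average formula; strictness comes from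
$-kx/(x-1)$. Only $p\ge0$ is needed in between, so isolated zeros of $p$ are permitted. -/
theorem eulerRho_re_lt (hk : 1 ≤ k) {W : Weighting k} {x y : ℝ} (hxy : x < y) (hy0 : y < 0)
    (hx : 0 < (polyP W).eval x) (hy : 0 < (polyP W).eval y)
    (h : ∀ t ∈ Icc x y, 0 ≤ (polyP W).eval t) :
    (eulerRho W x).re < (eulerRho W y).re := by
  have h1 := eulerLam_re_le hk hxy.le ((ofReal_mem_hyperbolicSet_iff hk W x).mpr hx)
    ((ofReal_mem_hyperbolicSet_iff hk W y).mpr hy) fun t ht c hc =>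
      symbolTrace_ne_of_polyP_nonneg (by linarith [ht.2]) (h t ht) hc
  rw [eulerRho_re_ofReal, eulerRho_re_ofReal]
  have h2 : y / (y - 1) < x / (x - 1) := by
    have hx1 : x - 1 < 0 := by linarith
    have hy1 : y - 1 < 0 := by linarith
    rw [← sub_pos, show x / (x - 1) - y / (y - 1) = (y - x) / ((x - 1) * (y - 1)) by
      have := hx1.ne; have := hy1.ne; field_simp; ring]
    exact div_pos (by linarith) (mul_pos_of_neg_of_neg hx1 hy1)
  have hk' : (0 : ℝ) < k := by exact_mod_cast hk
  nlinarith

/-- The polynomial `p` is positive on `(0, ∞)`. -/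
theorem polyP_pos (hk : 1 ≤ k) (W : Weighting k) {x : ℝ} (hx : 0 < x) : 0 < (polyP W).eval x :=
  (ofReal_mem_hyperbolicSet_iff hk W x).mp
    (slitPlane_subset_hyperbolicSet hk W (Or.inl (by simpa using hx)))

theorem polyP_ne_zero (hk : 1 ≤ k) (W : Weighting k) : polyP W ≠ 0 := fun h => by
  have := polyP_pos hk W one_pos
  rw [h] at this; simp at this

/-- A zero of `p` is not isolated from both sides by points where `p` is positive. -/
theorem polyP_touch (hk : 1 ≤ k) {W : Weighting k} {a s b : ℝ} (has : a < s) (hsb : s < b)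
    (hb : b < 0) (h : ∀ t ∈ Icc a b, t ≠ s → 0 < (polyP W).eval t) : 0 < (polyP W).eval s := by
  by_contra hs
  have hs' : (s : ℂ) ∉ hyperbolicSet W := by rwa [ofReal_mem_hyperbolicSet_iff hk]
  have hmem : ∀ t ∈ Icc a b, t ≠ s → (t : ℂ) ∈ hyperbolicSet W := fun t ht hts =>
    (ofReal_mem_hyperbolicSet_iff hk W t).mpr (h t ht hts)
  have hne1 : ∀ t : ℝ, t ≤ b → (t : ℂ) ≠ 1 := fun t ht h1 => by
    have : t = 1 := by exact_mod_cast h1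
    linarith
  have hcont : ∀ t : ℝ, t ≤ b → ContinuousAt (fun x : ℝ => lyapunov W x) t := fun t ht =>
    (continuousAt_lyapunov (hne1 t ht)).comp Complex.continuous_ofReal.continuousAt
  have hd : ∀ t ∈ Icc a b, t ≠ s →
      HasDerivAt (fun x : ℝ => lyapunov W x) ((eulerRho W t).re / t) t := fun t ht hts =>
    hasDerivAt_lyapunov (hmem t ht hts) (by linarith [ht.2]) (by linarith [ht.2])
  -- If $p(s)=0$, the Lyapunov exponent vanishes at $s$ and is positive at $a$ and $b$. Its
  -- derivative is $u(x)/x$ with $u=x\rho_1'/\rho_1$ and $x<0$, so $u$ is positive somewhere left of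
  -- $s$ and negative somewhere right of it, contrary to its monotonicity.
  obtain ⟨x, hx, hx'⟩ := exists_hasDerivAt_eq_slope (fun x : ℝ => lyapunov W x)
    (fun t => (eulerRho W t).re / t) has
    (fun t ht => (hcont t (by linarith [ht.2])).continuousWithinAt)
    fun t ht => hd t ⟨ht.1.le, by linarith [ht.2]⟩ ht.2.ne
  obtain ⟨y, hy, hy'⟩ := exists_hasDerivAt_eq_slope (fun x : ℝ => lyapunov W x)
    (fun t => (eulerRho W t).re / t) hsb
    (fun t ht => (hcont t ht.2).continuousWithinAt)
    fun t ht => hd t ⟨by linarith [ht.1], ht.2.le⟩ ht.1.ne'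
  have e0 : lyapunov W s = 0 := lyapunov_eq_zero hs'
  have ea : 0 < lyapunov W a :=
    lyapunov_pos (hmem a ⟨le_rfl, by linarith⟩ has.ne) (hne1 a (by linarith))
  have eb : 0 < lyapunov W b :=
    lyapunov_pos (hmem b ⟨by linarith, le_rfl⟩ hsb.ne') (hne1 b le_rfl)
  have h1 : (eulerRho W x).re / x < 0 := by
    rw [hx', e0]; exact div_neg_of_neg_of_pos (by linarith) (by linarith)
  have h2 : 0 < (eulerRho W y).re / y := by
    rw [hy', e0]; exact div_pos (by linarith) (by linarith)
  have hx0 : x < 0 := by linarith [hx.2]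
  have hy0 : y < 0 := by linarith [hy.2]
  have h3 : 0 < (eulerRho W x).re := by
    by_contra hc; exact absurd (div_nonneg_of_nonpos (not_lt.mp hc) hx0.le) (not_le.mpr h1)
  have h4 : (eulerRho W y).re < 0 := by
    by_contra hc
    exact absurd (div_nonpos_of_nonneg_of_nonpos (not_lt.mp hc) hy0.le) (not_le.mpr h2)
  have h5 := eulerRho_re_lt hk (hx.2.trans hy.1) hy0
    (h x ⟨hx.1.le, by linarith [hx.2]⟩ hx.2.ne) (h y ⟨by linarith [hy.1], hy.2.le⟩ hy.1.ne')
    fun t ht => by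
      rcases eq_or_ne t s with rfl | hts
      · have hcl : t ∈ closure (Ioo t b) := by rw [closure_Ioo hsb.ne]; exact ⟨le_rfl, hsb.le⟩
        have := (isClosed_Ici (a := (0 : ℝ))).preimage (polyP W).continuous
        exact (closure_minimal (fun r hr => (h r ⟨by linarith [hr.1], hr.2.le⟩ hr.1.ne').le) this)
          hcl
      · exact (h t ⟨by linarith [ht.1, hx.1], by linarith [ht.2, hy.2]⟩ hts).le
  linarith

end AztecDiamond

namespace AztecDiamond

open Set Topology Filter MeasureTheory

variable {k : ℕ}

/-! ### Signs of `p` and `p₀` -/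

theorem polyQ_monic (W : Weighting k) : (polyQ W).Monic :=
  Polynomial.monic_prod_of_monic _ _ fun s _ => (Polynomial.monic_X_sub_C s).pow _

theorem polyP₀_ne_zero (hk : 1 ≤ k) (W : Weighting k) : polyP₀ W ≠ 0 := fun h =>
  polyP_ne_zero hk W (by rw [polyP_eq, h, mul_zero])

theorem eval_polyP_eq (W : Weighting k) (x : ℝ) :
    (polyP W).eval x = (polyQ W).eval x ^ 2 * (polyP₀ W).eval x := by
  conv_lhs => rw [polyP_eq]
  simp

theorem polyP₀_pos (hk : 1 ≤ k) (W : Weighting k) {x : ℝ} (hx : 0 < x) :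
    0 < (polyP₀ W).eval x := by
  have h := polyP_pos hk W hx
  rw [eval_polyP_eq] at h
  exact pos_of_mul_pos_right h (sq_nonneg _)

theorem rootMultiplicity_polyQ (W : Weighting k) (s : ℝ) :
    (polyQ W).rootMultiplicity s = (polyP W).rootMultiplicity s / 2 := by
  classical
  rw [← Polynomial.count_roots, polyQ, Polynomial.roots_prod _ _ (Finset.prod_ne_zero_iff.mpr
    fun s _ => pow_ne_zero _ (Polynomial.X_sub_C_ne_zero s)), Multiset.count_bind]
  simp only [Polynomial.roots_pow, Polynomial.roots_X_sub_C, Multiset.count_nsmul,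
    Multiset.count_singleton]
  change ∑ x ∈ (polyP W).roots.toFinset, _ = _
  by_cases hs : s ∈ (polyP W).roots.toFinset
  · rw [Finset.sum_eq_single_of_mem s hs]
    · simp
    · intro b _ hb
      simp [hb.symm]
  · rw [Finset.sum_eq_zero]
    · rw [Multiset.mem_toFinset, ← Multiset.count_eq_zero, Polynomial.count_roots] at hs
      rw [hs, Nat.zero_div]
    · intro b hb
      have : s ≠ b := fun h => hs (h ▸ hb)
      simp [this]

theorem rootMultiplicity_polyP (hk : 1 ≤ k) (W : Weighting k) (s : ℝ) :
    (polyP W).rootMultiplicity s =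
      2 * ((polyP W).rootMultiplicity s / 2) + (polyP₀ W).rootMultiplicity s := by
  have h : polyQ W ^ 2 * polyP₀ W ≠ 0 := by rw [← polyP_eq]; exact polyP_ne_zero hk W
  conv_lhs => rw [polyP_eq]
  rw [Polynomial.rootMultiplicity_mul h, ← Polynomial.count_roots, Polynomial.roots_pow,
    Multiset.count_nsmul, Polynomial.count_roots, rootMultiplicity_polyQ]

theorem rootMultiplicity_polyP₀_le_one (hk : 1 ≤ k) (W : Weighting k) (s : ℝ) :
    (polyP₀ W).rootMultiplicity s ≤ 1 := by
  have := rootMultiplicity_polyP hk W s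
  omega

theorem mem_branchList_iff (hk : 1 ≤ k) (W : Weighting k) (x : ℝ) :
    x ∈ branchList W ↔ (polyP₀ W).eval x = 0 := by
  rw [branchList, Finset.mem_sort, Multiset.mem_toFinset, Polynomial.mem_roots (polyP₀_ne_zero hk W)]
  rfl

theorem sortedGT_branchList (W : Weighting k) : (branchList W).Pairwise (· > ·) := by
  have h1 : (branchList W).Pairwise (· ≥ ·) := Finset.pairwise_sort _ _
  have h2 : (branchList W).Nodup := Finset.sort_nodup _ _
  exact (h1.and h2).imp fun h => lt_of_le_of_ne h.1 h.2.symm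

theorem branchPoint_eq {W : Weighting k} {j : ℕ} (hj : j < (branchList W).length) :
    branchPoint W j = (branchList W)[j] := by
  rw [branchPoint, List.getD_eq_getElem _ _ hj]

theorem eval_polyP₀_branchPoint (hk : 1 ≤ k) {W : Weighting k} {j : ℕ}
    (hj : j < (branchList W).length) : (polyP₀ W).eval (branchPoint W j) = 0 := by
  rw [← mem_branchList_iff hk, branchPoint_eq hj]; exact List.getElem_mem _

theorem branchPoint_lt {W : Weighting k} {i j : ℕ} (hij : i < j)
    (hj : j < (branchList W).length) : branchPoint W j < branchPoint W i := by
  rw [branchPoint_eq hj, branchPoint_eq (hij.trans hj)]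
  exact List.pairwise_iff_getElem.mp (sortedGT_branchList W) i j _ _ hij

theorem branchPoint_nonpos (hk : 1 ≤ k) {W : Weighting k} {j : ℕ}
    (hj : j < (branchList W).length) : branchPoint W j ≤ 0 := by
  by_contra h
  exact (polyP₀_pos hk W (not_le.mp h)).ne' (eval_polyP₀_branchPoint hk hj)

/-- The zeros of $p_0$ are simple. What is left after dividing them out has no real zero and is
positive at $1$, so the sign of $p_0$ can be read off from the branch points. -/
theorem exists_polyP₀_eq (hk : 1 ≤ k) (W : Weighting k) :
    ∃ g : Polynomial ℝ, (∀ x, 0 < g.eval x) ∧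
      ∀ x, (polyP₀ W).eval x = ((branchList W).map fun s => x - s).prod * g.eval x := by
  classical
  obtain ⟨g, hg, -, hroots⟩ := Polynomial.exists_prod_multiset_X_sub_C_mul (polyP₀ W)
  have hnodup : (polyP₀ W).roots.Nodup := by
    rw [Multiset.nodup_iff_count_le_one]
    intro s
    rw [Polynomial.count_roots]
    exact rootMultiplicity_polyP₀_le_one hk W s
  have heval : ∀ x, (polyP₀ W).eval x = ((branchList W).map fun s => x - s).prod * g.eval x := by
    intro x
    conv_lhs => rw [← hg]
    rw [Polynomial.eval_mul, Polynomial.eval_multiset_prod, Multiset.map_map]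
    congr 1
    have : ((branchList W : List ℝ) : Multiset ℝ) = (polyP₀ W).roots := by
      rw [branchList, Finset.sort_eq, Multiset.toFinset_val, hnodup.dedup]
    rw [← this, Multiset.map_coe, Multiset.prod_coe]
    exact congrArg List.prod (List.map_congr_left fun s _ => by simp)
  have hg0 : g ≠ 0 := fun h => polyP₀_ne_zero hk W (by rw [← hg, h, mul_zero])
  have hgne : ∀ x, g.eval x ≠ 0 := fun x hx => by
    have : x ∈ g.roots := (Polynomial.mem_roots hg0).mpr hx
    rw [hroots] at this; simp at this
  have hg1 : 0 < g.eval 1 := by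
    have h1 := polyP₀_pos hk W one_pos
    rw [heval] at h1
    refine pos_of_mul_pos_right h1 (List.prod_nonneg ?_)
    intro a ha
    obtain ⟨s, hs, rfl⟩ := List.mem_map.mp ha
    have : s ≤ 0 := by
      by_contra h
      exact (polyP₀_pos hk W (not_le.mp h)).ne' ((mem_branchList_iff hk W s).mp hs)
    linarith
  refine ⟨g, fun x => ?_, heval⟩
  by_contra hx
  obtain ⟨y, -, hy⟩ := (isPreconnected_univ (α := ℝ)).intermediate_value (mem_univ x) (mem_univ 1)
    g.continuous.continuousOn ⟨not_lt.mp hx, hg1.le⟩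
  exact hgne y hy

theorem prod_pos_of_neg_of_even {l : List ℝ} (h : ∀ a ∈ l, a < 0) (hl : Even l.length) :
    0 < l.prod := by
  have : l.prod = (l.map fun a => -a).prod := by
    rw [List.prod_map_neg, hl.neg_one_pow, one_mul]
  rw [this]
  refine List.prod_pos fun a ha => ?_
  obtain ⟨s, hs, rfl⟩ := List.mem_map.mp ha
  exact neg_pos.mpr (h s hs)

theorem gap_subset_neg (hk : 1 ≤ k) {W : Weighting k} {l : ℕ} (hl : IsLoopIndex W l) :
    branchPoint W (2 * l - 1) < 0 := by
  have h1 := hl.1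
  have h2 := hl.2
  exact (branchPoint_lt (i := 0) (by omega) (by omega)).trans_le
    (branchPoint_nonpos hk (by omega))

theorem gap_nonempty {W : Weighting k} {l : ℕ} (hl : IsLoopIndex W l) :
    branchPoint W (2 * l) < branchPoint W (2 * l - 1) := by
  have h1 := hl.1
  exact branchPoint_lt (by omega) hl.2

/-- In $I_\ell$ exactly the $2\ell$ factors belonging to $x_0,\dots,x_{2\ell-1}$ are negative. -/
theorem polyP₀_pos_of_mem_gap (hk : 1 ≤ k) {W : Weighting k} {l : ℕ} (hl : IsLoopIndex W l)
    {x : ℝ} (hx : x ∈ gap W l) : 0 < (polyP₀ W).eval x := by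
  have hl1 := hl.1
  have hl2 := hl.2
  obtain ⟨g, hg, hev⟩ := exists_polyP₀_eq hk W
  rw [hev]
  refine mul_pos ?_ (hg x)
  rw [← List.take_append_drop (2 * l) (branchList W), List.map_append, List.prod_append]
  refine mul_pos (prod_pos_of_neg_of_even ?_ ?_) (List.prod_pos ?_)
  · intro a ha
    obtain ⟨s, hs, rfl⟩ := List.mem_map.mp ha
    obtain ⟨i, hi, rfl⟩ := List.mem_iff_getElem.mp hs
    rw [List.length_take] at hi
    have hi' : i < 2 * l := by omega
    rw [List.getElem_take, ← branchPoint_eq]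
    have : branchPoint W (2 * l - 1) ≤ branchPoint W i := by
      rcases (show i = 2 * l - 1 ∨ i < 2 * l - 1 by omega) with rfl | h
      · exact le_rfl
      · exact (branchPoint_lt h (by omega)).le
    linarith [hx.2]
  · rw [List.length_map, List.length_take, min_eq_left hl2.le]; exact even_two_mul l
  · intro a ha
    obtain ⟨s, hs, rfl⟩ := List.mem_map.mp ha
    obtain ⟨i, hi, rfl⟩ := List.mem_iff_getElem.mp hs
    rw [List.length_drop] at hi
    rw [List.getElem_drop, ← branchPoint_eq]
    have : branchPoint W (2 * l + i) ≤ branchPoint W (2 * l) := by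
      rcases Nat.eq_zero_or_pos i with rfl | h
      · exact le_rfl
      · exact (branchPoint_lt (by omega) (by omega)).le
    linarith [hx.1]

/-- As $p=q^2p_0$ with $p_0>0$ here, a zero of $p$ in the gap would be isolated with $p>0$ on both
sides, which `polyP_touch` rules out. -/
theorem polyP_pos_of_mem_gap (hk : 1 ≤ k) {W : Weighting k} {l : ℕ} (hl : IsLoopIndex W l)
    {s : ℝ} (hs : s ∈ gap W l) : 0 < (polyP W).eval s := by
  have hfin : {x | (polyP W).eval x = 0}.Finite := by
    refine (polyP W).roots.toFinset.finite_toSet.subset fun x hx => ?_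
    simpa [polyP_ne_zero hk W] using hx
  have hnhds : (gap W l ∩ ({x | (polyP W).eval x = 0} \ {s})ᶜ) ∈ 𝓝 s :=
    inter_mem (isOpen_Ioo.mem_nhds hs)
      ((hfin.subset sdiff_subset).isClosed.isOpen_compl.mem_nhds (by simp))
  obtain ⟨δ, hδ, hball⟩ := Metric.mem_nhds_iff.mp hnhds
  have hsub : Icc (s - δ / 2) (s + δ / 2) ⊆
      gap W l ∩ ({x | (polyP W).eval x = 0} \ {s})ᶜ := by
    refine subset_trans (fun x hx => ?_) hball
    rw [Metric.mem_ball, Real.dist_eq, abs_lt]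
    exact ⟨by linarith [hx.1], by linarith [hx.2]⟩
  refine polyP_touch hk (a := s - δ / 2) (b := s + δ / 2) (by linarith) (by linarith) ?_ ?_
  · exact (hsub ⟨by linarith, le_rfl⟩).1.2.trans (gap_subset_neg hk hl)
  · intro t ht hts
    have h := hsub ht
    have h0 : 0 ≤ (polyP W).eval t := by
      rw [eval_polyP_eq]
      exact mul_nonneg (sq_nonneg _) (polyP₀_pos_of_mem_gap hk hl h.1).le
    exact lt_of_le_of_ne h0 fun h0 => h.2 ⟨h0.symm, hts⟩

theorem mem_hyperbolicSet_of_mem_gap (hk : 1 ≤ k) {W : Weighting k} {l : ℕ}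
    (hl : IsLoopIndex W l) {s : ℝ} (hs : s ∈ gap W l) : (s : ℂ) ∈ hyperbolicSet W :=
  (ofReal_mem_hyperbolicSet_iff hk W s).mpr (polyP_pos_of_mem_gap hk hl hs)

theorem eulerRho_re_lt_of_mem_gap (hk : 1 ≤ k) {W : Weighting k} {l : ℕ} (hl : IsLoopIndex W l)
    {x y : ℝ} (hx : x ∈ gap W l) (hy : y ∈ gap W l) (hxy : x < y) :
    (eulerRho W x).re < (eulerRho W y).re :=
  eulerRho_re_lt hk hxy (hy.2.trans (gap_subset_neg hk hl)) (polyP_pos_of_mem_gap hk hl hx)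
    (polyP_pos_of_mem_gap hk hl hy) fun _ ht =>
      (polyP_pos_of_mem_gap hk hl ⟨hx.1.trans_le ht.1, ht.2.trans_lt hy.2⟩).le

theorem eulerRho_im_ofReal (hk : 1 ≤ k) {W : Weighting k} {x : ℝ}
    (hx : (x : ℂ) ∈ hyperbolicSet W) : (eulerRho W x).im = 0 := by
  rw [eulerRho, Complex.sub_im, eulerLam_im_ofReal hk hx, show (k : ℂ) * ((x : ℂ) / ((x : ℂ) - 1)) =
    ((k * (x / (x - 1)) : ℝ) : ℂ) by push_cast; rfl, Complex.ofReal_im, sub_zero]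

/-- The square of `eulerRho_mul`, multiplied by $4T^2$ (where $T$ is the trace) to turn $T'$ into
$p'$. It shows that $u^2$, where $u$ is the real part of `eulerRho`, behaves like $(x-b)^{\mu-2}$ at
a zero $b$ of $p$ of order $\mu\ge3$. -/
theorem eulerRho_sq_mul (hk : 1 ≤ k) {W : Weighting k} {x : ℝ} (hx : 0 < (polyP W).eval x)
    (h1 : x ≠ 1) :
    (eulerRho W x).re ^ 2 * (4 * (scaledPhi W).trace.eval x ^ 2 * (x - 1) ^ 2 *
      (polyP W).eval x) = x ^ 2 * ((x - 1) * (polyP W).derivative.eval x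
        - 2 * k * (polyP W).eval x) ^ 2 := by
  have hh := (ofReal_mem_hyperbolicSet_iff hk W x).mpr hx
  have h1' : (x : ℂ) ≠ 1 := by exact_mod_cast h1
  have hx1 : x - 1 ≠ 0 := sub_ne_zero.mpr h1
  set T := (scaledPhi W).trace with hT
  have hu : eulerRho W x = (((eulerRho W x).re : ℝ) : ℂ) :=
    Complex.ext rfl (by rw [eulerRho_im_ofReal hk hh, Complex.ofReal_im])
  have hTd : deriv (symbolTrace W) x = ((T.derivative.eval x : ℝ) : ℂ) := by
    have : symbolTrace W = fun z => Polynomial.aeval z T := rfl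
    rw [this, Polynomial.deriv_aeval]
    exact Polynomial.aeval_algebraMap_apply_eq_algebraMap_eval x _
  have hp : ((lam₁ W x - lam₂ W x) ^ 2 : ℂ) = (((polyP W).eval x : ℝ) : ℂ) := by
    rw [← aeval_polyP_eq]
    exact Polynomial.aeval_algebraMap_apply_eq_algebraMap_eval x _
  have h2 := congrArg (fun w => w ^ 2) (eulerRho_mul hh h1')
  simp only [mul_pow] at h2
  rw [hp, hu, hTd, symbolTrace_ofReal] at h2
  have h3 : (polyP W).eval x * (eulerRho W x).re ^ 2 =
      x ^ 2 * (T.derivative.eval x - k * T.eval x / (x - 1)) ^ 2 := by exact_mod_cast h2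
  have h4 : (x - 1) * (polyP W).derivative.eval x - 2 * k * (polyP W).eval x =
      2 * T.eval x * ((x - 1) * T.derivative.eval x - k * T.eval x) := by
    obtain ⟨n, rfl⟩ : ∃ n, k = n + 1 := ⟨k - 1, by omega⟩
    rw [polyP, show 2 * (n + 1) = 2 * n + 1 + 1 by ring]
    simp [Polynomial.derivative_pow, ← hT]
    ring
  rw [h4]
  have h5 : T.derivative.eval x - k * T.eval x / (x - 1) =
      ((x - 1) * T.derivative.eval x - k * T.eval x) / (x - 1) := by field_simp
  rw [h5, div_pow] at h3
  have h6 : (polyP W).eval x * (eulerRho W x).re ^ 2 * (x - 1) ^ 2 =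
      x ^ 2 * ((x - 1) * T.derivative.eval x - k * T.eval x) ^ 2 := by
    rw [h3]; field_simp
  linear_combination 4 * T.eval x ^ 2 * h6

end AztecDiamond

namespace AztecDiamond

open Set Topology Filter MeasureTheory

variable {k : ℕ}

/-! ### The end points of the gaps -/

/-- With $p=(x-b)^{j+3}g$ the identity `eulerRho_sq_mul` can be divided by $(x-b)^{j+3}$, and a
factor $(x-b)^{j+1}$ remains on the right. The denominator does not vanish at $b$: a zero of the
trace would give $p(b)=-4(b-1)^{2k}\ne0$. -/
theorem tendsto_eulerRho_re (hk : 1 ≤ k) {W : Weighting k} {b : ℝ} (hb : b < 0)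
    (hmult : 3 ≤ (polyP W).rootMultiplicity b) {F : Filter ℝ} (hF : F ≤ 𝓝 b)
    (hpos : ∀ᶠ x in F, 0 < (polyP W).eval x) :
    Tendsto (fun x : ℝ => (eulerRho W x).re) F (𝓝 0) := by
  obtain ⟨g, hg, hndvd⟩ :=
    Polynomial.exists_eq_pow_rootMultiplicity_mul_and_not_dvd (polyP W) (polyP_ne_zero hk W) b
  obtain ⟨j, hj⟩ : ∃ j, (polyP W).rootMultiplicity b = j + 3 := ⟨(polyP W).rootMultiplicity b - 3, by omega⟩
  rw [hj] at hg
  have hgb : g.eval b ≠ 0 := fun h => hndvd (Polynomial.dvd_iff_isRoot.mpr h)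
  have hpx : ∀ x, (polyP W).eval x = (x - b) ^ (j + 3) * g.eval x := fun x => by
    conv_lhs => rw [hg]
    simp
  have hp'x : ∀ x, (polyP W).derivative.eval x =
      (x - b) ^ (j + 2) * ((j + 3) * g.eval x + (x - b) * g.derivative.eval x) := fun x => by
    conv_lhs => rw [hg]
    simp [Polynomial.derivative_pow]
    ring
  set T := (scaledPhi W).trace with hT
  have hTb : T.eval b ≠ 0 := by
    intro h
    have h1 := hpx b
    rw [eval_polyP, ← hT, h, sub_self, zero_pow two_ne_zero, zero_pow (Nat.succ_ne_zero (j + 2)),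
      zero_mul] at h1
    have : (b - 1) ^ (2 * k) ≠ 0 := pow_ne_zero _ (by linarith)
    apply this; linarith
  set h : ℝ → ℝ := fun x => (x - 1) * ((j + 3) * g.eval x + (x - b) * g.derivative.eval x)
    - 2 * k * ((x - b) * g.eval x) with hh
  set D : ℝ → ℝ := fun x => 4 * T.eval x ^ 2 * (x - 1) ^ 2 * g.eval x with hD
  have hDb : D b ≠ 0 := by
    simp only [hD]
    exact mul_ne_zero (mul_ne_zero (by positivity) (pow_ne_zero _ (by linarith))) hgb
  have hDc : ContinuousAt D b := by simp only [hD]; fun_prop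
  have hhc : ContinuousAt h b := by simp only [hh]; fun_prop
  have hlim : Tendsto (fun x : ℝ => x ^ 2 * (x - b) ^ (j + 1) * h x ^ 2 / D x) (𝓝 b) (𝓝 0) := by
    have h1 : ContinuousAt (fun x : ℝ => x ^ 2 * (x - b) ^ (j + 1) * h x ^ 2 / D x) b :=
      ContinuousAt.div (by fun_prop) hDc hDb
    have h2 := h1.tendsto
    simpa using h2
  have hsq : Tendsto (fun x : ℝ => (eulerRho W x).re ^ 2) F (𝓝 0) := by
    refine (hlim.mono_left hF).congr' ?_
    filter_upwards [hpos, hF (hDc.eventually_ne hDb), hF (eventually_lt_nhds hb)] with x hx hx2 hx3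
    have h1 := eulerRho_sq_mul hk hx (by linarith)
    have hxb : x - b ≠ 0 := fun h0 => by
      rw [hpx, h0, zero_pow (by omega), zero_mul] at hx; exact lt_irrefl _ hx
    rw [hpx, hp'x, ← hT] at h1
    have h2 : (x - b) ^ (j + 3) * ((eulerRho W x).re ^ 2 * D x) =
        (x - b) ^ (j + 3) * (x ^ 2 * (x - b) ^ (j + 1) * h x ^ 2) := by
      simp only [hD, hh]
      linear_combination h1
    rw [div_eq_iff hx2]
    exact (mul_left_cancel₀ (pow_ne_zero _ hxb) h2).symm
  have h0 : Tendsto (fun x : ℝ => |(eulerRho W x).re|) F (𝓝 0) := by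
    have := (Real.continuous_sqrt.tendsto 0).comp hsq
    simpa [Function.comp_def, Real.sqrt_sq_eq_abs] using this
  exact (tendsto_zero_iff_abs_tendsto_zero _).mpr h0

/-- At a zero of order at least three $u=x\rho_1'/\rho_1$ tends to $0$, so $u\le0$ on the interval
by monotonicity. The Lyapunov exponent, of derivative $u/x\ge0$, then could not fall from a positive
value to $0$ at $b$. -/
theorem rootMultiplicity_lt_three_right (hk : 1 ≤ k) {W : Weighting k} {a b : ℝ} (hab : a < b)
    (hb : b < 0) (h : ∀ t ∈ Ioo a b, 0 < (polyP W).eval t) (h0 : (polyP W).eval b = 0) :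
    (polyP W).rootMultiplicity b < 3 := by
  by_contra hmult
  have hlim := tendsto_eulerRho_re hk hb (not_lt.mp hmult) (F := 𝓝[<] b) inf_le_left
    (eventually_of_mem (Ioo_mem_nhdsLT hab) h)
  have hmem : ∀ t ∈ Ioo a b, (t : ℂ) ∈ hyperbolicSet W := fun t ht =>
    (ofReal_mem_hyperbolicSet_iff hk W t).mpr (h t ht)
  have hne1 : ∀ t : ℝ, t ≤ b → (t : ℂ) ≠ 1 := fun t ht h1 => by
    have : t = 1 := by exact_mod_cast h1
    linarith
  have hu : ∀ x ∈ Ioo a b, (eulerRho W x).re ≤ 0 := fun x hx => by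
    refine ge_of_tendsto hlim ?_
    filter_upwards [Ioo_mem_nhdsLT hx.2] with y hy
    exact (eulerRho_re_lt hk hy.1 (hy.2.trans hb) (h x hx) (h y ⟨hx.1.trans hy.1, hy.2⟩)
      fun t ht => (h t ⟨hx.1.trans_le ht.1, ht.2.trans_lt hy.2⟩).le).le
  obtain ⟨x, hx1, hx2⟩ := exists_between hab
  obtain ⟨c, hc, hc'⟩ := exists_hasDerivAt_eq_slope (fun x : ℝ => lyapunov W x)
    (fun t => (eulerRho W t).re / t) hx2
    (fun t ht => ((continuousAt_lyapunov (hne1 t ht.2)).comp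
      Complex.continuous_ofReal.continuousAt).continuousWithinAt)
    fun t ht => hasDerivAt_lyapunov (hmem t ⟨hx1.trans ht.1, ht.2⟩) (by linarith [ht.2])
      (by linarith [ht.2])
  have e0 : lyapunov W b = 0 := lyapunov_eq_zero (by
    rw [ofReal_mem_hyperbolicSet_iff hk, h0]; exact lt_irrefl _)
  have e1 : 0 < lyapunov W x := lyapunov_pos (hmem x ⟨hx1, hx2⟩) (hne1 x hx2.le)
  have e2 : 0 ≤ (eulerRho W c).re / c :=
    div_nonneg_of_nonpos (hu c ⟨hx1.trans hc.1, hc.2⟩) (by linarith [hc.2])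
  rw [hc', e0] at e2
  exact absurd e2 (not_le.mpr (div_neg_of_neg_of_pos (by linarith) (by linarith)))

/-- Mirror image of the preceding argument: now $u\ge0$, and the exponent could not rise from $0$ at
$a$. -/
theorem rootMultiplicity_lt_three_left (hk : 1 ≤ k) {W : Weighting k} {a b : ℝ} (hab : a < b)
    (hb : b < 0) (h : ∀ t ∈ Ioo a b, 0 < (polyP W).eval t) (h0 : (polyP W).eval a = 0) :
    (polyP W).rootMultiplicity a < 3 := by
  by_contra hmult
  have hlim := tendsto_eulerRho_re hk (hab.trans hb) (not_lt.mp hmult) (F := 𝓝[>] a) inf_le_left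
    (eventually_of_mem (Ioo_mem_nhdsGT hab) h)
  have hmem : ∀ t ∈ Ioo a b, (t : ℂ) ∈ hyperbolicSet W := fun t ht =>
    (ofReal_mem_hyperbolicSet_iff hk W t).mpr (h t ht)
  have hne1 : ∀ t : ℝ, t ≤ b → (t : ℂ) ≠ 1 := fun t ht h1 => by
    have : t = 1 := by exact_mod_cast h1
    linarith
  have hu : ∀ x ∈ Ioo a b, 0 ≤ (eulerRho W x).re := fun x hx => by
    refine le_of_tendsto hlim ?_
    filter_upwards [Ioo_mem_nhdsGT hx.1] with y hy
    exact (eulerRho_re_lt hk hy.2 (hx.2.trans hb) (h y ⟨hy.1, hy.2.trans hx.2⟩) (h x hx)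
      fun t ht => (h t ⟨hy.1.trans_le ht.1, ht.2.trans_lt hx.2⟩).le).le
  obtain ⟨x, hx1, hx2⟩ := exists_between hab
  obtain ⟨c, hc, hc'⟩ := exists_hasDerivAt_eq_slope (fun x : ℝ => lyapunov W x)
    (fun t => (eulerRho W t).re / t) hx1
    (fun t ht => ((continuousAt_lyapunov (hne1 t (ht.2.trans hx2.le))).comp
      Complex.continuous_ofReal.continuousAt).continuousWithinAt)
    fun t ht => hasDerivAt_lyapunov (hmem t ⟨ht.1, ht.2.trans hx2⟩) (by linarith [ht.2])
      (by linarith [ht.2])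
  have e0 : lyapunov W a = 0 := lyapunov_eq_zero (by
    rw [ofReal_mem_hyperbolicSet_iff hk, h0]; exact lt_irrefl _)
  have e1 : 0 < lyapunov W x := lyapunov_pos (hmem x ⟨hx1, hx2⟩) (hne1 x hx2.le)
  have e2 : (eulerRho W c).re / c ≤ 0 :=
    div_nonpos_of_nonneg_of_nonpos (hu c ⟨hc.1, hc.2.trans hx2⟩) (by linarith [hc.2])
  rw [hc', e0] at e2
  exact absurd e2 (not_le.mpr (div_pos (by linarith) (by linarith)))

/-- The end points of a gap. -/
def IsGapEnd (W : Weighting k) (l : ℕ) (b : ℝ) : Prop :=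
  b = branchPoint W (2 * l) ∨ b = branchPoint W (2 * l - 1)

theorem closure_gap {W : Weighting k} {l : ℕ} (hl : IsLoopIndex W l) {x : ℝ}
    (hx : x ∈ closure (gap W l)) : x ∈ gap W l ∨ IsGapEnd W l x := by
  rw [gap, closure_Ioo (gap_nonempty hl).ne] at hx
  rcases hx.1.eq_or_lt with h | h
  · exact Or.inr (Or.inl h.symm)
  rcases hx.2.eq_or_lt with h' | h'
  · exact Or.inr (Or.inr h')
  exact Or.inl ⟨h, h'⟩

theorem IsGapEnd.lt_zero (hk : 1 ≤ k) {W : Weighting k} {l : ℕ} (hl : IsLoopIndex W l) {b : ℝ}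
    (hb : IsGapEnd W l b) : b < 0 := by
  have h1 := gap_nonempty hl
  have h2 := gap_subset_neg hk hl
  rcases hb with rfl | rfl
  · exact h1.trans h2
  · exact h2

theorem IsGapEnd.eval_polyP₀ (hk : 1 ≤ k) {W : Weighting k} {l : ℕ} (hl : IsLoopIndex W l) {b : ℝ}
    (hb : IsGapEnd W l b) : (polyP₀ W).eval b = 0 := by
  have h2 := hl.2
  rcases hb with rfl | rfl
  · exact eval_polyP₀_branchPoint hk h2
  · exact eval_polyP₀_branchPoint hk (by omega)

/-- The order of $p$ at a zero of $p_0$ is odd, and here it is less than three, so it is one and $q$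
cannot vanish. This makes $\rho$ non-stationary in the coordinate $w$ at the branch point. -/
theorem IsGapEnd.eval_polyQ (hk : 1 ≤ k) {W : Weighting k} {l : ℕ} (hl : IsLoopIndex W l) {b : ℝ}
    (hb : IsGapEnd W l b) : (polyQ W).eval b ≠ 0 := by
  have h0 : (polyP W).eval b = 0 := by
    rw [eval_polyP_eq, hb.eval_polyP₀ hk hl, mul_zero]
  have h1 := gap_nonempty hl
  have h2 := gap_subset_neg hk hl
  have h3 : (polyP W).rootMultiplicity b < 3 := by
    rcases hb with rfl | rfl
    · exact rootMultiplicity_lt_three_left hk h1 h2 (fun t ht => polyP_pos_of_mem_gap hk hl ht) h0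
    · exact rootMultiplicity_lt_three_right hk h1 h2 (fun t ht => polyP_pos_of_mem_gap hk hl ht) h0
  have h4 := rootMultiplicity_polyP hk W b
  have h5 : 0 < (polyP₀ W).rootMultiplicity b :=
    (Polynomial.rootMultiplicity_pos (polyP₀_ne_zero hk W)).mpr (hb.eval_polyP₀ hk hl)
  intro hq
  have h6 : 0 < (polyQ W).rootMultiplicity b :=
    (Polynomial.rootMultiplicity_pos (polyQ_monic W).ne_zero).mpr hq
  rw [rootMultiplicity_polyQ] at h6
  omega

theorem IsGapEnd.eval_derivative_polyP₀ (hk : 1 ≤ k) {W : Weighting k} {l : ℕ}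
    (hl : IsLoopIndex W l) {b : ℝ} (hb : IsGapEnd W l b) : (polyP₀ W).derivative.eval b ≠ 0 := by
  intro h
  have h1 : 1 < (polyP₀ W).rootMultiplicity b :=
    (Polynomial.one_lt_rootMultiplicity_iff_isRoot (polyP₀_ne_zero hk W)).mpr
      ⟨hb.eval_polyP₀ hk hl, h⟩
  exact absurd (rootMultiplicity_polyP₀_le_one hk W b) (not_le.mpr h1)

end AztecDiamond

namespace AztecDiamond

open Set Topology Filter MeasureTheory

variable {k : ℕ}

/-! ### Critical points on the loops -/

theorem two_le_analyticOrderAt_iff {f : ℂ → ℂ} {z : ℂ} (hf : AnalyticAt ℂ f z) :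
    2 ≤ analyticOrderAt f z ↔ f z = 0 ∧ deriv f z = 0 := by
  rw [show (2 : ℕ∞) = ((2 : ℕ) : ℕ∞) from rfl,
    natCast_le_analyticOrderAt_iff_iteratedDeriv_eq_zero hf]
  constructor
  · intro h
    exact ⟨by simpa using h 0 (by norm_num), by simpa using h 1 (by norm_num)⟩
  · rintro ⟨h0, h1⟩ i hi
    interval_cases i
    · simpa using h0
    · simpa using h1

/-- A function that takes real values on the real axis has a real derivative there. -/
theorem deriv_eq_ofReal {f : ℂ → ℂ} {x : ℝ} (hf : DifferentiableAt ℂ f x)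
    (hreal : ∀ᶠ y : ℝ in 𝓝 x, (f y).im = 0) :
    HasDerivAt (fun y : ℝ => (f y).re) (deriv (fun y : ℝ => (f y).re) x) x ∧
      deriv f x = ((deriv (fun y : ℝ => (f y).re) x : ℝ) : ℂ) := by
  have h1 := hf.hasDerivAt.real_of_complex
  have h2 := hf.hasDerivAt.comp_ofReal
  refine ⟨by rw [h1.deriv]; exact h1, ?_⟩
  rw [h1.deriv]
  refine h2.unique (h1.ofReal_comp.congr_of_eventuallyEq ?_)
  filter_upwards [hreal] with y hy
  exact Complex.ext (by simp) (by simp [hy])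

theorem analyticAt_eulerRho {W : Weighting k} {z : ℂ} (hz : z ∈ hyperbolicSet W) (h1 : z ≠ 1) :
    AnalyticAt ℂ (eulerRho W) z := by
  have h := analyticAt_lam₁ hz
  have h2 : AnalyticAt ℂ (fun z : ℂ => z / (z - 1)) z :=
    analyticAt_id.div (analyticAt_id.sub analyticAt_const) (sub_ne_zero.mpr h1)
  exact (analyticAt_id.mul (h.deriv.div h (lam₁_ne_zero hz))).sub (analyticAt_const.mul h2)

/-- The value of `η` for which `z` is a critical point of `F(·; χ, η)` on the sheet of `ρ₁`. -/
noncomputable def thetaC (W : Weighting k) (χ : ℝ) (z : ℂ) : ℂ :=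
  2 * (z / (z - 1)) - 1 + 2 / k * χ * eulerRho W z

/-- The restriction of `thetaC` to the real axis. -/
noncomputable def theta (W : Weighting k) (χ x : ℝ) : ℝ :=
  2 * (x / (x - 1)) - 1 + 2 / k * χ * (eulerRho W x).re

theorem analyticAt_thetaC {W : Weighting k} {z : ℂ} (χ : ℝ) (hz : z ∈ hyperbolicSet W)
    (h1 : z ≠ 1) : AnalyticAt ℂ (thetaC W χ) z := by
  have h2 : AnalyticAt ℂ (fun z : ℂ => z / (z - 1)) z :=
    analyticAt_id.div (analyticAt_id.sub analyticAt_const) (sub_ne_zero.mpr h1)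
  exact ((analyticAt_const.mul h2).sub analyticAt_const).add
    (analyticAt_const.mul (analyticAt_eulerRho hz h1))

theorem thetaC_ofReal (hk : 1 ≤ k) {W : Weighting k} (χ : ℝ) {x : ℝ}
    (hx : (x : ℂ) ∈ hyperbolicSet W) : thetaC W χ x = (theta W χ x : ℂ) := by
  have hu : eulerRho W x = (((eulerRho W x).re : ℝ) : ℂ) :=
    Complex.ext rfl (by rw [eulerRho_im_ofReal hk hx, Complex.ofReal_im])
  rw [thetaC, theta, hu]
  push_cast
  rw [Complex.ofReal_re]

theorem hasDerivAt_theta (hk : 1 ≤ k) {W : Weighting k} (χ : ℝ) {x : ℝ}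
    (hx : (x : ℂ) ∈ hyperbolicSet W) (h1 : x ≠ 1) :
    HasDerivAt (theta W χ) (deriv (theta W χ) x) x ∧
      deriv (thetaC W χ) x = ((deriv (theta W χ) x : ℝ) : ℂ) := by
  have hev : ∀ᶠ y : ℝ in 𝓝 x, (y : ℂ) ∈ hyperbolicSet W :=
    Complex.continuous_ofReal.continuousAt.eventually_mem ((isOpen_hyperbolicSet W).mem_nhds hx)
  have h := deriv_eq_ofReal
    (analyticAt_thetaC χ hx (by exact_mod_cast h1 : (x : ℂ) ≠ 1)).differentiableAt
    (hev.mono fun y hy => by rw [thetaC_ofReal hk χ hy, Complex.ofReal_im])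
  have heq : (fun y : ℝ => (thetaC W χ y).re) =ᶠ[𝓝 x] theta W χ :=
    hev.mono fun y hy => by simp only [thetaC_ofReal hk χ hy, Complex.ofReal_re]
  rw [heq.deriv_eq] at h
  exact ⟨h.1.congr_of_eventuallyEq heq.symm, h.2⟩

theorem trace_Phi (W : Weighting k) {z : ℂ} (h0 : z ≠ 0) (h1 : z ≠ 1) :
    (Phi W z).trace = symbolTrace W z / (z - 1) ^ k := by
  have h := congrArg Matrix.trace (map_scaledPhi W h0 h1)
  rw [Matrix.trace_smul, smul_eq_mul] at h
  rw [eq_div_iff (pow_ne_zero _ (sub_ne_zero.mpr h1)), mul_comm, ← h, ← trace_symbol]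
  rfl

theorem rhoSurface_eq (W : Weighting k) {P : ℂ × ℂ} (h0 : P.1 ≠ 0) (h1 : P.1 ≠ 1) :
    rhoSurface W P = (symbolTrace W P.1 + Polynomial.aeval P.1 (polyQ W) * P.2) /
      (2 * (P.1 - 1) ^ k) := by
  have := pow_ne_zero k (sub_ne_zero.mpr h1)
  rw [rhoSurface, trace_Phi W h0 h1]
  field_simp

theorem aeval_polyQ_sq (W : Weighting k) {P : ℂ × ℂ} (hP : P ∈ surface W) :
    (Polynomial.aeval P.1 (polyQ W) * P.2) ^ 2 = (lam₁ W P.1 - lam₂ W P.1) ^ 2 := by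
  have hP' : P.2 ^ 2 = Polynomial.aeval P.1 (polyP₀ W) := hP
  rw [← aeval_polyP_eq, mul_pow, hP']
  conv_rhs => rw [polyP_eq]
  simp

theorem lam_sub_ne_zero {W : Weighting k} {z : ℂ} (hz : z ∈ hyperbolicSet W) :
    lam₁ W z - lam₂ W z ≠ 0 := fun h => by
  have := (mem_hyperbolicSet_iff W z).mp hz
  rw [sub_eq_zero.mp h] at this
  exact lt_irrefl _ this

theorem analyticAt_lam₂ {W : Weighting k} {z : ℂ} (hz : z ∈ hyperbolicSet W) :
    AnalyticAt ℂ (lam₂ W) z := by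
  have : lam₂ W = fun z => symbolTrace W z - lam₁ W z := by ext z; rw [← lam_add]; ring
  rw [this]
  exact ((differentiable_symbolTrace W).analyticAt z).sub (analyticAt_lam₁ hz)

theorem lam₂_div (W : Weighting k) {z : ℂ} (hz : z ∈ hyperbolicSet W) (h1 : z ≠ 1) :
    lam₂ W z / (z - 1) ^ k = (lam₁ W z / (z - 1) ^ k)⁻¹ := by
  have := pow_ne_zero k (sub_ne_zero.mpr h1)
  have := lam₁_ne_zero hz
  have h := lam_mul W z
  rw [mul_comm 2 k, pow_mul] at h
  rw [inv_div]
  field_simp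
  linear_combination h

/-- Near a point of the surface over the hyperbolic set, `ρ` is one of the eigenvalues. -/
theorem exists_sheet {W : Weighting k} {x : ℂ} (hx : x ∈ hyperbolicSet W) (h0 : x ≠ 0)
    (h1 : x ≠ 1) {ψ : ℂ → ℂ × ℂ} (hψ : ContinuousAt ψ 0) (hψ0 : (ψ 0).1 = x)
    (hs : ∀ᶠ t in 𝓝 (0 : ℂ), ψ t ∈ surface W) :
    ∃ ε : ℤ, (ε = 1 ∨ ε = -1) ∧ ∀ᶠ t in 𝓝 (0 : ℂ),
      rhoSurface W (ψ t) = (lam₁ W (ψ t).1 / ((ψ t).1 - 1) ^ k) ^ ε := by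
  have hZ : ContinuousAt (fun t => (ψ t).1) 0 := continuousAt_fst.comp hψ
  have hmem : ∀ᶠ t in 𝓝 (0 : ℂ), (ψ t).1 ∈ hyperbolicSet W ∧ (ψ t).1 ≠ 0 ∧ (ψ t).1 ≠ 1 := by
    refine (hZ.eventually_mem ?_).and ((hZ.eventually_ne ?_).and (hZ.eventually_ne ?_))
    · rw [hψ0]; exact (isOpen_hyperbolicSet W).mem_nhds hx
    · rw [hψ0]; exact h0
    · rw [hψ0]; exact h1
  -- This ratio is continuous with square $1$, hence locally constant; its sign decides the sheet.
  set r : ℂ → ℂ := fun t => Polynomial.aeval (ψ t).1 (polyQ W) * (ψ t).2 /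
    (lam₁ W (ψ t).1 - lam₂ W (ψ t).1) with hr
  have hrc : ContinuousAt r 0 := by
    have hx' : (ψ 0).1 ∈ hyperbolicSet W := by rw [hψ0]; exact hx
    refine ContinuousAt.div ?_ ?_ (lam_sub_ne_zero hx')
    · exact ((Polynomial.continuous_aeval (polyQ W)).continuousAt.comp hZ).mul
        (continuousAt_snd.comp hψ)
    · exact (ContinuousAt.comp (f := fun t => (ψ t).1) (g := lam₁ W)
        (analyticAt_lam₁ hx').continuousAt hZ).sub
        (ContinuousAt.comp (f := fun t => (ψ t).1) (g := lam₂ W)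
          (analyticAt_lam₂ hx').continuousAt hZ)
  have hr2 : ∀ᶠ t in 𝓝 (0 : ℂ), r t = 1 ∨ r t = -1 := by
    filter_upwards [hmem, hs] with t ht hts
    rw [← mul_self_eq_one_iff, ← pow_two, hr, div_pow, aeval_polyQ_sq W hts,
      div_self (pow_ne_zero 2 (lam_sub_ne_zero ht.1))]
  have hcon : ∀ᶠ t in 𝓝 (0 : ℂ), r t = r 0 := by
    have hd : ∀ᶠ t in 𝓝 (0 : ℂ), dist (r t) (r 0) < 2 :=
      hrc.eventually (Metric.ball_mem_nhds _ two_pos)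
    filter_upwards [hd, hr2] with t ht htr
    have h0r := hr2.self_of_nhds
    rw [dist_eq_norm] at ht
    rcases htr with e | e <;> rcases h0r with e' | e' <;> rw [e, e'] at ht ⊢ <;> norm_num at ht
  have hval : ∀ᶠ t in 𝓝 (0 : ℂ), rhoSurface W (ψ t) =
      (lam₁ W (ψ t).1 + lam₂ W (ψ t).1 + r 0 * (lam₁ W (ψ t).1 - lam₂ W (ψ t).1)) /
        (2 * ((ψ t).1 - 1) ^ k) := by
    filter_upwards [hmem, hcon] with t ht htr
    rw [rhoSurface_eq W ht.2.1 ht.2.2, ← htr, lam_add, hr]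
    simp only
    rw [div_mul_cancel₀ _ (lam_sub_ne_zero ht.1)]
  rcases hr2.self_of_nhds with e | e
  · refine ⟨1, Or.inl rfl, ?_⟩
    filter_upwards [hmem, hval] with t ht htv
    have := pow_ne_zero k (sub_ne_zero.mpr ht.2.2)
    rw [htv, e, zpow_one]
    field_simp; ring
  · refine ⟨-1, Or.inr rfl, ?_⟩
    filter_upwards [hmem, hval] with t ht htv
    have := pow_ne_zero k (sub_ne_zero.mpr ht.2.2)
    rw [htv, e, zpow_neg_one, ← lam₂_div W ht.1 ht.2.2]
    field_simp; ring

theorem logDeriv_rho_comp {W : Weighting k} {Z : ℂ → ℂ} {t : ℂ} (hZ : DifferentiableAt ℂ Z t)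
    (hx : Z t ∈ hyperbolicSet W) (h0 : Z t ≠ 0) (h1 : Z t ≠ 1) :
    DifferentiableAt ℂ (fun s => lam₁ W (Z s) / (Z s - 1) ^ k) t ∧
    logDeriv (fun s => lam₁ W (Z s) / (Z s - 1) ^ k) t =
      deriv Z t / Z t * eulerRho W (Z t) := by
  have hL : DifferentiableAt ℂ (lam₁ W) (Z t) := (analyticAt_lam₁ hx).differentiableAt
  have hLc : DifferentiableAt ℂ (fun s => lam₁ W (Z s)) t := hL.comp t hZ
  have hm : DifferentiableAt ℂ (fun s => Z s - 1) t := hZ.sub_const 1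
  have hz1 : Z t - 1 ≠ 0 := sub_ne_zero.mpr h1
  have hzk : (Z t - 1) ^ k ≠ 0 := pow_ne_zero _ hz1
  have hmk : DifferentiableAt ℂ (fun s => (Z s - 1) ^ k) t := hm.fun_pow k
  refine ⟨hLc.fun_div hmk hzk, ?_⟩
  rw [logDeriv_div (f := fun s => lam₁ W (Z s)) (g := fun s => (Z s - 1) ^ k) t
    (lam₁_ne_zero hx) hzk hLc hmk, logDeriv_fun_pow hm, logDeriv_apply, logDeriv_apply, deriv_sub_const,
    show deriv (fun s => lam₁ W (Z s)) t = deriv (lam₁ W) (Z t) * deriv Z t from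
      deriv_comp t hL hZ, eulerRho, eulerLam]
  have := lam₁_ne_zero hx
  field_simp

/-- The derivative of `F` along a curve on one of the sheets. -/
theorem dF_eventuallyEq (hk : 1 ≤ k) {W : Weighting k} {x : ℂ} (hx : x ∈ hyperbolicSet W)
    (h0 : x ≠ 0) (h1 : x ≠ 1) {ψ : ℂ → ℂ × ℂ} (hψ : AnalyticAt ℂ ψ 0) (hψ0 : (ψ 0).1 = x) {ε : ℤ}
    (hε : ∀ᶠ t in 𝓝 (0 : ℂ),
      rhoSurface W (ψ t) = (lam₁ W (ψ t).1 / ((ψ t).1 - 1) ^ k) ^ ε) (χ η : ℝ) :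
    dF W χ η ψ =ᶠ[𝓝 0] fun t => deriv (fun s => (ψ s).1) t / (ψ t).1 *
      (k / 4 * (η - thetaC W (ε * χ) (ψ t).1)) := by
  have hZ : AnalyticAt ℂ (fun t => (ψ t).1) 0 := analyticAt_fst.comp hψ
  have hZc := hZ.continuousAt
  have hmem : ∀ᶠ t in 𝓝 (0 : ℂ), (ψ t).1 ∈ hyperbolicSet W ∧ (ψ t).1 ≠ 0 ∧ (ψ t).1 ≠ 1 := by
    refine (hZc.eventually_mem ?_).and ((hZc.eventually_ne ?_).and (hZc.eventually_ne ?_))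
    · rw [hψ0]; exact (isOpen_hyperbolicSet W).mem_nhds hx
    · rw [hψ0]; exact h0
    · rw [hψ0]; exact h1
  filter_upwards [hmem, hε.eventually_nhds, hZ.eventually_analyticAt] with t ht hte htZ
  have hk0 : (k : ℂ) ≠ 0 := by exact_mod_cast (by omega : k ≠ 0)
  have hd := logDeriv_rho_comp htZ.differentiableAt ht.1 ht.2.1 ht.2.2
  -- Passing from $\rho_1$ to $\rho_1^{-1}$ only changes the sign of $\chi$, so both sheets are
  -- described by `thetaC` at `ε * χ`.
  rw [dF, (logDeriv_congr_nhds (f := fun s => rhoSurface W (ψ s)) hte).eq_of_nhds, logDeriv_fun_zpow hd.1, hd.2,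
    logDeriv_apply, logDeriv_apply, deriv_sub_const, thetaC]
  have h2 := ht.2.1
  have h3 : (ψ t).1 - 1 ≠ 0 := sub_ne_zero.mpr ht.2.2
  push_cast
  field_simp
  ring

end AztecDiamond

namespace AztecDiamond

open Set Topology Filter MeasureTheory

variable {k : ℕ}

/-! ### The rough-smooth boundary -/

/-- Away from branch points $z$ is a local coordinate, and $dF$ is a nonvanishing function times
$\eta-\theta$. Vanishing to order two therefore means that both $\eta-\theta$ and $\theta'$ vanish.
-/
theorem exists_theta_of_isCritical (hk : 1 ≤ k) {W : Weighting k} {x : ℝ}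
    (hx : (x : ℂ) ∈ hyperbolicSet W) (h0 : x ≠ 0) (h1 : x ≠ 1) {χ η : ℝ} {P : ℂ × ℂ}
    (hPx : P.1 = x) (hP : IsCriticalOfOrder W χ η 2 P) :
    ∃ ε : ℤ, (ε = 1 ∨ ε = -1) ∧ theta W (ε * χ) x = η ∧ deriv (theta W (ε * χ)) x = 0 := by
  obtain ⟨ψ, ⟨hψ, hψ0, hψd, hψs⟩, hord⟩ := hP
  have h0' : (x : ℂ) ≠ 0 := by exact_mod_cast h0
  have h1' : (x : ℂ) ≠ 1 := by exact_mod_cast h1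
  have hψx : (ψ 0).1 = x := by rw [hψ0, hPx]
  obtain ⟨ε, hε, hrho⟩ := exists_sheet hx h0' h1' hψ.continuousAt hψx hψs
  refine ⟨ε, hε, ?_⟩
  have hk0 : (k : ℂ) ≠ 0 := by exact_mod_cast (by omega : k ≠ 0)
  have hZ : AnalyticAt ℂ (fun t => (ψ t).1) 0 := analyticAt_fst.comp hψ
  have hw : AnalyticAt ℂ (fun t => (ψ t).2) 0 := analyticAt_snd.comp hψ
  -- If $z'=0$, differentiating $w^2=p_0(z)$ gives $2ww'=0$; since $w\ne0$ over the hyperbolic set,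
  -- also $w'=0$, which a parametrization excludes.
  have hZ' : deriv (fun t => (ψ t).1) 0 ≠ 0 := by
    intro hz
    have hz2 := hZ.differentiableAt.hasDerivAt
    have hw2 := hw.differentiableAt.hasDerivAt
    rw [hz] at hz2
    have e1 : (fun t => (ψ t).2 ^ 2) =ᶠ[𝓝 0] fun t => Polynomial.aeval (ψ t).1 (polyP₀ W) := hψs
    have e2 := (hw2.fun_pow 2).congr_of_eventuallyEq e1.symm
    have e3 := ((polyP₀ W).hasDerivAt_aeval (ψ 0).1).comp (0 : ℂ) hz2
    have e4 := e2.unique e3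
    have hw0 : (ψ 0).2 ≠ 0 := by
      intro h
      have := aeval_polyQ_sq W hψs.self_of_nhds
      rw [h, mul_zero, zero_pow two_ne_zero, hψx] at this
      exact pow_ne_zero 2 (lam_sub_ne_zero hx) this.symm
    have hw' : deriv (fun t => (ψ t).2) 0 = 0 := by
      simpa [hw0] using e4
    rw [hw'] at hw2
    exact hψd (hz2.prodMk hw2).deriv
  have hT := analyticAt_thetaC (ε * χ) hx h1'
  have hord' := hord
  rw [analyticOrderAt_congr (dF_eventuallyEq hk hx h0' h1' hψ hψx hrho χ η)] at hord'
  have hTψ : AnalyticAt ℂ (fun t => thetaC W (ε * χ) (ψ t).1) 0 :=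
    AnalyticAt.comp_of_eq (g := thetaC W (ε * χ)) (f := fun t => (ψ t).1) hT hZ hψx
  have hA : AnalyticAt ℂ (fun t => deriv (fun s => (ψ s).1) t / (ψ t).1) 0 :=
    hZ.deriv.div hZ (by rw [hψx]; exact h0')
  have hB : AnalyticAt ℂ (fun t => (k / 4 * (η - thetaC W (ε * χ) (ψ t).1) : ℂ)) 0 :=
    analyticAt_const.mul (analyticAt_const.sub hTψ)
  rw [two_le_analyticOrderAt_iff (hA.fun_mul hB)] at hord'
  obtain ⟨d0, d1⟩ := hord'
  have hA0 : deriv (fun s => (ψ s).1) 0 / (ψ 0).1 ≠ 0 := div_ne_zero hZ' (by rw [hψx]; exact h0')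
  have hk4 : (k : ℂ) / 4 ≠ 0 := div_ne_zero hk0 (by norm_num)
  have t0 : (η : ℂ) - thetaC W (ε * χ) (ψ 0).1 = 0 := by
    simpa [hA0, hk0] using d0
  have hd := hA.differentiableAt.hasDerivAt.fun_mul ((((hT.differentiableAt.hasDerivAt.comp_of_eq
    (0 : ℂ) hZ.differentiableAt.hasDerivAt hψx.symm).const_sub (η : ℂ))).const_mul ((k : ℂ) / 4))
  have d1' := hd.deriv.symm.trans d1
  simp only [Function.comp_apply] at d1'
  rw [t0, mul_zero, mul_zero, zero_add] at d1'
  have d2 : deriv (thetaC W (ε * χ)) x = 0 := by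
    by_contra hne
    exact mul_ne_zero hA0 (mul_ne_zero hk4 (neg_ne_zero.mpr (mul_ne_zero hne hZ'))) d1'
  rw [(hasDerivAt_theta hk (ε * χ) hx h1).2] at d2
  rw [hψx, thetaC_ofReal hk _ hx] at t0
  exact ⟨by exact_mod_cast (sub_eq_zero.mp t0).symm, by exact_mod_cast d2⟩

/-- Converse of the preceding lemma. The sheet is parametrized explicitly by $t\mapsto(x+t,\
\varepsilon(\lambda_1-\lambda_2)/q)$, which is possible because $q$ has no zero in the gap. -/
theorem mem_roughSmoothCurve_of_theta (hk : 1 ≤ k) {W : Weighting k} {l : ℕ}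
    (hl : IsLoopIndex W l) {x χ η : ℝ} (hx : x ∈ gap W l) (hc : (χ, η) ∈ square) {ε : ℤ}
    (hε : ε = 1 ∨ ε = -1) (t0 : theta W (ε * χ) x = η) (t1 : deriv (theta W (ε * χ)) x = 0) :
    (χ, η) ∈ roughSmoothCurve W l := by
  have hh := mem_hyperbolicSet_of_mem_gap hk hl hx
  have hx0 : x < 0 := hx.2.trans (gap_subset_neg hk hl)
  have h0' : (x : ℂ) ≠ 0 := by exact_mod_cast hx0.ne
  have h1' : (x : ℂ) ≠ 1 := by exact_mod_cast (by linarith : x ≠ 1)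
  have hq : Polynomial.aeval (x : ℂ) (polyQ W) ≠ 0 := by
    intro h
    have h2 : (polyQ W).eval x = 0 := by
      rw [show (x : ℂ) = algebraMap ℝ ℂ x from rfl,
        Polynomial.aeval_algebraMap_apply_eq_algebraMap_eval] at h
      exact (map_eq_zero _).mp h
    have h3 := polyP_pos_of_mem_gap hk hl hx
    rw [eval_polyP_eq, h2] at h3
    simp at h3
  set w : ℂ → ℂ := fun z => ε * ((lam₁ W z - lam₂ W z) / Polynomial.aeval z (polyQ W)) with hw
  set ψ : ℂ → ℂ × ℂ := fun t => (x + t, w (x + t)) with hψdef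
  have haff : AnalyticAt ℂ (fun t : ℂ => (x : ℂ) + t) 0 := analyticAt_const.add analyticAt_id
  have haff0 : (fun t : ℂ => (x : ℂ) + t) 0 = x := by simp
  have hwa : AnalyticAt ℂ w x :=
    analyticAt_const.mul (((analyticAt_lam₁ hh).sub (analyticAt_lam₂ hh)).div
      ((Polynomial.differentiable_aeval (polyQ W)).analyticAt _) hq)
  have hψ : AnalyticAt ℂ ψ 0 := haff.prod (hwa.comp_of_eq haff haff0)
  have hmem : ∀ᶠ t : ℂ in 𝓝 0, (x + t : ℂ) ∈ hyperbolicSet W ∧ (x + t : ℂ) ≠ 0 ∧ (x + t : ℂ) ≠ 1 ∧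
      Polynomial.aeval (x + t : ℂ) (polyQ W) ≠ 0 := by
    have hqc : ContinuousAt (fun t : ℂ => Polynomial.aeval (x + t : ℂ) (polyQ W)) 0 :=
      ContinuousAt.comp_of_eq (g := fun z => Polynomial.aeval z (polyQ W))
        (Polynomial.continuous_aeval (polyQ W)).continuousAt haff.continuousAt haff0
    refine (haff.continuousAt.eventually_mem ?_).and ((haff.continuousAt.eventually_ne ?_).and
      ((haff.continuousAt.eventually_ne ?_).and (hqc.eventually_ne ?_)))
    · rw [add_zero]; exact (isOpen_hyperbolicSet W).mem_nhds hh
    · rw [add_zero]; exact h0'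
    · rw [add_zero]; exact h1'
    · simpa using hq
  have hε2 : (ε : ℂ) ^ 2 = 1 := by rcases hε with rfl | rfl <;> norm_num
  have hsurf : ∀ᶠ t : ℂ in 𝓝 0, ψ t ∈ surface W := by
    filter_upwards [hmem] with t ht
    change (w (x + t)) ^ 2 = Polynomial.aeval ((x : ℂ) + t) (polyP₀ W)
    have h := aeval_polyP_eq W (x + t)
    conv_lhs at h => rw [polyP_eq]
    rw [map_mul, map_pow] at h
    simp only [hw]
    rw [mul_pow, div_pow, ← h, hε2, one_mul, mul_div_cancel_left₀ _ (pow_ne_zero 2 ht.2.2.2)]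
  have hψ0 : (ψ 0).1 = x := by simp [hψdef]
  have hfst : HasDerivAt (fun t : ℂ => (ψ t).1) 1 0 := (hasDerivAt_id (0 : ℂ)).const_add _
  refine ⟨hc, ψ 0, ⟨hsurf.self_of_nhds, x, subset_closure hx, hψ0⟩, ψ, ⟨hψ, rfl, ?_, hsurf⟩, ?_⟩
  · intro hd
    have h1 := hψ.differentiableAt.hasDerivAt
    rw [hd] at h1
    have h2 := (hasFDerivAt_fst (𝕜 := ℂ) (p := ψ 0)).comp_hasDerivAt (0 : ℂ) h1
    exact one_ne_zero (hfst.unique h2)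
  · have hrho : ∀ᶠ t in 𝓝 (0 : ℂ),
        rhoSurface W (ψ t) = (lam₁ W (ψ t).1 / ((ψ t).1 - 1) ^ k) ^ ε := by
      filter_upwards [hmem] with t ht
      have hz := pow_ne_zero k (sub_ne_zero.mpr ht.2.2.1)
      rw [rhoSurface_eq W ht.2.1 ht.2.2.1]
      simp only [hψdef, hw]
      rw [mul_left_comm, mul_div_cancel₀ _ ht.2.2.2, ← lam_add]
      rcases hε with rfl | rfl
      · rw [zpow_one]; push_cast; field_simp; ring
      · rw [zpow_neg_one, ← lam₂_div W ht.1 ht.2.2.1]; push_cast; field_simp; ring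
    have heq := dF_eventuallyEq hk hh h0' h1' hψ hψ0 hrho χ η
    have hT := analyticAt_thetaC (ε * χ) hh h1'
    have hTψ : AnalyticAt ℂ (fun t => thetaC W (ε * χ) (ψ t).1) 0 :=
      AnalyticAt.comp_of_eq (g := thetaC W (ε * χ)) (f := fun t => (ψ t).1) hT haff hψ0
    have hZ : AnalyticAt ℂ (fun t => (ψ t).1) 0 := haff
    have hA : AnalyticAt ℂ (fun t => deriv (fun s => (ψ s).1) t / (ψ t).1) 0 :=
      hZ.deriv.div hZ (by rw [hψ0]; exact h0')
    have hB : AnalyticAt ℂ (fun t => (k / 4 * (η - thetaC W (ε * χ) (ψ t).1) : ℂ)) 0 :=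
      analyticAt_const.mul (analyticAt_const.sub hTψ)
    rw [analyticOrderAt_congr heq, two_le_analyticOrderAt_iff (hA.fun_mul hB)]
    have e0 : (η : ℂ) - thetaC W (ε * χ) (ψ 0).1 = 0 := by
      rw [hψ0, thetaC_ofReal hk _ hh, t0, sub_self]
    have e1 : deriv (thetaC W (ε * χ)) x = 0 := by
      rw [(hasDerivAt_theta hk (ε * χ) hh (by linarith)).2, t1, Complex.ofReal_zero]
    refine ⟨by simp only [e0]; simp, ?_⟩
    have hd := hA.differentiableAt.hasDerivAt.fun_mul ((((hT.differentiableAt.hasDerivAt.comp_of_eq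
      (0 : ℂ) hZ.differentiableAt.hasDerivAt hψ0.symm).const_sub (η : ℂ))).const_mul ((k : ℂ) / 4))
    refine hd.deriv.trans ?_
    simp only [Function.comp_apply]
    rw [e0, e1]
    simp

/-- At a branch point $w$ is the local coordinate and $z$ is stationary. The constant term of $dF$
is then $-\frac\chi2\rho'/\rho$ with $\rho'\ne0$, so $\chi=0$; the linear term, proportional to
$z''\ne0$, determines $\eta$. -/
theorem eq_of_isCritical_gapEnd (hk : 1 ≤ k) {W : Weighting k} {l : ℕ} (hl : IsLoopIndex W l)
    {b : ℝ} (hb : IsGapEnd W l b) {χ η : ℝ} {P : ℂ × ℂ} (hPb : P.1 = b)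
    (hP : IsCriticalOfOrder W χ η 2 P) : χ = 0 ∧ 2 * (b / (b - 1)) - 1 = η := by
  obtain ⟨ψ, ⟨hψ, hψ0, hψd, hψs⟩, hord⟩ := hP
  have hb0 : b < 0 := hb.lt_zero hk hl
  have h0' : (b : ℂ) ≠ 0 := by exact_mod_cast hb0.ne
  have h1' : (b : ℂ) ≠ 1 := by exact_mod_cast (by linarith : b ≠ 1)
  have hb1 : (b : ℂ) - 1 ≠ 0 := sub_ne_zero.mpr h1'
  have hψb : (ψ 0).1 = b := by rw [hψ0, hPb]
  have hk0 : (k : ℂ) ≠ 0 := by exact_mod_cast (by omega : k ≠ 0)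
  have hZ : AnalyticAt ℂ (fun t => (ψ t).1) 0 := analyticAt_fst.comp hψ
  have hw : AnalyticAt ℂ (fun t => (ψ t).2) 0 := analyticAt_snd.comp hψ
  have hreal : ∀ p : Polynomial ℝ, Polynomial.aeval (b : ℂ) p = ((p.eval b : ℝ) : ℂ) := fun p =>
    Polynomial.aeval_algebraMap_apply_eq_algebraMap_eval b p
  set Z : ℂ → ℂ := fun t => (ψ t).1 with hZdef
  set w : ℂ → ℂ := fun t => (ψ t).2 with hwdef
  have hZ0 : Z 0 = b := hψb
  have e1 : (fun t => w t ^ 2) =ᶠ[𝓝 0] fun t => Polynomial.aeval (Z t) (polyP₀ W) := hψs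
  have hw0 : w 0 = 0 := by
    have := e1.self_of_nhds
    simp only at this
    rw [hZ0, hreal, hb.eval_polyP₀ hk hl] at this
    simpa using this
  have hp' : Polynomial.aeval (b : ℂ) (polyP₀ W).derivative ≠ 0 := by
    rw [hreal]; exact_mod_cast hb.eval_derivative_polyP₀ hk hl
  have hdiff : ∀ᶠ t in 𝓝 (0 : ℂ), 2 * w t * deriv w t =
      Polynomial.aeval (Z t) (polyP₀ W).derivative * deriv Z t := by
    filter_upwards [e1.eventually_nhds, hZ.eventually_analyticAt, hw.eventually_analyticAt]
      with t ht htZ htw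
    have f1 := (htw.differentiableAt.hasDerivAt.fun_pow 2).congr_of_eventuallyEq
      (EventuallyEq.symm ht)
    have f2 := ((polyP₀ W).hasDerivAt_aeval (Z t)).comp t htZ.differentiableAt.hasDerivAt
    have f3 := f1.unique f2
    simpa using f3
  have hZ' : deriv Z 0 = 0 := by
    have := hdiff.self_of_nhds
    rw [hw0, hZ0] at this
    simpa [hp'] using this.symm
  have hw' : deriv w 0 ≠ 0 := by
    intro h
    have h1 := hZ.differentiableAt.hasDerivAt.prodMk hw.differentiableAt.hasDerivAt
    rw [hZ', h] at h1
    exact hψd h1.deriv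
  -- Differentiating $2ww'=p_0'(z)z'$ once more at the branch point gives $2w'^2=p_0'(b)z''$.
  have hZ'' : deriv (deriv Z) 0 ≠ 0 := by
    intro h
    have g1 := ((hw.differentiableAt.hasDerivAt.const_mul (2 : ℂ)).fun_mul
      hw.deriv.differentiableAt.hasDerivAt).congr_of_eventuallyEq (EventuallyEq.symm hdiff)
    have g2 := (((polyP₀ W).derivative.hasDerivAt_aeval (Z 0)).comp (0 : ℂ)
      hZ.differentiableAt.hasDerivAt).mul hZ.deriv.differentiableAt.hasDerivAt
    have g3 := g1.unique g2
    rw [hw0, hZ', h] at g3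
    simp [hw'] at g3
  have hρ0 : rhoSurface W (ψ 0) ≠ 0 ∧
      deriv (fun s => rhoSurface W (ψ s)) 0 ≠ 0 ∧ AnalyticAt ℂ (fun s => rhoSurface W (ψ s)) 0 := by
    have hev : (fun s => rhoSurface W (ψ s)) =ᶠ[𝓝 0] fun s =>
        (symbolTrace W (Z s) + Polynomial.aeval (Z s) (polyQ W) * w s) / (2 * (Z s - 1) ^ k) := by
      filter_upwards [hZ.continuousAt.eventually_ne (by rw [hZ0]; exact h0'),
        hZ.continuousAt.eventually_ne (by rw [hZ0]; exact h1')] with s hs0 hs1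
      exact rhoSurface_eq W hs0 hs1
    have hm : (2 * (Z 0 - 1) ^ k : ℂ) ≠ 0 := by
      rw [hZ0]; exact mul_ne_zero two_ne_zero (pow_ne_zero _ hb1)
    have hTb : symbolTrace W b ≠ 0 := by
      intro h
      rw [symbolTrace_ofReal] at h
      have h2 : (scaledPhi W).trace.eval b = 0 := by exact_mod_cast h
      have h3 := eval_polyP W b
      rw [eval_polyP_eq, hb.eval_polyP₀ hk hl, h2] at h3
      have : (b - 1) ^ (2 * k) ≠ 0 := pow_ne_zero _ (by linarith)
      apply this; linarith
    have hq : Polynomial.aeval (b : ℂ) (polyQ W) ≠ 0 := by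
      rw [hreal]; exact_mod_cast hb.eval_polyQ hk hl
    have n1 : HasDerivAt (fun s => symbolTrace W (Z s)) 0 0 := by
      have := ((differentiable_symbolTrace W) (Z 0)).hasDerivAt.comp (0 : ℂ)
        hZ.differentiableAt.hasDerivAt
      rw [hZ', mul_zero] at this; exact this
    have n2 : HasDerivAt (fun s => Polynomial.aeval (Z s) (polyQ W)) 0 0 := by
      have := ((polyQ W).hasDerivAt_aeval (Z 0)).comp (0 : ℂ) hZ.differentiableAt.hasDerivAt
      rw [hZ', mul_zero] at this; exact this
    have n3 : HasDerivAt (fun s => 2 * (Z s - 1) ^ k) 0 0 := by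
      have := ((hZ.differentiableAt.hasDerivAt.sub_const 1).fun_pow k).const_mul (2 : ℂ)
      rw [hZ'] at this; simpa using this
    have n4 := (n1.fun_add (n2.fun_mul hw.differentiableAt.hasDerivAt)).fun_div n3 hm
    have hT : AnalyticAt ℂ (fun s => symbolTrace W (Z s)) 0 :=
      ((differentiable_symbolTrace W).analyticAt _).comp hZ
    have hQ : AnalyticAt ℂ (fun s => Polynomial.aeval (Z s) (polyQ W)) 0 :=
      ((Polynomial.differentiable_aeval (polyQ W)).analyticAt (Z 0)).comp hZ
    refine ⟨?_, ?_, ?_⟩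
    · rw [show rhoSurface W (ψ 0) = _ from hev.self_of_nhds]
      simp only [hw0, mul_zero, add_zero]
      refine div_ne_zero ?_ hm
      rw [hZ0]; exact hTb
    · rw [hev.deriv_eq, n4.deriv]
      refine div_ne_zero ?_ (pow_ne_zero 2 hm)
      rw [zero_mul, zero_add, zero_add, mul_zero, sub_zero, hZ0]
      exact mul_ne_zero (mul_ne_zero hq hw') (mul_ne_zero two_ne_zero (pow_ne_zero _ hb1))
    · exact ((hT.add (hQ.mul hw)).div (analyticAt_const.mul ((hZ.sub analyticAt_const).pow k))
        hm).congr hev.symm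
  have hZ1 : AnalyticAt ℂ (fun s => Z s - 1) 0 := hZ.sub analyticAt_const
  have hZ10 : Z 0 - 1 ≠ 0 := by rw [hZ0]; exact hb1
  have hdFa : AnalyticAt ℂ (dF W χ η ψ) 0 := by
    have a1 : AnalyticAt ℂ (logDeriv Z) 0 := hZ.deriv.div hZ (by rw [hZ0]; exact h0')
    have a2 : AnalyticAt ℂ (logDeriv fun s => Z s - 1) 0 := hZ1.deriv.div hZ1 hZ10
    have a3 : AnalyticAt ℂ (logDeriv fun s => rhoSurface W (ψ s)) 0 :=
      hρ0.2.2.deriv.div hρ0.2.2 hρ0.1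
    exact ((analyticAt_const.mul a1).sub (analyticAt_const.mul a2)).sub (analyticAt_const.mul a3)
  rw [two_le_analyticOrderAt_iff hdFa] at hord
  obtain ⟨d0, d1⟩ := hord
  have hχ : χ = 0 := by
    rw [dF, logDeriv_apply, logDeriv_apply, logDeriv_apply, deriv_sub_const,
      show deriv (fun s => (ψ s).1) 0 = 0 from hZ'] at d0
    have h3 : (χ : ℂ) = 0 := by simpa [hρ0.1, hρ0.2.1] using d0
    exact_mod_cast h3
  refine ⟨hχ, ?_⟩
  have hgev : dF W χ η ψ =ᶠ[𝓝 0] fun t => deriv Z t *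
      ((k : ℂ) / 4 * (η + 1) / Z t - (k : ℂ) / 2 / (Z t - 1)) := by
    refine Eventually.of_forall fun t => ?_
    rw [dF, hχ, logDeriv_apply, logDeriv_apply, deriv_sub_const]
    simp only [hZdef]
    push_cast; ring
  rw [hgev.deriv_eq] at d1
  have hgd : DifferentiableAt ℂ
      (fun t => (k : ℂ) / 4 * (η + 1) / Z t - (k : ℂ) / 2 / (Z t - 1)) 0 :=
    ((analyticAt_const.div hZ (by rw [hZ0]; exact h0')).sub
      (analyticAt_const.div hZ1 hZ10)).differentiableAt
  rw [(hZ.deriv.differentiableAt.hasDerivAt.fun_mul hgd.hasDerivAt).deriv, hZ', zero_mul, add_zero,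
    mul_eq_zero, or_iff_right hZ'', hZ0] at d1
  have h2 : (2 * (b / (b - 1)) - 1 : ℂ) = η := by
    have d2 : (k : ℂ) * ((1 + η) * (b - 1) - 2 * b) = 0 := by
      field_simp at d1
      linear_combination d1 * (1 / 2)
    have d3 := (mul_eq_zero.mp d2).resolve_left hk0
    field_simp
    linear_combination -d3
  exact_mod_cast h2

end AztecDiamond

namespace AztecDiamond

open Set Topology Filter MeasureTheory

variable {k : ℕ}

/-! ### The saddle point -/

theorem eventually_pos_mul_of_hasDerivAt {f : ℝ → ℝ} {f' x : ℝ} (hf : HasDerivAt f f' x)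
    (h0 : f x = 0) (h' : 0 < f') : ∀ᶠ y in 𝓝[≠] x, 0 < f y * (y - x) := by
  have h := (hasDerivAt_iff_tendsto_slope.mp hf).eventually (lt_mem_nhds h')
  filter_upwards [h, self_mem_nhdsWithin] with y hy hyx
  have hyx' : y - x ≠ 0 := sub_ne_zero.mpr hyx
  rw [slope_def_field, h0, sub_zero] at hy
  have := mul_pos hy (lt_of_le_of_ne (sq_nonneg (y - x)) (pow_ne_zero 2 hyx').symm)
  rwa [show f y / (y - x) * (y - x) ^ 2 = f y * (y - x) by field_simp] at this

theorem exists_left_neg {f : ℝ → ℝ} {f' x c : ℝ} (hf : HasDerivAt f f' x)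
    (h0 : f x = 0) (h' : 0 < f') (hc : c < x) : ∃ y ∈ Ioo c x, f y < 0 := by
  have h := (eventually_pos_mul_of_hasDerivAt hf h0 h').filter_mono
    (nhdsWithin_mono x fun y (hy : y ∈ Iio x) => ne_of_lt hy)
  obtain ⟨y, hy, hy'⟩ := (h.and (Ioo_mem_nhdsLT hc)).exists
  exact ⟨y, hy', by nlinarith [hy'.2]⟩

theorem exists_right_pos {f : ℝ → ℝ} {f' x c : ℝ} (hf : HasDerivAt f f' x)
    (h0 : f x = 0) (h' : 0 < f') (hc : x < c) : ∃ y ∈ Ioo x c, 0 < f y := by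
  have h := (eventually_pos_mul_of_hasDerivAt hf h0 h').filter_mono
    (nhdsWithin_mono x fun y (hy : y ∈ Ioi x) => ne_of_gt hy)
  obtain ⟨y, hy, hy'⟩ := (h.and (Ioo_mem_nhdsGT hc)).exists
  exact ⟨y, hy', by nlinarith [hy'.1]⟩

/-- At the first zero after `z` the slope is positive, so `f` is negative just before it. This
forces a still earlier zero. -/
theorem not_downcrossing {f f' : ℝ → ℝ} {z y : ℝ} (hd : ∀ x ∈ Icc z y, HasDerivAt f (f' x) x)
    (hpos : ∀ x ∈ Icc z y, f x = 0 → 0 < f' x) (hzy : z ≤ y) (hz : 0 < f z) (hy : f y < 0) :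
    False := by
  have hcont : ContinuousOn f (Icc z y) := fun x hx => (hd x hx).continuousAt.continuousWithinAt
  have hclosed : IsClosed (Icc z y ∩ f ⁻¹' {0}) :=
    hcont.preimage_isClosed_of_isClosed isClosed_Icc isClosed_singleton
  have hcomp : IsCompact (Icc z y ∩ f ⁻¹' {0}) :=
    isCompact_Icc.of_isClosed_subset hclosed inter_subset_left
  obtain ⟨t, ht, ht0⟩ := intermediate_value_Icc' hzy hcont ⟨hy.le, hz.le⟩
  obtain ⟨s, ⟨hs, hs0⟩, hleast⟩ := hcomp.exists_isLeast ⟨t, ht, ht0⟩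
  have hs0' : f s = 0 := hs0
  have hzs : z < s := lt_of_le_of_ne hs.1 fun h => by rw [h, hs0'] at hz; exact lt_irrefl _ hz
  obtain ⟨r, hr, hr0⟩ := exists_left_neg (hd s hs) hs0' (hpos s hs hs0') hzs
  obtain ⟨q, hq, hq0⟩ := intermediate_value_Icc' hr.1.le
    (hcont.mono (Icc_subset_Icc_right (hr.2.le.trans hs.2))) ⟨hr0.le, hz.le⟩
  have := hleast ⟨⟨hq.1, by linarith [hq.2, hr.2, hs.2]⟩, hq0⟩
  linarith [hq.2, hr.2]

/-- If all zeros are crossed upwards there is only one. A nonnegative value at `x`, left of $x_0$,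
together with the negative values just left of $x_0$, would force a downcrossing. -/
theorem neg_of_upcrossing {f f' : ℝ → ℝ} {a b x₀ x : ℝ} (hd : ∀ x ∈ Ioo a b, HasDerivAt f (f' x) x)
    (hpos : ∀ x ∈ Ioo a b, f x = 0 → 0 < f' x) (hx₀ : x₀ ∈ Ioo a b) (h0 : f x₀ = 0)
    (hx : x ∈ Ioo a b) (hlt : x < x₀) : f x < 0 := by
  by_contra hneg
  have hsub : ∀ {z y}, x ≤ z → y < x₀ → Icc z y ⊆ Ioo a b := fun hz hy t ht =>
    ⟨hx.1.trans_le (hz.trans ht.1), (ht.2.trans_lt hy).trans hx₀.2⟩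
  obtain ⟨y, hy, hy0⟩ := exists_left_neg (hd x₀ hx₀) h0 (hpos x₀ hx₀ h0) hlt
  rcases (not_lt.mp hneg).eq_or_lt with h | h
  · obtain ⟨z, hz, hz0⟩ := exists_right_pos (hd x hx) h.symm (hpos x hx h.symm) hy.1
    exact not_downcrossing (fun t ht => hd t (hsub hz.1.le hy.2 ht))
      (fun t ht => hpos t (hsub hz.1.le hy.2 ht)) hz.2.le hz0 hy0
  · exact not_downcrossing (fun t ht => hd t (hsub le_rfl hy.2 ht))
      (fun t ht => hpos t (hsub le_rfl hy.2 ht)) hy.1.le h hy0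

theorem pos_of_upcrossing {f f' : ℝ → ℝ} {a b x₀ x : ℝ} (hd : ∀ x ∈ Ioo a b, HasDerivAt f (f' x) x)
    (hpos : ∀ x ∈ Ioo a b, f x = 0 → 0 < f' x) (hx₀ : x₀ ∈ Ioo a b) (h0 : f x₀ = 0)
    (hx : x ∈ Ioo a b) (hlt : x₀ < x) : 0 < f x := by
  by_contra hneg
  have hsub : ∀ {z y}, x₀ < z → y ≤ x → Icc z y ⊆ Ioo a b := fun hz hy t ht =>
    ⟨hx₀.1.trans (hz.trans_le ht.1), (ht.2.trans hy).trans_lt hx.2⟩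
  obtain ⟨y, hy, hy0⟩ := exists_right_pos (hd x₀ hx₀) h0 (hpos x₀ hx₀ h0) hlt
  rcases (not_lt.mp hneg).eq_or_lt with h | h
  · obtain ⟨z, hz, hz0⟩ := exists_left_neg (hd x hx) h (hpos x hx h) hy.2
    exact not_downcrossing (fun t ht => hd t (hsub hy.1 hz.2.le ht))
      (fun t ht => hpos t (hsub hy.1 hz.2.le ht)) hz.1.le hy0 hz0
  · exact not_downcrossing (fun t ht => hd t (hsub hy.1 le_rfl ht))
      (fun t ht => hpos t (hsub hy.1 le_rfl ht)) hy.2.le hy0 h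

/-- A point that can be joined to infinity outside of a curve is not in the interior. -/
theorem notMem_curveInterior {Γ : Set (ℝ × ℝ)} {f : ℝ → ℝ × ℝ} (hf : Continuous f)
    (hΓ : ∀ t, 0 ≤ t → f t ∉ Γ) (hunb : ∀ t, 0 ≤ t → t ≤ dist (f t) (f 0)) :
    f 0 ∉ curveInterior Γ := by
  rintro ⟨h0, hb⟩
  have hsub : f '' Ici 0 ⊆ connectedComponentIn Γᶜ (f 0) := by
    refine IsPreconnected.subset_connectedComponentIn
      (isPreconnected_Ici.image _ hf.continuousOn) ⟨0, self_mem_Ici, rfl⟩ ?_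
    rintro _ ⟨t, ht, rfl⟩
    exact hΓ t ht
  obtain ⟨r, hr⟩ := (hb.subset hsub).subset_closedBall (f 0)
  have h := hr ⟨|r| + 1, by simp only [mem_Ici]; positivity, rfl⟩
  rw [Metric.mem_closedBall] at h
  have := hunb (|r| + 1) (by positivity)
  linarith [le_abs_self r]

theorem hasDerivAt_eulerRho_re (hk : 1 ≤ k) {W : Weighting k} {l : ℕ} (hl : IsLoopIndex W l) {x : ℝ}
    (hx : x ∈ gap W l) : ∃ u', 0 ≤ u' ∧ HasDerivAt (fun y : ℝ => (eulerRho W y).re) u' x := by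
  have hx0 : x < 0 := hx.2.trans (gap_subset_neg hk hl)
  have h1' : (x : ℂ) ≠ 1 := by exact_mod_cast (by linarith : x ≠ 1)
  have h := (analyticAt_eulerRho (mem_hyperbolicSet_of_mem_gap hk hl
    hx) h1').differentiableAt.hasDerivAt.real_of_complex
  refine ⟨_, ?_, h⟩
  have hmono : MonotoneOn (fun y : ℝ => (eulerRho W y).re) (gap W l) :=
    StrictMonoOn.monotoneOn fun x hx y hy hxy => eulerRho_re_lt_of_mem_gap hk hl hx hy hxy
  have h2 := hmono.derivWithin_nonneg (x := x)
  rwa [derivWithin_of_isOpen (s := gap W l) isOpen_Ioo hx, h.deriv] at h2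

/-- A single `u'`, the derivative of $x\rho_1'/\rho_1$, serves all `s`. As it is nonnegative, the
slope of `theta W s` increases with `s`. -/
theorem exists_deriv_theta (hk : 1 ≤ k) {W : Weighting k} {l : ℕ} (hl : IsLoopIndex W l) {x : ℝ}
    (hx : x ∈ gap W l) : ∃ u', 0 ≤ u' ∧
      ∀ s : ℝ, HasDerivAt (theta W s) (-2 / (x - 1) ^ 2 + 2 / k * s * u') x := by
  obtain ⟨u', hu', h⟩ := hasDerivAt_eulerRho_re hk hl hx
  have hx0 : x < 0 := hx.2.trans (gap_subset_neg hk hl)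
  have hx1 : x - 1 ≠ 0 := by linarith
  refine ⟨u', hu', fun s => ?_⟩
  have hv : HasDerivAt (fun x : ℝ => 2 * (x / (x - 1)) - 1) (-2 / (x - 1) ^ 2) x := by
    refine ((((hasDerivAt_id x).fun_div ((hasDerivAt_id x).sub_const 1) hx1).const_mul
      2).sub_const 1).congr_deriv ?_
    simp only [id]
    field_simp; ring
  exact hv.fun_add (h.const_mul (2 / (k : ℝ) * s))

/-- Only one sheet is tested by the hypothesis: on the other one the slope is that of `theta W
(-s)`, which is negative throughout, so critical points there are simple. Branch points matter only
for $s=0$. -/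
theorem notMem_roughSmoothCurve (hk : 1 ≤ k) {W : Weighting k} {l : ℕ} (hl : IsLoopIndex W l)
    {s σ η : ℝ} (hs : 0 ≤ s) (hσ : σ = 1 ∨ σ = -1)
    (h : ∀ x ∈ gap W l, theta W s x = η → deriv (theta W s) x ≠ 0)
    (hend : s = 0 → ∀ b, IsGapEnd W l b → 2 * (b / (b - 1)) - 1 ≠ η) :
    (σ * s, η) ∉ roughSmoothCurve W l := by
  rintro ⟨-, P, ⟨-, x, hx, hPx⟩, hcrit⟩
  rcases closure_gap hl hx with hx | hx
  · have hx0 : x < 0 := hx.2.trans (gap_subset_neg hk hl)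
    obtain ⟨ε, hε, t0, t1⟩ := exists_theta_of_isCritical hk (mem_hyperbolicSet_of_mem_gap hk hl hx)
      hx0.ne (by linarith) hPx hcrit
    simp only at t0 t1
    have hεσ : (ε : ℝ) * σ = 1 ∨ (ε : ℝ) * σ = -1 := by
      rcases hε with rfl | rfl <;> rcases hσ with rfl | rfl <;> norm_num
    rw [← mul_assoc] at t0 t1
    rcases hεσ with e | e <;> rw [e] at t0 t1
    · rw [one_mul] at t0 t1
      exact h x hx t0 t1
    · obtain ⟨u', hu', hd⟩ := exists_deriv_theta hk hl hx
      rw [(hd _).deriv] at t1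
      have h1 : -2 / (x - 1) ^ 2 < 0 :=
        div_neg_of_neg_of_pos (by norm_num) (by have : x - 1 ≠ 0 := by linarith
                                                positivity)
      have h2 : 0 ≤ 2 / (k : ℝ) * s * u' := by positivity
      linarith
  · obtain ⟨h1, h2⟩ := eq_of_isCritical_gapEnd hk hl hx hPx hcrit
    simp only at h1 h2
    have hs0 : s = 0 := by rcases hσ with rfl | rfl <;> linarith
    exact hend hs0 x hx h2

theorem tendsto_theta_zero_gapEnd (hk : 1 ≤ k) {W : Weighting k} {l : ℕ} (hl : IsLoopIndex W l)
    {b : ℝ} (hb : IsGapEnd W l b) :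
    (𝓝[gap W l] b).NeBot ∧ Tendsto (theta W 0) (𝓝[gap W l] b) (𝓝 (2 * (b / (b - 1)) - 1)) := by
  constructor
  · rw [← mem_closure_iff_nhdsWithin_neBot, gap, closure_Ioo (gap_nonempty hl).ne]
    rcases hb with rfl | rfl
    · exact left_mem_Icc.mpr (gap_nonempty hl).le
    · exact right_mem_Icc.mpr (gap_nonempty hl).le
  · have hb1 : b - 1 ≠ 0 := by linarith [hb.lt_zero hk hl]
    have h : ContinuousAt (fun x : ℝ => 2 * (x / (x - 1)) - 1) b :=
      ((continuousAt_const.mul (continuousAt_id.div (continuousAt_id.sub continuousAt_const)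
        hb1)).sub continuousAt_const)
    refine (h.tendsto.mono_left nhdsWithin_le_nhds).congr fun x => ?_
    simp [theta]

/-- Inside of the rough-smooth curve, `η - θ` has a zero at which `θ` decreases. -/
theorem exists_saddle (hk : 1 ≤ k) {W : Weighting k} {l : ℕ} (hl : IsLoopIndex W l) {χ η : ℝ}
    (hsq : (χ, η) ∈ square) (hint : (χ, η) ∈ curveInterior (roughSmoothCurve W l)) :
    ∃ x ∈ gap W l, theta W |χ| x = η ∧ deriv (theta W |χ|) x < 0 := by
  by_contra! hcon
  set s := |χ| with hs
  have hs0 : 0 ≤ s := abs_nonneg χ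
  obtain ⟨ε, hε, hεσ⟩ : ∃ ε : ℤ, (ε = 1 ∨ ε = -1) ∧ χ = ε * s := by
    rcases abs_choice χ with h | h
    · exact ⟨1, Or.inl rfl, by rw [hs, h]; simp⟩
    · exact ⟨-1, Or.inr rfl, by rw [hs, h]; simp⟩
  have hσ : (ε : ℝ) = 1 ∨ (ε : ℝ) = -1 := by rcases hε with rfl | rfl <;> norm_num
  have hεχ : (ε : ℝ) * χ = s := by rw [hεσ]; rcases hσ with h | h <;> rw [h] <;> ring
  -- By assumption the slope at a zero is not negative; if it were $0$, the point would lie on the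
  -- curve itself.
  have hpos : ∀ x ∈ gap W l, theta W s x = η → 0 < deriv (theta W s) x := fun x hx h0 => by
    refine lt_of_le_of_ne (hcon x hx h0) fun h1 => hint.1 ?_
    exact mem_roughSmoothCurve_of_theta hk hl hx hsq hε (by rw [hεχ]; exact h0)
      (by rw [hεχ]; exact h1.symm)
  have hder : ∀ x ∈ gap W l, HasDerivAt (theta W s) (deriv (theta W s) x) x := fun x hx => by
    obtain ⟨u', -, h⟩ := exists_deriv_theta hk hl hx
    rw [(h s).deriv]; exact h s
  by_cases hzero : ∃ x₀ ∈ gap W l, theta W s x₀ = η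
  · obtain ⟨x₀, hx₀, hx₀η⟩ := hzero
    set u : ℝ → ℝ := fun x => (eulerRho W x).re with hu
    have hth : ∀ t x, theta W (s + t) x = theta W s x + 2 * t / k * u x := fun t x => by
      simp only [theta, hu]; ring
    have hd : ∀ x ∈ Ioo (branchPoint W (2 * l)) (branchPoint W (2 * l - 1)),
        HasDerivAt (fun x => theta W s x - η) (deriv (theta W s) x) x := fun x hx =>
      (hder x hx).sub_const η
    have hp : ∀ x ∈ Ioo (branchPoint W (2 * l)) (branchPoint W (2 * l - 1)),
        theta W s x - η = 0 → 0 < deriv (theta W s) x := fun x hx h => hpos x hx (sub_eq_zero.mp h)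
    -- Along this ray $x_0$ remains a critical point, and its slope stays positive. Another one $x$
    -- would satisfy $\theta_s(x)-\eta=\frac{2t}k(u(x_0)-u(x))$, but the two sides have opposite
    -- signs on either side of $x_0$.
    set f : ℝ → ℝ × ℝ := fun t => (ε * (s + t), η + 2 * t / k * u x₀) with hf
    have hf0 : f 0 = (χ, η) := by simp [hf, hεσ]
    refine notMem_curveInterior (Γ := roughSmoothCurve W l) (f := f) (by fun_prop) ?_ ?_
      (hf0 ▸ hint)
    · intro t ht
      rcases ht.eq_or_lt with rfl | htpos
      · rw [hf0]; exact hint.1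
      refine notMem_roughSmoothCurve hk hl (by linarith) hσ ?_ fun h => by linarith
      intro x hx hxη
      rw [hth] at hxη
      have ht2 : 0 < 2 * t / k := div_pos (by linarith) (by exact_mod_cast hk)
      rcases lt_trichotomy x x₀ with hlt | rfl | hlt
      · have h1 := neg_of_upcrossing hd hp hx₀ (sub_eq_zero.mpr hx₀η) hx hlt
        have h2 := eulerRho_re_lt_of_mem_gap hk hl hx hx₀ hlt
        have h3 := mul_lt_mul_of_pos_left h2 ht2
        simp only [hu] at hxη
        linarith
      · obtain ⟨u', hu', h⟩ := exists_deriv_theta hk hl hx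
        have h1 := hpos x hx hx₀η
        rw [(h s).deriv] at h1
        rw [(h (s + t)).deriv]
        have : 0 ≤ 2 * t / k * u' := mul_nonneg ht2.le hu'
        have e : 2 / (k : ℝ) * (s + t) * u' = 2 / k * s * u' + 2 * t / k * u' := by ring
        rw [e]
        linarith
      · have h1 := pos_of_upcrossing hd hp hx₀ (sub_eq_zero.mpr hx₀η) hx hlt
        have h2 := eulerRho_re_lt_of_mem_gap hk hl hx₀ hx hlt
        have h3 := mul_lt_mul_of_pos_left h2 ht2
        simp only [hu] at hxη
        linarith
    · intro t ht
      -- In the maximum metric the first coordinate alone already moves by `t`.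
      refine le_trans ?_ (le_max_left _ _)
      rw [Real.dist_eq]
      simp only [hf]
      rcases hσ with h | h <;> rw [h] <;> ring_nf <;> simp [abs_of_nonneg ht]
  · push Not at hzero
    have hcont : ContinuousOn (theta W s) (gap W l) := fun x hx =>
      (hder x hx).continuousAt.continuousWithinAt
    have hsign : (∀ x ∈ gap W l, η < theta W s x) ∨ ∀ x ∈ gap W l, theta W s x < η := by
      by_contra! h
      obtain ⟨⟨x, hx, hx'⟩, y, hy, hy'⟩ := h
      obtain ⟨w, hw, hw'⟩ := isPreconnected_Ioo.intermediate_value hx hy hcont ⟨hx', hy'⟩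
      exact hzero w hw hw'
    have key : ∀ τ : ℝ, (τ = 1 ∨ τ = -1) →
        (∀ x ∈ gap W l, 0 < τ * (η - theta W s x)) → False := by
      intro τ hτ h
      -- Without critical points in the gap, $\eta-\theta_s$ has a constant sign there. Moving
      -- $\eta$ vertically in the direction of that sign creates none.
      set f : ℝ → ℝ × ℝ := fun t => (ε * s, η + τ * t) with hf
      have hf0 : f 0 = (χ, η) := by simp [hf, hεσ]
      refine notMem_curveInterior (Γ := roughSmoothCurve W l) (f := f) (by fun_prop) ?_ ?_
        (hf0 ▸ hint)
      · intro t ht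
        rcases ht.eq_or_lt with rfl | htpos
        · rw [hf0]; exact hint.1
        refine notMem_roughSmoothCurve hk hl hs0 hσ ?_ ?_
        · intro x hx hx'
          have h1 := h x hx
          rw [hx'] at h1
          rcases hτ with rfl | rfl <;> nlinarith
        · intro hs' b hb hb'
          obtain ⟨hne, hlim⟩ := tendsto_theta_zero_gapEnd hk hl hb
          have hlim2 : Tendsto (fun x => τ * (η - theta W 0 x)) (𝓝[gap W l] b)
              (𝓝 (τ * (η - (2 * (b / (b - 1)) - 1)))) := (hlim.const_sub η).const_mul τ
          have h1 : 0 ≤ τ * (η - (2 * (b / (b - 1)) - 1)) := by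
            refine ge_of_tendsto hlim2 ?_
            filter_upwards [self_mem_nhdsWithin] with x hx
            have := h x hx
            rw [hs'] at this; exact this.le
          rw [hb'] at h1
          rcases hτ with rfl | rfl <;> nlinarith
      · intro t ht
        refine le_trans ?_ (le_max_right _ _)
        rw [Real.dist_eq]
        simp only [hf]
        rcases hτ with h | h <;> rw [h] <;> ring_nf <;> simp [abs_of_nonneg ht]
    rcases hsign with h | h
    · exact key (-1) (Or.inr rfl) fun x hx => by linarith [h x hx]
    · exact key 1 (Or.inl rfl) fun x hx => by linarith [h x hx]

end AztecDiamond

namespace AztecDiamond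

open Set Topology Filter MeasureTheory

variable {k : ℕ}

/-! ### The height function -/

/-- The function `-Re F` on the sheet of `ρ₁`, for `s = |χ|`. -/
noncomputable def height (W : Weighting k) (s η : ℝ) (z : ℂ) : ℝ :=
  k / 2 * (1 - s) * Real.log ‖z - 1‖ + s / 2 * Real.log ‖lam₁ W z‖
    - k / 4 * (η + 1) * Real.log ‖z‖

theorem norm_lam₁_pos (hk : 1 ≤ k) (W : Weighting k) (z : ℂ) : 0 < ‖lam₁ W z‖ := by
  rcases eq_or_ne z 1 with rfl | h1
  · exact norm_pos_iff.mpr (lam₁_ne_zero (slitPlane_subset_hyperbolicSet hk W (by simp)))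
  · exact (pow_pos (norm_pos_iff.mpr (sub_ne_zero.mpr h1)) k).trans_le (norm_pow_le_norm_lam₁ W z)

theorem continuousAt_height (hk : 1 ≤ k) (W : Weighting k) (s η : ℝ) {z : ℂ} (h0 : z ≠ 0)
    (h1 : z ≠ 1) : ContinuousAt (height W s η) z := by
  have c1 : ContinuousAt (fun z : ℂ => Real.log ‖z - 1‖) z :=
    (continuousAt_id.sub continuousAt_const).norm.log (norm_ne_zero_iff.mpr (sub_ne_zero.mpr h1))
  have c2 : ContinuousAt (fun z : ℂ => Real.log ‖lam₁ W z‖) z :=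
    (continuous_norm_lam₁ W).continuousAt.log (norm_lam₁_pos hk W z).ne'
  have c3 : ContinuousAt (fun z : ℂ => Real.log ‖z‖) z :=
    continuousAt_id.norm.log (norm_ne_zero_iff.mpr h0)
  exact ((continuousAt_const.mul c1).add (continuousAt_const.mul c2)).sub (continuousAt_const.mul c3)

theorem symbolTrace_conj (W : Weighting k) (z : ℂ) :
    symbolTrace W (starRingEnd ℂ z) = starRingEnd ℂ (symbolTrace W z) := by
  rw [symbolTrace, Polynomial.aeval_conj]; rfl

theorem norm_lam₁_conj (W : Weighting k) (z : ℂ) : ‖lam₁ W (starRingEnd ℂ z)‖ = ‖lam₁ W z‖ := by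
  have h1 : (starRingEnd ℂ z - 1) ^ (2 * k) = starRingEnd ℂ ((z - 1) ^ (2 * k)) := by simp
  have h2 : (starRingEnd ℂ (symbolTrace W z)) ^ 2 - 4 * starRingEnd ℂ ((z - 1) ^ (2 * k)) =
      starRingEnd ℂ (symbolTrace W z ^ 2 - 4 * (z - 1) ^ (2 * k)) := by
    simp only [map_sub, map_pow, map_mul, map_ofNat]
  rw [norm_lam₁, norm_lam₁, symbolTrace_conj, h1, h2, RCLike.norm_conj, RCLike.norm_conj,
    RCLike.norm_conj]

theorem height_conj (W : Weighting k) (s η : ℝ) (z : ℂ) :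
    height W s η (starRingEnd ℂ z) = height W s η z := by
  have h1 : starRingEnd ℂ z - 1 = starRingEnd ℂ (z - 1) := by simp
  rw [height, height, norm_lam₁_conj, h1, RCLike.norm_conj, RCLike.norm_conj]

/-- Since $|\lambda_1|\ge|z-1|^k$, the height is at least its value for $s=0$. That explicit bound
makes it large near $0$ and near infinity. -/
theorem le_height {W : Weighting k} {s : ℝ} (hs : 0 ≤ s) (η : ℝ) {z : ℂ} (h1 : z ≠ 1) :
    k / 2 * Real.log ‖z - 1‖ - k / 4 * (η + 1) * Real.log ‖z‖ ≤ height W s η z := by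
  have hpos : 0 < ‖z - 1‖ := norm_pos_iff.mpr (sub_ne_zero.mpr h1)
  have h : k * Real.log ‖z - 1‖ ≤ Real.log ‖lam₁ W z‖ := by
    rw [← Real.log_pow]
    exact Real.log_le_log (by positivity) (norm_pow_le_norm_lam₁ W z)
  rw [height]
  nlinarith [mul_le_mul_of_nonneg_left h hs]

/-- The derivative of the height along circles around `0`, divided by the imaginary part. -/
noncomputable def heightSlope (W : Weighting k) (s : ℝ) (z : ℂ) : ℝ :=
  k / 2 * (1 - s) / ‖z - 1‖ ^ 2 - s / 2 * ((eulerLam W z).im / z.im)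

theorem circleMap_re (r θ : ℝ) : (circleMap 0 r θ).re = r * Real.cos θ := by
  rw [circleMap_zero, Complex.re_ofReal_mul, Complex.exp_ofReal_mul_I_re]

theorem circleMap_im (r θ : ℝ) : (circleMap 0 r θ).im = r * Real.sin θ := by
  rw [circleMap_zero, Complex.im_ofReal_mul, Complex.exp_ofReal_mul_I_im]

theorem circleMap_pi (r : ℝ) : circleMap 0 r Real.pi = ((-r : ℝ) : ℂ) := by
  apply Complex.ext
  · rw [circleMap_re]; simp
  · rw [circleMap_im]; simp

theorem hasDerivAt_height_circle (hk : 1 ≤ k) {W : Weighting k} (s η : ℝ) {r θ : ℝ} (hr : 0 < r)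
    (hθ : θ ∈ Ioo 0 Real.pi) :
    HasDerivAt (fun θ => height W s η (circleMap 0 r θ))
      (r * Real.sin θ * heightSlope W s (circleMap 0 r θ)) θ := by
  set z := circleMap 0 r θ with hz
  have him : z.im = r * Real.sin θ := circleMap_im r θ
  have hzim : 0 < z.im := him ▸ mul_pos hr (Real.sin_pos_of_pos_of_lt_pi hθ.1 hθ.2)
  have hh : z ∈ hyperbolicSet W := slitPlane_subset_hyperbolicSet hk W (Or.inr hzim.ne')
  have h0 : z ≠ 0 := fun h => by rw [h] at hzim; simp at hzim
  have h1 : z - 1 ≠ 0 := fun h => by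
    have := congrArg Complex.im h; simp at this; exact hzim.ne' this
  have hc : HasDerivAt (circleMap 0 r) (z * Complex.I) θ := hasDerivAt_circleMap 0 r θ
  have d1 := hasDerivAt_log_norm (hc.sub_const 1) h1
  have d2 := hasDerivAt_log_norm (g := fun θ => lam₁ W (circleMap 0 r θ))
    (HasDerivAt.comp (h₂ := lam₁ W) (h := circleMap 0 r) θ
      (analyticAt_lam₁ hh).differentiableAt.hasDerivAt hc) (lam₁_ne_zero hh)
  have d3 := hasDerivAt_log_norm hc h0
  have hd := ((d1.const_mul (k / 2 * (1 - s))).fun_add (d2.const_mul (s / 2))).fun_sub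
    (d3.const_mul (k / 4 * (η + 1)))
  refine hd.congr_deriv ?_
  have e1 : (z * Complex.I / (z - 1)).re = z.im / ‖z - 1‖ ^ 2 := by
    rw [Complex.div_re, ← Complex.normSq_eq_norm_sq]
    simp only [Complex.mul_I_re, Complex.mul_I_im, Complex.sub_re, Complex.sub_im, Complex.one_re,
      Complex.one_im]
    ring
  have e2 : (deriv (lam₁ W) z * (z * Complex.I) / lam₁ W z).re = -(eulerLam W z).im := by
    rw [show deriv (lam₁ W) z * (z * Complex.I) / lam₁ W z = eulerLam W z * Complex.I by
      rw [eulerLam]; ring, Complex.mul_I_re]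
  have e3 : (z * Complex.I / z).re = 0 := by rw [mul_div_cancel_left₀ _ h0, Complex.I_re]
  rw [e1, ← hz, e2, e3, heightSlope, ← him]
  field_simp
  ring

/-- As the angle increases, $|z-1|$ grows and
$\operatorname{Im}(z\lambda_1'/\lambda_1)/\operatorname{Im}z$ grows. Both contributions have the
right sign because $0\le s\le1$. -/
theorem heightSlope_antitone (hk : 1 ≤ k) {W : Weighting k} {s : ℝ} (hs : 0 ≤ s) (hs1 : s ≤ 1)
    {r θ θ' : ℝ} (hr : 0 < r) (hθ : θ ∈ Ioo 0 Real.pi) (hθ' : θ' ∈ Ioo 0 Real.pi) (h : θ ≤ θ') :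
    heightSlope W s (circleMap 0 r θ') ≤ heightSlope W s (circleMap 0 r θ) := by
  have him : ∀ θ ∈ Ioo 0 Real.pi, 0 < (circleMap 0 r θ).im := fun θ hθ => by
    rw [circleMap_im]; exact mul_pos hr (Real.sin_pos_of_pos_of_lt_pi hθ.1 hθ.2)
  have hre : (circleMap 0 r θ').re ≤ (circleMap 0 r θ).re := by
    rw [circleMap_re, circleMap_re]
    exact mul_le_mul_of_nonneg_left (Real.cos_le_cos_of_nonneg_of_le_pi hθ.1.le hθ'.2.le h) hr.le
  have hn : ∀ θ, ‖circleMap 0 r θ‖ = r := fun θ => by simp [abs_of_pos hr]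
  have h1 := eulerLam_im_div_le hk W (him θ' hθ') (him θ hθ) (by rw [hn, hn]) hre
  have hsq : ∀ θ, ‖circleMap 0 r θ - 1‖ ^ 2 = r ^ 2 + 1 - 2 * (circleMap 0 r θ).re := fun θ => by
    rw [← Complex.normSq_eq_norm_sq, Complex.normSq_apply]
    have h2 : (circleMap 0 r θ).re ^ 2 + (circleMap 0 r θ).im ^ 2 = r ^ 2 := by
      rw [circleMap_re, circleMap_im]; linear_combination r ^ 2 * Real.sin_sq_add_cos_sq θ
    simp only [Complex.sub_re, Complex.sub_im, Complex.one_re, Complex.one_im]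
    linear_combination h2
  have hpos : 0 < ‖circleMap 0 r θ - 1‖ ^ 2 := by
    have : circleMap 0 r θ - 1 ≠ 0 := fun h => by
      have h3 := congrArg Complex.im h
      simp only [Complex.sub_im, Complex.one_im, Complex.zero_im, sub_zero] at h3
      exact (him θ hθ).ne' h3
    positivity
  have h2 : k / 2 * (1 - s) / ‖circleMap 0 r θ' - 1‖ ^ 2 ≤
      k / 2 * (1 - s) / ‖circleMap 0 r θ - 1‖ ^ 2 := by
    refine div_le_div_of_nonneg_left (mul_nonneg (by positivity) (by linarith)) hpos ?_
    rw [hsq, hsq]; linarith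
  have h3 := mul_le_mul_of_nonneg_left h1 (by linarith : 0 ≤ s / 2)
  rw [heightSlope, heightSlope]
  linarith

theorem continuousAt_height_circle (hk : 1 ≤ k) {W : Weighting k} (s η : ℝ) {r θ : ℝ} (hr : 0 < r)
    (hθ : θ ∈ Ioc 0 Real.pi) : ContinuousAt (fun θ => height W s η (circleMap 0 r θ)) θ := by
  refine ContinuousAt.comp (f := circleMap 0 r) (continuousAt_height hk W s η ?_ ?_)
    (continuous_circleMap 0 r).continuousAt
  · exact circleMap_ne_center hr.ne'
  · intro h
    rcases hθ.2.eq_or_lt with rfl | hlt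
    · rw [circleMap_pi] at h
      have : -r = 1 := by exact_mod_cast h
      linarith
    · have h2 := congrArg Complex.im h
      rw [circleMap_im, Complex.one_im] at h2
      exact (mul_pos hr (Real.sin_pos_of_pos_of_lt_pi hθ.1 hlt)).ne' h2

/-- On upper half circles the superlevel sets of the height are arcs. -/
theorem min_le_height_circle (hk : 1 ≤ k) {W : Weighting k} {s : ℝ} (hs : 0 ≤ s) (hs1 : s ≤ 1)
    (η : ℝ) {r θ₁ θ θ₂ : ℝ} (hr : 0 < r) (h1 : 0 < θ₁) (h1θ : θ₁ ≤ θ) (hθ2 : θ ≤ θ₂)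
    (h2 : θ₂ ≤ Real.pi) :
    min (height W s η (circleMap 0 r θ₁)) (height W s η (circleMap 0 r θ₂)) ≤
      height W s η (circleMap 0 r θ) := by
  rcases hθ2.eq_or_lt with rfl | hlt
  · exact min_le_right _ _
  have hθ : θ ∈ Ioo 0 Real.pi := ⟨by linarith, by linarith⟩
  -- The slope changes sign at most once, from plus to minus: the height increases up to `θ` or
  -- decreases from `θ` on, which decides which end point is lower.
  by_cases hS : 0 ≤ heightSlope W s (circleMap 0 r θ)
  · refine (min_le_left _ _).trans ?_
    have hmono : MonotoneOn (fun θ => height W s η (circleMap 0 r θ)) (Icc θ₁ θ) := by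
      refine monotoneOn_of_deriv_nonneg (convex_Icc _ _) (fun t ht =>
        (continuousAt_height_circle hk s η hr ⟨by linarith [ht.1], by linarith [ht.2]⟩
          ).continuousWithinAt) ?_ ?_ <;> rw [interior_Icc] <;> intro t ht
      · exact (hasDerivAt_height_circle hk s η hr
          ⟨by linarith [ht.1], by linarith [ht.2]⟩).differentiableAt.differentiableWithinAt
      · have ht' : t ∈ Ioo 0 Real.pi := ⟨by linarith [ht.1], by linarith [ht.2]⟩
        rw [(hasDerivAt_height_circle hk s η hr ht').deriv]
        exact mul_nonneg (mul_nonneg hr.le (Real.sin_pos_of_pos_of_lt_pi ht'.1 ht'.2).le)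
          (hS.trans (heightSlope_antitone hk hs hs1 hr ht' hθ ht.2.le))
    exact hmono ⟨le_rfl, h1θ⟩ ⟨h1θ, le_rfl⟩ h1θ
  · refine (min_le_right _ _).trans ?_
    have hmono : AntitoneOn (fun θ => height W s η (circleMap 0 r θ)) (Icc θ θ₂) := by
      refine antitoneOn_of_deriv_nonpos (convex_Icc _ _) (fun t ht =>
        (continuousAt_height_circle hk s η hr ⟨by linarith [ht.1], by linarith [ht.2]⟩
          ).continuousWithinAt) ?_ ?_ <;> rw [interior_Icc] <;> intro t ht
      · exact (hasDerivAt_height_circle hk s η hr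
          ⟨by linarith [ht.1], by linarith [ht.2]⟩).differentiableAt.differentiableWithinAt
      · have ht' : t ∈ Ioo 0 Real.pi := ⟨by linarith [ht.1], by linarith [ht.2]⟩
        rw [(hasDerivAt_height_circle hk s η hr ht').deriv]
        exact mul_nonpos_of_nonneg_of_nonpos
          (mul_nonneg hr.le (Real.sin_pos_of_pos_of_lt_pi ht'.1 ht'.2).le)
          ((heightSlope_antitone hk hs hs1 hr hθ ht' ht.1.le).trans (not_le.mp hS).le)
    exact hmono ⟨le_rfl, hθ2⟩ ⟨hθ2, le_rfl⟩ hθ2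

/-- At the angle $\pi$ numerator and denominator of
$\operatorname{Im}(z\lambda_1'/\lambda_1)/\operatorname{Im}z$ both vanish, and the quotient of their
derivatives is the real derivative of $x\lambda_1'/\lambda_1$. Combined with the other term this is
a multiple of the slope of `theta`. -/
theorem tendsto_heightSlope (hk : 1 ≤ k) {W : Weighting k} {s : ℝ} {r : ℝ} (hr : 0 < r)
    (hx : ((-r : ℝ) : ℂ) ∈ hyperbolicSet W) :
    Tendsto (fun θ => heightSlope W s (circleMap 0 r θ)) (𝓝[<] Real.pi)
      (𝓝 (-(k / 4 * deriv (theta W s) (-r)))) := by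
  have hk0 : (k : ℝ) ≠ 0 := by exact_mod_cast (by omega : k ≠ 0)
  have hev : ∀ᶠ y : ℝ in 𝓝 (-r), (y : ℂ) ∈ hyperbolicSet W :=
    Complex.continuous_ofReal.continuousAt.eventually_mem ((isOpen_hyperbolicSet W).mem_nhds hx)
  have hUa : DifferentiableAt ℂ (eulerLam W) ((-r : ℝ) : ℂ) := by
    have h := analyticAt_lam₁ hx
    exact (analyticAt_id.mul (h.deriv.div h (lam₁_ne_zero hx))).differentiableAt
  obtain ⟨dU, dU'⟩ := deriv_eq_ofReal hUa (hev.mono fun y hy => eulerLam_im_ofReal hk hy)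
  set U' := deriv (fun y : ℝ => (eulerLam W y).re) (-r) with hU'
  have hr1 : -r - 1 ≠ 0 := by linarith
  have hth : deriv (theta W s) (-r) = -2 / (-r - 1) ^ 2 + 2 / k * s * (U' + k / (-r - 1) ^ 2) := by
    have hv : HasDerivAt (fun x : ℝ => x / (x - 1)) (-1 / (-r - 1) ^ 2) (-r) := by
      refine ((hasDerivAt_id (-r)).fun_div ((hasDerivAt_id (-r)).sub_const 1) hr1).congr_deriv ?_
      simp only [id]; ring
    have hd := ((hv.const_mul 2).sub_const 1).fun_add
      ((dU.fun_sub (hv.const_mul (k : ℝ))).const_mul (2 / k * s))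
    have heq : theta W s = fun x : ℝ => 2 * (x / (x - 1)) - 1 + 2 / k * s *
        ((eulerLam W x).re - k * (x / (x - 1))) := by
      ext x; rw [theta, eulerRho_re_ofReal]
    rw [heq, hd.deriv]; ring
  have hcm : HasDerivAt (circleMap 0 r) (((-r : ℝ) : ℂ) * Complex.I) Real.pi := by
    rw [← circleMap_pi]; exact hasDerivAt_circleMap 0 r Real.pi
  have g1 : HasDerivAt (fun θ => (eulerLam W (circleMap 0 r θ)).im) (-r * U') Real.pi := by
    have h := HasDerivAt.comp_of_eq (h₂ := eulerLam W) Real.pi hUa.hasDerivAt hcm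
      (circleMap_pi r).symm
    rw [dU'] at h
    have h2 := Complex.imCLM.hasFDerivAt.comp_hasDerivAt Real.pi h
    refine h2.congr_deriv ?_
    simp [mul_comm]
  have g2 : HasDerivAt (fun θ => (circleMap 0 r θ).im) (-r) Real.pi := by
    have h2 := Complex.imCLM.hasFDerivAt.comp_hasDerivAt Real.pi hcm
    refine h2.congr_deriv ?_
    simp
  have hle : 𝓝[<] Real.pi ≤ 𝓝[≠] Real.pi := nhdsWithin_mono _ fun y (hy : y < Real.pi) => hy.ne
  have hq := ((hasDerivAt_iff_tendsto_slope.mp g1).mono_left hle).div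
    ((hasDerivAt_iff_tendsto_slope.mp g2).mono_left hle) (by linarith : -r ≠ 0)
  have hq' : Tendsto (fun θ => (eulerLam W (circleMap 0 r θ)).im / (circleMap 0 r θ).im)
      (𝓝[<] Real.pi) (𝓝 U') := by
    rw [mul_div_cancel_left₀ _ (by linarith : -r ≠ 0)] at hq
    refine hq.congr' ?_
    filter_upwards [self_mem_nhdsWithin] with θ hθ
    have hne : θ - Real.pi ≠ 0 := sub_ne_zero.mpr (ne_of_lt hθ)
    simp only [Pi.div_apply, slope_def_field]
    rw [circleMap_pi, eulerLam_im_ofReal hk hx, Complex.ofReal_im, sub_zero, sub_zero,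
      div_div_div_cancel_right₀ hne]
  have hB : Tendsto (fun θ => k / 2 * (1 - s) / ‖circleMap 0 r θ - 1‖ ^ 2) (𝓝[<] Real.pi)
      (𝓝 (k / 2 * (1 - s) / (-r - 1) ^ 2)) := by
    have hn : ‖circleMap 0 r Real.pi - 1‖ ^ 2 = (-r - 1) ^ 2 := by
      rw [circleMap_pi, ← Complex.ofReal_one, ← Complex.ofReal_sub, Complex.norm_real,
        Real.norm_eq_abs, sq_abs]
    have hc : ContinuousAt (fun θ => k / 2 * (1 - s) / ‖circleMap 0 r θ - 1‖ ^ 2) Real.pi := by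
      refine ContinuousAt.div continuousAt_const ?_ (by rw [hn]; exact pow_ne_zero 2 hr1)
      exact (((continuous_circleMap 0 r).sub continuous_const).norm.pow 2).continuousAt
    have := hc.tendsto.mono_left (nhdsWithin_le_nhds (s := Iio Real.pi))
    rwa [hn] at this
  have := hB.sub (hq'.const_mul (s / 2))
  have hval : -(k / 4 * deriv (theta W s) (-r)) =
      k / 2 * (1 - s) / (-r - 1) ^ 2 - s / 2 * U' := by
    rw [hth]
    field_simp
    ring
  rw [hval]
  exact this

/-- If `θ` decreases at `-r`, then the height on the circle of radius `r` is at most that of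
`-r`. -/
theorem height_circle_le (hk : 1 ≤ k) {W : Weighting k} {s : ℝ} (hs : 0 ≤ s) (hs1 : s ≤ 1)
    (η : ℝ) {r : ℝ} (hr : 0 < r) (hx : ((-r : ℝ) : ℂ) ∈ hyperbolicSet W)
    (hd : deriv (theta W s) (-r) < 0) {z : ℂ} (hz : ‖z‖ = r) (h1 : z ≠ 1) :
    height W s η z ≤ height W s η ((-r : ℝ) : ℂ) := by
  have hkpos : (0 : ℝ) < k := by exact_mod_cast hk
  have hS : ∀ θ ∈ Ioo 0 Real.pi, 0 ≤ heightSlope W s (circleMap 0 r θ) := fun θ hθ => by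
    have h1 : -(k / 4 * deriv (theta W s) (-r)) ≤ heightSlope W s (circleMap 0 r θ) := by
      refine le_of_tendsto (tendsto_heightSlope hk hr hx) ?_
      filter_upwards [Ioo_mem_nhdsLT hθ.2] with θ' hθ'
      exact heightSlope_antitone hk hs hs1 hr hθ ⟨hθ.1.trans hθ'.1, hθ'.2⟩ hθ'.1.le
    have h2 : 0 < -(k / 4 * deriv (theta W s) (-r)) := by nlinarith
    linarith
  have hmono : MonotoneOn (fun θ => height W s η (circleMap 0 r θ)) (Ioc 0 Real.pi) := by
    refine monotoneOn_of_deriv_nonneg (convex_Ioc _ _) (fun t ht =>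
      (continuousAt_height_circle hk s η hr ht).continuousWithinAt) ?_ ?_ <;>
      rw [interior_Ioc] <;> intro t ht
    · exact (hasDerivAt_height_circle hk s η hr ht).differentiableAt.differentiableWithinAt
    · rw [(hasDerivAt_height_circle hk s η hr ht).deriv]
      exact mul_nonneg (mul_nonneg hr.le (Real.sin_pos_of_pos_of_lt_pi ht.1 ht.2).le) (hS t ht)
  have hupper : ∀ θ ∈ Ioc 0 Real.pi,
      height W s η (circleMap 0 r θ) ≤ height W s η ((-r : ℝ) : ℂ) := fun θ hθ => by
    rw [← circleMap_pi]
    exact hmono hθ ⟨Real.pi_pos, le_rfl⟩ hθ.2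
  have hz' : circleMap 0 r z.arg = z := by
    rw [circleMap_zero, ← hz]; exact Complex.norm_mul_exp_arg_mul_I z
  rcases lt_trichotomy z.arg 0 with h | h | h
  · have h2 : circleMap 0 r (-z.arg) = starRingEnd ℂ z := by
      conv_rhs => rw [← hz']
      simp [circleMap_zero, ← Complex.exp_conj]
    rw [← height_conj, ← h2]
    exact hupper _ ⟨by linarith, by linarith [Complex.neg_pi_lt_arg z]⟩
  · have hc : ContinuousAt (fun θ => height W s η (circleMap 0 r θ)) 0 := by
      refine ContinuousAt.comp (f := circleMap 0 r) (continuousAt_height hk W s η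
        (circleMap_ne_center hr.ne') ?_) (continuous_circleMap 0 r).continuousAt
      rw [← h, hz']; exact h1
    have h3 : height W s η (circleMap 0 r 0) ≤ height W s η ((-r : ℝ) : ℂ) := by
      refine le_of_tendsto (hc.tendsto.mono_left (nhdsWithin_le_nhds (s := Ioi 0))) ?_
      filter_upwards [Ioc_mem_nhdsGT Real.pi_pos] with θ hθ using hupper θ hθ
    rwa [← h, hz'] at h3
  · have := hupper z.arg ⟨h, Complex.arg_le_pi z⟩
    rwa [hz'] at this

/-- The derivative of the height along the negative axis. -/
theorem hasDerivAt_height_ofReal (hk : 1 ≤ k) {W : Weighting k} (s η : ℝ) {x : ℝ} (h0 : x < 0)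
    (hx : (x : ℂ) ∈ hyperbolicSet W) :
    HasDerivAt (fun x : ℝ => height W s η x) (k / 4 * (theta W s x - η) / x) x := by
  have h1 : x - 1 ≠ 0 := by linarith
  have d1 := hasDerivAt_log_norm_sub_one (x := x) (by linarith)
  have d2 := hasDerivAt_log_norm_lam₁ hx h0.ne
  have d3 : HasDerivAt (fun x : ℝ => Real.log ‖(x : ℂ)‖) x⁻¹ x := by
    simp only [Complex.norm_real, Real.norm_eq_abs, Real.log_abs]
    exact Real.hasDerivAt_log h0.ne
  refine (((d1.const_mul (k / 2 * (1 - s))).fun_add (d2.const_mul (s / 2))).fun_sub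
    (d3.const_mul (k / 4 * (η + 1)))).congr_deriv ?_
  have hk0 : (k : ℝ) ≠ 0 := by exact_mod_cast (by omega : k ≠ 0)
  have := h0.ne
  rw [theta, eulerRho_re_ofReal]
  field_simp
  ring

end AztecDiamond

namespace AztecDiamond

open Set Topology Filter MeasureTheory

variable {k : ℕ}

/-! ### The mountain pass -/

/-- A symmetric function of the eigenvalues is entire, by the recursion with trace and determinant,
although $\lambda_1$ itself is not. It substitutes for $\lambda_1^n$ in the maximum principle. -/
theorem differentiable_lam_pow_add (W : Weighting k) (n : ℕ) :
    Differentiable ℂ fun z => lam₁ W z ^ n + lam₂ W z ^ n := by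
  suffices h : Differentiable ℂ (fun z => lam₁ W z ^ n + lam₂ W z ^ n) ∧
      Differentiable ℂ fun z => lam₁ W z ^ (n + 1) + lam₂ W z ^ (n + 1) from h.1
  induction n with
  | zero =>
    refine ⟨by simp, ?_⟩
    simp only [zero_add, pow_one, lam_add]
    exact differentiable_symbolTrace W
  | succ n ih =>
    refine ⟨ih.2, ?_⟩
    have h : (fun z => lam₁ W z ^ (n + 1 + 1) + lam₂ W z ^ (n + 1 + 1)) = fun z =>
        symbolTrace W z * (lam₁ W z ^ (n + 1) + lam₂ W z ^ (n + 1)) -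
          (z - 1) ^ (2 * k) * (lam₁ W z ^ n + lam₂ W z ^ n) := by
      ext z
      rw [← lam_add, ← lam_mul]; ring
    rw [h]
    exact ((differentiable_symbolTrace W).mul ih.2).sub
      (((differentiable_id.sub_const 1).pow _).mul ih.1)

theorem norm_lam_pow_add_le (W : Weighting k) (n : ℕ) (z : ℂ) :
    ‖lam₁ W z ^ n + lam₂ W z ^ n‖ ≤ 2 * ‖lam₁ W z‖ ^ n := by
  refine (norm_add_le _ _).trans ?_
  rw [norm_pow, norm_pow, two_mul]
  gcongr
  exact norm_lam₂_le W z

theorem exists_le_norm_lam_pow_add {W : Weighting k} {z : ℂ} (hz : z ∈ hyperbolicSet W) :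
    ∃ c > 0, ∀ n : ℕ, c * ‖lam₁ W z‖ ^ n ≤ ‖lam₁ W z ^ n + lam₂ W z ^ n‖ := by
  have hlt := (mem_hyperbolicSet_iff W z).mp hz
  have hpos : 0 < ‖lam₁ W z‖ := norm_pos_iff.mpr (lam₁_ne_zero hz)
  set q := ‖lam₂ W z‖ / ‖lam₁ W z‖ with hq
  have hq0 : 0 ≤ q := by positivity
  have hq1 : q < 1 := (div_lt_one hpos).mpr hlt
  have hq2 : ‖lam₂ W z‖ = q * ‖lam₁ W z‖ := by rw [hq]; field_simp
  refine ⟨1 - q, by linarith, fun n => ?_⟩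
  rcases Nat.eq_zero_or_pos n with rfl | hn
  · norm_num; linarith
  · have h1 : ‖lam₁ W z ^ n‖ - ‖lam₂ W z ^ n‖ ≤ ‖lam₁ W z ^ n + lam₂ W z ^ n‖ := by
      have := norm_sub_le (lam₁ W z ^ n + lam₂ W z ^ n) (lam₂ W z ^ n)
      rw [add_sub_cancel_right] at this
      linarith
    refine le_trans ?_ h1
    rw [norm_pow, norm_pow, hq2, mul_pow, sub_mul, one_mul]
    have h2 : q ^ n ≤ q := pow_le_of_le_one hq0 hq1.le (by omega)
    have h3 : 0 ≤ ‖lam₁ W z‖ ^ n := by positivity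
    nlinarith

/-- Bounds the error of rounding an exponent to an integer. -/
theorem mul_log_le {a b t : ℝ} (ht : t ∈ Icc (0 : ℝ) 1) (hb : |a| ≤ b) : t * a ≤ b := by
  have h1 : t * a ≤ t * |a| := mul_le_mul_of_nonneg_left (le_abs_self a) ht.1
  nlinarith [abs_nonneg a, ht.2]

/-- The maximum principle for the height on annuli. -/
theorem height_le_of_annulus (hk : 1 ≤ k) {W : Weighting k} {s : ℝ} (hs : 0 ≤ s) (hs1 : s < 1)
    {η : ℝ} (hη : -1 ≤ η) {r₁ r₂ M : ℝ} (hr₁ : 0 < r₁)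
    (hM : ∀ z : ℂ, ‖z‖ = r₁ ∨ ‖z‖ = r₂ → z ≠ 1 → height W s η z ≤ M) {y : ℂ}
    (hy1 : r₁ < ‖y‖) (hy2 : ‖y‖ < r₂) (hy : y ∈ hyperbolicSet W) (hyne : y ≠ 1) :
    height W s η y ≤ M := by
  have hkpos : (0 : ℝ) < k := by exact_mod_cast hk
  set A := k / 4 * (η + 1) with hA
  set B := k / 2 * (1 - s) with hB
  have hA0 : 0 ≤ A := mul_nonneg (by positivity) (by linarith)
  have hB0 : 0 < B := mul_pos (by positivity) (by linarith)
  obtain ⟨c, hc, hcn⟩ := exists_le_norm_lam_pow_add hy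
  obtain ⟨z₀, -, hz₀⟩ := (isCompact_closedBall (0 : ℂ) r₂).exists_isMinOn
    ⟨y, by simpa using hy2.le⟩ (continuous_norm_lam₁ W).continuousOn
  set m := ‖lam₁ W z₀‖ with hm
  have hm0 : 0 < m := norm_lam₁_pos hk W z₀
  set K := Real.log 2 + Real.log (r₂ + 1) + |Real.log m| + (|Real.log r₁| + |Real.log r₂|) with hK
  set K' := |Real.log c| + |Real.log ‖y - 1‖| + |Real.log ‖lam₁ W y‖| + |Real.log ‖y‖| with hK'
  have hylog : 0 < ‖y‖ := by linarith
  have hy1log : 0 < ‖y - 1‖ := norm_pos_iff.mpr (sub_ne_zero.mpr hyne)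
  have key : ∀ N : ℕ, 1 ≤ N → N * height W s η y - K' ≤ N * M + K := by
    intro N hN
    have hN0 : (0 : ℝ) < N := by exact_mod_cast hN
    -- Integer exponents make `F` holomorphic on the annulus, with $\log|F|$ about `N * height`. The
    -- first exponent is rounded up, since $\log|z-1|$ is only bounded above; this also makes it
    -- positive, so that `F` vanishes at $1$. The exponent of $\lambda_1$ is rounded down, since
    -- $\log|\lambda_1|$ is bounded below.
    set b := ⌈N * B⌉₊ with hb
    set n := ⌊N * (s / 2)⌋₊ with hn
    set a := ⌊N * A⌋₊ with ha
    have fb : (b : ℝ) - N * B ∈ Icc (0 : ℝ) 1 :=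
      ⟨by linarith [Nat.le_ceil (N * B)], by linarith [Nat.ceil_lt_add_one (by positivity : 0 ≤ N * B)]⟩
    have fn : N * (s / 2) - n ∈ Icc (0 : ℝ) 1 :=
      ⟨by linarith [Nat.floor_le (by positivity : 0 ≤ N * (s / 2))],
        by linarith [Nat.lt_floor_add_one (N * (s / 2))]⟩
    have fa : N * A - a ∈ Icc (0 : ℝ) 1 :=
      ⟨by linarith [Nat.floor_le (by positivity : 0 ≤ N * A)],
        by linarith [Nat.lt_floor_add_one (N * A)]⟩
    have hbpos : b ≠ 0 := (Nat.ceil_pos.mpr (by positivity)).ne'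
    set F : ℂ → ℂ := fun z => (z - 1) ^ b * (lam₁ W z ^ n + lam₂ W z ^ n) * (z ^ a)⁻¹ with hF
    set U : Set ℂ := {z | r₁ < ‖z‖ ∧ ‖z‖ < r₂} with hU
    have hUo : IsOpen U := (isOpen_lt continuous_const continuous_norm).inter
      (isOpen_lt continuous_norm continuous_const)
    have hUc : closure U ⊆ {z | r₁ ≤ ‖z‖ ∧ ‖z‖ ≤ r₂} :=
      closure_minimal (fun z hz => ⟨hz.1.le, hz.2.le⟩)
        ((isClosed_le continuous_const continuous_norm).inter
          (isClosed_le continuous_norm continuous_const))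
    have hUb : Bornology.IsBounded U :=
      Metric.isBounded_closedBall.subset fun z hz => mem_closedBall_zero_iff.mpr hz.2.le
    have hFd : DiffContOnCl ℂ F U := by
      refine DifferentiableOn.diffContOnCl fun z hz => ?_
      have hz0 : z ≠ 0 := norm_pos_iff.mp (hr₁.trans_le (hUc hz).1)
      refine DifferentiableAt.differentiableWithinAt (DifferentiableAt.fun_mul
        (DifferentiableAt.fun_mul ?_ (differentiable_lam_pow_add W n z)) ?_)
      · fun_prop
      · exact (differentiableAt_id.pow a).inv (pow_ne_zero a hz0)
    have hFb : ∀ z ∈ frontier U, ‖F z‖ ≤ Real.exp (N * M + K) := by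
      intro z hz
      rw [hUo.frontier_eq] at hz
      have hz2 := hUc hz.1
      have hzr : ‖z‖ = r₁ ∨ ‖z‖ = r₂ := by
        by_contra h
        push Not at h
        exact hz.2 ⟨lt_of_le_of_ne hz2.1 h.1.symm, lt_of_le_of_ne hz2.2 h.2⟩
      rcases eq_or_ne z 1 with rfl | hz1
      · simp only [hF, sub_self]
        rw [zero_pow hbpos]; simp; positivity
      have l0 : 0 < ‖z‖ := hr₁.trans_le hz2.1
      have l1 : 0 < ‖z - 1‖ := norm_pos_iff.mpr (sub_ne_zero.mpr hz1)
      have l2 : 0 < ‖lam₁ W z‖ := norm_lam₁_pos hk W z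
      have h1 : ‖F z‖ ≤ ‖z - 1‖ ^ b * (2 * ‖lam₁ W z‖ ^ n) * (‖z‖ ^ a)⁻¹ := by
        simp only [hF, norm_mul, norm_inv, norm_pow]
        gcongr
        exact norm_lam_pow_add_le W n z
      refine h1.trans ((Real.log_le_iff_le_exp (by positivity)).mp ?_)
      rw [Real.log_mul (by positivity) (by positivity), Real.log_mul (by positivity) (by positivity),
        Real.log_mul (by positivity) (by positivity), Real.log_inv, Real.log_pow, Real.log_pow,
        Real.log_pow]
      have e := hM z hzr hz1
      have e' := mul_le_mul_of_nonneg_left e hN0.le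
      rw [height, ← hA, ← hB] at e'
      have e1 : (b - N * B) * Real.log ‖z - 1‖ ≤ Real.log (r₂ + 1) := by
        have g1 : Real.log ‖z - 1‖ ≤ Real.log (r₂ + 1) :=
          Real.log_le_log l1 ((norm_sub_le z 1).trans (by simpa using hz2.2))
        have g2 : 0 ≤ Real.log (r₂ + 1) := Real.log_nonneg (by linarith)
        nlinarith [mul_le_mul_of_nonneg_left g1 fb.1, fb.2]
      have e2 : (N * (s / 2) - n) * -Real.log ‖lam₁ W z‖ ≤ |Real.log m| := by
        have g1 : Real.log m ≤ Real.log ‖lam₁ W z‖ :=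
          Real.log_le_log hm0 (hz₀ (mem_closedBall_zero_iff.mpr hz2.2))
        nlinarith [mul_le_mul_of_nonneg_left (neg_le_neg g1) fn.1,
          mul_log_le fn (a := -Real.log m) (b := |Real.log m|) (by rw [abs_neg])]
      have e3 : (N * A - a) * Real.log ‖z‖ ≤ |Real.log r₁| + |Real.log r₂| := by
        refine mul_log_le fa ?_
        rcases hzr with h | h <;> rw [h] <;> linarith [abs_nonneg (Real.log r₁),
          abs_nonneg (Real.log r₂)]
      rw [hK]
      linarith
    have h2 := Complex.norm_le_of_forall_mem_frontier_norm_le hUb hFd hFb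
      (subset_closure (show y ∈ U from ⟨hy1, hy2⟩))
    have h3 : ‖y - 1‖ ^ b * (c * ‖lam₁ W y‖ ^ n) * (‖y‖ ^ a)⁻¹ ≤ ‖F y‖ := by
      simp only [hF, norm_mul, norm_inv, norm_pow]
      gcongr
      exact hcn n
    have l2 : 0 < ‖lam₁ W y‖ := norm_lam₁_pos hk W y
    have h4 := (Real.log_le_iff_le_exp (by positivity)).mpr (h3.trans h2)
    rw [Real.log_mul (by positivity) (by positivity), Real.log_mul (by positivity) (by positivity),
      Real.log_mul (by positivity) (by positivity), Real.log_inv, Real.log_pow, Real.log_pow,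
      Real.log_pow] at h4
    have e1 : (b - N * B) * -Real.log ‖y - 1‖ ≤ |Real.log ‖y - 1‖| :=
      mul_log_le fb (by rw [abs_neg])
    have e2 : (N * (s / 2) - n) * Real.log ‖lam₁ W y‖ ≤ |Real.log ‖lam₁ W y‖| :=
      mul_log_le fn le_rfl
    have e3 : (N * A - a) * -Real.log ‖y‖ ≤ |Real.log ‖y‖| := mul_log_le fa (by rw [abs_neg])
    rw [height, ← hA, ← hB, hK']
    linarith [neg_abs_le (Real.log c)]
  by_contra hlt
  push Not at hlt
  -- The errors `K` and `K'` do not depend on `N`, so a large `N` contradicts a strict excess over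
  -- `M`.
  obtain ⟨N, hN⟩ := exists_nat_gt ((K + K') / (height W s η y - M))
  rw [div_lt_iff₀ (by linarith)] at hN
  have h5 := key (N + 1) (by omega)
  push_cast at h5
  linarith

/-- Along the negative axis the derivative of the height is $\frac k4(\theta-\eta)/x$. As
$\theta-\eta$ decreases through $0$ and $x<0$, it changes sign from minus to plus. -/
theorem height_min_of_saddle (hk : 1 ≤ k) {W : Weighting k} {s η x : ℝ} (hx0 : x < 0)
    (hx : (x : ℂ) ∈ hyperbolicSet W) (hη : theta W s x = η) (hd : deriv (theta W s) x < 0) :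
    ∀ᶠ y : ℝ in 𝓝[≠] x, height W s η x < height W s η y := by
  have hkpos : (0 : ℝ) < k := by exact_mod_cast hk
  have h1 := (hasDerivAt_theta hk s hx (by linarith)).1.const_sub η
  have h2 := eventually_pos_mul_of_hasDerivAt h1 (by rw [hη, sub_self]) (by linarith)
  have h3 : ∀ᶠ y : ℝ in 𝓝 x, (y : ℂ) ∈ hyperbolicSet W ∧ y < 0 :=
    (Complex.continuous_ofReal.continuousAt.eventually_mem
      ((isOpen_hyperbolicSet W).mem_nhds hx)).and (eventually_lt_nhds hx0)
  have h4 : ∀ᶠ y : ℝ in 𝓝 x, y ≠ x → 0 < (η - theta W s y) * (y - x) :=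
    eventually_nhdsWithin_iff.mp h2
  obtain ⟨δ, hδ, hball⟩ := Metric.eventually_nhds_iff_ball.mp (h3.and h4)
  refine eventually_nhdsWithin_iff.mpr (Metric.eventually_nhds_iff_ball.mpr ⟨δ, hδ, ?_⟩)
  intro y hy hyx
  have hsub : uIcc x y ⊆ Metric.ball x δ :=
    (convex_ball x δ).ordConnected.uIcc_subset (Metric.mem_ball_self hδ) hy
  have hder : ∀ t ∈ uIcc x y, HasDerivAt (fun x : ℝ => height W s η x)
      (k / 4 * (theta W s t - η) / t) t := fun t ht =>
    hasDerivAt_height_ofReal hk s η (hball t (hsub ht)).1.2 (hball t (hsub ht)).1.1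
  have hsign : ∀ t ∈ uIcc x y, t ≠ x → 0 < k / 4 * (theta W s t - η) / t * (t - x) := by
    intro t ht htx
    obtain ⟨⟨-, ht0⟩, h⟩ := hball t (hsub ht)
    have h' := h htx
    rw [show k / 4 * (theta W s t - η) / t * (t - x) =
      k / 4 * ((η - theta W s t) * (t - x)) / (-t) by have := ht0.ne; field_simp; ring]
    exact div_pos (mul_pos (by positivity) h') (by linarith)
  rcases lt_or_gt_of_ne (show y ≠ x from hyx) with hlt | hlt
  · rw [uIcc_of_ge hlt.le] at hder hsign
    obtain ⟨c, hc, hc'⟩ := exists_hasDerivAt_eq_slope (fun x : ℝ => height W s η x) _ hlt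
      (fun t ht => (hder t ht).continuousAt.continuousWithinAt)
      fun t ht => hder t (Ioo_subset_Icc_self ht)
    have h5 := hsign c (Ioo_subset_Icc_self hc) hc.2.ne
    rw [hc'] at h5
    have h6 : (height W s η x - height W s η y) / (x - y) < 0 := by nlinarith [hc.2]
    have h7 := (div_neg_iff.mp h6).resolve_left fun h => by linarith [h.2]
    linarith [h7.1]
  · rw [uIcc_of_le hlt.le] at hder hsign
    obtain ⟨c, hc, hc'⟩ := exists_hasDerivAt_eq_slope (fun x : ℝ => height W s η x) _ hlt
      (fun t ht => (hder t ht).continuousAt.continuousWithinAt)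
      fun t ht => hder t (Ioo_subset_Icc_self ht)
    have h5 := hsign c (Ioo_subset_Icc_self hc) hc.1.ne'
    rw [hc'] at h5
    have h6 : 0 < (height W s η y - height W s η x) / (y - x) := by nlinarith [hc.1]
    have h7 := (div_pos_iff.mp h6).resolve_right fun h => by linarith [h.2]
    linarith [h7.1]

theorem height_circle_le_of_upper (hk : 1 ≤ k) {W : Weighting k} {s η r M : ℝ} (hr : 0 < r)
    (h : ∀ θ ∈ Ioo 0 Real.pi, height W s η (circleMap 0 r θ) ≤ M) {z : ℂ} (hz : ‖z‖ = r)
    (h1 : z ≠ 1) : height W s η z ≤ M := by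
  have hz' : circleMap 0 r z.arg = z := by
    rw [circleMap_zero, ← hz]; exact Complex.norm_mul_exp_arg_mul_I z
  have hz0 : z ≠ 0 := norm_pos_iff.mp (hz ▸ hr)
  have hc : ContinuousAt (fun θ => height W s η (circleMap 0 r θ)) z.arg := by
    refine ContinuousAt.comp (f := circleMap 0 r) (continuousAt_height hk W s η
      (circleMap_ne_center hr.ne') ?_) (continuous_circleMap 0 r).continuousAt
    rw [hz']; exact h1
  have hpi := Real.pi_pos
  have h2 : ∀ θ ∈ Ioo (-Real.pi) 0, height W s η (circleMap 0 r θ) ≤ M := fun θ hθ => by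
    have h3 : circleMap 0 r (-θ) = starRingEnd ℂ (circleMap 0 r θ) := by
      simp [circleMap_zero, ← Complex.exp_conj]
    rw [← height_conj, ← h3]
    exact h _ ⟨by linarith [hθ.2], by linarith [hθ.1]⟩
  have hb1 := Complex.neg_pi_lt_arg z
  have hb2 := Complex.arg_le_pi z
  suffices hs : ∃ᶠ θ in 𝓝 z.arg, height W s η (circleMap 0 r θ) ≤ M by
    have h4 : z.arg ∈ closure {θ | height W s η (circleMap 0 r θ) ≤ M} :=
      mem_closure_iff_frequently.mpr hs
    by_contra hlt
    push Not at hlt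
    rw [← hz'] at hlt
    exact hs ((hc.eventually (lt_mem_nhds hlt)).mono fun θ hθ => not_le.mpr hθ)
  rcases lt_or_ge 0 z.arg with hpos | hneg
  · refine Filter.Frequently.filter_mono (f := 𝓝[<] z.arg) (Eventually.frequently ?_)
      nhdsWithin_le_nhds
    filter_upwards [Ioo_mem_nhdsLT hpos] with θ hθ using h θ ⟨hθ.1, hθ.2.trans_le hb2⟩
  · refine Filter.Frequently.filter_mono (f := 𝓝[<] z.arg) (Eventually.frequently ?_)
      nhdsWithin_le_nhds
    filter_upwards [Ioo_mem_nhdsLT hb1] with θ hθ using h2 θ ⟨hθ.1, hθ.2.trans_le hneg⟩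

/-- Every circle around `0` other than that through the saddle `x` contains a point that is
higher than `x`. -/
theorem exists_height_gt (hk : 1 ≤ k) {W : Weighting k} {s : ℝ} (hs : 0 ≤ s) (hs1 : s < 1)
    {η : ℝ} (hη1 : -1 ≤ η) {x : ℝ} (hx0 : x < 0) (hx : (x : ℂ) ∈ hyperbolicSet W)
    (hη : theta W s x = η) (hd : deriv (theta W s) x < 0) {r : ℝ} (hr : 0 < r) (hrx : r ≠ -x) :
    ∃ θ ∈ Ioo 0 Real.pi, height W s η x < height W s η (circleMap 0 r θ) := by
  -- Otherwise the height is at most that of `x` on both boundary circles of the annulus, hence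
  -- inside it. But points of the negative axis next to `x` in this annulus are strictly higher.
  by_contra! hcon
  have hc1 : ∀ z : ℂ, ‖z‖ = r → z ≠ 1 → height W s η z ≤ height W s η x := fun z hz h1 =>
    height_circle_le_of_upper hk hr hcon hz h1
  have hc2 : ∀ z : ℂ, ‖z‖ = -x → z ≠ 1 → height W s η z ≤ height W s η x := fun z hz h1 => by
    have := height_circle_le hk hs hs1.le η (r := -x) (by linarith) (by rw [neg_neg]; exact hx)
      (by rw [neg_neg]; exact hd) hz h1
    rwa [neg_neg] at this
  have h3 : ∀ᶠ y : ℝ in 𝓝 x, (y : ℂ) ∈ hyperbolicSet W ∧ y < 0 :=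
    (Complex.continuous_ofReal.continuousAt.eventually_mem
      ((isOpen_hyperbolicSet W).mem_nhds hx)).and (eventually_lt_nhds hx0)
  have hmin := height_min_of_saddle hk hx0 hx hη hd
  rcases lt_or_gt_of_ne hrx with hlt | hlt
  · have h4 := (hmin.filter_mono (nhdsWithin_mono x fun y (hy : y ∈ Ioi x) => ne_of_gt hy)).and
      ((h3.filter_mono nhdsWithin_le_nhds).and (Ioo_mem_nhdsGT (show x < -r by linarith)))
    obtain ⟨y, hy1, ⟨hy2, hy3⟩, hy4⟩ := h4.exists
    have hny : ‖(y : ℂ)‖ = -y := by rw [Complex.norm_real, Real.norm_eq_abs, abs_of_neg hy3]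
    have h5 := height_le_of_annulus hk hs hs1 hη1 hr (r₂ := -x) (M := height W s η x)
      (fun z hz h1 => hz.elim (fun h => hc1 z h h1) fun h => hc2 z h h1) (y := y)
      (by rw [hny]; linarith [hy4.2]) (by rw [hny]; linarith [hy4.1]) hy2
      (by exact_mod_cast (by linarith : y ≠ 1))
    linarith
  · have h4 := (hmin.filter_mono (nhdsWithin_mono x fun y (hy : y ∈ Iio x) => ne_of_lt hy)).and
      ((h3.filter_mono nhdsWithin_le_nhds).and (Ioo_mem_nhdsLT (show -r < x by linarith)))
    obtain ⟨y, hy1, ⟨hy2, hy3⟩, hy4⟩ := h4.exists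
    have hny : ‖(y : ℂ)‖ = -y := by rw [Complex.norm_real, Real.norm_eq_abs, abs_of_neg hy3]
    have h5 := height_le_of_annulus hk hs hs1 hη1 (r₁ := -x) (by linarith) (r₂ := r)
      (M := height W s η x)
      (fun z hz h1 => hz.elim (fun h => hc2 z h h1) fun h => hc1 z h h1) (y := y)
      (by rw [hny]; linarith [hy4.2]) (by rw [hny]; linarith [hy4.1]) hy2
      (by exact_mod_cast (by linarith : y ≠ 1))
    linarith

end AztecDiamond

namespace AztecDiamond

open Set Topology Filter MeasureTheory

variable {k : ℕ}

/-! ### Joining points by contours -/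

/-- The complex conjugate of a contour. -/
theorem IsContour.conj {I : (ℂ → ℂ) → ℂ} {K : Set ℂ} {a b : ℂ} (hI : IsContour I K a b) :
    IsContour (fun g => starRingEnd ℂ (I fun z => starRingEnd ℂ (g (starRingEnd ℂ z))))
      (starRingEnd ℂ '' K) (starRingEnd ℂ a) (starRingEnd ℂ b) where
  isCompact := hI.isCompact.image Complex.continuous_conj
  congr f g h := by
    congr 1
    refine hI.congr _ _ fun z hz => ?_
    rw [h (mem_image_of_mem _ hz)]
  add f g hf hg := by
    have hc : ∀ f, ContinuousOn f (starRingEnd ℂ '' K) →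
        ContinuousOn (fun z => starRingEnd ℂ (f (starRingEnd ℂ z))) K := fun f hf =>
      Complex.continuous_conj.comp_continuousOn
        (hf.comp Complex.continuous_conj.continuousOn (mapsTo_image _ _))
    simp only [map_add, hI.add _ _ (hc f hf) (hc g hg)]
  smul c f := by
    simp only [map_mul, hI.smul, Complex.conj_conj]
  bound := by
    obtain ⟨L, hL, h⟩ := hI.bound
    refine ⟨L, hL, fun g M hM hg => ?_⟩
    rw [RCLike.norm_conj]
    refine h _ M hM fun z hz => ?_
    rw [RCLike.norm_conj]
    exact hg _ (mem_image_of_mem _ hz)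
  ftc Q g hg h := by
    rw [hI.ftc (fun z => starRingEnd ℂ (Q (starRingEnd ℂ z)))
      (fun z => starRingEnd ℂ (g (starRingEnd ℂ z))) (Complex.continuous_conj.comp_continuousOn
        (hg.comp Complex.continuous_conj.continuousOn (mapsTo_image _ _))) fun z hz => ?_]
    · simp
    · have h1 := (h _ (mem_image_of_mem _ hz)).conj_conj
      rwa [Complex.conj_conj] at h1

/-- Two points can be joined by a contour in a set. -/
def Joinable (U : Set ℂ) (a b : ℂ) : Prop := ∃ I K, IsContour I K a b ∧ K ⊆ U

theorem Joinable.refl (U : Set ℂ) (a : ℂ) : Joinable U a a :=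
  ⟨fun _ => 0, ∅, ⟨isCompact_empty, by simp, by simp, by simp, ⟨0, le_rfl, by simp⟩, by simp⟩,
    empty_subset _⟩

theorem Joinable.symm {U : Set ℂ} {a b : ℂ} : Joinable U a b → Joinable U b a :=
  fun ⟨_, K, h, hK⟩ => ⟨_, K, h.symm, hK⟩

theorem Joinable.trans {U : Set ℂ} {a b c : ℂ} : Joinable U a b → Joinable U b c → Joinable U a c :=
  fun ⟨_, _, h, hK⟩ ⟨_, _, h', hK'⟩ => ⟨_, _, h.trans h', union_subset hK hK'⟩

theorem Joinable.mono {U V : Set ℂ} {a b : ℂ} (hUV : U ⊆ V) : Joinable U a b → Joinable V a b :=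
  fun ⟨I, K, h, hK⟩ => ⟨I, K, h, hK.trans hUV⟩

theorem joinable_of_contDiff {U : Set ℂ} {γ : ℝ → ℂ} (hγ : ContDiff ℝ 1 γ) {a b : ℝ}
    (h : ∀ t ∈ uIcc a b, γ t ∈ U) : Joinable U (γ a) (γ b) := by
  rcases lt_trichotomy a b with hab | rfl | hab
  · rw [uIcc_of_le hab.le] at h
    exact ⟨_, _, (IsRectifiable.of_contDiffOn hab hγ.contDiffOn).isContour, image_subset_iff.mpr h⟩
  · exact Joinable.refl _ _
  · rw [uIcc_of_ge hab.le] at h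
    exact Joinable.symm
      ⟨_, _, (IsRectifiable.of_contDiffOn hab hγ.contDiffOn).isContour, image_subset_iff.mpr h⟩

theorem contDiff_circleMap_radius (θ : ℝ) : ContDiff ℝ 1 fun r : ℝ => circleMap 0 r θ := by
  simp only [circleMap_zero]
  exact Complex.ofRealCLM.contDiff.mul contDiff_const

/-- The part of the upper half plane with radii in `J` that is higher than `M`. -/
def upperRegion (W : Weighting k) (s η M : ℝ) (J : Set ℝ) : Set ℂ :=
  {z | 0 < z.im ∧ ‖z‖ ∈ J ∧ M < height W s η z}

theorem circleMap_mem_upperRegion {W : Weighting k} {s η M : ℝ} {J : Set ℝ} {r θ : ℝ} (hr : 0 < r)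
    (hrJ : r ∈ J) (hθ : θ ∈ Ioo 0 Real.pi) (h : M < height W s η (circleMap 0 r θ)) :
    circleMap 0 r θ ∈ upperRegion W s η M J := by
  refine ⟨?_, by simpa [abs_of_pos hr] using hrJ, h⟩
  rw [circleMap_im]; exact mul_pos hr (Real.sin_pos_of_pos_of_lt_pi hθ.1 hθ.2)

theorem joinable_arc (hk : 1 ≤ k) {W : Weighting k} {s : ℝ} (hs : 0 ≤ s) (hs1 : s ≤ 1)
    {η M : ℝ} {J : Set ℝ} {r θ θ' : ℝ} (hr : 0 < r) (hrJ : r ∈ J) (hθ : θ ∈ Ioo 0 Real.pi)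
    (hθ' : θ' ∈ Ioo 0 Real.pi) (h : M < height W s η (circleMap 0 r θ))
    (h' : M < height W s η (circleMap 0 r θ')) :
    Joinable (upperRegion W s η M J) (circleMap 0 r θ) (circleMap 0 r θ') := by
  wlog hle : θ ≤ θ' generalizing θ θ'
  · exact (this hθ' hθ h' h (not_le.mp hle).le).symm
  refine joinable_of_contDiff (contDiff_circleMap 0 r) fun t ht => ?_
  rw [uIcc_of_le hle] at ht
  exact circleMap_mem_upperRegion hr hrJ ⟨hθ.1.trans_le ht.1, ht.2.trans_lt hθ'.2⟩
    ((lt_min h h').trans_le (min_le_height_circle hk hs hs1 η hr hθ.1 ht.1 ht.2 hθ'.2.le))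

/-- The region meets every upper half circle with radius in `J` in a nonempty connected set of
angles. A point of it can be moved radially a little, so joinability passes to nearby radii and
then, `J` being connected, to all radii. -/
theorem joinable_upperRegion (hk : 1 ≤ k) {W : Weighting k} {s : ℝ} (hs : 0 ≤ s) (hs1 : s ≤ 1)
    {η M : ℝ} {J : Set ℝ} (hJ : J.OrdConnected) (hJ0 : J ⊆ Ioi 0)
    (hpass : ∀ r ∈ J, ∃ θ ∈ Ioo 0 Real.pi, M < height W s η (circleMap 0 r θ)) {r r' θ θ' : ℝ}
    (hr : r ∈ J) (hr' : r' ∈ J) (hθ : θ ∈ Ioo 0 Real.pi) (hθ' : θ' ∈ Ioo 0 Real.pi)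
    (h : M < height W s η (circleMap 0 r θ)) (h' : M < height W s η (circleMap 0 r' θ')) :
    Joinable (upperRegion W s η M J) (circleMap 0 r θ) (circleMap 0 r' θ') := by
  refine IsPreconnected.induction₂' hJ.isPreconnected
    (P := fun r r' => ∀ θ ∈ Ioo 0 Real.pi, ∀ θ' ∈ Ioo 0 Real.pi,
      M < height W s η (circleMap 0 r θ) → M < height W s η (circleMap 0 r' θ') →
      Joinable (upperRegion W s η M J) (circleMap 0 r θ) (circleMap 0 r' θ'))
    ?_ ?_ hr hr' θ hθ θ' hθ' h h'
  · intro r hr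
    obtain ⟨θ₀, hθ₀, h₀⟩ := hpass r hr
    have hr0 : 0 < r := hJ0 hr
    have hcont : ContinuousAt (fun t : ℝ => height W s η (circleMap 0 t θ₀)) r := by
      refine ContinuousAt.comp (f := fun t : ℝ => circleMap 0 t θ₀)
        (continuousAt_height hk W s η (circleMap_ne_center hr0.ne') fun h1 => ?_)
        (contDiff_circleMap_radius θ₀).continuous.continuousAt
      have := congrArg Complex.im h1
      rw [circleMap_im, Complex.one_im] at this
      exact (mul_pos hr0 (Real.sin_pos_of_pos_of_lt_pi hθ₀.1 hθ₀.2)).ne' this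
    obtain ⟨δ, hδ, hball⟩ := Metric.eventually_nhds_iff_ball.mp (hcont.eventually (lt_mem_nhds h₀))
    filter_upwards [self_mem_nhdsWithin, mem_nhdsWithin_of_mem_nhds (Metric.ball_mem_nhds r hδ)]
      with r' hr' hr'b
    have hseg : Joinable (upperRegion W s η M J) (circleMap 0 r θ₀) (circleMap 0 r' θ₀) := by
      refine joinable_of_contDiff (γ := fun t : ℝ => circleMap 0 t θ₀)
        (contDiff_circleMap_radius θ₀) fun t ht => ?_
      have htJ : t ∈ J := hJ.uIcc_subset hr hr' ht
      exact circleMap_mem_upperRegion (hJ0 htJ) htJ hθ₀ (hball t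
        ((convex_ball r δ).ordConnected.uIcc_subset (Metric.mem_ball_self hδ) hr'b ht))
    have h₀' := hball r' hr'b
    exact ⟨fun θ hθ θ' hθ' h h' =>
        ((joinable_arc hk hs hs1 hr0 hr hθ hθ₀ h h₀).trans hseg).trans
          (joinable_arc hk hs hs1 (hJ0 hr') hr' hθ₀ hθ' h₀' h'),
      fun θ hθ θ' hθ' h h' =>
        ((joinable_arc hk hs hs1 (hJ0 hr') hr' hθ hθ₀ h h₀').trans hseg.symm).trans
          (joinable_arc hk hs hs1 hr0 hr hθ₀ hθ' h₀ h')⟩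
  · intro r₁ r₂ r₃ _ h₂ _ h12 h23 θ hθ θ' hθ' h h'
    obtain ⟨θ₀, hθ₀, h₀⟩ := hpass r₂ h₂
    exact (h12 θ hθ θ₀ hθ₀ h h₀).trans (h23 θ₀ hθ₀ θ' hθ' h₀ h')

/-- A contour in the closed upper half plane from `c > 0` to `-r < 0`. -/
theorem exists_upper_contour (hk : 1 ≤ k) {W : Weighting k} {s : ℝ} (hs : 0 ≤ s) (hs1 : s ≤ 1)
    {η M : ℝ} {J : Set ℝ} (hJ : J.OrdConnected) (hJ0 : J ⊆ Ioi 0)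
    (hpass : ∀ r ∈ J, ∃ θ ∈ Ioo 0 Real.pi, M < height W s η (circleMap 0 r θ)) {c r : ℝ}
    (hc : c ∈ J) (hr : r ∈ J) (hcM : ∀ z : ℂ, ‖z‖ = c → M < height W s η z)
    (hrM : M < height W s η ((-r : ℝ) : ℂ)) :
    Joinable {z | 0 ≤ z.im ∧ (z.im = 0 → z = c ∨ z = (-r : ℝ)) ∧ ‖z‖ ∈ J ∧ M < height W s η z}
      c ((-r : ℝ) : ℂ) := by
  have hc0 : 0 < c := hJ0 hc
  have hr0 : 0 < r := hJ0 hr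
  have hpi := Real.pi_pos
  have hsub : upperRegion W s η M J ⊆
      {z | 0 ≤ z.im ∧ (z.im = 0 → z = c ∨ z = (-r : ℝ)) ∧ ‖z‖ ∈ J ∧ M < height W s η z} :=
    fun z hz => ⟨hz.1.le, fun h => absurd h hz.1.ne', hz.2⟩
  have hnc : ∀ θ, ‖circleMap 0 c θ‖ = c := fun θ => by simp [abs_of_pos hc0]
  have hnr : ∀ θ, ‖circleMap 0 r θ‖ = r := fun θ => by simp [abs_of_pos hr0]
  have h1 : Joinable {z | 0 ≤ z.im ∧ (z.im = 0 → z = c ∨ z = (-r : ℝ)) ∧ ‖z‖ ∈ J ∧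
      M < height W s η z} (circleMap 0 c 0) (circleMap 0 c (Real.pi / 2)) := by
    refine joinable_of_contDiff (contDiff_circleMap 0 c) fun t ht => ?_
    rw [uIcc_of_le (by positivity)] at ht
    rcases ht.1.eq_or_lt with rfl | htpos
    · refine ⟨?_, fun _ => Or.inl ?_, by rw [hnc]; exact hc, hcM _ (hnc _)⟩
      · rw [circleMap_im]; simp
      · simp [circleMap_zero]
    · exact hsub (circleMap_mem_upperRegion hc0 hc ⟨htpos, by linarith [ht.2]⟩ (hcM _ (hnc _)))
  have hcontr : ContinuousAt (fun θ => height W s η (circleMap 0 r θ)) Real.pi :=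
    continuousAt_height_circle hk s η hr0 ⟨hpi, le_rfl⟩
  have hrM' : M < height W s η (circleMap 0 r Real.pi) := by rw [circleMap_pi]; exact hrM
  obtain ⟨θ₁, hθ₁M, hθ₁⟩ := (((hcontr.eventually (lt_mem_nhds hrM')).filter_mono
    (nhdsWithin_le_nhds (s := Iio Real.pi))).and (Ioo_mem_nhdsLT hpi)).exists
  have h2 := (joinable_upperRegion hk hs hs1 hJ hJ0 hpass hc hr
    (θ := Real.pi / 2) ⟨by linarith, by linarith⟩ hθ₁ (hcM _ (hnc _)) hθ₁M).mono hsub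
  have h3 : Joinable {z | 0 ≤ z.im ∧ (z.im = 0 → z = c ∨ z = (-r : ℝ)) ∧ ‖z‖ ∈ J ∧
      M < height W s η z} (circleMap 0 r θ₁) (circleMap 0 r Real.pi) := by
    refine joinable_of_contDiff (contDiff_circleMap 0 r) fun t ht => ?_
    rw [uIcc_of_le hθ₁.2.le] at ht
    rcases ht.2.eq_or_lt with rfl | htlt
    · refine ⟨?_, fun _ => Or.inr (circleMap_pi r), by rw [hnr]; exact hr, hrM'⟩
      rw [circleMap_im]; simp
    · exact hsub (circleMap_mem_upperRegion hr0 hr ⟨hθ₁.1.trans_le ht.1, htlt⟩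
        ((lt_min hθ₁M hrM').trans_le
          (min_le_height_circle hk hs hs1 η hr0 hθ₁.1 ht.1 ht.2 le_rfl)))
  have h4 := (h1.trans h2).trans h3
  rwa [circleMap_pi, show circleMap 0 c 0 = (c : ℂ) by simp [circleMap_zero]] at h4

/-! ### Closing up -/

/-- The branch `log (-i(z - p))` is holomorphic near the closed upper half plane without `p`, so it
is a primitive even if the contour touches the real axis. -/
theorem IsContour.im_sub_inv {I : (ℂ → ℂ) → ℂ} {K : Set ℂ} {a b p : ℝ} (hI : IsContour I K a b)
    (hK : ∀ z ∈ K, 0 ≤ z.im ∧ z ≠ p) :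
    (I fun z => (z - p)⁻¹).im =
      (Complex.log (-Complex.I * (b - p))).im - (Complex.log (-Complex.I * (a - p))).im := by
  rw [hI.ftc (fun z => Complex.log (-Complex.I * (z - p))) (fun z => (z - p)⁻¹), Complex.sub_im]
  · exact continuousOn_sub_inv fun h => (hK _ h).2 rfl
  · intro z hz
    obtain ⟨him, hne⟩ := hK z hz
    have hne' : z - p ≠ 0 := sub_ne_zero.mpr hne
    have hs : -Complex.I * (z - p) ∈ Complex.slitPlane := by
      rw [Complex.mem_slitPlane_iff]
      simp only [neg_mul, Complex.neg_re, Complex.I_mul_re, neg_neg, Complex.sub_im,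
        Complex.ofReal_im, sub_zero, Complex.neg_im, Complex.I_mul_im, Complex.sub_re,
        Complex.ofReal_re]
      rcases him.eq_or_lt with h | h
      · right
        intro h2
        exact hne (Complex.ext (by simp; linarith) (by simp [← h]))
      · exact Or.inl h
    have h1 : HasDerivAt (fun z : ℂ => -Complex.I * (z - p)) (-Complex.I) z := by
      simpa using ((hasDerivAt_id z).sub_const (p : ℂ)).const_mul (-Complex.I)
    refine (h1.clog hs).congr_deriv ?_
    have : -Complex.I ≠ 0 := neg_ne_zero.mpr Complex.I_ne_zero
    field_simp

theorem im_log_neg_I_mul_of_pos {x : ℝ} (hx : 0 < x) :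
    (Complex.log (-Complex.I * x)).im = -(Real.pi / 2) := by
  rw [Complex.log_im, mul_comm, Complex.arg_real_mul _ hx, Complex.arg_neg_I]

theorem im_log_neg_I_mul_of_neg {x : ℝ} (hx : x < 0) :
    (Complex.log (-Complex.I * x)).im = Real.pi / 2 := by
  rw [Complex.log_im, show -Complex.I * (x : ℂ) = ((-x : ℝ) : ℂ) * Complex.I by push_cast; ring,
    Complex.arg_real_mul _ (by linarith), Complex.arg_I]

/-- A contour in the upper half plane and its mirror image form a closed contour. -/
theorem exists_closed_contour {U : Set ℂ} {c r : ℝ} (hc : 0 < c) (hr : 0 < r)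
    (hU : ∀ z ∈ U, 0 ≤ z.im ∧ z ≠ 0 ∧ z ≠ 1) (h : Joinable U c ((-r : ℝ) : ℂ)) :
    ∃ I K, IsContour I K (c : ℂ) c ∧ K ⊆ U ∪ starRingEnd ℂ '' U ∧
      I (fun z => z⁻¹) = 2 * Real.pi * Complex.I ∧
      (c < 1 → I (fun z => (z - 1)⁻¹) = 0) ∧
      (1 < c → I (fun z => (z - 1)⁻¹) = 2 * Real.pi * Complex.I) := by
  obtain ⟨I, K, hI, hK⟩ := h
  have hconj := hI.conj.symm
  rw [Complex.conj_ofReal, Complex.conj_ofReal] at hconj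
  -- Adding the reversed mirror image subtracts the complex conjugate, which leaves twice the
  -- imaginary part; this depends only on the sides of `p` on which the two end points lie.
  have key : ∀ p : ℝ, I (fun z => (z - p)⁻¹) +
      -starRingEnd ℂ (I fun z => starRingEnd ℂ ((starRingEnd ℂ z - p)⁻¹)) =
      2 * ((I fun z => (z - p)⁻¹).im : ℂ) * Complex.I := fun p => by
    have h1 : (fun z => starRingEnd ℂ ((starRingEnd ℂ z - p)⁻¹)) = fun z : ℂ => (z - p)⁻¹ := by
      ext z; simp
    rw [h1, ← sub_eq_add_neg, Complex.sub_conj]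
    push_cast; rfl
  have him0 := hI.im_sub_inv (p := 0) fun z hz => ⟨(hU z (hK hz)).1, by
    rw [Complex.ofReal_zero]; exact (hU z (hK hz)).2.1⟩
  have him1 := hI.im_sub_inv (p := 1) fun z hz => ⟨(hU z (hK hz)).1, by
    rw [Complex.ofReal_one]; exact (hU z (hK hz)).2.2⟩
  simp only [← Complex.ofReal_sub] at him0 him1
  rw [im_log_neg_I_mul_of_neg (by linarith)] at him0 him1
  rw [im_log_neg_I_mul_of_pos (by linarith)] at him0
  have key0 := key 0
  have key1 := key 1
  rw [him0] at key0
  rw [him1] at key1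
  refine ⟨_, _, hI.trans hconj, union_subset_union hK (image_mono hK), ?_, ?_, ?_⟩
  · simp only [Complex.ofReal_zero, sub_zero] at key0
    rw [key0]; push_cast; ring
  · intro h
    simp only [Complex.ofReal_one] at key1
    rw [key1, im_log_neg_I_mul_of_neg (by linarith)]; simp
  · intro h
    simp only [Complex.ofReal_one] at key1
    rw [key1, im_log_neg_I_mul_of_pos (by linarith)]; push_cast; ring

end AztecDiamond

namespace AztecDiamond

open Set Topology Filter MeasureTheory

variable {k : ℕ}

/-! ### The contours of steep descent -/

/-- The contour crosses the real axis only at `c` and at `-r`, the latter in the window. Whether it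
winds around $1$ depends only on the position of `c` relative to $1$. -/
theorem exists_closed_contour_height (hk : 1 ≤ k) {W : Weighting k} {s : ℝ} (hs : 0 ≤ s)
    (hs1 : s ≤ 1) {η M a b : ℝ} {J : Set ℝ} (hJ : J.OrdConnected) (hJ0 : J ⊆ Ioi 0)
    (hpass : ∀ r ∈ J, ∃ θ ∈ Ioo 0 Real.pi, M < height W s η (circleMap 0 r θ)) {c r : ℝ}
    (hc : c ∈ J) (hc1 : c ≠ 1) (hr : r ∈ J) (hcM : ∀ z : ℂ, ‖z‖ = c → M < height W s η z)
    (hrM : M < height W s η ((-r : ℝ) : ℂ)) (hrgap : -r ∈ Ioo a b) :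
    ∃ I K, IsContour I K (c : ℂ) c ∧
      (∀ z ∈ K, z ∈ cutDomain a b ∧ z ≠ 1 ∧ ‖z‖ ∈ J ∧ M < height W s η z) ∧
      I (fun z => z⁻¹) = 2 * Real.pi * Complex.I ∧
      (c < 1 → I (fun z => (z - 1)⁻¹) = 0) ∧
      (1 < c → I (fun z => (z - 1)⁻¹) = 2 * Real.pi * Complex.I) := by
  have hc0 : 0 < c := hJ0 hc
  have hr0 : 0 < r := hJ0 hr
  have hne1 : ∀ z : ℂ, (z.im = 0 → z = c ∨ z = (-r : ℝ)) → z ≠ 1 := by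
    rintro z h rfl
    rcases h (by simp) with h | h
    · exact hc1 (by exact_mod_cast h.symm)
    · have : (1 : ℝ) = -r := by exact_mod_cast h
      linarith
  obtain ⟨I, K, hI, hK, h0, h1, h2⟩ := exists_closed_contour hc0 hr0 (fun z hz =>
    ⟨hz.1, norm_pos_iff.mp (hJ0 hz.2.2.1), hne1 z hz.2.1⟩)
    (exists_upper_contour hk hs hs1 hJ hJ0 hpass hc hr hcM hrM)
  have hcut : ∀ z : ℂ, (z.im = 0 → z = c ∨ z = (-r : ℝ)) → z ∈ cutDomain a b := by
    intro z h
    by_cases him : z.im = 0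
    · rcases h him with rfl | rfl
      · exact Or.inl (Or.inl (by simpa using hc0))
      · exact Or.inr ⟨by simp, by simpa using hrgap⟩
    · exact Or.inl (Or.inr him)
  refine ⟨I, K, hI, fun z hz => ?_, h0, h1, h2⟩
  rcases hK hz with h | ⟨w, h, rfl⟩
  · exact ⟨hcut z h.2.1, hne1 z h.2.1, h.2.2⟩
  · have h' : (starRingEnd ℂ w).im = 0 → starRingEnd ℂ w = c ∨ starRingEnd ℂ w = (-r : ℝ) := by
      intro him
      rw [Complex.conj_im, neg_eq_zero] at him
      rcases h.2.1 him with h3 | h3 <;> rw [h3, Complex.conj_ofReal]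
      · exact Or.inl rfl
      · exact Or.inr rfl
    refine ⟨hcut _ h', hne1 _ h', ?_, ?_⟩
    · rw [RCLike.norm_conj]; exact h.2.2.1
    · rw [height_conj]; exact h.2.2.2

/-- For $\eta>-1$ the term $-\frac k4(\eta+1)\log|z|$ tends to infinity at $0$, while $\log|z-1|$
stays bounded. -/
theorem exists_small_radius (hk : 1 ≤ k) (W : Weighting k) {s η : ℝ} (hs : 0 ≤ s) (hη : -1 < η)
    (M : ℝ) {b : ℝ} (hb : 0 < b) :
    ∃ c, 0 < c ∧ c < 1 ∧ c < b ∧ ∀ z : ℂ, ‖z‖ = c → M < height W s η z := by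
  have hkpos : (0 : ℝ) < k := by exact_mod_cast hk
  have hA : 0 < k / 4 * (η + 1) := mul_pos (by positivity) (by linarith)
  have hlim : Tendsto (fun c : ℝ => -(k / 4 * (η + 1)) * Real.log c) (𝓝[>] 0) atTop := by
    have h := (tendsto_neg_atBot_atTop.comp Real.tendsto_log_nhdsGT_zero).const_mul_atTop hA
    refine h.congr fun c => ?_
    simp only [Function.comp_apply]; ring
  have hev := hlim.eventually (eventually_gt_atTop (M + k / 2 * Real.log 2))
  obtain ⟨c, hc, hc2⟩ :=
    (hev.and (Ioo_mem_nhdsGT (show 0 < min b (1 / 2) by positivity))).exists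
  have hcb : c < b := hc2.2.trans_le (min_le_left _ _)
  have hc1 : c < 1 / 2 := hc2.2.trans_le (min_le_right _ _)
  refine ⟨c, hc2.1, by linarith, hcb, fun z hz => ?_⟩
  have hz1 : z ≠ 1 := by rintro rfl; rw [norm_one] at hz; linarith
  refine lt_of_lt_of_le ?_ (le_height hs η hz1)
  have h1 : 1 / 2 ≤ ‖z - 1‖ := by
    have := norm_sub_norm_le (1 : ℂ) z
    rw [norm_one, hz, norm_sub_rev] at this
    linarith
  have h2 : -Real.log 2 ≤ Real.log ‖z - 1‖ := by
    rw [← Real.log_inv]; exact Real.log_le_log (by norm_num) (by simpa using h1)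
  have h3 := mul_le_mul_of_nonneg_left h2 (by positivity : (0 : ℝ) ≤ k / 2)
  rw [hz]
  linarith

/-- At infinity the lower bound grows like $(\frac k2-\frac k4(\eta+1))\log|z|$, with a positive
coefficient as $\eta<1$. -/
theorem exists_large_radius (hk : 1 ≤ k) (W : Weighting k) {s η : ℝ} (hs : 0 ≤ s) (hη : η < 1)
    (M b : ℝ) : ∃ c, 1 < c ∧ b < c ∧ ∀ z : ℂ, ‖z‖ = c → M < height W s η z := by
  have hkpos : (0 : ℝ) < k := by exact_mod_cast hk
  have hA : 0 < k / 2 - k / 4 * (η + 1) := by nlinarith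
  have hlim : Tendsto (fun c : ℝ => (k / 2 - k / 4 * (η + 1)) * Real.log c) atTop atTop :=
    Real.tendsto_log_atTop.const_mul_atTop hA
  obtain ⟨c, hc, hc2⟩ := ((hlim.eventually (eventually_gt_atTop (M + k / 2 * Real.log 2))).and
    (eventually_gt_atTop (max b 2))).exists
  have hcb : b < c := (le_max_left _ _).trans_lt hc2
  have hc1 : 2 < c := (le_max_right _ _).trans_lt hc2
  refine ⟨c, by linarith, hcb, fun z hz => ?_⟩
  have hz1 : z ≠ 1 := by rintro rfl; rw [norm_one] at hz; linarith
  refine lt_of_lt_of_le ?_ (le_height hs η hz1)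
  have h1 : c / 2 ≤ ‖z - 1‖ := by
    have := norm_sub_norm_le z 1
    rw [norm_one, hz] at this
    linarith
  have h2 : Real.log c - Real.log 2 ≤ Real.log ‖z - 1‖ := by
    rw [← Real.log_div (by linarith) (by norm_num)]; exact Real.log_le_log (by linarith) h1
  have h3 := mul_le_mul_of_nonneg_left h2 (by positivity : (0 : ℝ) ≤ k / 2)
  rw [hz]
  linarith

theorem exists_height_lower_bound (hk : 1 ≤ k) {W : Weighting k} {s η M a b : ℝ} (hb : b ≤ 0)
    {K : Set ℂ} (hKc : IsCompact K)
    (hK : ∀ z ∈ K, z ∈ cutDomain a b ∧ z ≠ 1 ∧ M < height W s η z) :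
    ∃ M', M < M' ∧ ∀ z ∈ K, M' ≤ height W s η z := by
  rcases K.eq_empty_or_nonempty with rfl | hne
  · exact ⟨M + 1, by linarith, by simp⟩
  · obtain ⟨z₀, hz₀, hmin⟩ := hKc.exists_isMinOn hne (f := height W s η) fun z hz =>
      (continuousAt_height hk W s η (ne_zero_of_mem_cutDomain hb (hK z hz).1)
        (hK z hz).2.1).continuousWithinAt
    exact ⟨_, (hK z₀ hz₀).2.2, fun z hz => hmin hz⟩

theorem exists_norm_lt {K : Set ℂ} (hKc : IsCompact K) {c : ℝ} (h : ∀ z ∈ K, ‖z‖ < c) :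
    ∃ c', c' < c ∧ ∀ z ∈ K, ‖z‖ ≤ c' := by
  rcases K.eq_empty_or_nonempty with rfl | hne
  · exact ⟨c - 1, by linarith, by simp⟩
  · obtain ⟨z₀, hz₀, hmax⟩ := hKc.exists_isMaxOn hne continuous_norm.continuousOn
    exact ⟨_, h z₀ hz₀, fun z hz => hmax hz⟩

theorem exists_lt_norm {K : Set ℂ} (hKc : IsCompact K) {c : ℝ} (h : ∀ z ∈ K, c < ‖z‖) :
    ∃ c', c < c' ∧ ∀ z ∈ K, c' ≤ ‖z‖ := by
  rcases K.eq_empty_or_nonempty with rfl | hne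
  · exact ⟨c + 1, by linarith, by simp⟩
  · obtain ⟨z₀, hz₀, hmin⟩ := hKc.exists_isMinOn hne continuous_norm.continuousOn
    exact ⟨_, h z₀ hz₀, fun z hz => hmin hz⟩

theorem continuousAt_deriv_theta (hk : 1 ≤ k) {W : Weighting k} (s : ℝ) {x : ℝ}
    (hx : (x : ℂ) ∈ hyperbolicSet W) (h1 : x ≠ 1) : ContinuousAt (deriv (theta W s)) x := by
  have hev : ∀ᶠ y : ℝ in 𝓝 x, (y : ℂ) ∈ hyperbolicSet W ∧ y ≠ 1 :=
    (Complex.continuous_ofReal.continuousAt.eventually_mem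
      ((isOpen_hyperbolicSet W).mem_nhds hx)).and (eventually_ne_nhds h1)
  have heq : (fun y : ℝ => (deriv (thetaC W s) y).re) =ᶠ[𝓝 x] deriv (theta W s) :=
    hev.mono fun y hy => by simp only [(hasDerivAt_theta hk s hy.1 hy.2).2, Complex.ofReal_re]
  refine ContinuousAt.congr ?_ heq
  exact Complex.continuous_re.continuousAt.comp (ContinuousAt.comp (f := fun y : ℝ => (y : ℂ))
    (analyticAt_thetaC s hx (by exact_mod_cast h1)).deriv.continuousAt
    Complex.continuous_ofReal.continuousAt)

/-- A circle and two closed contours, inside and outside of it, which are higher than it. -/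
theorem exists_contours (hk : 1 ≤ k) {W : Weighting k} {l : ℕ} (hl : IsLoopIndex W l) {s η : ℝ}
    (hs : 0 ≤ s) (hs1 : s < 1) (hη : η ∈ Ioo (-1 : ℝ) 1) {x : ℝ} (hx : x ∈ gap W l)
    (hθ : theta W s x = η) (hd : deriv (theta W s) x < 0) :
    ∃ r M₁ M₂ : ℝ, 0 < r ∧ r ≠ 1 ∧ -r ∈ gap W l ∧ M₁ < M₂ ∧
      (∀ z : ℂ, ‖z‖ = r → height W s η z ≤ M₁) ∧
      (∃ I K c, IsContour I K c c ∧ (∀ z ∈ K, z ∈ cutDomain (branchPoint W (2 * l))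
          (branchPoint W (2 * l - 1)) ∧ z ≠ 1 ∧ ‖z‖ < r ∧ M₂ ≤ height W s η z) ∧
        I (fun z => z⁻¹) = 2 * Real.pi * Complex.I ∧ I (fun z => (z - 1)⁻¹) = 0) ∧
      (∃ I K c, IsContour I K c c ∧ (∀ z ∈ K, z ∈ cutDomain (branchPoint W (2 * l))
          (branchPoint W (2 * l - 1)) ∧ z ≠ 1 ∧ r < ‖z‖ ∧ M₂ ≤ height W s η z) ∧
        I (fun z => z⁻¹) = 2 * Real.pi * Complex.I ∧
        I (fun z => (z - 1)⁻¹) = 2 * Real.pi * Complex.I) := by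
  set a := branchPoint W (2 * l) with ha
  set b := branchPoint W (2 * l - 1) with hb
  have hb0 : b < 0 := gap_subset_neg hk hl
  have hx0 : x < 0 := hx.2.trans hb0
  have hxh := mem_hyperbolicSet_of_mem_gap hk hl hx
  set M := height W s η x with hM
  have hpass : ∀ r, 0 < r → r ≠ -x →
      ∃ θ ∈ Ioo 0 Real.pi, M < height W s η (circleMap 0 r θ) := fun r hr hrx =>
    exists_height_gt hk hs hs1 hη.1.le hx0 hxh hθ hd hr hrx
  have hmin := height_min_of_saddle hk hx0 hxh hθ hd
  have hgap : gap W l ∈ 𝓝 x := isOpen_Ioo.mem_nhds hx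
  have hg₁ : ∀ᶠ y in 𝓝[>] x, y ∈ gap W l := mem_nhdsWithin_of_mem_nhds hgap
  have hg₂ : ∀ᶠ y in 𝓝[<] x, y ∈ gap W l := mem_nhdsWithin_of_mem_nhds hgap
  have hs₁ : ∀ᶠ y in 𝓝[>] x, y ∈ Ioi x := self_mem_nhdsWithin
  have hs₂ : ∀ᶠ y in 𝓝[<] x, y ∈ Iio x := self_mem_nhdsWithin
  -- The saddle is a strict minimum along the axis, so the two loops can cross the gap at higher
  -- points on either side of it.
  obtain ⟨y₁, hy₁M, hy₁g, hy₁x⟩ := ((hmin.filter_mono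
    (nhdsWithin_mono x fun y (hy : y ∈ Ioi x) => ne_of_gt hy)).and (hg₁.and hs₁)).exists
  obtain ⟨y₂, hy₂M, hy₂g, hy₂x⟩ := ((hmin.filter_mono
    (nhdsWithin_mono x fun y (hy : y ∈ Iio x) => ne_of_lt hy)).and (hg₂.and hs₂)).exists
  have hy₁0 : y₁ < 0 := hy₁g.2.trans hb0
  rw [mem_Ioi] at hy₁x
  rw [mem_Iio] at hy₂x
  obtain ⟨c₁, hc₁0, hc₁1, hc₁x, hc₁M⟩ := exists_small_radius hk W hs hη.1 M (b := -x) (by linarith)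
  obtain ⟨c₂, hc₂1, hc₂x, hc₂M⟩ := exists_large_radius hk W hs hη.2 M (-x)
  obtain ⟨I₁, K₁, hI₁, hK₁, e₁, f₁, -⟩ := exists_closed_contour_height (a := a) (b := b) hk hs
    hs1.le (J := Ioo 0 (-x)) ordConnected_Ioo (fun r hr => hr.1) (fun r hr => hpass r hr.1 hr.2.ne)
    (c := c₁) (r := -y₁) ⟨hc₁0, hc₁x⟩ hc₁1.ne ⟨by linarith, by linarith⟩ hc₁M
    (by rw [neg_neg]; exact hy₁M) (by rw [neg_neg]; exact hy₁g)
  obtain ⟨I₂, K₂, hI₂, hK₂, e₂, -, f₂⟩ := exists_closed_contour_height (a := a) (b := b) hk hs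
    hs1.le (J := Ioi (-x)) ordConnected_Ioi (fun r (hr : -x < r) => by
      rw [mem_Ioi]; linarith) (fun r (hr : -x < r) => hpass r (by linarith) hr.ne')
    (c := c₂) (r := -y₂) hc₂x hc₂1.ne' (by rw [mem_Ioi]; linarith) hc₂M
    (by rw [neg_neg]; exact hy₂M) (by rw [neg_neg]; exact hy₂g)
  obtain ⟨M₁', hM₁', hK₁M⟩ := exists_height_lower_bound hk hb0.le hI₁.isCompact
    fun z hz => ⟨(hK₁ z hz).1, (hK₁ z hz).2.1, (hK₁ z hz).2.2.2⟩
  obtain ⟨M₂', hM₂', hK₂M⟩ := exists_height_lower_bound hk hb0.le hI₂.isCompact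
    fun z hz => ⟨(hK₂ z hz).1, (hK₂ z hz).2.1, (hK₂ z hz).2.2.2⟩
  obtain ⟨d₁, hd₁, hK₁d⟩ := exists_norm_lt hI₁.isCompact fun z hz => (hK₁ z hz).2.2.1.2
  obtain ⟨d₂, hd₂, hK₂d⟩ := exists_lt_norm hI₂.isCompact fun z hz => (hK₂ z hz).2.2.1
  -- All that is needed of the circle is stable under small changes of its radius: below both loops
  -- in height, disjoint from them, and with $\theta'<0$ at its leftmost point.
  have hev : ∀ᶠ y in 𝓝 x, y ∈ gap W l ∧ height W s η y < min M₁' M₂' ∧ -d₂ < y ∧ y < -d₁ ∧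
      deriv (theta W s) y < 0 := by
    refine (show ∀ᶠ y in 𝓝 x, y ∈ gap W l from hgap).and (Eventually.and ?_
      ((eventually_gt_nhds (by linarith)).and ((eventually_lt_nhds (by linarith)).and ?_)))
    · exact (hasDerivAt_height_ofReal hk s η hx0 hxh).continuousAt.eventually
        (gt_mem_nhds (lt_min hM₁' hM₂'))
    · exact (continuousAt_deriv_theta hk s hxh (by linarith)).eventually (gt_mem_nhds hd)
  -- The freedom in the radius is used to keep the circle away from the pole at $1$, which would lie
  -- on it if $x=-1$.
  have hne1 : ∀ᶠ y in 𝓝[<] x, -y ≠ 1 := by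
    rcases lt_or_ge (-1) x with h | h
    · filter_upwards [mem_nhdsWithin_of_mem_nhds (lt_mem_nhds h)] with y hy hy1
      linarith
    · filter_upwards [self_mem_nhdsWithin] with y hy hy1
      rw [mem_Iio] at hy
      linarith
  obtain ⟨y, ⟨hyg, hyM, hyd₂, hyd₁, hyd⟩, hy1⟩ :=
    ((hev.filter_mono nhdsWithin_le_nhds).and hne1).exists
  have hy0 : y < 0 := hyg.2.trans hb0
  refine ⟨-y, height W s η y, min M₁' M₂', by linarith, hy1, by rw [neg_neg]; exact hyg, hyM,
    fun z hz => ?_, ⟨I₁, K₁, c₁, hI₁, fun z hz => ⟨(hK₁ z hz).1, (hK₁ z hz).2.1, ?_, ?_⟩, e₁,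
      f₁ hc₁1⟩, ⟨I₂, K₂, c₂, hI₂, fun z hz => ⟨(hK₂ z hz).1, (hK₂ z hz).2.1, ?_, ?_⟩, e₂,
      f₂ hc₂1⟩⟩
  · have h := height_circle_le hk hs hs1.le η (r := -y) (by linarith)
      (by rw [neg_neg]; exact mem_hyperbolicSet_of_mem_gap hk hl hyg) (by rw [neg_neg]; exact hyd)
      hz (by rintro rfl; rw [norm_one] at hz; exact hy1 hz.symm)
    rwa [neg_neg] at h
  · linarith [hK₁d z hz]
  · exact (min_le_left _ _).trans (hK₁M z hz)
  · linarith [hK₂d z hz]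
  · exact (min_le_right _ _).trans (hK₂M z hz)

end AztecDiamond

/-! ### Residues at 1 and at infinity, and the deformation of the outer contour -/

namespace AztecDiamond

open Set Topology Filter MeasureTheory

variable {k : ℕ}

theorem zpow_add_one_mul_pow_inv {z : ℂ} (h0 : z ≠ 0) (h1 : z ≠ 1) (p : ℤ) (e : ℕ) :
    z ^ (p + 1) * ((z - 1) ^ (e + 1))⁻¹ =
      z ^ p * ((z - 1) ^ e)⁻¹ + z ^ p * ((z - 1) ^ (e + 1))⁻¹ := by
  have h1' : z - 1 ≠ 0 := sub_ne_zero.mpr h1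
  rw [zpow_add_one₀ h0, pow_succ]
  field_simp
  ring

theorem continuousOn_zpow_mul_pow_inv {K : Set ℂ} (h0 : (0 : ℂ) ∉ K) (h1 : (1 : ℂ) ∉ K) (p : ℤ)
    (e : ℕ) : ContinuousOn (fun z : ℂ => z ^ p * ((z - 1) ^ e)⁻¹) K :=
  (continuousOn_zpow_id p h0).mul (IsContour.continuousOn_pow_inv h1)

/-- A function without pole at `0` only sees the winding number around `1`. -/
theorem exists_residue_of_nonneg (p e : ℕ) :
    ∃ d : ℂ, ∀ (I : (ℂ → ℂ) → ℂ) (K : Set ℂ) (a : ℂ), IsContour I K a a → 0 ∉ K → 1 ∉ K →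
      I (fun z => z ^ (p : ℤ) * ((z - 1) ^ e)⁻¹) = d * I (fun z => (z - 1)⁻¹) := by
  induction p generalizing e with
  | zero =>
    match e with
    | 0 => exact ⟨0, fun I K a hI h0 h1 => by simpa using hI.zpow_eq h0 0⟩
    | 1 => exact ⟨1, fun I K a hI h0 h1 => by simp⟩
    | e + 2 => exact ⟨0, fun I K a hI h0 h1 => by simpa using hI.pole_eq_zero h1 e⟩
  | succ p ih =>
    match e with
    | 0 =>
      refine ⟨0, fun I K a hI h0 h1 => ?_⟩
      have := hI.zpow_eq h0 ((p + 1 : ℕ) : ℤ)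
      rw [if_neg (by omega)] at this
      simpa using this
    | e + 1 =>
      obtain ⟨d, hd⟩ := ih e
      obtain ⟨d', hd'⟩ := ih (e + 1)
      refine ⟨d + d', fun I K a hI h0 h1 => ?_⟩
      rw [add_mul, ← hd I K a hI h0 h1, ← hd' I K a hI h0 h1,
        ← hI.add _ _ (continuousOn_zpow_mul_pow_inv h0 h1 _ _)
          (continuousOn_zpow_mul_pow_inv h0 h1 _ _)]
      refine hI.congr _ _ fun z hz => ?_
      have := zpow_add_one_mul_pow_inv (z := z) (by rintro rfl; exact h0 hz)
        (by rintro rfl; exact h1 hz) p e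
      simpa using this

/-- A function that decays quadratically at infinity has no residue there. -/
theorem exists_residue_of_decay (p : ℤ) (e : ℕ) (hp : p + 2 ≤ e) :
    ∃ d : ℂ, ∀ (I : (ℂ → ℂ) → ℂ) (K : Set ℂ) (a : ℂ), IsContour I K a a → 0 ∉ K → 1 ∉ K →
      I (fun z => z ^ p * ((z - 1) ^ e)⁻¹) = d * (I (fun z => (z - 1)⁻¹) - I (fun z => z⁻¹)) := by
  induction e generalizing p with
  | zero =>
    refine ⟨0, fun I K a hI h0 h1 => ?_⟩
    have := hI.zpow_eq h0 p
    rw [if_neg (by omega)] at this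
    simpa using this
  | succ e ih =>
    -- The denominator now has exponent `e + 1`, so `e - 1` is the largest admissible exponent of
    -- `z`; `j` counts downwards from it.
    obtain ⟨j, rfl⟩ : ∃ j : ℕ, p = (e : ℤ) - 1 - j := ⟨(e - 1 - p).toNat, by omega⟩
    induction j with
    | zero =>
      rcases Nat.eq_zero_or_pos e with rfl | he
      · refine ⟨1, fun I K a hI h0 h1 => ?_⟩
        rw [one_mul, ← hI.sub (continuousOn_sub_inv h1) (continuousOn_inv_id h0)]
        refine hI.congr _ _ fun z hz => ?_
        have hz0 : z ≠ 0 := by rintro rfl; exact h0 hz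
        have hz1 : z - 1 ≠ 0 := sub_ne_zero.mpr (by rintro rfl; exact h1 hz)
        simp
        field_simp
        ring
      · refine ⟨0, fun I K a hI h0 h1 => ?_⟩
        rw [zero_mul]
        -- The derivative of $(z/(z-1))^e$ is $-e\,z^{e-1}(z-1)^{-e-1}$.
        refine hI.eq_zero (Q := fun z => -(e : ℂ)⁻¹ * (z ^ e * ((z - 1) ^ e)⁻¹))
          (continuousOn_zpow_mul_pow_inv h0 h1 _ _) fun z hz => ?_
        have hz0 : z ≠ 0 := by rintro rfl; exact h0 hz
        have hz1 : z - 1 ≠ 0 := sub_ne_zero.mpr (by rintro rfl; exact h1 hz)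
        have h2 : HasDerivAt (fun z : ℂ => (z - 1) ^ e) (e * (z - 1) ^ (e - 1)) z := by
          simpa using ((hasDerivAt_id z).sub_const (1 : ℂ)).fun_pow e
        refine (((hasDerivAt_pow e z).fun_mul (h2.fun_inv (pow_ne_zero _ hz1))).const_mul
          _).congr_deriv ?_
        obtain ⟨f, rfl⟩ : ∃ f, e = f + 1 := ⟨e - 1, by omega⟩
        have : ((f : ℂ) + 1) ≠ 0 := by exact_mod_cast Nat.succ_ne_zero f
        rw [show ((f + 1 : ℕ) : ℤ) - 1 - (0 : ℕ) = (f : ℤ) by push_cast; ring, zpow_natCast]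
        simp only [Nat.add_sub_cancel]
        push_cast
        field_simp
        ring
    | succ j ihj =>
      obtain ⟨d, hd⟩ := ihj (by omega)
      obtain ⟨d', hd'⟩ := ih ((e : ℤ) - 1 - (j + 1 : ℕ)) (by omega)
      refine ⟨d - d', fun I K a hI h0 h1 => ?_⟩
      rw [sub_mul, ← hd I K a hI h0 h1, ← hd' I K a hI h0 h1,
        ← hI.sub (continuousOn_zpow_mul_pow_inv h0 h1 _ _)
          (continuousOn_zpow_mul_pow_inv h0 h1 _ _)]
      refine hI.congr _ _ fun z hz => ?_
      have := zpow_add_one_mul_pow_inv (z := z) (by rintro rfl; exact h0 hz)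
        (by rintro rfl; exact h1 hz) ((e : ℤ) - 1 - (j + 1 : ℕ)) e
      rw [show (e : ℤ) - 1 - (j + 1 : ℕ) + 1 = (e : ℤ) - 1 - j by push_cast; ring] at this
      rw [this]; ring

variable {I J : (ℂ → ℂ) → ℂ} {K K' : Set ℂ} {a c : ℂ}

theorem continuousOn_eval_mul_pow_inv {K : Set ℂ} (h1 : (1 : ℂ) ∉ K) (b : Polynomial ℂ) (e : ℕ) :
    ContinuousOn (fun z : ℂ => b.eval z * ((z - 1) ^ e)⁻¹) K :=
  (Polynomial.continuous b).continuousOn.mul (IsContour.continuousOn_pow_inv h1)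

/-- Only the nonnegative part of a Laurent polynomial contributes to the residue at `1` against a
function with a pole only at `1` which vanishes at infinity. -/
theorem IsContour.integral_laurentPos (hI : IsContour I K a a) (h0 : (0 : ℂ) ∉ K)
    (h1 : (1 : ℂ) ∉ K) (hJ : IsContour J K' c c) (h0' : (0 : ℂ) ∉ K') (h1' : (1 : ℂ) ∉ K')
    (hI1 : I (fun z => (z - 1)⁻¹) = J (fun z => (z - 1)⁻¹))
    (hJ0 : J (fun z => z⁻¹) = J (fun z => (z - 1)⁻¹)) {t : Polynomial ℂ} {e : ℕ}
    (ht : t.natDegree < e) (b : Polynomial ℂ) (s : ℤ) :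
    I (fun z => t.eval z * ((z - 1) ^ e)⁻¹ * laurentPos b s z) =
      J (fun z => t.eval z * ((z - 1) ^ e)⁻¹ * (z ^ s * b.eval z)) := by
  have key : ∀ i ∈ Finset.range (t.natDegree + 1), ∀ j : ℕ,
      I (fun z => if 0 ≤ s + j then z ^ (s + i + j) * ((z - 1) ^ e)⁻¹ else 0) =
        J (fun z => z ^ (s + i + j) * ((z - 1) ^ e)⁻¹) := by
    intro i hi j
    rw [Finset.mem_range] at hi
    split_ifs with hs
    · obtain ⟨d, hd⟩ := exists_residue_of_nonneg (s + i + j).toNat e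
      have hc : (((s + i + j).toNat : ℕ) : ℤ) = s + i + j := Int.toNat_of_nonneg (by omega)
      rw [hc] at hd
      rw [hd I K a hI h0 h1, hd J K' c hJ h0' h1', hI1]
    -- Here $s+j\le-1$ and $i\le e-1$, so the exponent is at most $e-2$. The function decays
    -- quadratically, and its integral over `J`, which winds equally around $0$ and $1$, vanishes.
    · obtain ⟨d, hd⟩ := exists_residue_of_decay (s + i + j) e (by omega)
      rw [hd J K' c hJ h0' h1', hJ0, sub_self, mul_zero]
      simpa using hI.smul 0 fun _ => 0
  have hIcont : ∀ i j : ℕ, ContinuousOn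
      (fun z : ℂ => if 0 ≤ s + j then z ^ (s + i + j) * ((z - 1) ^ e)⁻¹ else 0) K := by
    intro i j
    split_ifs
    · exact continuousOn_zpow_mul_pow_inv h0 h1 _ _
    · exact continuousOn_const
  have hIc : ∀ i j : ℕ, ContinuousOn (fun z : ℂ => (t.coeff i * b.coeff j) *
      (if 0 ≤ s + j then z ^ (s + i + j) * ((z - 1) ^ e)⁻¹ else 0)) K :=
    fun i j => continuousOn_const.mul (hIcont i j)
  have hJc : ∀ i j : ℕ, ContinuousOn (fun z : ℂ => (t.coeff i * b.coeff j) *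
      (z ^ (s + i + j) * ((z - 1) ^ e)⁻¹)) K' :=
    fun i j => continuousOn_const.mul (continuousOn_zpow_mul_pow_inv h0' h1' _ _)
  rw [hI.congr _ (fun z => ∑ i ∈ Finset.range (t.natDegree + 1),
      ∑ j ∈ Finset.range (b.natDegree + 1), (t.coeff i * b.coeff j) *
        (if 0 ≤ s + j then z ^ (s + i + j) * ((z - 1) ^ e)⁻¹ else 0)),
    hJ.congr _ (fun z => ∑ i ∈ Finset.range (t.natDegree + 1),
      ∑ j ∈ Finset.range (b.natDegree + 1), (t.coeff i * b.coeff j) *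
        (z ^ (s + i + j) * ((z - 1) ^ e)⁻¹)),
    hI.sum _ (fun i _ => continuousOn_finsetSum _ fun j _ => hIc i j),
    hJ.sum _ (fun i _ => continuousOn_finsetSum _ fun j _ => hJc i j)]
  · refine Finset.sum_congr rfl fun i hi => ?_
    rw [hI.sum _ fun j _ => hIc i j, hJ.sum _ fun j _ => hJc i j]
    refine Finset.sum_congr rfl fun j _ => ?_
    rw [hI.smul, hJ.smul, key i hi j]
  · intro z hz
    have hz0 : z ≠ 0 := by rintro rfl; exact h0' hz
    simp only
    rw [Polynomial.eval_eq_sum_range, Polynomial.eval_eq_sum_range, Finset.mul_sum, Finset.sum_mul,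
      Finset.sum_mul_sum]
    refine Finset.sum_congr rfl fun i _ => Finset.sum_congr rfl fun j _ => ?_
    rw [zpow_add₀ hz0, zpow_add₀ hz0, zpow_natCast, zpow_natCast]
    ring
  · intro z hz
    have hz0 : z ≠ 0 := by rintro rfl; exact h0 hz
    simp only
    rw [Polynomial.eval_eq_sum_range, laurentPos, Finset.sum_mul,
      Finset.sum_mul_sum]
    refine Finset.sum_congr rfl fun i _ => Finset.sum_congr rfl fun j _ => ?_
    split_ifs with h
    · rw [← zpow_natCast z (s + j).toNat, Int.toNat_of_nonneg h,
        show s + i + (j : ℤ) = i + (s + j) by ring, zpow_add₀ hz0 (i : ℤ) (s + j),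
        zpow_natCast]
      ring
    · ring

/-- The inner integral of a Laurent polynomial against the Cauchy kernel. -/
theorem IsContour.cauchy_laurent (hJ : IsContour J K' c c) (h0 : (0 : ℂ) ∉ K')
    (hJ0 : J (fun z => z⁻¹) = 2 * Real.pi * Complex.I) {w : ℂ} (hw0 : w ≠ 0) (hw : w ∉ K')
    (hJw : J (fun z => (z - w)⁻¹) = 2 * Real.pi * Complex.I) (b : Polynomial ℂ) (s : ℤ) :
    J (fun z => z ^ s * b.eval z * (z - w)⁻¹) = 2 * Real.pi * Complex.I * laurentPos b s w := by
  rw [hJ.laurent_div_sub h0 hw0 hw, hJ0, hJw]; ring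

/-- Deformation of the outer contour around `1` to two contours on both sides of a circle. -/
theorem integral_laurentPos_eq {l r ρ : ℝ} (hlr : l < r) (hr : r ≤ 0) (hρ : 0 < ρ) {g : ℂ → ℂ}
    (hg : DifferentiableOn ℂ g (cutDomain l r)) (e : ℕ) (b : Polynomial ℂ) (s : ℤ)
    {I₁ I₂ I₃ I₄ : (ℂ → ℂ) → ℂ} {K₁ K₂ K₃ K₄ : Set ℂ} {c₁ c₂ c₃ c₄ : ℂ}
    (h₁ : IsContour I₁ K₁ c₁ c₁) (s₁ : K₁ ⊆ cutDomain l r) (n₁ : 1 ∉ K₁)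
    (e₁ : I₁ (fun z => z⁻¹) = 0) (f₁ : I₁ (fun z => (z - 1)⁻¹) = 2 * Real.pi * Complex.I)
    (h₂ : IsContour I₂ K₂ c₂ c₂) (s₂ : K₂ ⊆ cutDomain l r) (n₂ : 1 ∉ K₂)
    (r₂ : ∀ z ∈ K₂, ‖z‖ < ρ)
    (e₂ : I₂ (fun z => z⁻¹) = 2 * Real.pi * Complex.I) (f₂ : I₂ (fun z => (z - 1)⁻¹) = 0)
    (h₃ : IsContour I₃ K₃ c₃ c₃) (s₃ : K₃ ⊆ cutDomain l r) (n₃ : 1 ∉ K₃)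
    (r₃ : ∀ z ∈ K₃, ρ < ‖z‖)
    (e₃ : I₃ (fun z => z⁻¹) = 2 * Real.pi * Complex.I)
    (f₃ : I₃ (fun z => (z - 1)⁻¹) = 2 * Real.pi * Complex.I)
    (h₄ : IsContour I₄ K₄ c₄ c₄) (s₄ : K₄ ⊆ cutDomain l r) (n₄ : 1 ∉ K₄)
    (e₄ : I₄ (fun z => z⁻¹) = 2 * Real.pi * Complex.I)
    (f₄ : I₄ (fun z => (z - 1)⁻¹) = 2 * Real.pi * Complex.I) :
    2 * Real.pi * Complex.I * I₁ (fun w => g w * ((w - 1) ^ e)⁻¹ * laurentPos b s w) =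
      2 * Real.pi * Complex.I * I₄ (fun w => g w * ((w - 1) ^ e)⁻¹ * (w ^ s * b.eval w)) +
      I₃ (fun w => g w * ((w - 1) ^ e)⁻¹ * circ ρ (fun z => z ^ s * b.eval z * (z - w)⁻¹)) -
      I₂ (fun w => g w * ((w - 1) ^ e)⁻¹ * circ ρ (fun z => z ^ s * b.eval z * (z - w)⁻¹)) := by
  have hne : ∀ {K : Set ℂ}, K ⊆ cutDomain l r → ∀ z ∈ K, z ≠ 0 := fun hK z hz =>
    ne_zero_of_mem_cutDomain hr (hK hz)
  have hl : DifferentiableOn ℂ (fun w : ℂ => w ^ s * b.eval w) (cutDomain l r) := fun w hw =>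
    ((differentiableAt_zpow.mpr (Or.inl (ne_zero_of_mem_cutDomain hr hw))).mul
      b.differentiable.differentiableAt).differentiableWithinAt
  obtain ⟨c, d, -, hcd⟩ := exists_residues_cutDomain hlr hr e
    (h := fun w => g w * laurentPos b s w)
    (hg.mul (differentiable_laurentPos b s).differentiableOn)
  obtain ⟨c', d', -, hcd'⟩ := exists_residues_cutDomain hlr hr e
    (h := fun w => g w * (w ^ s * b.eval w)) (hg.mul hl)
  have comm : ∀ (I : (ℂ → ℂ) → ℂ) (u v : ℂ → ℂ), I (fun w => g w * u w * v w) =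
      I (fun w => g w * v w * u w) := fun I u v => by
    congr 1; ext w; ring
  have hcirc := circ_isContour hρ
  have h0s : (0 : ℂ) ∉ Metric.sphere (0 : ℂ) ρ := by simpa using hρ.ne
  -- For `w` inside the circle the Cauchy integral picks out the part with nonnegative exponents.
  have hin : I₂ (fun w => g w * ((w - 1) ^ e)⁻¹ * circ ρ (fun z => z ^ s * b.eval z * (z - w)⁻¹))
      = 2 * Real.pi * Complex.I * I₂ (fun w => g w * ((w - 1) ^ e)⁻¹ * laurentPos b s w) := by
    rw [← h₂.smul]
    refine h₂.congr _ _ fun w hw => ?_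
    rw [hcirc.cauchy_laurent h0s (circ_inv hρ) (hne s₂ w hw) (by simpa using (r₂ w hw).ne)
      (circ_sub_inv_of_lt (r₂ w hw))]
    ring
  have hpow : ∀ {K : Set ℂ}, (1 : ℂ) ∉ K → K ⊆ cutDomain l r →
      ContinuousOn (fun w => g w * ((w - 1) ^ e)⁻¹) K := fun h1 hK =>
    (hg.continuousOn.mono hK).mul (IsContour.continuousOn_pow_inv h1)
  -- For `w` outside the circle the Cauchy integral gives minus the part with negative exponents.
  have hout : I₃ (fun w => g w * ((w - 1) ^ e)⁻¹ * circ ρ (fun z => z ^ s * b.eval z * (z - w)⁻¹))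
      = 2 * Real.pi * Complex.I * (I₃ (fun w => g w * ((w - 1) ^ e)⁻¹ * laurentPos b s w) -
        I₃ (fun w => g w * ((w - 1) ^ e)⁻¹ * (w ^ s * b.eval w))) := by
    have hc : ContinuousOn (fun w => g w * ((w - 1) ^ e)⁻¹ * laurentPos b s w) K₃ :=
      (hpow n₃ s₃).mul (differentiable_laurentPos b s).continuous.continuousOn
    have hc' : ContinuousOn (fun w => g w * ((w - 1) ^ e)⁻¹ * (w ^ s * b.eval w)) K₃ :=
      (hpow n₃ s₃).mul (hl.continuousOn.mono s₃)
    rw [← h₃.sub hc hc', ← h₃.smul]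
    refine h₃.congr _ _ fun w hw => ?_
    rw [hcirc.laurent_div_sub h0s (hne s₃ w hw) (by simpa using (r₃ w hw).ne'), circ_inv hρ,
      circ_sub_inv_of_gt hρ (r₃ w hw)]
    ring
  -- All integrals become combinations of the two winding numbers, which are $(0,1)=(1,1)-(1,0)$ for
  -- $I_1$, $I_3$ and $I_2$, and are the same for $I_3$ and $I_4$.
  rw [hin, hout, comm I₁, comm I₂, comm I₃ _ (laurentPos b s), comm I₃ _ (fun w => w ^ s * _),
    comm I₄, hcd I₁ K₁ c₁ h₁ s₁ n₁, hcd I₂ K₂ c₂ h₂ s₂ n₂, hcd I₃ K₃ c₃ h₃ s₃ n₃,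
    hcd' I₃ K₃ c₃ h₃ s₃ n₃, hcd' I₄ K₄ c₄ h₄ s₄ n₄, e₁, e₂, e₃, e₄, f₁, f₂, f₃, f₄]
  ring

end AztecDiamond

namespace AztecDiamond

open Set Topology Filter MeasureTheory Matrix

variable {k : ℕ}

/-! ### Integer powers of the symbol -/

theorem natDegree_mul_le_of_le {R : Type*} [CommRing R]
    {A B : Matrix (Fin 2) (Fin 2) (Polynomial R)} {a b : ℕ}
    (hA : ∀ i j, (A i j).natDegree ≤ a) (hB : ∀ i j, (B i j).natDegree ≤ b) (i j : Fin 2) :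
    ((A * B) i j).natDegree ≤ a + b := by
  rw [Matrix.mul_apply, Fin.sum_univ_two]
  exact (Polynomial.natDegree_add_le_of_le
    (Polynomial.natDegree_mul_le_of_le (hA i 0) (hB 0 j))
    (Polynomial.natDegree_mul_le_of_le (hA i 1) (hB 1 j))).trans (by simp)

theorem natDegree_pow_le_of_le {A : Matrix (Fin 2) (Fin 2) (Polynomial ℂ)} {a : ℕ}
    (hA : ∀ i j, (A i j).natDegree ≤ a) (n : ℕ) (i j : Fin 2) :
    ((A ^ n) i j).natDegree ≤ a * n := by
  induction n generalizing i j with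
  | zero =>
    rw [pow_zero, Matrix.one_apply]
    split_ifs <;> simp
  | succ n ih => rw [pow_succ]; exact natDegree_mul_le_of_le ih hA i j

/-- The polynomial matrix `(z - 1)ᵏ Φ(z)` with complex coefficients. -/
noncomputable def complexSymbol (W : Weighting k) : Matrix (Fin 2) (Fin 2) (Polynomial ℂ) :=
  (scaledPhi W).map (Polynomial.map (algebraMap ℝ ℂ))

theorem natDegree_scaledPhi_le (W : Weighting k) (i j : Fin 2) :
    (scaledPhi W i j).natDegree ≤ k := by
  have h1 : ∀ (p : ℝ × ℝ) (i j : Fin 2), (polyFactor p i j).natDegree ≤ 1 := by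
    intro p i j
    fin_cases i <;> fin_cases j
    · change (Polynomial.X + Polynomial.C _ : Polynomial ℝ).natDegree ≤ 1
      compute_degree
    · change (Polynomial.C _ : Polynomial ℝ).natDegree ≤ 1
      exact (Polynomial.natDegree_C _).trans_le zero_le_one
    · change (Polynomial.C _ * Polynomial.X : Polynomial ℝ).natDegree ≤ 1
      compute_degree
    · change (Polynomial.X + Polynomial.C _ : Polynomial ℝ).natDegree ≤ 1
      compute_degree
  have key : ∀ L : List (ℝ × ℝ), ∀ i j, ((L.map polyFactor).prod i j).natDegree
      ≤ L.length := by
    intro L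
    induction L with
    | nil =>
      intro i j
      rw [List.map_nil, List.prod_nil, Matrix.one_apply]
      split_ifs <;> simp
    | cons p L ih =>
      intro i j
      rw [List.map_cons, List.prod_cons, List.length_cons, add_comm]
      exact natDegree_mul_le_of_le (h1 p) ih i j
  have h := key W.pairs i j
  rwa [W.length_pairs, ← scaledPhi_eq] at h

theorem natDegree_complexSymbol_le (W : Weighting k) (i j : Fin 2) :
    (complexSymbol W i j).natDegree ≤ k :=
  (Polynomial.natDegree_map_le (p := scaledPhi W i j)).trans (natDegree_scaledPhi_le W i j)

theorem eval_complexSymbol (W : Weighting k) (z : ℂ) :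
    (complexSymbol W).map (Polynomial.eval z) = symbol W z := by
  ext i j
  simp [complexSymbol, symbol, Polynomial.aeval_def, Polynomial.eval_map]

/-- A polynomial matrix which is a multiple of the `n`-th power of `Φ`. -/
noncomputable def symbolPow (W : Weighting k) (n : ℤ) : Matrix (Fin 2) (Fin 2) (Polynomial ℂ) :=
  if 0 ≤ n then complexSymbol W ^ n.natAbs else (complexSymbol W).adjugate ^ n.natAbs

theorem natDegree_symbolPow_le (W : Weighting k) (n : ℤ) (i j : Fin 2) :
    (symbolPow W n i j).natDegree ≤ k * n.natAbs := by
  unfold symbolPow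
  split_ifs
  · exact natDegree_pow_le_of_le (natDegree_complexSymbol_le W) _ i j
  · refine natDegree_pow_le_of_le (fun i j => ?_) _ i j
    rw [Matrix.adjugate_fin_two]
    fin_cases i <;> fin_cases j
    · exact natDegree_complexSymbol_le W 1 1
    · exact (Polynomial.natDegree_neg _).trans_le (natDegree_complexSymbol_le W 0 1)
    · exact (Polynomial.natDegree_neg _).trans_le (natDegree_complexSymbol_le W 1 0)
    · exact natDegree_complexSymbol_le W 0 0

theorem symbol_eq_smul_Phi (W : Weighting k) {z : ℂ} (h0 : z ≠ 0) (h1 : z ≠ 1) :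
    symbol W z = (z - 1) ^ k • Phi W z := map_scaledPhi W h0 h1

theorem Phi_eq_smul_symbol (W : Weighting k) {z : ℂ} (h0 : z ≠ 0) (h1 : z ≠ 1) :
    Phi W z = ((z - 1) ^ k)⁻¹ • symbol W z := by
  rw [symbol_eq_smul_Phi W h0 h1, smul_smul,
    inv_mul_cancel₀ (pow_ne_zero _ (sub_ne_zero.mpr h1)), one_smul]

theorem det_Phi (W : Weighting k) {z : ℂ} (h0 : z ≠ 0) (h1 : z ≠ 1) : (Phi W z).det = 1 := by
  have := pow_ne_zero k (sub_ne_zero.mpr h1)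
  rw [Phi_eq_smul_symbol W h0 h1, Matrix.det_smul, det_symbol, Fintype.card_fin]
  field_simp
  ring

theorem isUnit_det_Phi (W : Weighting k) {z : ℂ} (h0 : z ≠ 0) (h1 : z ≠ 1) :
    IsUnit (Phi W z).det := by rw [det_Phi W h0 h1]; exact isUnit_one

theorem Phi_inv (W : Weighting k) {z : ℂ} (h0 : z ≠ 0) (h1 : z ≠ 1) :
    (Phi W z)⁻¹ = ((z - 1) ^ k)⁻¹ • (symbol W z).adjugate := by
  rw [Matrix.inv_def, det_Phi W h0 h1, Ring.inverse_one, one_smul, Phi_eq_smul_symbol W h0 h1,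
    Matrix.adjugate_smul]
  simp

/-- As $\det\Phi=1$, the inverse is the adjugate. So negative powers too are polynomial matrices
divided by a power of $z-1$, with the exponent $k|n|$. -/
theorem Phi_zpow (W : Weighting k) {z : ℂ} (h0 : z ≠ 0) (h1 : z ≠ 1) (n : ℤ) :
    Phi W z ^ n = ((z - 1) ^ (k * n.natAbs))⁻¹ • (symbolPow W n).map (Polynomial.eval z) := by
  have hpow : ∀ (A : Matrix (Fin 2) (Fin 2) (Polynomial ℂ)) (m : ℕ),
      (A ^ m).map (Polynomial.eval z) = (A.map (Polynomial.eval z)) ^ m := fun A m =>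
    map_pow ((Polynomial.evalRingHom z).mapMatrix (m := Fin 2)) A m
  have hadj : ((complexSymbol W).adjugate).map (Polynomial.eval z) = (symbol W z).adjugate := by
    rw [← eval_complexSymbol]
    exact RingHom.map_adjugate (Polynomial.evalRingHom z) (complexSymbol W)
  unfold symbolPow
  split_ifs with h
  · obtain ⟨m, rfl⟩ := Int.eq_ofNat_of_zero_le h
    rw [zpow_natCast, Int.natAbs_natCast, hpow, eval_complexSymbol, Phi_eq_smul_symbol W h0 h1,
      smul_pow, inv_pow, pow_mul]
  · obtain ⟨m, rfl⟩ : ∃ m : ℕ, n = -m := ⟨(-n).toNat, by omega⟩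
    rw [← Matrix.inv_zpow', zpow_natCast, Int.natAbs_neg,
      Int.natAbs_natCast, hpow, hadj, Phi_inv W h0 h1, smul_pow, inv_pow, pow_mul]
    exact isUnit_det_Phi W h0 h1

/-! ### Spectral projections -/

/-- The spectral projection onto the eigenspace of the larger eigenvalue. -/
noncomputable def eigProj₁ (W : Weighting k) (z : ℂ) : Matrix (Fin 2) (Fin 2) ℂ :=
  (lam₁ W z - lam₂ W z)⁻¹ • (symbol W z - lam₂ W z • (1 : Matrix (Fin 2) (Fin 2) ℂ))

/-- The spectral projection onto the eigenspace of the smaller eigenvalue. -/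
noncomputable def eigProj₂ (W : Weighting k) (z : ℂ) : Matrix (Fin 2) (Fin 2) ℂ :=
  (lam₁ W z - lam₂ W z)⁻¹ • (lam₁ W z • (1 : Matrix (Fin 2) (Fin 2) ℂ) - symbol W z)

/-- The larger eigenvalue of `Φ`. -/
noncomputable def rhoLarge (W : Weighting k) (z : ℂ) : ℂ := lam₁ W z / (z - 1) ^ k

theorem rhoLarge_ne_zero {W : Weighting k} {z : ℂ} (hz : z ∈ hyperbolicSet W) (h1 : z ≠ 1) :
    rhoLarge W z ≠ 0 :=
  div_ne_zero (lam₁_ne_zero hz) (pow_ne_zero _ (sub_ne_zero.mpr h1))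

theorem eigProj_add {W : Weighting k} {z : ℂ} (hz : z ∈ hyperbolicSet W) :
    eigProj₁ W z + eigProj₂ W z = 1 := by
  rw [eigProj₁, eigProj₂, ← smul_add, show symbol W z - lam₂ W z • (1 : Matrix (Fin 2) (Fin 2) ℂ) +
    (lam₁ W z • 1 - symbol W z) = (lam₁ W z - lam₂ W z) • 1 by rw [sub_smul]; abel, smul_smul,
    inv_mul_cancel₀ (lam_sub_ne_zero hz), one_smul]

theorem differentiableOn_symbol_apply (W : Weighting k) (i j : Fin 2) (U : Set ℂ) :
    DifferentiableOn ℂ (fun z => symbol W z i j) U :=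
  (Polynomial.differentiable_aeval (𝕜 := ℂ) (scaledPhi W i j)).differentiableOn

theorem differentiableOn_eigProj₁ (W : Weighting k) (i j : Fin 2) :
    DifferentiableOn ℂ (fun z => eigProj₁ W z i j) (hyperbolicSet W) := by
  have h : (fun z => eigProj₁ W z i j) = fun z => (lam₁ W z - lam₂ W z)⁻¹ *
      (symbol W z i j - lam₂ W z * (1 : Matrix (Fin 2) (Fin 2) ℂ) i j) := by
    ext z; simp [eigProj₁]
  rw [h]
  exact (((differentiableOn_lam₁ W).sub (differentiableOn_lam₂ W)).inv fun z hz =>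
    lam_sub_ne_zero hz).mul ((differentiableOn_symbol_apply W i j _).sub
      ((differentiableOn_lam₂ W).mul_const _))

theorem differentiableOn_eigProj₂ (W : Weighting k) (i j : Fin 2) :
    DifferentiableOn ℂ (fun z => eigProj₂ W z i j) (hyperbolicSet W) := by
  have h : (fun z => eigProj₂ W z i j) = fun z => (lam₁ W z - lam₂ W z)⁻¹ *
      (lam₁ W z * (1 : Matrix (Fin 2) (Fin 2) ℂ) i j - symbol W z i j) := by
    ext z; simp [eigProj₂]
  rw [h]
  exact (((differentiableOn_lam₁ W).sub (differentiableOn_lam₂ W)).inv fun z hz =>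
    lam_sub_ne_zero hz).mul (((differentiableOn_lam₁ W).mul_const _).sub
      (differentiableOn_symbol_apply W i j _))

/-- The Cayley–Hamilton theorem; it makes `eigProj₁` and `eigProj₂` eigenprojections without any
choice of eigenvectors. -/
theorem symbol_mul_self (W : Weighting k) (z : ℂ) :
    symbol W z * symbol W z = (lam₁ W z + lam₂ W z) • symbol W z -
      (lam₁ W z * lam₂ W z) • (1 : Matrix (Fin 2) (Fin 2) ℂ) := by
  rw [lam_add, lam_mul, ← trace_symbol, ← det_symbol W]
  ext i j
  fin_cases i <;> fin_cases j <;>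
    simp [Matrix.mul_apply, Fin.sum_univ_two, Matrix.trace, Matrix.det_fin_two] <;> ring

theorem eigProj₁_mul_symbol (W : Weighting k) (z : ℂ) :
    eigProj₁ W z * symbol W z = lam₁ W z • eigProj₁ W z := by
  rw [eigProj₁, smul_mul_assoc, sub_mul, symbol_mul_self, smul_comm, smul_mul_assoc, one_mul]
  congr 1
  module

theorem eigProj₂_mul_symbol (W : Weighting k) (z : ℂ) :
    eigProj₂ W z * symbol W z = lam₂ W z • eigProj₂ W z := by
  rw [eigProj₂, smul_mul_assoc, sub_mul, symbol_mul_self, smul_comm, smul_mul_assoc, one_mul]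
  congr 1
  module

theorem mul_zpow_of_mul_eq_smul {P A : Matrix (Fin 2) (Fin 2) ℂ} (hA : IsUnit A.det) {c : ℂ}
    (hc : c ≠ 0) (h : P * A = c • P) (n : ℤ) : P * A ^ n = c ^ n • P := by
  have hpow : ∀ m : ℕ, P * A ^ m = c ^ m • P := by
    intro m
    induction m with
    | zero => simp
    | succ m ih => rw [pow_succ, ← mul_assoc, ih, smul_mul_assoc, h, smul_smul, ← pow_succ]
  rcases Int.eq_nat_or_neg n with ⟨m, rfl | rfl⟩
  · simpa using hpow m
  · have h2 : c ^ m • (P * A ^ (-(m : ℤ))) = P := by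
      rw [← smul_mul_assoc, ← hpow m, mul_assoc, ← zpow_natCast A m, ← Matrix.zpow_add hA,
        add_neg_cancel, zpow_zero, mul_one]
    have h3 : P * A ^ (-(m : ℤ)) = (c ^ m)⁻¹ • (c ^ m • (P * A ^ (-(m : ℤ)))) := by
      rw [smul_smul, inv_mul_cancel₀ (pow_ne_zero _ hc), one_smul]
    rw [h3, h2, _root_.zpow_neg, zpow_natCast]

theorem eigProj₁_mul_Phi_zpow {W : Weighting k} {z : ℂ} (hz : z ∈ hyperbolicSet W) (h0 : z ≠ 0)
    (h1 : z ≠ 1) (n : ℤ) : eigProj₁ W z * Phi W z ^ n = rhoLarge W z ^ n • eigProj₁ W z := by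
  refine mul_zpow_of_mul_eq_smul (isUnit_det_Phi W h0 h1) (rhoLarge_ne_zero hz h1) ?_ n
  rw [Phi_eq_smul_symbol W h0 h1, mul_smul_comm, eigProj₁_mul_symbol, smul_smul, rhoLarge,
    div_eq_inv_mul]

theorem eigProj₂_mul_Phi_zpow {W : Weighting k} {z : ℂ} (hz : z ∈ hyperbolicSet W) (h0 : z ≠ 0)
    (h1 : z ≠ 1) (n : ℤ) : eigProj₂ W z * Phi W z ^ n = rhoLarge W z ^ (-n) • eigProj₂ W z := by
  rw [_root_.zpow_neg, ← _root_.inv_zpow]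
  refine mul_zpow_of_mul_eq_smul (isUnit_det_Phi W h0 h1)
    (inv_ne_zero (rhoLarge_ne_zero hz h1)) ?_ n
  rw [Phi_eq_smul_symbol W h0 h1, mul_smul_comm, eigProj₂_mul_symbol, smul_smul, rhoLarge,
    ← lam₂_div W hz h1, div_eq_inv_mul]

theorem Phi_zpow_eq_add {W : Weighting k} {z : ℂ} (hz : z ∈ hyperbolicSet W) (h0 : z ≠ 0)
    (h1 : z ≠ 1) (n : ℤ) :
    Phi W z ^ n = rhoLarge W z ^ n • eigProj₁ W z + rhoLarge W z ^ (-n) • eigProj₂ W z := by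
  rw [← eigProj₁_mul_Phi_zpow hz h0 h1, ← eigProj₂_mul_Phi_zpow hz h0 h1, ← add_mul,
    eigProj_add hz, one_mul]

theorem eig_Phi {W : Weighting k} {z : ℂ} (hz : z ∈ hyperbolicSet W) (h0 : z ≠ 0) (h1 : z ≠ 1) :
    eigLarge (Phi W z) = rhoLarge W z ∧ eigSmall (Phi W z) = (rhoLarge W z)⁻¹ := by
  have hk1 := pow_ne_zero k (sub_ne_zero.mpr h1)
  rw [rhoLarge, ← lam₂_div W hz h1]
  refine eig_eq_of_norm_lt ?_ ?_ ?_
  · rw [norm_div, norm_div]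
    exact div_lt_div_of_pos_right ((mem_hyperbolicSet_iff W z).mp hz) (norm_pos_iff.mpr hk1)
  · rw [trace_Phi W h0 h1, ← lam_add, add_div]
  · rw [det_Phi W h0 h1, div_mul_div_comm, lam_mul]
    rw [div_eq_one_iff_eq (mul_ne_zero hk1 hk1)]; ring

theorem rho_eq_of_mem_slitPlane (hk : 1 ≤ k) {W : Weighting k} {z : ℂ} (hz : z ∈ Complex.slitPlane)
    (h1 : z ≠ 1) : rho₁ W z = rhoLarge W z ∧ rho₂ W z = (rhoLarge W z)⁻¹ := by
  rw [rho₁, rho₂, extendFromAbove, extendFromAbove, if_pos hz, if_pos hz]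
  exact eig_Phi (slitPlane_subset_hyperbolicSet hk W hz) (Complex.slitPlane_ne_zero hz) h1

/-- The eigenvector matrix only enters through the spectral projections. -/
theorem Diagonalizes.exists_finite (hk : 1 ≤ k) {W : Weighting k}
    {E : ℂ → Matrix (Fin 2) (Fin 2) ℂ} (hE : Diagonalizes W E) :
    ∃ S : Set ℂ, S.Finite ∧ ∀ z ∈ Complex.slitPlane, z ≠ 1 → z ∉ S →
      rho₁ W z = rhoLarge W z ∧ rho₂ W z = (rhoLarge W z)⁻¹ ∧
      proj₁ E z = eigProj₁ W z ∧ proj₂ E z = eigProj₂ W z := by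
  obtain ⟨S, hS, h⟩ := hE
  refine ⟨S, hS, fun z hz h1 hzS => ?_⟩
  obtain ⟨e₁, e₂⟩ := rho_eq_of_mem_slitPlane hk (W := W) hz h1
  obtain ⟨hu, hΦ⟩ := h z hzS
  have h0 := Complex.slitPlane_ne_zero hz
  have hz' := slitPlane_subset_hyperbolicSet hk W hz
  have hk1 := pow_ne_zero k (sub_ne_zero.mpr h1)
  refine ⟨e₁, e₂, ?_⟩
  have hl₁ : lam₁ W z = (z - 1) ^ k * rho₁ W z := by rw [e₁, rhoLarge]; field_simp
  have hl₂ : lam₂ W z = (z - 1) ^ k * rho₂ W z := by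
    rw [e₂, rhoLarge, ← lam₂_div W hz' h1]; field_simp
  have hne := lam_sub_ne_zero hz'
  have hEE : E z * (E z)⁻¹ = 1 := Matrix.mul_nonsing_inv _ hu
  have hconj : ∀ c d : ℂ, E z * Matrix.diagonal ![c, d] * (E z)⁻¹ = c • proj₁ E z + d • proj₂ E z := by
    intro c d
    rw [proj₁, proj₂, ← smul_mul_assoc c, ← smul_mul_assoc d, ← mul_smul_comm c,
      ← mul_smul_comm d, ← add_mul, ← mul_add]
    congr 2
    ext i j
    fin_cases i <;> fin_cases j <;> simp
  have hsum : proj₁ E z + proj₂ E z = 1 := by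
    have h := hconj 1 1
    rw [one_smul, one_smul] at h
    rw [← h, show Matrix.diagonal ![(1 : ℂ), 1] = 1 by
      ext i j; fin_cases i <;> fin_cases j <;> simp, mul_one, hEE]
  -- Together with `hsum` and $\lambda_1\ne\lambda_2$ this determines both projections, so the
  -- freedom in choosing `E` disappears.
  have hsym : symbol W z = lam₁ W z • proj₁ E z + lam₂ W z • proj₂ E z := by
    rw [symbol_eq_smul_Phi W h0 h1, hΦ, hconj, smul_add, smul_smul, smul_smul, ← hl₁, ← hl₂]
  constructor
  · rw [eigProj₁, hsym, ← hsum, smul_add, show lam₁ W z • proj₁ E z + lam₂ W z • proj₂ E z -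
      (lam₂ W z • proj₁ E z + lam₂ W z • proj₂ E z) = (lam₁ W z - lam₂ W z) • proj₁ E z by module,
      smul_smul, inv_mul_cancel₀ hne, one_smul]
  · rw [eigProj₂, hsym, ← hsum, smul_add, show lam₁ W z • proj₁ E z + lam₁ W z • proj₂ E z -
      (lam₁ W z • proj₁ E z + lam₂ W z • proj₂ E z) = (lam₁ W z - lam₂ W z) • proj₂ E z by module,
      smul_smul, inv_mul_cancel₀ hne, one_smul]

end AztecDiamond

namespace AztecDiamond

open Set Topology Filter MeasureTheory Matrix

variable {k : ℕ}

/-! ### Systems of contours -/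

/-- A closed contour in the cut plane with winding numbers `u` around `0` and `v` around `1`. -/
structure IsLoop (l r : ℝ) (I : (ℂ → ℂ) → ℂ) (K : Set ℂ) (c u v : ℂ) : Prop where
  isContour : IsContour I K c c
  subset : K ⊆ cutDomain l r
  one_notMem : 1 ∉ K
  inv_eq : I (fun z => z⁻¹) = 2 * Real.pi * Complex.I * u
  sub_inv_eq : I (fun z => (z - 1)⁻¹) = 2 * Real.pi * Complex.I * v

/-- A closed contour that goes around `0`, `1` and the set `K'`. -/
structure IsOuterLoop (J : (ℂ → ℂ) → ℂ) (K : Set ℂ) (c : ℂ) (K' : Set ℂ) : Prop where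
  isContour : IsContour J K c c
  zero_notMem : 0 ∉ K
  one_notMem : 1 ∉ K
  notMem : ∀ w ∈ K', w ∉ K
  inv_eq : J (fun z => z⁻¹) = 2 * Real.pi * Complex.I
  sub_inv_one_eq : J (fun z => (z - 1)⁻¹) = 2 * Real.pi * Complex.I
  sub_inv_eq : ∀ w ∈ K', J (fun z => (z - w)⁻¹) = 2 * Real.pi * Complex.I

theorem two_pi_I_ne_zero : (2 * Real.pi * Complex.I : ℂ) ≠ 0 := Complex.two_pi_I_ne_zero

/-- A contour that misses the segment from $0$ to $1$ has the same winding number around both end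
points. -/
theorem exists_real_mem_Ioo_of_sub_inv_ne {I : (ℂ → ℂ) → ℂ} {K : Set ℂ} {c : ℂ}
    (hI : IsContour I K c c) (h0 : (0 : ℂ) ∉ K) (h1 : (1 : ℂ) ∉ K)
    (h : I (fun z => (z - 1)⁻¹) ≠ I (fun z => z⁻¹)) : ∃ x ∈ Ioo (0 : ℝ) 1, (x : ℂ) ∈ K := by
  by_contra! hc
  refine h (hI.sub_inv_eq_inv fun z hz x hx hzx => ?_)
  rw [mul_one] at hzx
  subst hzx
  refine hc x ⟨hx.1.lt_of_ne ?_, hx.2.lt_of_ne ?_⟩ hz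
  · rintro rfl; exact h0 (by simpa using hz)
  · rintro rfl; exact h1 (by simpa using hz)

/-- A contour that misses the ray from $1$ to infinity does not wind around $1$. -/
theorem exists_real_mem_Ioi_of_sub_inv_ne {I : (ℂ → ℂ) → ℂ} {K : Set ℂ} {c : ℂ}
    (hI : IsContour I K c c) (h1 : (1 : ℂ) ∉ K)
    (h : I (fun z => (z - 1)⁻¹) ≠ 0) : ∃ x ∈ Ioi (1 : ℝ), (x : ℂ) ∈ K := by
  by_contra! hc
  refine h (hI.sub_inv_eq_zero one_ne_zero fun z hz x hx hzx => ?_)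
  rw [mul_one] at hzx
  subst hzx
  refine hc x (hx.lt_of_ne ?_) hz
  rintro rfl; exact h1 (by simpa using hz)

theorem SimpleContour.Encloses.integral_eq {γ : SimpleContour} {a : ℂ} (h : γ.Encloses a) :
    γ.integral (fun z => (z - a)⁻¹) = 2 * Real.pi * Complex.I := by
  have := h.2
  rw [SimpleContour.winding, inv_mul_eq_one₀ two_pi_I_ne_zero] at this
  exact this.symm

theorem SimpleContour.Excludes.integral_eq {γ : SimpleContour} {a : ℂ} (h : γ.Excludes a) :
    γ.integral (fun z => (z - a)⁻¹) = 0 := by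
  have := h.2
  rw [SimpleContour.winding, mul_eq_zero] at this
  exact this.resolve_left (inv_ne_zero two_pi_I_ne_zero)

/-- The winding numbers force a crossing of $(0,1)$ and one of $(1,\infty)$. As there are only two
real points, none is left for the negative axis. -/
theorem trace_subset_slitPlane {γ : SimpleContour} (h1 : γ.Encloses 1) (h0 : γ.Excludes 0)
    (hr : γ.realPoints.ncard = 2) : γ.trace ⊆ Complex.slitPlane := by
  have e0 := h0.integral_eq
  simp only [sub_zero] at e0
  obtain ⟨x, hx, hxγ⟩ := exists_real_mem_Ioo_of_sub_inv_ne γ.isContour h0.1 h1.1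
    (by rw [h1.integral_eq, e0]; exact two_pi_I_ne_zero)
  obtain ⟨y, hy, hyγ⟩ := exists_real_mem_Ioi_of_sub_inv_ne γ.isContour h1.1
    (by rw [h1.integral_eq]; exact two_pi_I_ne_zero)
  rw [mem_Ioi] at hy
  have hfin : γ.realPoints.Finite := Set.finite_of_ncard_ne_zero (by rw [hr]; norm_num)
  have hpair : ({x, y} : Set ℝ) = γ.realPoints := by
    refine Set.eq_of_subset_of_ncard_le ?_ ?_ hfin
    · rintro z (rfl | rfl)
      · exact hxγ
      · exact hyγ
    · rw [hr, Set.ncard_pair (by linarith [hx.2] : x ≠ y)]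
  intro z hz
  by_cases him : z.im = 0
  · have hzr : (z.re : ℂ) = z := Complex.ext (by simp) (by simp [him])
    have : z.re ∈ ({x, y} : Set ℝ) := by
      rw [hpair]
      change (z.re : ℂ) ∈ γ.trace
      rwa [hzr]
    left
    rcases this with h | h
    · rw [h]; exact hx.1
    · rw [mem_singleton_iff.mp h]; linarith
  · exact Or.inr him

theorem AdmissiblePair.isLoop {γ₁ γ₀₁ : SimpleContour} (h : AdmissiblePair γ₁ γ₀₁) (l r : ℝ) :
    IsLoop l r γ₁.integral γ₁.trace (γ₁.toFun 0) 0 1 where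
  isContour := γ₁.isContour
  subset := (trace_subset_slitPlane h.1 h.2.1 h.2.2.1).trans subset_union_left
  one_notMem := h.1.1
  inv_eq := by simpa using h.2.1.integral_eq
  sub_inv_eq := by rw [h.1.integral_eq, mul_one]

theorem AdmissiblePair.isOuterLoop {γ₁ γ₀₁ : SimpleContour} (h : AdmissiblePair γ₁ γ₀₁) :
    IsOuterLoop γ₀₁.integral γ₀₁.trace (γ₀₁.toFun 0) γ₁.trace where
  isContour := γ₀₁.isContour
  zero_notMem := h.2.2.2.1.1
  one_notMem := h.2.2.2.2.1.1
  notMem w hw := (h.2.2.2.2.2.1 w hw).1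
  inv_eq := by simpa using h.2.2.2.1.integral_eq
  sub_inv_one_eq := h.2.2.2.2.1.integral_eq
  sub_inv_eq w hw := (h.2.2.2.2.2.1 w hw).integral_eq

theorem AdmissibleSmooth.isLoop {W : Weighting k} {l : ℕ} {γ : SimpleContour}
    (h : AdmissibleSmooth W l γ) :
    IsLoop (branchPoint W (2 * l)) (branchPoint W (2 * l - 1)) γ.integral γ.trace (γ.toFun 0)
      1 1 where
  isContour := γ.isContour
  subset := by
    obtain ⟨-, -, a, ha, b, hb, hab⟩ := h
    rw [mem_Ioi] at hb
    intro z hz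
    by_cases him : z.im = 0
    · have hzr : (z.re : ℂ) = z := Complex.ext (by simp) (by simp [him])
      have : z.re ∈ γ.realPoints := by
        change (z.re : ℂ) ∈ γ.trace
        rwa [hzr]
      rw [hab] at this
      rcases this with h | h
      · exact Or.inr ⟨him, by rw [h]; exact ha⟩
      · left; left
        rw [mem_singleton_iff.mp h]; linarith
    · exact Or.inl (Or.inr him)
  one_notMem := h.2.1.1
  inv_eq := by simpa using h.1.integral_eq
  sub_inv_eq := by rw [h.2.1.integral_eq, mul_one]

/-- The points of an admissible contour on the cut. -/
theorem AdmissibleSmooth.exists_mem_slitPlane {W : Weighting k} {l : ℕ} {γ : SimpleContour}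
    (h : AdmissibleSmooth W l γ) : ∃ a : ℂ, ∀ z ∈ γ.trace, z ≠ a → z ∈ Complex.slitPlane := by
  obtain ⟨-, -, a, ha, b, hb, hab⟩ := h
  rw [mem_Ioi] at hb
  refine ⟨a, fun z hz hza => ?_⟩
  by_cases him : z.im = 0
  · have hzr : (z.re : ℂ) = z := Complex.ext (by simp) (by simp [him])
    have : z.re ∈ γ.realPoints := by
      change (z.re : ℂ) ∈ γ.trace
      rwa [hzr]
    rw [hab] at this
    rcases this with h | h
    · exact absurd (by rw [← hzr, h]) hza
    · left
      rw [mem_singleton_iff.mp h]; linarith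
  · exact Or.inr him

theorem cutDomain_subset_hyperbolicSet (hk : 1 ≤ k) {W : Weighting k} {l : ℕ}
    (hl : IsLoopIndex W l) :
    cutDomain (branchPoint W (2 * l)) (branchPoint W (2 * l - 1)) ⊆ hyperbolicSet W := by
  rintro z (hz | ⟨him, hre⟩)
  · exact slitPlane_subset_hyperbolicSet hk W hz
  · have hzr : (z.re : ℂ) = z := Complex.ext (by simp) (by simp [him])
    rw [← hzr]
    exact mem_hyperbolicSet_of_mem_gap hk hl hre

/-! ### The double contour integral -/

section double

variable {l r ρ : ℝ} {I₁ I₂ I₃ I₄ J : (ℂ → ℂ) → ℂ} {K₁ K₂ K₃ K₄ K : Set ℂ} {c₁ c₂ c₃ c₄ c : ℂ}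
  {g G H : Fin 2 → ℂ → ℂ} {b : Fin 2 → Polynomial ℂ} {e : ℕ} {s : ℤ}

/-- For `w` on the inner contour the `z`-integral is evaluated in closed form, because `H` is a
Laurent polynomial. The double integral thus becomes a single one, independent of the choice of the
outer contour. -/
theorem double_integral_eq (hr : r ≤ 0) (h₁ : IsLoop l r I₁ K₁ c₁ 0 1)
    (hJ : IsOuterLoop J K c K₁) (hH : ∀ a, ∀ z, z ≠ 0 → z ≠ 1 → H a z = z ^ s * (b a).eval z) :
    I₁ (fun w => J (fun z => ∑ a, G a w * (H a z * (z - w)⁻¹))) =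
      2 * Real.pi * Complex.I * I₁ (fun w => ∑ a, G a w * laurentPos (b a) s w) := by
  rw [← h₁.isContour.smul]
  refine h₁.isContour.congr _ _ fun w hw => ?_
  have hw0 := ne_zero_of_mem_cutDomain hr (h₁.subset hw)
  have hc : ∀ a, ContinuousOn (fun z => G a w * (z ^ s * (b a).eval z * (z - w)⁻¹)) K := fun a =>
    continuousOn_const.mul (((continuousOn_zpow_id s hJ.zero_notMem).mul
      (b a).continuous.continuousOn).mul (continuousOn_sub_inv (hJ.notMem w hw)))
  rw [hJ.isContour.congr _ (fun z => ∑ a, G a w * (z ^ s * (b a).eval z * (z - w)⁻¹)),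
    hJ.isContour.sum _ fun a _ => hc a, Finset.mul_sum]
  · refine Finset.sum_congr rfl fun a _ => ?_
    rw [hJ.isContour.smul, hJ.isContour.cauchy_laurent hJ.zero_notMem hJ.inv_eq hw0
      (hJ.notMem w hw) (hJ.sub_inv_eq w hw)]
    ring
  · intro z hz
    refine Finset.sum_congr rfl fun a _ => ?_
    rw [hH a z (by rintro rfl; exact hJ.zero_notMem hz) (by rintro rfl; exact hJ.one_notMem hz)]

/-- The scalar deformation summed over the matrix index `a`. The first term on the right becomes the
smooth kernel, the second the remainder. -/
theorem integral_sum_laurentPos_eq (hlr : l < r) (hr : r ≤ 0) (hρ : 0 < ρ) (hρ1 : ρ ≠ 1)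
    (hg : ∀ a, DifferentiableOn ℂ (g a) (cutDomain l r))
    (h₁ : IsLoop l r I₁ K₁ c₁ 0 1) (h₂ : IsLoop l r I₂ K₂ c₂ 1 0) (r₂ : ∀ z ∈ K₂, ‖z‖ < ρ)
    (h₃ : IsLoop l r I₃ K₃ c₃ 1 1) (r₃ : ∀ z ∈ K₃, ρ < ‖z‖) (h₄ : IsLoop l r I₄ K₄ c₄ 1 1)
    (hG : ∀ a, ∀ w ∈ cutDomain l r, w ≠ 1 → G a w = g a w * ((w - 1) ^ e)⁻¹)
    (hH : ∀ a, ∀ z, z ≠ 0 → z ≠ 1 → H a z = z ^ s * (b a).eval z) :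
    2 * Real.pi * Complex.I * I₁ (fun w => ∑ a, G a w * laurentPos (b a) s w) =
      2 * Real.pi * Complex.I * I₄ (fun w => ∑ a, G a w * H a w) +
      ∑ a, (I₃ (fun w => G a w * circ ρ (fun z => H a z * (z - w)⁻¹)) -
        I₂ (fun w => G a w * circ ρ (fun z => H a z * (z - w)⁻¹))) := by
  have hcirc : ∀ a w, circ ρ (fun z => H a z * (z - w)⁻¹) =
      circ ρ (fun z => z ^ s * (b a).eval z * (z - w)⁻¹) := fun a w => by
    refine (circ_isContour hρ).congr _ _ fun z hz => ?_
    rw [mem_sphere_zero_iff_norm] at hz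
    rw [hH a z (by rintro rfl; rw [norm_zero] at hz; exact hρ.ne hz)
      (by rintro rfl; rw [norm_one] at hz; exact hρ1 hz.symm)]
  have hGc : ∀ a, ∀ {K : Set ℂ}, K ⊆ cutDomain l r → 1 ∉ K →
      ContinuousOn (fun w => g a w * ((w - 1) ^ e)⁻¹) K := fun a K hK h1 =>
    ((hg a).continuousOn.mono hK).mul (IsContour.continuousOn_pow_inv h1)
  have c₁' : ∀ a, ContinuousOn (fun w => g a w * ((w - 1) ^ e)⁻¹ * laurentPos (b a) s w) K₁ :=
    fun a => (hGc a h₁.subset h₁.one_notMem).mul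
      (differentiable_laurentPos (b a) s).continuous.continuousOn
  have c₄' : ∀ a, ContinuousOn
      (fun w => g a w * ((w - 1) ^ e)⁻¹ * (w ^ s * (b a).eval w)) K₄ := fun a =>
    (hGc a h₄.subset h₄.one_notMem).mul ((continuousOn_zpow_id s fun h =>
      ne_zero_of_mem_cutDomain hr (h₄.subset h) rfl).mul (b a).continuous.continuousOn)
  rw [h₁.isContour.congr _ (fun w => ∑ a, g a w * ((w - 1) ^ e)⁻¹ * laurentPos (b a) s w),
    h₄.isContour.congr _ (fun w => ∑ a, g a w * ((w - 1) ^ e)⁻¹ * (w ^ s * (b a).eval w)),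
    h₁.isContour.sum _ fun a _ => c₁' a, h₄.isContour.sum _ fun a _ => c₄' a, Finset.mul_sum,
    Finset.mul_sum, ← Finset.sum_add_distrib]
  · refine Finset.sum_congr rfl fun a _ => ?_
    rw [h₃.isContour.congr _ (fun w => g a w * ((w - 1) ^ e)⁻¹ *
        circ ρ (fun z => z ^ s * (b a).eval z * (z - w)⁻¹)),
      h₂.isContour.congr _ (fun w => g a w * ((w - 1) ^ e)⁻¹ *
        circ ρ (fun z => z ^ s * (b a).eval z * (z - w)⁻¹)),
      integral_laurentPos_eq hlr hr hρ (hg a) e (b a) s h₁.isContour h₁.subset h₁.one_notMem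
        (by simpa using h₁.inv_eq) (by simpa using h₁.sub_inv_eq) h₂.isContour h₂.subset
        h₂.one_notMem r₂ (by simpa using h₂.inv_eq) (by simpa using h₂.sub_inv_eq) h₃.isContour
        h₃.subset h₃.one_notMem r₃ (by simpa using h₃.inv_eq) (by simpa using h₃.sub_inv_eq)
        h₄.isContour h₄.subset h₄.one_notMem (by simpa using h₄.inv_eq)
        (by simpa using h₄.sub_inv_eq)]
    · ring
    · intro w hw
      simp only [hcirc, hG a w (h₂.subset hw) (by rintro rfl; exact h₂.one_notMem hw)]
    · intro w hw
      simp only [hcirc, hG a w (h₃.subset hw) (by rintro rfl; exact h₃.one_notMem hw)]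
  · intro w hw
    have h0 := ne_zero_of_mem_cutDomain hr (h₄.subset hw)
    have h1 : w ≠ 1 := by rintro rfl; exact h₄.one_notMem hw
    refine Finset.sum_congr rfl fun a _ => ?_
    rw [hG a w (h₄.subset hw) h1, hH a w h0 h1]
  · intro w hw
    have h1 : w ≠ 1 := by rintro rfl; exact h₁.one_notMem hw
    refine Finset.sum_congr rfl fun a _ => ?_
    rw [hG a w (h₁.subset hw) h1]

/-- If `G` and `G'` come from the two sheets, their sum is rational with its only pole at $1$ and
vanishes at infinity. Then restricting `H` to its nonnegative exponents makes no difference on a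
contour around $0$ and $1$. This relates the remainders on the two sheets. -/
theorem integral_add_laurentPos_eq (hr : r ≤ 0) {G' g' : Fin 2 → ℂ → ℂ} {e' e'' : ℕ}
    {t : Fin 2 → Polynomial ℂ}
    (hg : ∀ a, DifferentiableOn ℂ (g a) (cutDomain l r))
    (hg' : ∀ a, DifferentiableOn ℂ (g' a) (cutDomain l r))
    (h₁ : IsLoop l r I₁ K₁ c₁ 0 1) (hJ : IsOuterLoop J K c K₁)
    (hG : ∀ a, ∀ w ∈ cutDomain l r, w ≠ 1 → G a w = g a w * ((w - 1) ^ e)⁻¹)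
    (hG' : ∀ a, ∀ w ∈ cutDomain l r, w ≠ 1 → G' a w = g' a w * ((w - 1) ^ e')⁻¹)
    (ht : ∀ a, (t a).natDegree < e'')
    (hsum : ∀ a, ∀ w ∈ cutDomain l r, w ≠ 1 → G a w + G' a w = (t a).eval w * ((w - 1) ^ e'')⁻¹)
    (hH : ∀ a, ∀ z, z ≠ 0 → z ≠ 1 → H a z = z ^ s * (b a).eval z) :
    I₁ (fun w => ∑ a, G a w * laurentPos (b a) s w) +
      I₁ (fun w => ∑ a, G' a w * laurentPos (b a) s w) =
      J (fun z => ∑ a, (t a).eval z * ((z - 1) ^ e'')⁻¹ * H a z) := by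
  have hc : ∀ {g G : Fin 2 → ℂ → ℂ} {e : ℕ}, (∀ a, DifferentiableOn ℂ (g a) (cutDomain l r)) →
      (∀ a, ∀ w ∈ cutDomain l r, w ≠ 1 → G a w = g a w * ((w - 1) ^ e)⁻¹) →
      ContinuousOn (fun w => ∑ a, G a w * laurentPos (b a) s w) K₁ := by
    intro g G e hg hG
    refine continuousOn_finsetSum _ fun a _ => ContinuousOn.mul ?_
      (differentiable_laurentPos (b a) s).continuous.continuousOn
    refine (((hg a).continuousOn.mono h₁.subset).mul
      (IsContour.continuousOn_pow_inv h₁.one_notMem (n := e))).congr fun w hw => ?_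
    exact hG a w (h₁.subset hw) (by rintro rfl; exact h₁.one_notMem hw)
  have h0 : (0 : ℂ) ∉ K₁ := fun h => ne_zero_of_mem_cutDomain hr (h₁.subset h) rfl
  have ct : ∀ a, ContinuousOn (fun w => (t a).eval w * ((w - 1) ^ e'')⁻¹ *
      laurentPos (b a) s w) K₁ := fun a =>
    (continuousOn_eval_mul_pow_inv h₁.one_notMem _ _).mul
      (differentiable_laurentPos (b a) s).continuous.continuousOn
  have cJ : ∀ a, ContinuousOn (fun z => (t a).eval z * ((z - 1) ^ e'')⁻¹ *
      (z ^ s * (b a).eval z)) K := fun a =>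
    (continuousOn_eval_mul_pow_inv hJ.one_notMem _ _).mul
      ((continuousOn_zpow_id s hJ.zero_notMem).mul (b a).continuous.continuousOn)
  rw [← h₁.isContour.add _ _ (hc hg hG) (hc hg' hG'),
    h₁.isContour.congr _ (fun w => ∑ a, (t a).eval w * ((w - 1) ^ e'')⁻¹ * laurentPos (b a) s w),
    hJ.isContour.congr _ (fun z => ∑ a, (t a).eval z * ((z - 1) ^ e'')⁻¹ *
      (z ^ s * (b a).eval z)), h₁.isContour.sum _ fun a _ => ct a,
    hJ.isContour.sum _ fun a _ => cJ a]
  · refine Finset.sum_congr rfl fun a _ => ?_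
    refine h₁.isContour.integral_laurentPos h0 h₁.one_notMem hJ.isContour hJ.zero_notMem
      hJ.one_notMem ?_ ?_ (ht a) (b a) s
    · rw [h₁.sub_inv_eq, hJ.sub_inv_one_eq, mul_one]
    · rw [hJ.inv_eq, hJ.sub_inv_one_eq]
  · intro z hz
    refine Finset.sum_congr rfl fun a _ => ?_
    rw [hH a z (by rintro rfl; exact hJ.zero_notMem hz) (by rintro rfl; exact hJ.one_notMem hz)]
  · intro w hw
    simp only
    rw [← Finset.sum_add_distrib]
    refine Finset.sum_congr rfl fun a _ => ?_
    rw [← add_mul, hsum a w (h₁.subset hw) (by rintro rfl; exact h₁.one_notMem hw)]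

end double

end AztecDiamond

namespace AztecDiamond

open Set Topology Filter MeasureTheory Matrix

variable {k : ℕ}

/-! ### The factors of the integrand -/

/-- The part of the integrand of the double integral that depends on `z`. -/
noncomputable def innerFactor (W : Weighting k) (X : ℕ) (ξ n : ℤ) (a j : Fin 2) (z : ℂ) : ℂ :=
  (z ^ (ξ + 1))⁻¹ * (1 - z⁻¹) ^ X * (Phi W z ^ n) a j

/-- The part of the integrand of the double integral that depends on `w`. -/
noncomputable def outerFactor (W : Weighting k) (P : ℂ → Matrix (Fin 2) (Fin 2) ℂ) (X : ℕ)
    (ξ t : ℤ) (i a : Fin 2) (w : ℂ) : ℂ :=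
  w ^ ξ * ((1 - w⁻¹) ^ X)⁻¹ * rhoLarge W w ^ t * P w i a

theorem one_sub_inv_pow {z : ℂ} (h0 : z ≠ 0) (X : ℕ) :
    (1 - z⁻¹) ^ X = z ^ (-(X : ℤ)) * (z - 1) ^ X := by
  rw [_root_.zpow_neg, zpow_natCast, ← inv_pow, ← mul_pow]
  congr 1
  field_simp

/-- The factor $(1-z^{-1})^X$ cancels the poles of $\Phi^n$ at $1$ as long as $k|n|\le X$. -/
theorem innerFactor_eq (W : Weighting k) {X : ℕ} (ξ : ℤ) {n : ℤ} (hn : k * n.natAbs ≤ X)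
    (a j : Fin 2) {z : ℂ} (h0 : z ≠ 0) (h1 : z ≠ 1) :
    innerFactor W X ξ n a j z = z ^ (-ξ - 1 - X) *
      ((Polynomial.X - Polynomial.C 1) ^ (X - k * n.natAbs) * symbolPow W n a j).eval z := by
  have h1' : z - 1 ≠ 0 := sub_ne_zero.mpr h1
  have hX : (z - 1) ^ X = (z - 1) ^ (X - k * n.natAbs) * (z - 1) ^ (k * n.natAbs) := by
    rw [← pow_add, Nat.sub_add_cancel hn]
  rw [innerFactor, Phi_zpow W h0 h1, one_sub_inv_pow h0, hX, ← _root_.zpow_neg,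
    show -ξ - 1 - (X : ℤ) = -(ξ + 1) + -(X : ℤ) by ring, zpow_add₀ h0]
  simp only [Matrix.smul_apply, Matrix.map_apply, smul_eq_mul, Polynomial.eval_mul,
    Polynomial.eval_pow, Polynomial.eval_sub, Polynomial.eval_X, Polynomial.eval_C]
  have := pow_ne_zero (k * n.natAbs) h1'
  field_simp

/-- The holomorphic numerator of `outerFactor`. -/
noncomputable def outerNumerator (W : Weighting k) (P : ℂ → Matrix (Fin 2) (Fin 2) ℂ) (X : ℕ)
    (ξ t : ℤ) (i a : Fin 2) (w : ℂ) : ℂ :=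
  w ^ (ξ + X) * (w - 1) ^ (k * (t.natAbs - t).toNat) * lam₁ W w ^ t * P w i a

/-- The exponent $|t|-t$ is $0$ or $2|t|$; it allows the same denominator $(w-1)^{X+k|t|}$ for both
signs of $t$. -/
theorem outerFactor_eq (W : Weighting k) (P : ℂ → Matrix (Fin 2) (Fin 2) ℂ) (X : ℕ) (ξ t : ℤ)
    (i a : Fin 2) {w : ℂ} (h0 : w ≠ 0) (h1 : w ≠ 1) :
    outerFactor W P X ξ t i a w =
      outerNumerator W P X ξ t i a w * ((w - 1) ^ (X + k * t.natAbs))⁻¹ := by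
  have h1' : w - 1 ≠ 0 := sub_ne_zero.mpr h1
  have h2 : (((w - 1) ^ k) ^ t)⁻¹ = (w - 1) ^ (k * (t.natAbs - t).toNat) *
      ((w - 1) ^ (k * t.natAbs))⁻¹ := by
    have hc : (((|t| - t).toNat : ℕ) : ℤ) = |t| - t :=
      Int.toNat_of_nonneg (sub_nonneg.mpr (le_abs_self t))
    rw [← _root_.zpow_neg, ← zpow_natCast, ← zpow_natCast, ← zpow_natCast, ← _root_.zpow_neg,
      ← _root_.zpow_mul, ← zpow_add₀ h1']
    congr 1
    push_cast
    rw [hc]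
    ring
  rw [outerFactor, outerNumerator, one_sub_inv_pow h0, rhoLarge, div_zpow, div_eq_mul_inv, h2,
    zpow_add₀ h0, mul_inv, ← _root_.zpow_neg, neg_neg, pow_add, mul_inv]
  ring

theorem differentiableOn_outerNumerator {W : Weighting k} {P : ℂ → Matrix (Fin 2) (Fin 2) ℂ}
    {U : Set ℂ} (hU : U ⊆ hyperbolicSet W) (h0 : (0 : ℂ) ∉ U)
    (hP : ∀ i a, DifferentiableOn ℂ (fun z => P z i a) U) (X : ℕ) (ξ t : ℤ) (i a : Fin 2) :
    DifferentiableOn ℂ (outerNumerator W P X ξ t i a) U := by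
  have c1 : DifferentiableOn ℂ (fun w : ℂ => w ^ (ξ + X)) U :=
    differentiableOn_id.zpow (Or.inl fun w hw => by rintro rfl; exact h0 hw)
  have c2 : DifferentiableOn ℂ (fun w : ℂ => (w - 1) ^ (k * (t.natAbs - t).toNat)) U := by
    fun_prop
  have c3 : DifferentiableOn ℂ (fun w : ℂ => lam₁ W w ^ t) U :=
    ((differentiableOn_lam₁ W).mono hU).zpow (Or.inl fun w hw => lam₁_ne_zero (hU hw))
  exact ((c1.mul c2).mul c3).mul (hP i a)

/-- The sum over both sheets is a rational function. -/
theorem outerFactor_add (W : Weighting k) {X : ℕ} {ξ : ℤ} (hξ : -(X : ℤ) ≤ ξ) (t : ℤ)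
    (i a : Fin 2) {w : ℂ} (hw : w ∈ hyperbolicSet W) (h0 : w ≠ 0) (h1 : w ≠ 1) :
    outerFactor W (eigProj₁ W) X ξ t i a w + outerFactor W (eigProj₂ W) X ξ (-t) i a w =
      (Polynomial.X ^ (ξ + X).toNat * symbolPow W t i a).eval w *
        ((w - 1) ^ (X + k * t.natAbs))⁻¹ := by
  have hc : (((ξ + X).toNat : ℕ) : ℤ) = ξ + X := Int.toNat_of_nonneg (by omega)
  have h := congrFun (congrFun (Phi_zpow_eq_add hw h0 h1 t) i) a
  rw [Phi_zpow W h0 h1] at h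
  simp only [Matrix.smul_apply, Matrix.map_apply, Matrix.add_apply, smul_eq_mul] at h
  have h' : outerFactor W (eigProj₁ W) X ξ t i a w + outerFactor W (eigProj₂ W) X ξ (-t) i a w =
      w ^ ξ * ((1 - w⁻¹) ^ X)⁻¹ * (rhoLarge W w ^ t * eigProj₁ W w i a +
        rhoLarge W w ^ (-t) * eigProj₂ W w i a) := by
    rw [outerFactor, outerFactor]; ring
  rw [h', ← h, one_sub_inv_pow h0, mul_inv, ← _root_.zpow_neg, neg_neg, Polynomial.eval_mul,
    Polynomial.eval_pow, Polynomial.eval_X, ← zpow_natCast w, hc, zpow_add₀ h0, pow_add, mul_inv]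
  ring

/-- Here $\xi\le-1$ enters: it makes the rational function vanish at infinity. -/
theorem natDegree_rational_lt (W : Weighting k) {X : ℕ} {ξ : ℤ} (hξ : -(X : ℤ) ≤ ξ)
    (hξ1 : ξ ≤ -1) (t : ℤ) (i a : Fin 2) :
    (Polynomial.X ^ (ξ + X).toNat * symbolPow W t i a).natDegree < X + k * t.natAbs := by
  have h := Polynomial.natDegree_mul_le_of_le
    (Polynomial.natDegree_X_pow_le (R := ℂ) (ξ + X).toNat) (natDegree_symbolPow_le W t i a)
  omega

theorem zpow_mul_inv_zpow {z : ℂ} (h0 : z ≠ 0) (h1 : z ≠ 1) (X : ℕ) (ξ ξ' : ℤ) :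
    z ^ ξ' * ((1 - z⁻¹) ^ X)⁻¹ * ((z ^ (ξ + 1))⁻¹ * (1 - z⁻¹) ^ X) = z ^ (ξ' - ξ) / z := by
  have h : (1 - z⁻¹) ≠ 0 := by
    rw [sub_ne_zero]; exact fun h => h1 (inv_eq_one.mp h.symm)
  have := pow_ne_zero X h
  rw [zpow_sub₀ h0, zpow_add_one₀ h0]
  field_simp

/-- On the diagonal $w=z$ the factors $(1-z^{-1})^X$ cancel and the powers of $\Phi$ collapse to
powers of one eigenvalue. Only differences of coordinates remain, as in the smooth kernel; `σ` is
$\pm1$ according to the sheet. -/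
theorem sum_outerFactor_mul_innerFactor {W : Weighting k} {P : ℂ → Matrix (Fin 2) (Fin 2) ℂ}
    {z : ℂ} (h0 : z ≠ 0) (h1 : z ≠ 1) (hz : z ∈ hyperbolicSet W) {σ : ℤ}
    (hP : ∀ n : ℤ, P z * Phi W z ^ n = rhoLarge W z ^ (σ * n) • P z) (X : ℕ) (ξ ξ' n n' : ℤ)
    (i j : Fin 2) :
    ∑ a, outerFactor W P X ξ' (σ * -n') i a z * innerFactor W X ξ n a j z =
      rhoLarge W z ^ (σ * (n - n')) * z ^ (ξ' - ξ) * P z i j / z := by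
  have h : ∑ a, outerFactor W P X ξ' (σ * -n') i a z * innerFactor W X ξ n a j z =
      z ^ ξ' * ((1 - z⁻¹) ^ X)⁻¹ * ((z ^ (ξ + 1))⁻¹ * (1 - z⁻¹) ^ X) *
      (rhoLarge W z ^ (σ * -n') * (P z * Phi W z ^ n) i j) := by
    simp only [Matrix.mul_apply, Fin.sum_univ_two, outerFactor, innerFactor]
    ring
  rw [h, zpow_mul_inv_zpow h0 h1, hP, Matrix.smul_apply, smul_eq_mul, ← mul_assoc (_ ^ (σ * -n')),
    ← zpow_add₀ (rhoLarge_ne_zero hz h1), ← mul_add, neg_add_eq_sub]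
  ring

/-- The same cancellation for the sum over both sheets, which yields the integrand of the single
integral in the finite kernel. -/
theorem sum_rational_mul_innerFactor (W : Weighting k) {X : ℕ} {ξ' : ℤ} (hξ : -(X : ℤ) ≤ ξ')
    {z : ℂ} (h0 : z ≠ 0) (h1 : z ≠ 1) (ξ n n' : ℤ) (i j : Fin 2) :
    ∑ a, (Polynomial.X ^ (ξ' + X).toNat * symbolPow W (-n') i a).eval z *
        ((z - 1) ^ (X + k * (-n').natAbs))⁻¹ * innerFactor W X ξ n a j z =
      (Phi W z ^ (n - n')) i j * z ^ (ξ' - ξ) / z := by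
  have hc : (((ξ' + X).toNat : ℕ) : ℤ) = ξ' + X := Int.toNat_of_nonneg (by omega)
  have hr : ∀ a, (Polynomial.X ^ (ξ' + X).toNat * symbolPow W (-n') i a).eval z *
      ((z - 1) ^ (X + k * (-n').natAbs))⁻¹ =
      z ^ ξ' * ((1 - z⁻¹) ^ X)⁻¹ * (Phi W z ^ (-n')) i a := fun a => by
    rw [Phi_zpow W h0 h1, one_sub_inv_pow h0, mul_inv, ← _root_.zpow_neg, neg_neg,
      Polynomial.eval_mul, Polynomial.eval_pow, Polynomial.eval_X, ← zpow_natCast z, hc,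
      zpow_add₀ h0, pow_add, mul_inv]
    simp only [Matrix.smul_apply, Matrix.map_apply, smul_eq_mul]
    ring
  have h : ∑ a, z ^ ξ' * ((1 - z⁻¹) ^ X)⁻¹ * (Phi W z ^ (-n')) i a * innerFactor W X ξ n a j z =
      z ^ ξ' * ((1 - z⁻¹) ^ X)⁻¹ * ((z ^ (ξ + 1))⁻¹ * (1 - z⁻¹) ^ X) *
      (Phi W z ^ (-n') * Phi W z ^ n) i j := by
    simp only [Matrix.mul_apply, Fin.sum_univ_two, innerFactor]
    ring
  simp only [hr]
  rw [h, zpow_mul_inv_zpow h0 h1, ← Matrix.zpow_add (isUnit_det_Phi W h0 h1), neg_add_eq_sub]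
  ring

/-! ### Comparison of the kernels -/

/-- The remainder of the saddle point analysis on one sheet. -/
noncomputable def remainder (W : Weighting k) (P : ℂ → Matrix (Fin 2) (Fin 2) ℂ)
    (I₂ I₃ : (ℂ → ℂ) → ℂ) (ρ : ℝ) (X : ℕ) (ξ ξ' n t : ℤ) (i j : Fin 2) : ℂ :=
  ∑ a, (I₃ (fun w => outerFactor W P X ξ' t i a w *
      circ ρ (fun z => innerFactor W X ξ n a j z * (z - w)⁻¹)) -
    I₂ (fun w => outerFactor W P X ξ' t i a w *
      circ ρ (fun z => innerFactor W X ξ n a j z * (z - w)⁻¹)))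

/-- On $\gamma_1$, which stays off the cut, `E` can be replaced by the spectral projection outside a
finite set, and a finite set does not affect the integral. -/
theorem double_integral_eq_finiteKernel (hk : 1 ≤ k) {W : Weighting k}
    {E : ℂ → Matrix (Fin 2) (Fin 2) ℂ} (hE : Diagonalizes W E) {γ₁ γ₀₁ : SimpleContour}
    (hγ : AdmissiblePair γ₁ γ₀₁) (X : ℕ) (ξ ξ' n n' : ℤ) (i j : Fin 2) :
    γ₁.integral (fun w => γ₀₁.integral (fun z => w ^ ξ' / z ^ (ξ + 1) *
        ((1 - z⁻¹) ^ X / (1 - w⁻¹) ^ X) * rho₁ W w ^ (-n') *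
        (proj₁ E w * Phi W z ^ n) i j / (z - w))) =
      γ₁.integral (fun w => γ₀₁.integral (fun z => ∑ a,
        outerFactor W (eigProj₁ W) X ξ' (-n') i a w * (innerFactor W X ξ n a j z *
          (z - w)⁻¹))) := by
  obtain ⟨S, hS, h⟩ := hE.exists_finite hk
  refine γ₁.integral_congr_off_finite hS fun w hw hwS => ?_
  have hs := trace_subset_slitPlane hγ.1 hγ.2.1 hγ.2.2.1 hw
  obtain ⟨e₁, -, e₃, -⟩ := h w hs (by rintro rfl; exact hγ.1.1 hw) hwS
  congr 1
  ext z
  rw [e₁, e₃]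
  simp only [Matrix.mul_apply, Fin.sum_univ_two, outerFactor, innerFactor, div_eq_mul_inv]
  ring

theorem smooth_integral_eq (hk : 1 ≤ k) {W : Weighting k} {l : ℕ}
    {E : ℂ → Matrix (Fin 2) (Fin 2) ℂ} (hE : Diagonalizes W E) {γ : SimpleContour}
    (hγ : AdmissibleSmooth W l γ) (d q : ℤ) (i j : Fin 2) :
    γ.integral (fun z => rho₁ W z ^ d * z ^ q * proj₁ E z i j / z) =
      γ.integral (fun z => rhoLarge W z ^ d * z ^ q * eigProj₁ W z i j / z) ∧
    γ.integral (fun z => rho₂ W z ^ d * z ^ q * proj₂ E z i j / z) =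
      γ.integral (fun z => rhoLarge W z ^ (-d) * z ^ q * eigProj₂ W z i j / z) := by
  obtain ⟨S, hS, h⟩ := hE.exists_finite hk
  obtain ⟨a, ha⟩ := hγ.exists_mem_slitPlane
  constructor <;> refine γ.integral_congr_off_finite (hS.insert a) fun z hz hzS => ?_
  · rw [mem_insert_iff, not_or] at hzS
    obtain ⟨e₁, e₂, e₃, e₄⟩ := h z (ha z hz hzS.1) (by rintro rfl; exact hγ.2.1.1 hz) hzS.2
    rw [e₁, e₃]
  · rw [mem_insert_iff, not_or] at hzS
    obtain ⟨e₁, e₂, e₃, e₄⟩ := h z (ha z hz hzS.1) (by rintro rfl; exact hγ.2.1.1 hz) hzS.2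
    rw [e₂, e₄, _root_.inv_zpow, _root_.zpow_neg]

/-- The integrand is rational with poles only at $0$ and $1$, so the integral is determined by the
two winding numbers. -/
theorem integral_Phi_zpow_eq (W : Weighting k) (d q : ℤ) (i j : Fin 2) {I J : (ℂ → ℂ) → ℂ}
    {K K' : Set ℂ} {a c : ℂ} (hI : IsContour I K a a) (h0 : 0 ∉ K) (h1 : 1 ∉ K)
    (hJ : IsContour J K' c c) (h0' : 0 ∉ K') (h1' : 1 ∉ K')
    (e0 : I (fun z => z⁻¹) = J (fun z => z⁻¹))
    (e1 : I (fun z => (z - 1)⁻¹) = J (fun z => (z - 1)⁻¹)) :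
    I (fun z => (Phi W z ^ d) i j * z ^ q / z) = J (fun z => (Phi W z ^ d) i j * z ^ q / z) := by
  obtain ⟨u, v, h⟩ := exists_residues_polynomial (symbolPow W d i j) (k * d.natAbs) (q - 1)
  have key : ∀ z : ℂ, z ≠ 0 → z ≠ 1 → (Phi W z ^ d) i j * z ^ q / z =
      z ^ (q - 1) * (symbolPow W d i j).eval z * ((z - 1) ^ (k * d.natAbs))⁻¹ := by
    intro z hz0 hz1
    rw [Phi_zpow W hz0 hz1, zpow_sub_one₀ hz0]
    simp only [Matrix.smul_apply, Matrix.map_apply, smul_eq_mul]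
    ring
  rw [hI.congr _ _ fun z hz => key z (by rintro rfl; exact h0 hz) (by rintro rfl; exact h1 hz),
    hJ.congr _ _ fun z hz => key z (by rintro rfl; exact h0' hz) (by rintro rfl; exact h1' hz),
    h I K a hI h0 h1, h J K' c hJ h0' h1', e0, e1]

/-- The difference of the kernels, as a remainder on either sheet. -/
theorem finiteKernel_sub_smoothKernel (hk : 1 ≤ k) {W : Weighting k} {l : ℕ}
    (hl : IsLoopIndex W l) {ρ : ℝ} (hρ : 0 < ρ) (hρ1 : ρ ≠ 1) {I₂ I₃ : (ℂ → ℂ) → ℂ}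
    {K₂ K₃ : Set ℂ} {c₂ c₃ : ℂ}
    (h₂ : IsLoop (branchPoint W (2 * l)) (branchPoint W (2 * l - 1)) I₂ K₂ c₂ 1 0)
    (r₂ : ∀ z ∈ K₂, ‖z‖ < ρ)
    (h₃ : IsLoop (branchPoint W (2 * l)) (branchPoint W (2 * l - 1)) I₃ K₃ c₃ 1 1)
    (r₃ : ∀ z ∈ K₃, ρ < ‖z‖) {E : ℂ → Matrix (Fin 2) (Fin 2) ℂ} (hE : Diagonalizes W E)
    {γ₁ γ₀₁ γ : SimpleContour} (hγ₁ : AdmissiblePair γ₁ γ₀₁) (hγ : AdmissibleSmooth W l γ)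
    {N : ℕ} {m ξ m' ξ' κ ζ κ' ζ' : ℤ} (hN : Even N) (hm : 0 < m) (hmN : m < N)
    (hξ : -((k * (N / 2) : ℕ) : ℤ) ≤ ξ') (hξ1 : ξ' ≤ -1) (hκ : m - m' = κ - κ')
    (hζ : ξ' - ξ = ζ' - ζ) (i j : Fin 2) :
    finiteKernel W E γ₁ γ₀₁ N m ξ m' ξ' i j - smoothKernel W E γ κ ζ κ' ζ' i j =
        1 / (2 * Real.pi * Complex.I) ^ 2 * remainder W (eigProj₁ W) I₂ I₃ ρ (k * (N / 2)) ξ ξ'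
          (m - (N / 2 : ℕ)) (-(m' - (N / 2 : ℕ))) i j ∧
      finiteKernel W E γ₁ γ₀₁ N m ξ m' ξ' i j - smoothKernel W E γ κ ζ κ' ζ' i j =
        -(1 / (2 * Real.pi * Complex.I) ^ 2 * remainder W (eigProj₂ W) I₂ I₃ ρ (k * (N / 2)) ξ ξ'
          (m - (N / 2 : ℕ)) (m' - (N / 2 : ℕ)) i j) := by
  set X := k * (N / 2) with hX
  set n : ℤ := m - (N / 2 : ℕ) with hn
  set n' : ℤ := m' - (N / 2 : ℕ) with hn'
  set c : ℂ := 2 * Real.pi * Complex.I with hc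
  have hc0 : c ≠ 0 := two_pi_I_ne_zero
  have hlr := gap_nonempty hl
  have hr0 : branchPoint W (2 * l - 1) ≤ 0 := (gap_subset_neg hk hl).le
  have hcut := cutDomain_subset_hyperbolicSet hk hl
  have h₁ := hγ₁.isLoop (branchPoint W (2 * l)) (branchPoint W (2 * l - 1))
  have hJ := hγ₁.isOuterLoop
  have h₄ := hγ.isLoop
  -- From $0<m<N$ the exponent $m-N/2$ is at most $N/2$ in absolute value.
  have hnX : k * n.natAbs ≤ X := by
    rw [hX]
    obtain ⟨M, hM⟩ := hN
    exact Nat.mul_le_mul_left _ (by omega)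
  have hH : ∀ a, ∀ z, z ≠ 0 → z ≠ 1 → innerFactor W X ξ n a j z = z ^ (-ξ - 1 - X) *
      ((Polynomial.X - Polynomial.C 1) ^ (X - k * n.natAbs) * symbolPow W n a j).eval z :=
    fun a z h0 h1 => innerFactor_eq W ξ hnX a j h0 h1
  have h0cut : (0 : ℂ) ∉ cutDomain (branchPoint W (2 * l)) (branchPoint W (2 * l - 1)) :=
    fun h => ne_zero_of_mem_cutDomain hr0 h rfl
  have hg : ∀ (P : ℂ → Matrix (Fin 2) (Fin 2) ℂ),
      (∀ i a, DifferentiableOn ℂ (fun z => P z i a) (hyperbolicSet W)) → ∀ t a, DifferentiableOn ℂ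
      (outerNumerator W P X ξ' t i a)
      (cutDomain (branchPoint W (2 * l)) (branchPoint W (2 * l - 1))) := fun P hP t a =>
    differentiableOn_outerNumerator hcut h0cut (fun i a => (hP i a).mono hcut) X ξ' t i a
  have hG : ∀ (P : ℂ → Matrix (Fin 2) (Fin 2) ℂ) (t : ℤ) (a : Fin 2),
      ∀ w ∈ cutDomain (branchPoint W (2 * l)) (branchPoint W (2 * l - 1)), w ≠ 1 →
      outerFactor W P X ξ' t i a w =
        outerNumerator W P X ξ' t i a w * ((w - 1) ^ (X + k * t.natAbs))⁻¹ :=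
    fun P t a w hw h1 => outerFactor_eq W P X ξ' t i a (ne_zero_of_mem_cutDomain hr0 hw) h1
  have hd₁ := differentiableOn_eigProj₁ W
  have hd₂ := differentiableOn_eigProj₂ W
  have D := double_integral_eq hr0 h₁ hJ hH
    (G := outerFactor W (eigProj₁ W) X ξ' (-n') i)
  have A₁ := integral_sum_laurentPos_eq hlr hr0 hρ hρ1 (hg _ hd₁ (-n')) h₁ h₂ r₂ h₃ r₃ h₄
    (hG (eigProj₁ W) (-n')) hH
  have A₂ := integral_sum_laurentPos_eq hlr hr0 hρ hρ1 (hg _ hd₂ n') h₁ h₂ r₂ h₃ r₃ h₄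
    (hG (eigProj₂ W) n') hH
  -- The sheets carry the exponents `-n'` and `n'` of the larger eigenvalue, because the smaller one
  -- is its inverse.
  have A := integral_add_laurentPos_eq hr0 (hg _ hd₁ (-n')) (hg _ hd₂ n') h₁ hJ
    (hG (eigProj₁ W) (-n')) (hG (eigProj₂ W) n')
    (fun a => natDegree_rational_lt W hξ hξ1 (-n') i a)
    (fun a w hw h1 => by
      have := outerFactor_add W hξ (-n') i a (hcut hw) (ne_zero_of_mem_cutDomain hr0 hw) h1
      rwa [neg_neg] at this) hH
  have hJ' := hJ.isContour.congr _ (fun z => (Phi W z ^ (n - n')) i j * z ^ (ξ' - ξ) / z)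
    fun z hz => sum_rational_mul_innerFactor W hξ (by rintro rfl; exact hJ.zero_notMem hz)
      (by rintro rfl; exact hJ.one_notMem hz) ξ n n' i j
  rw [hJ'] at A
  have h04 : (0 : ℂ) ∉ γ.trace := fun h => h0cut (h₄.subset h)
  have hS₁ := h₄.isContour.congr
    (fun z => ∑ a, outerFactor W (eigProj₁ W) X ξ' (-n') i a z * innerFactor W X ξ n a j z)
    (fun z => rhoLarge W z ^ (n - n') * z ^ (ξ' - ξ) * eigProj₁ W z i j / z) fun z hz => by
      have h1 : z ≠ 1 := by rintro rfl; exact h₄.one_notMem hz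
      have h0 := ne_zero_of_mem_cutDomain hr0 (h₄.subset hz)
      have hz' := hcut (h₄.subset hz)
      have := sum_outerFactor_mul_innerFactor (P := eigProj₁ W) h0 h1 hz' (σ := 1)
        (fun n => by rw [one_mul]; exact eigProj₁_mul_Phi_zpow hz' h0 h1 n) X ξ ξ' n n' i j
      rwa [one_mul, one_mul] at this
  have hS₂ := h₄.isContour.congr
    (fun z => ∑ a, outerFactor W (eigProj₂ W) X ξ' n' i a z * innerFactor W X ξ n a j z)
    (fun z => rhoLarge W z ^ (-(n - n')) * z ^ (ξ' - ξ) * eigProj₂ W z i j / z) fun z hz => by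
      have h1 : z ≠ 1 := by rintro rfl; exact h₄.one_notMem hz
      have h0 := ne_zero_of_mem_cutDomain hr0 (h₄.subset hz)
      have hz' := hcut (h₄.subset hz)
      have := sum_outerFactor_mul_innerFactor (P := eigProj₂ W) h0 h1 hz' (σ := -1)
        (fun n => by rw [neg_one_mul]; exact eigProj₂_mul_Phi_zpow hz' h0 h1 n) X ξ ξ' n n' i j
      rwa [neg_one_mul, neg_one_mul, neg_neg] at this
  rw [hS₁] at A₁
  rw [hS₂] at A₂
  have hcont : ∀ (P : ℂ → Matrix (Fin 2) (Fin 2) ℂ),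
      (∀ i a, DifferentiableOn ℂ (fun z => P z i a) (hyperbolicSet W)) → ∀ t : ℤ, ContinuousOn
      (fun z => rhoLarge W z ^ t * z ^ (ξ' - ξ) * P z i j / z) γ.trace := by
    intro P hP t
    have hsub := h₄.subset.trans hcut
    have c1 : ContinuousOn (fun z => rhoLarge W z ^ t) γ.trace := by
      refine ContinuousOn.zpow₀ ?_ t fun z hz => Or.inl (rhoLarge_ne_zero (hsub hz)
        (by rintro rfl; exact h₄.one_notMem hz))
      exact ((differentiableOn_lam₁ W).continuousOn.mono hsub).div (by fun_prop) fun z hz =>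
        pow_ne_zero _ (sub_ne_zero.mpr (by rintro rfl; exact h₄.one_notMem hz))
    exact ((c1.mul (continuousOn_zpow_id _ h04)).mul ((hP i j).continuousOn.mono hsub)).div
      continuousOn_id fun z hz => by rintro rfl; exact h04 hz
  -- The single integral is moved to the contour of the smooth kernel, where $\Phi^{n-n'}$ splits
  -- into the contributions $S_1$ and $S_2$ of the two sheets.
  have hS := integral_Phi_zpow_eq W (n - n') (ξ' - ξ) i j hJ.isContour hJ.zero_notMem
    hJ.one_notMem h₄.isContour h04 h₄.one_notMem
    (by rw [hJ.inv_eq, h₄.inv_eq, mul_one]) (by rw [hJ.sub_inv_one_eq, h₄.sub_inv_eq, mul_one])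
  rw [h₄.isContour.congr (fun z => (Phi W z ^ (n - n')) i j * z ^ (ξ' - ξ) / z)
    (fun z => rhoLarge W z ^ (n - n') * z ^ (ξ' - ξ) * eigProj₁ W z i j / z +
      rhoLarge W z ^ (-(n - n')) * z ^ (ξ' - ξ) * eigProj₂ W z i j / z) fun z hz => by
      have h1 : z ≠ 1 := by rintro rfl; exact h₄.one_notMem hz
      have h0 := ne_zero_of_mem_cutDomain hr0 (h₄.subset hz)
      simp only
      rw [Phi_zpow_eq_add (hcut (h₄.subset hz)) h0 h1]
      simp only [Matrix.add_apply, Matrix.smul_apply, smul_eq_mul]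
      ring, h₄.isContour.add _ _ (hcont _ hd₁ _) (hcont _ hd₂ _)] at hS
  obtain ⟨e₁, e₂⟩ := smooth_integral_eq hk hE hγ (κ - κ') (ζ' - ζ) i j
  have hnn : n - n' = m - m' := by rw [hn, hn']; ring
  have hfin : finiteKernel W E γ₁ γ₀₁ N m ξ m' ξ' i j =
      -((if m' < m then 1 else 0) / c) *
        γ₀₁.integral (fun z => (Phi W z ^ (n - n')) i j * z ^ (ξ' - ξ) / z) +
      1 / c ^ 2 * γ₁.integral (fun w => γ₀₁.integral (fun z => ∑ a,
        outerFactor W (eigProj₁ W) X ξ' (-n') i a w * (innerFactor W X ξ n a j z *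
          (z - w)⁻¹))) := by
    rw [← double_integral_eq_finiteKernel hk hE hγ₁, hnn, finiteKernel, Matrix.of_apply,
      show -n' = ((N / 2 : ℕ) : ℤ) - m' by rw [hn']; ring]
  have hsm : smoothKernel W E γ κ ζ κ' ζ' i j =
      (if κ ≤ κ' then 1 else 0) / c *
        γ.integral (fun z => rhoLarge W z ^ (n - n') * z ^ (ξ' - ξ) * eigProj₁ W z i j / z) -
      (if κ' < κ then 1 else 0) / c *
        γ.integral (fun z => rhoLarge W z ^ (-(n - n')) * z ^ (ξ' - ξ) * eigProj₂ W z i j / z) := by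
    rw [smoothKernel, Matrix.of_apply, e₁, e₂, hnn, hκ, hζ]
  rw [hfin, hsm, D, hS]
  rw [hS] at A
  change _ = _ + remainder W (eigProj₁ W) I₂ I₃ ρ X ξ ξ' n (-n') i j at A₁
  change _ = _ + remainder W (eigProj₂ W) I₂ I₃ ρ X ξ ξ' n n' i j at A₂
  generalize γ.integral (fun z => rhoLarge W z ^ (n - n') * z ^ (ξ' - ξ) * eigProj₁ W z i j / z)
    = S₁ at *
  generalize γ.integral (fun z => rhoLarge W z ^ (-(n - n')) * z ^ (ξ' - ξ) * eigProj₂ W z i j / z)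
    = S₂ at *
  generalize remainder W (eigProj₁ W) I₂ I₃ ρ X ξ ξ' n (-n') i j = R₁ at *
  generalize remainder W (eigProj₂ W) I₂ I₃ ρ X ξ ξ' n n' i j = R₂ at *
  generalize γ₁.integral (fun w => ∑ a, outerFactor W (eigProj₁ W) X ξ' (-n') i a w * _) = L₁ at *
  generalize γ₁.integral (fun w => ∑ a, outerFactor W (eigProj₂ W) X ξ' n' i a w * _) = L₂ at *
  rw [← hc] at *
  have hκ' : κ' < κ ↔ m' < m := by omega
  have hR₁ : R₁ = c * L₁ - c * S₁ := by linear_combination -A₁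
  have hR₂ : R₂ = c * L₂ - c * S₂ := by linear_combination -A₂
  rw [hR₁, hR₂, eq_sub_of_add_eq' A]
  -- With $c=2\pi i$, the double integral contributes $S_1/c$ up to the remainder. For $m'<m$ the
  -- single integral $-(S_1+S_2)/c$ turns this into $-S_2/c$, in accordance with the two cases of
  -- the smooth kernel.
  by_cases h : m' < m
  · rw [if_pos h, if_neg (by omega), if_pos (hκ'.mpr h)]
    constructor <;> field_simp <;> ring
  · rw [if_neg h, if_pos (by omega), if_neg (by omega)]
    constructor <;> field_simp <;> ring

end AztecDiamond

namespace AztecDiamond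

open Set Topology Filter MeasureTheory Matrix

variable {k : ℕ}

/-! ### Exponential bounds -/

theorem norm_zpow_eq_exp {z : ℂ} (hz : z ≠ 0) (n : ℤ) :
    ‖z ^ n‖ = Real.exp (n * Real.log ‖z‖) := by
  have h := norm_pos_iff.mpr hz
  rw [norm_zpow, mul_comm, Real.exp_mul, Real.exp_log h, Real.rpow_intCast]

theorem log_norm_rhoLarge {W : Weighting k} {z : ℂ} (hz : z ∈ hyperbolicSet W) (h1 : z ≠ 1) :
    Real.log ‖rhoLarge W z‖ = Real.log ‖lam₁ W z‖ - k * Real.log ‖z - 1‖ := by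
  have h := norm_ne_zero_iff.mpr (pow_ne_zero k (sub_ne_zero.mpr h1))
  rw [rhoLarge, norm_div, Real.log_div (norm_ne_zero_iff.mpr (lam₁_ne_zero hz)) h, norm_pow,
    Real.log_pow]

theorem log_norm_rhoLarge_nonneg {W : Weighting k} {z : ℂ} (hz : z ∈ hyperbolicSet W)
    (h1 : z ≠ 1) : 0 ≤ Real.log ‖rhoLarge W z‖ := by
  have hpos : 0 < ‖z - 1‖ := norm_pos_iff.mpr (sub_ne_zero.mpr h1)
  have h : k * Real.log ‖z - 1‖ ≤ Real.log ‖lam₁ W z‖ := by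
    rw [← Real.log_pow]
    exact Real.log_le_log (by positivity) (norm_pow_le_norm_lam₁ W z)
  rw [log_norm_rhoLarge hz h1]
  linarith

theorem natCast_mul_half {N : ℕ} (hN : Even N) : ((k * (N / 2) : ℕ) : ℝ) = k * N / 2 := by
  rw [Nat.cast_mul, Nat.cast_div hN.two_dvd (by norm_num)]
  push_cast
  ring

theorem norm_one_sub_inv_pow {z : ℂ} (h0 : z ≠ 0) (h1 : z ≠ 1) {N : ℕ} (hN : Even N) :
    ‖(1 - z⁻¹) ^ (k * (N / 2))‖ =
      Real.exp (k * N / 2 * (Real.log ‖z - 1‖ - Real.log ‖z‖)) := by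
  have h1' : z - 1 ≠ 0 := sub_ne_zero.mpr h1
  rw [one_sub_inv_pow h0, norm_mul, norm_zpow_eq_exp h0, ← zpow_natCast (z - 1),
    norm_zpow_eq_exp h1', ← Real.exp_add, Int.cast_neg, Int.cast_natCast, natCast_mul_half hN]
  congr 1
  ring

/-- The bounded part of the integrand. -/
noncomputable def envelope (W : Weighting k) (A : ℝ) (z : ℂ) : ℝ :=
  Real.exp (A * (|Real.log ‖z‖| + Real.log ‖rhoLarge W z‖))

/-- Both $\rho_1^n$ and $\rho_1^{-n}$ are bounded by $|\rho_1|^{|n|}$, since $|\rho_1|\ge1$. Thus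
only $|n|\approx N|\chi|/2$ matters and the height for $s=|\chi|$ appears. -/
theorem norm_innerFactor_le {W : Weighting k} {z : ℂ} (hz : z ∈ hyperbolicSet W) (h0 : z ≠ 0)
    (h1 : z ≠ 1) {N : ℕ} (hN : Even N) {A η s : ℝ} {ξ n : ℤ} (hn : |(n : ℝ)| ≤ N * s / 2 + A)
    (hξ : |(ξ : ℝ) - k * N / 4 * (η - 1)| + 1 ≤ A) (a j : Fin 2) :
    ‖innerFactor W (k * (N / 2)) ξ n a j z‖ ≤ Real.exp (N * height W s η z) *
      (envelope W A z * (‖eigProj₁ W z a j‖ + ‖eigProj₂ W z a j‖)) := by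
  set R := Real.log ‖rhoLarge W z‖ with hR
  have hR0 : 0 ≤ R := log_norm_rhoLarge_nonneg hz h1
  have hρ := rhoLarge_ne_zero hz h1
  have hΦ : ‖(Phi W z ^ n) a j‖ ≤ Real.exp ((N * s / 2 + A) * R) *
      (‖eigProj₁ W z a j‖ + ‖eigProj₂ W z a j‖) := by
    rw [Phi_zpow_eq_add hz h0 h1]
    simp only [Matrix.add_apply, Matrix.smul_apply, smul_eq_mul]
    refine (norm_add_le _ _).trans ?_
    rw [norm_mul, norm_mul, norm_zpow_eq_exp hρ, norm_zpow_eq_exp hρ, mul_add]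
    have hb := abs_le.mp hn
    gcongr
    · exact hb.2
    · push_cast; linarith [hb.1]
  have hkey : ((-(ξ + 1) : ℤ) : ℝ) * Real.log ‖z‖ +
      k * N / 2 * (Real.log ‖z - 1‖ - Real.log ‖z‖) + (N * s / 2 + A) * R ≤
      N * height W s η z + A * (|Real.log ‖z‖| + R) := by
    have h2 : ((k * N / 4 * (η - 1) - ξ) - 1) * Real.log ‖z‖ ≤ A * |Real.log ‖z‖| := by
      refine (le_abs_self _).trans ?_
      rw [abs_mul]
      refine mul_le_mul_of_nonneg_right ?_ (abs_nonneg _)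
      refine (abs_sub _ _).trans ?_
      rw [abs_one, abs_sub_comm]
      exact hξ
    rw [height, hR, log_norm_rhoLarge hz h1]
    push_cast
    linarith
  rw [innerFactor, norm_mul, norm_mul, ← _root_.zpow_neg, norm_zpow_eq_exp h0,
    norm_one_sub_inv_pow h0 h1 hN, ← Real.exp_add]
  calc _ ≤ Real.exp (((-(ξ + 1) : ℤ) : ℝ) * Real.log ‖z‖ +
        k * N / 2 * (Real.log ‖z - 1‖ - Real.log ‖z‖)) * (Real.exp ((N * s / 2 + A) * R) *
        (‖eigProj₁ W z a j‖ + ‖eigProj₂ W z a j‖)) := by gcongr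
    _ = Real.exp (((-(ξ + 1) : ℤ) : ℝ) * Real.log ‖z‖ +
        k * N / 2 * (Real.log ‖z - 1‖ - Real.log ‖z‖) + (N * s / 2 + A) * R) *
        (‖eigProj₁ W z a j‖ + ‖eigProj₂ W z a j‖) := by rw [Real.exp_add _ ((_ + A) * R)]; ring
    _ ≤ Real.exp (N * height W s η z + A * (|Real.log ‖z‖| + R)) *
        (‖eigProj₁ W z a j‖ + ‖eigProj₂ W z a j‖) := by gcongr
    _ = _ := by rw [Real.exp_add, envelope]; ring

/-- A one-sided bound on `t` suffices, as $\log|\rho_1|\ge0$. This is what decides which sheet is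
used for which sign of $\chi$. -/
theorem norm_outerFactor_le {W : Weighting k} {P : ℂ → Matrix (Fin 2) (Fin 2) ℂ} {w : ℂ}
    (hw : w ∈ hyperbolicSet W) (h0 : w ≠ 0) (h1 : w ≠ 1) {N : ℕ} (hN : Even N) {A η s : ℝ}
    {ξ t : ℤ} (ht : (t : ℝ) ≤ -(N * s / 2) + A) (hξ : |(ξ : ℝ) - k * N / 4 * (η - 1)| ≤ A)
    (i a : Fin 2) :
    ‖outerFactor W P (k * (N / 2)) ξ t i a w‖ ≤ Real.exp (-(N * height W s η w)) *
      (envelope W A w * ‖P w i a‖) := by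
  set R := Real.log ‖rhoLarge W w‖ with hR
  have hR0 : 0 ≤ R := log_norm_rhoLarge_nonneg hw h1
  have hkey : (ξ : ℝ) * Real.log ‖w‖ + -(k * N / 2 * (Real.log ‖w - 1‖ - Real.log ‖w‖)) + t * R ≤
      -(N * height W s η w) + A * (|Real.log ‖w‖| + R) := by
    have h2 : (ξ - k * N / 4 * (η - 1)) * Real.log ‖w‖ ≤ A * |Real.log ‖w‖| := by
      refine (le_abs_self _).trans ?_
      rw [abs_mul]
      exact mul_le_mul_of_nonneg_right hξ (abs_nonneg _)
    have h3 := mul_le_mul_of_nonneg_right ht hR0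
    rw [hR, log_norm_rhoLarge hw h1] at h3 ⊢
    rw [height]
    linarith
  rw [outerFactor, norm_mul, norm_mul, norm_mul, norm_inv, norm_zpow_eq_exp h0,
    norm_one_sub_inv_pow h0 h1 hN, norm_zpow_eq_exp (rhoLarge_ne_zero hw h1), ← Real.exp_neg,
    ← Real.exp_add, ← Real.exp_add, envelope, ← mul_assoc, ← Real.exp_add]
  gcongr

theorem continuousOn_envelope {W : Weighting k} (A : ℝ) {K : Set ℂ} (hK : K ⊆ hyperbolicSet W)
    (h0 : (0 : ℂ) ∉ K) (h1 : (1 : ℂ) ∉ K) : ContinuousOn (envelope W A) K := by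
  have hne1 : ∀ z ∈ K, z ≠ 1 := fun z hz => by rintro rfl; exact h1 hz
  have c1 : ContinuousOn (fun z : ℂ => Real.log ‖z‖) K :=
    continuousOn_id.norm.log fun z hz => norm_ne_zero_iff.mpr (by rintro rfl; exact h0 hz)
  have c2 : ContinuousOn (rhoLarge W) K :=
    ((differentiableOn_lam₁ W).continuousOn.mono hK).div (by fun_prop) fun z hz =>
      pow_ne_zero _ (sub_ne_zero.mpr (hne1 z hz))
  have c3 : ContinuousOn (fun z : ℂ => Real.log ‖rhoLarge W z‖) K :=
    c2.norm.log fun z hz => norm_ne_zero_iff.mpr (rhoLarge_ne_zero (hK hz) (hne1 z hz))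
  exact (continuousOn_const.mul (c1.abs.add c3)).rexp

theorem envelope_nonneg (W : Weighting k) (A : ℝ) (z : ℂ) : 0 ≤ envelope W A z :=
  (Real.exp_pos _).le

/-- The remainder on one contour is exponentially small. -/
theorem exists_remainder_bound {W : Weighting k} {l r ρ s η M₁ M₂ : ℝ} (hr : r ≤ 0) (hρ : 0 < ρ)
    (hρ1 : ρ ≠ 1) (hcut : cutDomain l r ⊆ hyperbolicSet W) (hρc : Metric.sphere 0 ρ ⊆ cutDomain l r)
    (hM₁ : ∀ z : ℂ, ‖z‖ = ρ → height W s η z ≤ M₁) {I : (ℂ → ℂ) → ℂ} {K : Set ℂ} {c u v : ℂ}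
    (hI : IsLoop l r I K c u v) (hKρ : ∀ z ∈ K, ‖z‖ ≠ ρ) (hM₂ : ∀ z ∈ K, M₂ ≤ height W s η z)
    {P : ℂ → Matrix (Fin 2) (Fin 2) ℂ}
    (hP : ∀ i a, DifferentiableOn ℂ (fun z => P z i a) (hyperbolicSet W)) (A : ℝ) (i a j : Fin 2) :
    ∃ C : ℝ, ∀ (N : ℕ) (ξ ξ' n t : ℤ), Even N → |(n : ℝ)| ≤ N * s / 2 + A →
      |(ξ : ℝ) - k * N / 4 * (η - 1)| + 1 ≤ A → (t : ℝ) ≤ -(N * s / 2) + A →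
      |(ξ' : ℝ) - k * N / 4 * (η - 1)| ≤ A →
      ‖I (fun w => outerFactor W P (k * (N / 2)) ξ' t i a w *
        circ ρ (fun z => innerFactor W (k * (N / 2)) ξ n a j z * (z - w)⁻¹))‖ ≤
        C * Real.exp (-(M₂ - M₁) * N) := by
  have hKh := hI.subset.trans hcut
  have hSh := hρc.trans hcut
  have h0K : (0 : ℂ) ∉ K := fun h => ne_zero_of_mem_cutDomain hr (hI.subset h) rfl
  have h0S : (0 : ℂ) ∉ Metric.sphere (0 : ℂ) ρ := by simpa using hρ.ne
  have h1S : (1 : ℂ) ∉ Metric.sphere (0 : ℂ) ρ := by simpa using hρ1.symm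
  obtain ⟨L, hL0, hL⟩ := hI.isContour.bound
  obtain ⟨D₁, hD₁⟩ := hI.isContour.isCompact.exists_bound_of_continuousOn
    (f := fun w => envelope W A w * ‖P w i a‖)
    ((continuousOn_envelope A hKh h0K hI.one_notMem).mul ((hP i a).continuousOn.mono hKh).norm)
  obtain ⟨D₂, hD₂⟩ := (isCompact_sphere (0 : ℂ) ρ).exists_bound_of_continuousOn
    (f := fun z => envelope W A z * (‖eigProj₁ W z a j‖ + ‖eigProj₂ W z a j‖))
    ((continuousOn_envelope A hSh h0S h1S).mul
      (((differentiableOn_eigProj₁ W a j).continuousOn.mono hSh).norm.add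
        ((differentiableOn_eigProj₂ W a j).continuousOn.mono hSh).norm))
  -- The Cauchy kernel is bounded by the inverse distance between the radii of `w` and of the
  -- circle.
  obtain ⟨D₃, hD₃⟩ := hI.isContour.isCompact.exists_bound_of_continuousOn
    (f := fun w : ℂ => |ρ - ‖w‖|⁻¹)
    (ContinuousOn.inv₀ (by fun_prop) fun w hw => abs_ne_zero.mpr (sub_ne_zero.mpr (hKρ w hw).symm))
  have hD₂0 : 0 ≤ D₂ := (norm_nonneg _).trans (hD₂ ρ (by simpa using hρ.le))
  refine ⟨L * (|D₁| * (2 * Real.pi * ρ * (D₂ * |D₃|))), fun N ξ ξ' n t hN hn hξ ht hξ' => ?_⟩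
  have hbound := hL (fun w => outerFactor W P (k * (N / 2)) ξ' t i a w *
    circ ρ (fun z => innerFactor W (k * (N / 2)) ξ n a j z * (z - w)⁻¹))
    (Real.exp (-(N * M₂)) * |D₁| * (2 * Real.pi * ρ * (Real.exp (N * M₁) * D₂ * |D₃|)))
    (by positivity) fun w hw => ?_
  · refine hbound.trans_eq ?_
    rw [show -(M₂ - M₁) * N = -(N * M₂) + N * M₁ by ring, Real.exp_add]
    ring
  · have hw1 : w ≠ 1 := by rintro rfl; exact hI.one_notMem hw
    have hw0 := ne_zero_of_mem_cutDomain hr (hI.subset hw)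
    rw [norm_mul]
    refine mul_le_mul ?_ (circ_norm_le hρ fun z hz => ?_) (norm_nonneg _) (by positivity)
    · refine (norm_outerFactor_le (hKh hw) hw0 hw1 hN ht hξ' i a).trans ?_
      have h2 := (le_abs_self _).trans ((hD₁ w hw).trans (le_abs_self _))
      have h3 := hM₂ w hw
      have h4 := mul_nonneg (envelope_nonneg W A w) (norm_nonneg (P w i a))
      gcongr
    · have hzS : z ∈ Metric.sphere (0 : ℂ) ρ := by simpa using hz
      rw [norm_mul, norm_inv]
      have hz1 : z ≠ 1 := by rintro rfl; exact h1S hzS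
      have hz0 : z ≠ 0 := by rintro rfl; exact h0S hzS
      have hpos : 0 < |ρ - ‖w‖| := abs_pos.mpr (sub_ne_zero.mpr (hKρ w hw).symm)
      have h4 : ‖z - w‖⁻¹ ≤ |D₃| := by
        have h5 : |ρ - ‖w‖| ≤ ‖z - w‖ := by rw [← hz]; exact abs_norm_sub_norm_le z w
        have h6 := (le_abs_self _).trans ((hD₃ w hw).trans (le_abs_self _))
        exact (inv_anti₀ hpos h5).trans h6
      refine mul_le_mul ?_ h4 (by positivity) (by positivity)
      refine (norm_innerFactor_le (hSh hzS) hz0 hz1 hN hn hξ a j).trans ?_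
      have h2 := (le_abs_self _).trans (hD₂ z hzS)
      have h3 := hM₁ z hz
      have h5 := mul_nonneg (envelope_nonneg W A z)
        (add_nonneg (norm_nonneg (eigProj₁ W z a j)) (norm_nonneg (eigProj₂ W z a j)))
      gcongr

theorem sphere_subset_cutDomain {l r ρ : ℝ} (hρ : 0 < ρ) (h : -ρ ∈ Ioo l r) :
    Metric.sphere (0 : ℂ) ρ ⊆ cutDomain l r := by
  intro z hz
  rw [mem_sphere_zero_iff_norm] at hz
  by_cases him : z.im = 0
  · have hzr : z = (z.re : ℂ) := Complex.ext (by simp) (by simp [him])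
    rw [hzr, Complex.norm_real, Real.norm_eq_abs] at hz
    rcases abs_cases z.re with ⟨h1, -⟩ | ⟨h1, -⟩
    · exact Or.inl (Or.inl (by linarith))
    · exact Or.inr ⟨him, by rw [show z.re = -ρ by linarith]; exact h⟩
  · exact Or.inl (Or.inr him)

/-- The coordinates are close to their macroscopic values. -/
theorem abs_mCoord_sub_le {N : ℕ} (hN : Even N) (χ : ℝ) (κ : ℤ) :
    |((mCoord N χ κ - (N / 2 : ℕ) : ℤ) : ℝ) - N * χ / 2| ≤ |(κ : ℝ)| + 1 := by
  have h1 := Int.le_ceil ((N : ℝ) / 2 * (χ + 1))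
  have h2 := Int.ceil_lt_add_one ((N : ℝ) / 2 * (χ + 1))
  have h3 : ((N / 2 : ℕ) : ℝ) = N / 2 := by
    rw [Nat.cast_div hN.two_dvd (by norm_num)]; norm_num
  have h4 := neg_abs_le (κ : ℝ)
  have h5 := le_abs_self (κ : ℝ)
  rw [mCoord, Int.cast_sub, Int.cast_add, Int.cast_natCast, h3, abs_le]
  constructor <;> linarith

theorem abs_xiCoord_sub_le (k N : ℕ) (η : ℝ) (ζ : ℤ) :
    |(xiCoord k N η ζ : ℝ) - k * N / 4 * (η - 1)| ≤ |(ζ : ℝ)| + 1 := by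
  have h1 := Int.le_ceil ((k : ℝ) * N / 4 * (η - 1))
  have h2 := Int.ceil_lt_add_one ((k : ℝ) * N / 4 * (η - 1))
  have h4 := neg_abs_le (ζ : ℝ)
  have h5 := le_abs_self (ζ : ℝ)
  rw [xiCoord]
  push_cast
  rw [abs_le]
  constructor <;> linarith

theorem eventually_inRange (hk : 1 ≤ k) {χ η : ℝ} (h : (χ, η) ∈ square) (κ ζ : ℤ) :
    ∀ᶠ N : ℕ in atTop ⊓ 𝓟 {N | Even N}, InRange k N (mCoord N χ κ) (xiCoord k N η ζ) := by
  obtain ⟨⟨hχ1, hχ2⟩, hη1, hη2⟩ := h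
  have hk' : (1 : ℝ) ≤ k := by exact_mod_cast hk
  have key : ∀ c d : ℝ, 0 < c → ∀ᶠ N : ℕ in atTop, d < c * N := fun c d hc =>
    (tendsto_natCast_atTop_atTop.const_mul_atTop hc).eventually_gt_atTop d
  rw [eventually_inf_principal]
  filter_upwards [key ((χ + 1) / 2) (-κ) (by simp only at hχ1; linarith),
    key ((1 - χ) / 2) (κ + 1) (by simp only at hχ2; linarith),
    key ((η + 1) / 4 * k) (-ζ) (by simp only at hη1; nlinarith),
    key ((1 - η) / 4 * k) (ζ + 2) (by simp only at hη2; nlinarith)] with N e₁ e₂ e₃ e₄ hN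
  have h1 := Int.le_ceil ((N : ℝ) / 2 * (χ + 1))
  have h2 := Int.ceil_lt_add_one ((N : ℝ) / 2 * (χ + 1))
  have h3 := Int.le_ceil ((k : ℝ) * N / 4 * (η - 1))
  have h4 := Int.ceil_lt_add_one ((k : ℝ) * N / 4 * (η - 1))
  refine ⟨?_, ?_, ?_, ?_⟩
  · rw [mCoord, ← Int.cast_pos (R := ℝ)]; push_cast; linarith
  · rw [mCoord, ← Int.cast_lt (R := ℝ)]; push_cast; linarith
  · rw [xiCoord, ← Int.cast_le (R := ℝ), Int.cast_neg, Int.cast_natCast, natCast_mul_half hN]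
    push_cast; linarith
  · rw [xiCoord, ← Int.cast_le (R := ℝ)]; push_cast; linarith

end AztecDiamond

/-! ### The exponential bound for the kernels and the limit -/

namespace AztecDiamond

open Set Topology Filter MeasureTheory Matrix

variable {k : ℕ}

/-- Both sheets give an exponentially small bound under the corresponding sign of `χ`. -/
theorem exists_kernel_bound (hk : 1 ≤ k) (W : Weighting k) {l : ℕ} (hl : IsLoopIndex W l)
    {χ η ρ M₁ M₂ : ℝ} (hρ : 0 < ρ) (hρ1 : ρ ≠ 1) (hρg : -ρ ∈ gap W l)
    (hM₁ : ∀ z : ℂ, ‖z‖ = ρ → height W |χ| η z ≤ M₁) {I₂ I₃ : (ℂ → ℂ) → ℂ} {K₂ K₃ : Set ℂ}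
    {c₂ c₃ : ℂ}
    (h₂ : IsLoop (branchPoint W (2 * l)) (branchPoint W (2 * l - 1)) I₂ K₂ c₂ 1 0)
    (r₂ : ∀ z ∈ K₂, ‖z‖ < ρ) (m₂ : ∀ z ∈ K₂, M₂ ≤ height W |χ| η z)
    (h₃ : IsLoop (branchPoint W (2 * l)) (branchPoint W (2 * l - 1)) I₃ K₃ c₃ 1 1)
    (r₃ : ∀ z ∈ K₃, ρ < ‖z‖) (m₃ : ∀ z ∈ K₃, M₂ ≤ height W |χ| η z) (κ ζ κ' ζ' : ℤ)
    (i j : Fin 2) :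
    ∃ C : ℝ, ∀ E : ℂ → Matrix (Fin 2) (Fin 2) ℂ, Diagonalizes W E →
      ∀ γ₁ γ₀₁ γ : SimpleContour, AdmissiblePair γ₁ γ₀₁ → AdmissibleSmooth W l γ →
      ∀ N : ℕ, Even N → InRange k N (mCoord N χ κ) (xiCoord k N η ζ) →
        InRange k N (mCoord N χ κ') (xiCoord k N η ζ') →
        ‖finiteKernel W E γ₁ γ₀₁ N
            (mCoord N χ κ) (xiCoord k N η ζ) (mCoord N χ κ') (xiCoord k N η ζ') i j
          - smoothKernel W E γ κ ζ κ' ζ' i j‖ ≤ C * Real.exp (-(M₂ - M₁) * N) := by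
  have hr0 : branchPoint W (2 * l - 1) ≤ 0 := (gap_subset_neg hk hl).le
  have hcut := cutDomain_subset_hyperbolicSet hk hl
  have hρc := sphere_subset_cutDomain hρ hρg
  -- One bound for all shifts. The summand 2 covers the rounding of the coordinates and the
  -- additional exponent of $z^{\xi+1}$.
  set A : ℝ := |(κ : ℝ)| + |(ζ : ℝ)| + |(κ' : ℝ)| + |(ζ' : ℝ)| + 2 with hA
  have hκ0 := abs_nonneg (κ : ℝ)
  have hκ0' := abs_nonneg (κ' : ℝ)
  have hζ0 := abs_nonneg (ζ : ℝ)
  have hζ0' := abs_nonneg (ζ' : ℝ)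
  have key : ∀ P : ℂ → Matrix (Fin 2) (Fin 2) ℂ,
      (∀ i a, DifferentiableOn ℂ (fun z => P z i a) (hyperbolicSet W)) → ∃ C : ℝ,
      ∀ N : ℕ, Even N → ∀ t : ℤ, (t : ℝ) ≤ -(N * |χ| / 2) + A →
        ‖remainder W P I₂ I₃ ρ (k * (N / 2)) (xiCoord k N η ζ) (xiCoord k N η ζ')
          (mCoord N χ κ - (N / 2 : ℕ)) t i j‖ ≤ C * Real.exp (-(M₂ - M₁) * N) := by
    intro P hP
    choose C₂ hC₂ using fun a => exists_remainder_bound hr0 hρ hρ1 hcut hρc hM₁ h₂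
      (fun z hz => (r₂ z hz).ne) m₂ hP A i a j
    choose C₃ hC₃ using fun a => exists_remainder_bound hr0 hρ hρ1 hcut hρc hM₁ h₃
      (fun z hz => (r₃ z hz).ne') m₃ hP A i a j
    refine ⟨∑ a, (C₃ a + C₂ a), fun N hN t ht => ?_⟩
    have hn : |((mCoord N χ κ - (N / 2 : ℕ) : ℤ) : ℝ)| ≤ N * |χ| / 2 + A := by
      have h := abs_mCoord_sub_le hN χ κ
      have h1 := abs_sub_abs_le_abs_sub ((mCoord N χ κ - (N / 2 : ℕ) : ℤ) : ℝ) (N * χ / 2)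
      have h2 : |(N : ℝ) * χ / 2| = N * |χ| / 2 := by
        rw [abs_div, abs_mul, Nat.abs_cast, abs_two]
      rw [h2] at h1
      linarith
    have hξ : |(xiCoord k N η ζ : ℝ) - k * N / 4 * (η - 1)| + 1 ≤ A := by
      linarith [abs_xiCoord_sub_le k N η ζ]
    have hξ' : |(xiCoord k N η ζ' : ℝ) - k * N / 4 * (η - 1)| ≤ A := by
      linarith [abs_xiCoord_sub_le k N η ζ']
    rw [remainder, Finset.sum_mul]
    refine (norm_sum_le _ _).trans (Finset.sum_le_sum fun a _ => ?_)
    rw [add_mul]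
    exact (norm_sub_le _ _).trans (add_le_add (hC₃ a N _ _ _ t hN hn hξ ht hξ')
      (hC₂ a N _ _ _ t hN hn hξ ht hξ'))
  set d : ℂ := 1 / (2 * Real.pi * Complex.I) ^ 2 with hd
  have hid : ∀ E : ℂ → Matrix (Fin 2) (Fin 2) ℂ, Diagonalizes W E →
      ∀ γ₁ γ₀₁ γ : SimpleContour, AdmissiblePair γ₁ γ₀₁ → AdmissibleSmooth W l γ →
      ∀ N : ℕ, Even N → InRange k N (mCoord N χ κ) (xiCoord k N η ζ) →
        InRange k N (mCoord N χ κ') (xiCoord k N η ζ') → _ := fun E hE γ₁ γ₀₁ γ hγ₁ hγ N hN hR hR' =>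
    finiteKernel_sub_smoothKernel hk hl hρ hρ1 h₂ r₂ h₃ r₃ hE hγ₁ hγ hN hR.1 hR.2.1 hR'.2.2.1
      hR'.2.2.2 (m' := mCoord N χ κ')
      (ξ := xiCoord k N η ζ) (κ := κ) (κ' := κ') (ζ := ζ) (ζ' := ζ')
      (by simp only [mCoord]; ring) (by simp only [xiCoord]; ring) i j
  -- The exponent of $\rho_1$ in the outer factor is $-n'\approx-N\chi/2$ on the first sheet and
  -- $n'\approx N\chi/2$ on the second. For each sign of $\chi$ one of them is about $-N|\chi|/2$.
  rcases le_total 0 χ with hχ | hχ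
  · obtain ⟨C, hC⟩ := key (eigProj₁ W) (differentiableOn_eigProj₁ W)
    refine ⟨‖d‖ * C, fun E hE γ₁ γ₀₁ γ hγ₁ hγ N hN hR hR' => ?_⟩
    rw [(hid E hE γ₁ γ₀₁ γ hγ₁ hγ N hN hR hR').1, norm_mul, mul_assoc ‖d‖ C]
    refine mul_le_mul_of_nonneg_left (hC N hN _ ?_) (norm_nonneg d)
    have h := (abs_le.mp (abs_mCoord_sub_le hN χ κ')).1
    rw [Int.cast_neg, abs_of_nonneg hχ]
    linarith
  · obtain ⟨C, hC⟩ := key (eigProj₂ W) (differentiableOn_eigProj₂ W)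
    refine ⟨‖d‖ * C, fun E hE γ₁ γ₀₁ γ hγ₁ hγ N hN hR hR' => ?_⟩
    rw [(hid E hE γ₁ γ₀₁ γ hγ₁ hγ N hN hR hR').2, norm_neg, norm_mul, mul_assoc ‖d‖ C]
    refine mul_le_mul_of_nonneg_left (hC N hN _ ?_) (norm_nonneg d)
    have h := (abs_le.mp (abs_mCoord_sub_le hN χ κ')).2
    rw [abs_of_nonpos hχ]
    linarith

end AztecDiamond

theorem mainTheorem3 {k : ℕ} (hk : 1 ≤ k) (W : Weighting k) (l : ℕ) (hl : IsLoopIndex W l)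
    (χ η : ℝ) (hS : (χ, η) ∈ smoothRegion W)
    (hint : (χ, η) ∈ curveInterior (roughSmoothCurve W l)) :
    ∃ ε : ℝ, 0 < ε ∧ ∀ κ ζ κ' ζ' : ℤ, ∃ C : ℝ,
      ∀ E : ℂ → Matrix (Fin 2) (Fin 2) ℂ, Diagonalizes W E →
      ∀ γ₁ γ₀₁ γ : SimpleContour, AdmissiblePair γ₁ γ₀₁ → AdmissibleSmooth W l γ →
        Filter.Tendsto
          (fun N : ℕ => finiteKernel W E γ₁ γ₀₁ N
            (mCoord N χ κ) (xiCoord k N η ζ) (mCoord N χ κ') (xiCoord k N η ζ'))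
          (Filter.atTop ⊓ Filter.principal {N | Even N})
          (nhds (smoothKernel W E γ κ ζ κ' ζ')) ∧
        ∀ N : ℕ, Even N →
          InRange k N (mCoord N χ κ) (xiCoord k N η ζ) →
          InRange k N (mCoord N χ κ') (xiCoord k N η ζ') →
          ∀ i j, ‖finiteKernel W E γ₁ γ₀₁ N
              (mCoord N χ κ) (xiCoord k N η ζ) (mCoord N χ κ') (xiCoord k N η ζ') i j
            - smoothKernel W E γ κ ζ κ' ζ' i j‖ ≤ C * Real.exp (-ε * N) := by
  have hsq := hS.1
  have hχ : |χ| < 1 := abs_lt.mpr hsq.1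
  obtain ⟨x, hx, hθ, hd⟩ := exists_saddle hk hl hsq hint
  obtain ⟨ρ, M₁, M₂, hρ, hρ1, hρg, hM, hM₁, ⟨I₂, K₂, c₂, hI₂, hK₂, e₂, f₂⟩,
    I₃, K₃, c₃, hI₃, hK₃, e₃, f₃⟩ :=
    exists_contours hk hl (abs_nonneg χ) hχ hsq.2 hx hθ hd
  have h₂ : IsLoop (branchPoint W (2 * l)) (branchPoint W (2 * l - 1)) I₂ K₂ c₂ 1 0 :=
    ⟨hI₂, fun z hz => (hK₂ z hz).1, fun h => (hK₂ 1 h).2.1 rfl, by rw [e₂, mul_one],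
      by rw [f₂, mul_zero]⟩
  have h₃ : IsLoop (branchPoint W (2 * l)) (branchPoint W (2 * l - 1)) I₃ K₃ c₃ 1 1 :=
    ⟨hI₃, fun z hz => (hK₃ z hz).1, fun h => (hK₃ 1 h).2.1 rfl, by rw [e₃, mul_one],
      by rw [f₃, mul_one]⟩
  -- The rate is the difference in height between the loops and the circle, which are fixed before
  -- the shifts, `E` and the contours of the kernels.
  refine ⟨M₂ - M₁, sub_pos.mpr hM, fun κ ζ κ' ζ' => ?_⟩
  choose C hC using exists_kernel_bound hk W hl hρ hρ1 hρg hM₁ h₂ (fun z hz => (hK₂ z hz).2.2.1)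
    (fun z hz => (hK₂ z hz).2.2.2) h₃ (fun z hz => (hK₃ z hz).2.2.1)
    (fun z hz => (hK₃ z hz).2.2.2) κ ζ κ' ζ'
  refine ⟨∑ i, ∑ j, |C i j|, fun E hE γ₁ γ₀₁ γ hγ₁ hγ => ?_⟩
  have hbound : ∀ N : ℕ, Even N →
      InRange k N (mCoord N χ κ) (xiCoord k N η ζ) →
      InRange k N (mCoord N χ κ') (xiCoord k N η ζ') →
      ∀ i j, ‖finiteKernel W E γ₁ γ₀₁ N
          (mCoord N χ κ) (xiCoord k N η ζ) (mCoord N χ κ') (xiCoord k N η ζ') i j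
        - smoothKernel W E γ κ ζ κ' ζ' i j‖ ≤
        (∑ i, ∑ j, |C i j|) * Real.exp (-(M₂ - M₁) * N) := by
    intro N hN hR hR' i j
    refine (hC i j E hE γ₁ γ₀₁ γ hγ₁ hγ N hN hR hR').trans ?_
    refine mul_le_mul_of_nonneg_right ?_ (Real.exp_pos _).le
    calc C i j ≤ |C i j| := le_abs_self _
      _ ≤ ∑ j, |C i j| :=
        Finset.single_le_sum (f := fun j => |C i j|) (fun _ _ => abs_nonneg _) (Finset.mem_univ j)
      _ ≤ ∑ i, ∑ j, |C i j| := Finset.single_le_sum (f := fun i => ∑ j, |C i j|)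
        (fun _ _ => Finset.sum_nonneg fun _ _ => abs_nonneg _) (Finset.mem_univ i)
  refine ⟨?_, hbound⟩
  refine tendsto_pi_nhds.mpr fun i => tendsto_pi_nhds.mpr fun j => ?_
  rw [tendsto_iff_norm_sub_tendsto_zero]
  refine squeeze_zero' (Filter.Eventually.of_forall fun _ => norm_nonneg _)
    (g := fun N : ℕ => (∑ i, ∑ j, |C i j|) * Real.exp (-(M₂ - M₁) * N)) ?_ ?_
  · filter_upwards [eventually_inRange hk hsq κ ζ, eventually_inRange hk hsq κ' ζ',
      Filter.mem_inf_of_right (Filter.mem_principal_self _)] with N h h' hN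
    exact hbound N hN h h' i j
  · refine Filter.Tendsto.mono_left ?_ inf_le_left
    rw [← mul_zero (∑ i, ∑ j, |C i j|)]
    refine Filter.Tendsto.const_mul _ (Real.tendsto_exp_atBot.comp ?_)
    exact tendsto_natCast_atTop_atTop.const_mul_atTop_of_neg (by linarith)
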